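/- Let $m,n$ be integers with $n>2m\geq 2$. Write $\langle x\rangle=(1+|x|^2)^{1/2}$. Let $\mathcal R_0^{\pm}(E)$, $E>0$, be the boundary values from the upper ($+$) and lower ($-$) half plane of the free resolvent $\mathcal R_0(z)=((-\Delta)^m-z)^{-1}$ on $\mathbb R^n$; these are convolution operators. Let $V:\mathbb R^n\to\mathbb R$ be measurable with $|V(x)|\leq C\langle x\rangle^{-\beta}$ for some $\beta>n$ and some $C$, and put $v=|V|^{1/2}$. Let $\lambda_0>0$ and let $\chi\in C_0^\infty((-\lambda_0,\lambda_0))$ be real-valued and equal to $1$ in a neighborhood of $0$. An operator with integral kernel $T(x,y)$ is called absolutely bounded if the operator with kernel $|T(x,y)|$ is bounded on $L^2(\mathbb R^n)$. For $0<\lambda<\lambda_0$ let $\Gamma(\lambda)$ be an absolutely bounded operator with complex kernel $\Gamma(\lambda)(x,y)$, such that for almost every $(x,y)$ the derivatives $\partial_\lambda^k\Gamma(\lambda)(x,y)$, $1\leq k\leq\lceil \frac n2\rceil+1$, exist for all $0<\lambda<\lambda_0$. Let $$ \widetilde\Gamma(x,y)=\sup_{0<\lambda<\lambda_0}\Big[|\Gamma(\lambda)(x,y)|+\sup_{1\leq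 k\leq\lceil \frac n2\rceil+1}\big|\lambda^{k-1}\partial_\lambda^k\Gamma(\lambda)(x,y)\big|\Big]. $$ If $2m<n<4m$, assume that the operator with kernel $\widetilde\Gamma$ is bounded on $L^2(\mathbb R^n)$. If $n\geq 4m$, assume that there are $C$ and $\epsilon>0$ such that $\widetilde\Gamma(x,y)\leq C\langle x\rangle^{-\frac n2-\epsilon}\langle y\rangle^{-\frac n2-\epsilon}$ for almost every $(x,y)$. Then the kernel $$ K(x,y)=\int_0^\infty\chi(\lambda)\lambda^{2m-1}\Big[\mathcal R_0^+(\lambda^{2m})\,v\,\Gamma(\lambda)\,v\,\big[\mathcal R_0^+(\lambda^{2m})-\mathcal R_0^-(\lambda^{2m})\big]\Big](x,y)\,d\lambda $$ is well defined for all $x,y\in\mathbb R^n$ (for $0<\lambda<\lambda_0$ the integral over $\mathbb R^{2n}$ that defines the composed kernel converges absolutely, and so does the integral in $\lambda$). Moreover $K$ is measurable and admissible, that is, $$ \sup_{x\in\mathbb R^n}\int_{\mathbb R^n}|K(x,y)|\,dy+\sup_{y\in\mathbb R^n}\int_{\mathbb R^n}|K(x,y)|\,dx<\infty, $$ and the operator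 with kernel $K$ is bounded on $L^p(\mathbb R^n)$ for every $1\leq p\leq\infty$. -/

import Mathlib

open MeasureTheory Set Filter Topology
open scoped ENNReal NNReal ContDiff FourierTransform

noncomputable section

namespace HigherOrderSchrodinger

/-- The Japanese bracket `⟨x⟩ = (1 + |x|²)^{1/2}`. -/
def bracket {n : ℕ} (x : EuclideanSpace ℝ (Fin n)) : ℝ :=
  Real.sqrt (1 + ‖x‖ ^ 2)

/-! ### The free resolvent -/

/-- The convolution kernel of the free resolvent `((-Δ)^m - z)⁻¹` on `ℝⁿ`, for `z ∉ [0, ∞)`.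
With `𝓕 f ξ = ∫ e^{-2πi x·ξ} f(x) dx` the operator `(-Δ)^m` is multiplication by `(2π|ξ|)^{2m}`, so
the kernel is the inverse Fourier transform of `1 / ((2π|ξ|)^{2m} - z)`. The symbol is not
integrable when `n ≥ 2m`; the inverse transform is taken in the Gaussian (Abel) sense, and the limit
exists at every `x ≠ 0`. -/
def freeResolvent (n m : ℕ) (z : ℂ) (x : EuclideanSpace ℝ (Fin n)) : ℂ :=
  limUnder (𝓝[>] (0 : ℝ)) fun δ : ℝ =>
    𝓕⁻ (fun ξ : EuclideanSpace ℝ (Fin n) =>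
      (Real.exp (-δ * ‖ξ‖ ^ 2) : ℂ) / (((2 * Real.pi * ‖ξ‖) ^ (2 * m) : ℝ) - z)) x

/-- The kernel of `𝓡₀⁺(E)`, `E > 0`: the boundary value of the resolvent from the upper
half plane. -/
def freeResolventPlus (n m : ℕ) (E : ℝ) (x : EuclideanSpace ℝ (Fin n)) : ℂ :=
  limUnder (𝓝[>] (0 : ℝ)) fun ε : ℝ => freeResolvent n m ((E : ℂ) + ε * Complex.I) x

/-- The kernel of `𝓡₀⁻(E)`, `E > 0`: the boundary value of the resolvent from the lower
half plane. -/
def freeResolventMinus (n m : ℕ) (E : ℝ) (x : EuclideanSpace ℝ (Fin n)) : ℂ :=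
  limUnder (𝓝[>] (0 : ℝ)) fun ε : ℝ => freeResolvent n m ((E : ℂ) - ε * Complex.I) x

/-! ### Integral operators -/

/-- The integral operator with the nonnegative kernel `k` is bounded on `L²(ℝⁿ)`. -/
def KernelBoundedL2 {n : ℕ}
    (k : EuclideanSpace ℝ (Fin n) → EuclideanSpace ℝ (Fin n) → ℝ≥0∞) : Prop :=
  AEMeasurable (Function.uncurry k) (volume.prod volume) ∧
    ∃ C : ℝ≥0, ∀ f : EuclideanSpace ℝ (Fin n) → ℂ, MemLp f 2 volume →
      eLpNorm (fun x => ∫⁻ y, k x y * ‖f y‖ₑ) 2 volume ≤ C * eLpNorm f 2 volume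

/-- An operator with integral kernel `T(x,y)` is absolutely bounded if the operator with kernel
`|T(x,y)|` is bounded on `L²`. -/
def AbsolutelyBounded {n : ℕ}
    (T : EuclideanSpace ℝ (Fin n) → EuclideanSpace ℝ (Fin n) → ℂ) : Prop :=
  AEStronglyMeasurable (Function.uncurry T) (volume.prod volume) ∧
    KernelBoundedL2 fun x y => ‖T x y‖ₑ

/-- Admissible kernels: `sup_x ∫ |K(x,y)| dy + sup_y ∫ |K(x,y)| dx < ∞`. -/
def Admissible {n : ℕ}
    (K : EuclideanSpace ℝ (Fin n) → EuclideanSpace ℝ (Fin n) → ℂ) : Prop :=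
  AEStronglyMeasurable (Function.uncurry K) (volume.prod volume) ∧
    (⨆ x, ∫⁻ y, ‖K x y‖ₑ) + (⨆ y, ∫⁻ x, ‖K x y‖ₑ) < ⊤

/-- The integral operator `f ↦ ∫ K(x,y) f(y) dy` is bounded on `L^p(ℝⁿ)`: for `f ∈ L^p` the integral
converges absolutely for almost every `x`, and it defines an element of `L^p` of norm at most
`C ‖f‖_p`. -/
def KernelBoundedLp {n : ℕ}
    (K : EuclideanSpace ℝ (Fin n) → EuclideanSpace ℝ (Fin n) → ℂ) (p : ℝ≥0∞) : Prop :=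
  ∃ C : ℝ≥0, ∀ f : EuclideanSpace ℝ (Fin n) → ℂ, MemLp f p volume →
    (∀ᵐ x, Integrable (fun y => K x y * f y) volume) ∧
    MemLp (fun x => ∫ y, K x y * f y) p volume ∧
    eLpNorm (fun x => ∫ y, K x y * f y) p volume ≤ C * eLpNorm f p volume

/-! ### The family `Γ(λ)` and its majorant -/

/-- The number `⌈n/2⌉ + 1` of `λ`-derivatives. -/
def numDeriv (n : ℕ) : ℕ := ⌈(n : ℝ) / 2⌉₊ + 1

/-- `Γ̃(x,y) = sup_{0<λ<λ₀} [ |Γ(λ)(x,y)| + sup_{1≤k≤⌈n/2⌉+1} |λ^{k-1} ∂_λ^k Γ(λ)(x,y)| ]`, with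
values in `[0, ∞]`. -/
def gammaTilde {n : ℕ} (lam₀ : ℝ)
    (Γ : ℝ → EuclideanSpace ℝ (Fin n) → EuclideanSpace ℝ (Fin n) → ℂ)
    (x y : EuclideanSpace ℝ (Fin n)) : ℝ≥0∞ :=
  ⨆ lam ∈ Ioo 0 lam₀,
    (‖Γ lam x y‖ₑ +
      ⨆ k ∈ Finset.Icc 1 (numDeriv n),
        ‖(lam : ℂ) ^ (k - 1) * iteratedDeriv k (fun μ => Γ μ x y) lam‖ₑ)

/-- The derivatives `∂_λ^k Γ(λ)(x,y)`, `k ≤ ⌈n/2⌉ + 1`, exist for all `0 < λ < λ₀`, for almost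
every `(x,y)`. -/
def HasLamDerivatives {n : ℕ} (lam₀ : ℝ)
    (Γ : ℝ → EuclideanSpace ℝ (Fin n) → EuclideanSpace ℝ (Fin n) → ℂ) : Prop :=
  ∀ᵐ z : EuclideanSpace ℝ (Fin n) × EuclideanSpace ℝ (Fin n) ∂(volume.prod volume),
    ∀ k < numDeriv n, DifferentiableOn ℝ (iteratedDeriv k fun μ => Γ μ z.1 z.2) (Ioo 0 lam₀)

/-! ### The kernel `K` -/

/-- The integrand, in `z = (z₁, z₂)`, of the composition
`[𝓡₀⁺(λ^{2m}) v Γ(λ) v (𝓡₀⁺(λ^{2m}) - 𝓡₀⁻(λ^{2m}))](x,y)`, where `v = |V|^{1/2}`. -/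
def compIntegrand {n : ℕ} (m : ℕ) (V : EuclideanSpace ℝ (Fin n) → ℝ)
    (Γ : ℝ → EuclideanSpace ℝ (Fin n) → EuclideanSpace ℝ (Fin n) → ℂ) (lam : ℝ)
    (x y : EuclideanSpace ℝ (Fin n)) (z : EuclideanSpace ℝ (Fin n) × EuclideanSpace ℝ (Fin n)) :
    ℂ :=
  freeResolventPlus n m (lam ^ (2 * m)) (x - z.1) * (Real.sqrt |V z.1| : ℂ) *
    Γ lam z.1 z.2 * (Real.sqrt |V z.2| : ℂ) *
    (freeResolventPlus n m (lam ^ (2 * m)) (z.2 - y) -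
      freeResolventMinus n m (lam ^ (2 * m)) (z.2 - y))

/-- `[𝓡₀⁺(λ^{2m}) v Γ(λ) v (𝓡₀⁺(λ^{2m}) - 𝓡₀⁻(λ^{2m}))](x,y)`. -/
def compKernel {n : ℕ} (m : ℕ) (V : EuclideanSpace ℝ (Fin n) → ℝ)
    (Γ : ℝ → EuclideanSpace ℝ (Fin n) → EuclideanSpace ℝ (Fin n) → ℂ) (lam : ℝ)
    (x y : EuclideanSpace ℝ (Fin n)) : ℂ :=
  ∫ z, compIntegrand m V Γ lam x y z ∂(volume.prod volume)

/-- The integrand, in `λ`, of the kernel `K(x,y)`. -/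
def lowEnergyIntegrand {n : ℕ} (m : ℕ) (χ : ℝ → ℝ) (V : EuclideanSpace ℝ (Fin n) → ℝ)
    (Γ : ℝ → EuclideanSpace ℝ (Fin n) → EuclideanSpace ℝ (Fin n) → ℂ)
    (x y : EuclideanSpace ℝ (Fin n)) (lam : ℝ) : ℂ :=
  (χ lam : ℂ) * (lam : ℂ) ^ (2 * m - 1) * compKernel m V Γ lam x y

/-- `K(x,y) = ∫₀^∞ χ(λ) λ^{2m-1} [𝓡₀⁺(λ^{2m}) v Γ(λ) v (𝓡₀⁺ - 𝓡₀⁻)(λ^{2m})](x,y) dλ`. -/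
def lowEnergyKernel {n : ℕ} (m : ℕ) (χ : ℝ → ℝ) (V : EuclideanSpace ℝ (Fin n) → ℝ)
    (Γ : ℝ → EuclideanSpace ℝ (Fin n) → EuclideanSpace ℝ (Fin n) → ℂ)
    (x y : EuclideanSpace ℝ (Fin n)) : ℂ :=
  ∫ lam in Ioi (0 : ℝ), lowEnergyIntegrand m χ V Γ x y lam

end HigherOrderSchrodinger

end

namespace HigherOrderSchrodinger


/-! ### Symbols on the half line -/

/-! The free resolvent kernel is explicit. Put `a = (n - 3) / 2` and r = |x|. Partial fractions over
the 2m-th roots of unity reduce it to kernels of (-Δ + κ²)⁻¹, which are multiples of r^{2-n} P(κr)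
with P the Poisson-type integral `poissonKer` (a Macdonald function up to a power). By
`exists_freeResolvent_amplitude`, 𝓡₀⁺(λ^{2m}) has the kernel C r^{2m-n} A(λr), and in 𝓡₀⁺ - 𝓡₀⁻ the
roots telescope to C i λ^{n-2m} J(λr), where J(s) is the integral of e^{isu} (1 - u²)^a over [-1,
1].

The amplitude A is e^{is} times a symbol of order a - 2(m - 1), regular at 0 by cancellation among
the roots (`isSymbol_outAmp`). The moment J is e^{is} F + e^{-is} G with F, G symbols of order -(a +
1) (`sphereMoment_decomp`). Symbols are measured by s d/ds, which commutes with dilations, so A(λr)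
is a symbol in λ uniformly in r.

Thus K(x,y) is the integral over (z₁, z₂) of v Γ v against an oscillatory integral in λ with weight
λ^{n-1} r₁^{2m-n} A(λr₁) J(λr₂), where r₁ = |x - z₁| and r₂ = |z₂ - y|. Its phases are r₁ ± r₂, and
⌈n/2⌉ + 1 integrations by parts produce that many powers of (1 + λ|r₁ - r₂|)⁻¹
(`exists_norm_oscillatory_le`). Integrating this bound in x leaves λ^{n-1-2m}, uniformly in r₂,
which is bounded near 0.

Integrating the same bound in y would leave λ⁻¹, a logarithmic divergence. The remedy
(`exists_norm_oscillatory_le'`) is that λ^{n-1} J(λr₂) is itself a λ-derivative, namely of λ^n times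
the moment with parameter a + 1. One integration by parts against it gains the decay (1 + λr₂)⁻¹ and
a factor λ, because λ∂_λ is O(λ) on χΓ and O(λr₁), relative to its size, on the amplitude. The price
is a factor 1 + r₁. The remaining ⌈n/2⌉ integrations by parts still suffice, and the y-integral is
at most a constant times 1 + r₁^{2m-n}.

What is left is that the integral of v Γ̃ v (1 + |x - z₁|^{2m-n}) over (z₁, z₂) is bounded in x. For
n < 4m this is Cauchy–Schwarz, since |x|^{2(2m-n)} is then locally integrable. For n ≥ 4m it follows
from the pointwise decay of Γ̃. Admissibility then gives every L^p bound by the Schur test. -/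

/-- The Euler derivative `s f'(s)`. -/
noncomputable def eul (f : ℝ → ℂ) (s : ℝ) : ℂ := s * deriv f s

/-- `f` and its Euler derivatives up to order `k` are bounded by `w` on `S`. -/
def IsSymbol (S : Set ℝ) : ℕ → (ℝ → ℝ) → (ℝ → ℂ) → Prop
  | 0, w, f => ∀ s ∈ S, ‖f s‖ ≤ w s
  | k + 1, w, f => (∀ s ∈ S, ‖f s‖ ≤ w s) ∧ (∀ s ∈ S, DifferentiableAt ℝ f s) ∧
      IsSymbol S k w (eul f)

namespace IsSymbol

variable {S S' : Set ℝ} {k : ℕ} {w w' : ℝ → ℝ} {f g : ℝ → ℂ}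

theorem bound (h : IsSymbol S k w f) : ∀ s ∈ S, ‖f s‖ ≤ w s := by
  cases k with
  | zero => exact h
  | succ k => exact h.1

theorem nonneg (h : IsSymbol S k w f) : ∀ s ∈ S, 0 ≤ w s :=
  fun s hs => (norm_nonneg _).trans (h.bound s hs)

theorem eul (h : IsSymbol S (k + 1) w f) : IsSymbol S k w (eul f) := h.2.2

theorem differentiableAt (h : IsSymbol S (k + 1) w f) : ∀ s ∈ S, DifferentiableAt ℝ f s := h.2.1

theorem continuousOn (h : IsSymbol S (k + 1) w f) : ContinuousOn f S :=
  fun s hs => (h.differentiableAt s hs).continuousAt.continuousWithinAt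

theorem mono (h : IsSymbol S k w f) (hw : ∀ s ∈ S, w s ≤ w' s) : IsSymbol S k w' f := by
  induction k generalizing f with
  | zero => exact fun s hs => (h s hs).trans (hw s hs)
  | succ k ih => exact ⟨fun s hs => (h.1 s hs).trans (hw s hs), h.2.1, ih h.2.2⟩

theorem pred (h : IsSymbol S (k + 1) w f) : IsSymbol S k w f := by
  induction k generalizing f with
  | zero => exact h.1
  | succ k ih => exact ⟨h.1, h.2.1, ih h.2.2⟩

theorem of_le {j : ℕ} (h : IsSymbol S k w f) (hj : j ≤ k) : IsSymbol S j w f := by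
  induction k with
  | zero => obtain rfl : j = 0 := by omega
            exact h
  | succ k ih =>
    rcases Nat.lt_or_ge k j with h1 | h1
    · obtain rfl : j = k + 1 := by omega
      exact h
    · exact ih h.pred h1

theorem mono_set (h : IsSymbol S k w f) (hS : S' ⊆ S) : IsSymbol S' k w f := by
  induction k generalizing f with
  | zero => exact fun s hs => h s (hS hs)
  | succ k ih => exact ⟨fun s hs => h.1 s (hS hs), fun s hs => h.2.1 s (hS hs), ih h.2.2⟩

theorem _root_.HigherOrderSchrodinger.eul_congr (hS : IsOpen S) (hfg : EqOn f g S) :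
    EqOn (HigherOrderSchrodinger.eul f) (HigherOrderSchrodinger.eul g) S := by
  intro s hs
  have : f =ᶠ[𝓝 s] g := by filter_upwards [hS.mem_nhds hs] with t ht using hfg ht
  simp only [HigherOrderSchrodinger.eul, this.deriv_eq]

theorem congr (hS : IsOpen S) (h : IsSymbol S k w f) (hfg : EqOn f g S) : IsSymbol S k w g := by
  induction k generalizing f g with
  | zero => exact fun s hs => by rw [← hfg hs]; exact h s hs
  | succ k ih =>
    refine ⟨fun s hs => by rw [← hfg hs]; exact h.1 s hs, fun s hs => ?_, ih h.2.2 (eul_congr hS hfg)⟩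
    have : f =ᶠ[𝓝 s] g := by filter_upwards [hS.mem_nhds hs] with t ht using hfg ht
    exact (this.differentiableAt_iff).1 (h.2.1 s hs)

theorem add (hS : IsOpen S) (h : IsSymbol S k w f) (h' : IsSymbol S k w' g) :
    IsSymbol S k (fun s => w s + w' s) (fun s => f s + g s) := by
  induction k generalizing f g with
  | zero => exact fun s hs => (norm_add_le _ _).trans (add_le_add (h s hs) (h' s hs))
  | succ k ih =>
    refine ⟨fun s hs => (norm_add_le _ _).trans (add_le_add (h.1 s hs) (h'.1 s hs)),
      fun s hs => (h.2.1 s hs).add (h'.2.1 s hs), (ih h.2.2 h'.2.2).congr hS fun s hs => ?_⟩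
    simp only [HigherOrderSchrodinger.eul]
    rw [deriv_fun_add (h.2.1 s hs) (h'.2.1 s hs)]
    ring

theorem const_mul (hS : IsOpen S) (c : ℂ) (h : IsSymbol S k w f) :
    IsSymbol S k (fun s => ‖c‖ * w s) (fun s => c * f s) := by
  induction k generalizing f with
  | zero => exact fun s hs => by
              rw [norm_mul]; exact mul_le_mul_of_nonneg_left (h s hs) (norm_nonneg _)
  | succ k ih =>
    refine ⟨fun s hs => by
      rw [norm_mul]; exact mul_le_mul_of_nonneg_left (h.1 s hs) (norm_nonneg _),
      fun s hs => (h.2.1 s hs).const_mul c, (ih h.2.2).congr hS fun s hs => ?_⟩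
    simp only [HigherOrderSchrodinger.eul]
    rw [deriv_const_mul c (h.2.1 s hs)]
    ring

/-- The Leibniz rule splits the product in two at each Euler derivative, whence `2 ^ k`. -/
theorem mul (hS : IsOpen S) (h : IsSymbol S k w f) (h' : IsSymbol S k w' g) :
    IsSymbol S k (fun s => 2 ^ k * (w s * w' s)) (fun s => f s * g s) := by
  induction k generalizing f g with
  | zero => exact fun s hs => by
              simp only [norm_mul, pow_zero, one_mul]
              exact mul_le_mul (h s hs) (h' s hs) (norm_nonneg _) (h.nonneg s hs)
  | succ k ih =>
    refine ⟨fun s hs => ?_, fun s hs => (h.2.1 s hs).mul (h'.2.1 s hs), ?_⟩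
    · rw [norm_mul]
      have := mul_le_mul (h.1 s hs) (h'.1 s hs) (norm_nonneg _) (h.nonneg s hs)
      have h1 : (1 : ℝ) ≤ 2 ^ (k + 1) := one_le_pow₀ (by norm_num)
      have h2 : 0 ≤ w s * w' s := mul_nonneg (h.nonneg s hs) (h'.nonneg s hs)
      nlinarith
    · refine (((ih h.2.2 h'.pred).add hS (ih h.pred h'.2.2)).mono fun s hs => ?_).congr hS
        fun s hs => ?_
      · rw [pow_succ]; apply le_of_eq; ring
      · simp only [HigherOrderSchrodinger.eul]
        rw [deriv_fun_mul (h.2.1 s hs) (h'.2.1 s hs)]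
        ring

/-- Combines an estimate that is sharp near 0 with another that is sharp at infinity. -/
theorem min (h : IsSymbol S k w f) (h' : IsSymbol S k w' f) :
    IsSymbol S k (fun s => min (w s) (w' s)) f := by
  induction k generalizing f with
  | zero => exact fun s hs => le_min (h s hs) (h' s hs)
  | succ k ih => exact ⟨fun s hs => le_min (h.1 s hs) (h'.1 s hs), h.2.1, ih h.2.2 h'.2.2⟩

theorem zero (hS : IsOpen S) (hw : ∀ s ∈ S, 0 ≤ w s) : IsSymbol S k w (fun _ => 0) := by
  induction k with
  | zero => exact fun s hs => by simpa using hw s hs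
  | succ k ih =>
    refine ⟨fun s hs => by simpa using hw s hs, fun s hs => by fun_prop, ih.congr hS fun s _ => ?_⟩
    simp [HigherOrderSchrodinger.eul]

theorem const (hS : IsOpen S) (c : ℂ) : IsSymbol S k (fun _ => ‖c‖) (fun _ => c) := by
  cases k with
  | zero => exact fun s hs => le_rfl
  | succ k =>
    refine ⟨fun s hs => le_rfl, fun s hs => by fun_prop,
      (IsSymbol.zero hS fun _ _ => norm_nonneg c).congr hS fun s _ => ?_⟩
    simp [HigherOrderSchrodinger.eul]

theorem sum (hS : IsOpen S) {ι : Type*} (s : Finset ι) {w : ι → ℝ → ℝ} {f : ι → ℝ → ℂ}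
    (h : ∀ i ∈ s, IsSymbol S k (w i) (f i)) :
    IsSymbol S k (fun t => ∑ i ∈ s, w i t) (fun t => ∑ i ∈ s, f i t) := by
  classical
  induction s using Finset.induction_on with
  | empty => simpa using IsSymbol.zero (k := k) (w := fun _ => 0) hS (fun _ _ => le_rfl)
  | insert i s hi ih =>
    simp only [Finset.sum_insert hi]
    exact (h i (Finset.mem_insert_self i s)).add hS
      (ih fun j hj => h j (Finset.mem_insert_of_mem hj))

/-- The operator s d/ds commutes with dilations. This is the reason for using Euler derivatives: an
amplitude evaluated at λr is a symbol in λ with constants that do not depend on r. -/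
theorem comp_mul {r : ℝ} (hr : 0 < r) (h : IsSymbol (Ioi 0) k w f) :
    IsSymbol (Ioi 0) k (fun s => w (s * r)) (fun s => f (s * r)) := by
  induction k generalizing f with
  | zero => exact fun s hs => h _ (mul_pos hs hr)
  | succ k ih =>
    refine ⟨fun s hs => h.1 _ (mul_pos hs hr), fun s hs => ?_, (ih h.2.2).congr isOpen_Ioi ?_⟩
    · exact DifferentiableAt.comp s (h.2.1 _ (mul_pos hs hr)) (by fun_prop)
    · intro s hs
      have h1 := (h.2.1 _ (mul_pos hs hr)).hasDerivAt.scomp s ((hasDerivAt_id s).mul_const r)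
      simp only [HigherOrderSchrodinger.eul]
      have h2 : deriv (fun s => f (s * r)) s = r * deriv f (s * r) := by
        have := h1.deriv
        simpa [Function.comp_def] using this
      rw [h2]; push_cast; ring

/-- A sequence of functions whose Euler derivatives are combinations of itself and its successor. -/
theorem of_family (hS : IsOpen S) {X : ℕ → ℝ → ℂ} {α β : ℕ → ℂ} {M : ℝ} {K : ℕ}
    (hα : ∀ j ≤ K, ‖α j‖ ≤ M) (hβ : ∀ j ≤ K, ‖β j‖ ≤ M)
    (hX : ∀ j < K, ∀ s ∈ S, DifferentiableAt ℝ (X j) s)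
    (hD : ∀ j < K, ∀ s ∈ S, HigherOrderSchrodinger.eul (X j) s = α j * X j s + β j * X (j + 1) s)
    (hb : ∀ j ≤ K, ∀ s ∈ S, ‖X j s‖ ≤ w s) {j : ℕ} (hj : j + k ≤ K) :
    IsSymbol S k (fun s => (1 + 2 * M) ^ k * w s) (X j) := by
  have hM : 0 ≤ M := (norm_nonneg _).trans (hα 0 (Nat.zero_le _))
  have hw : ∀ s ∈ S, 0 ≤ w s := fun s hs => (norm_nonneg _).trans (hb 0 (Nat.zero_le _) s hs)
  have h0 : ∀ k j, j ≤ K → ∀ s ∈ S, ‖X j s‖ ≤ (1 + 2 * M) ^ k * w s := by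
    intro k j hj s hs
    have h1 : (1 : ℝ) ≤ (1 + 2 * M) ^ k := one_le_pow₀ (by linarith)
    have := hw s hs
    have := hb j hj s hs
    nlinarith
  induction k generalizing j with
  | zero => exact h0 0 j hj
  | succ k ih =>
    refine ⟨h0 _ j (by omega), hX j (by omega), ?_⟩
    -- Each Euler derivative gives two terms with coefficients at most `M`, so the constant grows by
    -- at most the factor `1 + 2 * M`.
    refine ((((ih (j := j) (by omega)).const_mul hS (α j)).add hS
      ((ih (j := j + 1) (by omega)).const_mul hS (β j))).mono fun s hs => ?_).congr hS
        fun s hs => (hD j (by omega) s hs).symm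
    have h1 : 0 ≤ (1 + 2 * M) ^ k * w s := mul_nonneg (by positivity) (hw s hs)
    have h2 := hα j (by omega)
    have h3 := hβ j (by omega)
    rw [pow_succ]
    nlinarith [mul_le_mul_of_nonneg_right h2 h1, mul_le_mul_of_nonneg_right h3 h1]

theorem rpow (α : ℝ) : IsSymbol (Ioi 0) k (fun s => (1 + |α|) ^ k * s ^ α)
    (fun s => ((s ^ α : ℝ) : ℂ)) := by
  have hd : ∀ s : ℝ, 0 < s → HasDerivAt (fun s : ℝ => ((s ^ α : ℝ) : ℂ))
      ((α * s ^ (α - 1) : ℝ) : ℂ) s := fun s hs =>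
    (Real.hasDerivAt_rpow_const (Or.inl hs.ne')).ofReal_comp
  have hb : ∀ k : ℕ, ∀ s ∈ Ioi (0 : ℝ), ‖((s ^ α : ℝ) : ℂ)‖ ≤ (1 + |α|) ^ k * s ^ α := by
    intro k s hs
    have : 0 < s ^ α := Real.rpow_pos_of_pos hs _
    rw [Complex.norm_real, Real.norm_of_nonneg this.le]
    have h1 : (1 : ℝ) ≤ (1 + |α|) ^ k := one_le_pow₀ (by linarith [abs_nonneg α])
    nlinarith
  induction k with
  | zero => exact hb 0
  | succ k ih =>
    refine ⟨hb _, fun s hs => (hd s hs).differentiableAt,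
      ((ih.const_mul isOpen_Ioi α).mono fun s hs => ?_).congr isOpen_Ioi fun s hs => ?_⟩
    · have : 0 < s ^ α := Real.rpow_pos_of_pos hs _
      rw [Complex.norm_real, Real.norm_eq_abs, pow_succ]
      have h1 : 0 < (1 + |α|) ^ k := by positivity
      nlinarith [mul_pos h1 this]
    · simp only [HigherOrderSchrodinger.eul, (hd s hs).deriv]
      rw [← Complex.ofReal_mul, ← Complex.ofReal_mul]
      congr 1
      rw [Real.rpow_sub_one (ne_of_gt hs)]
      have : s ≠ 0 := ne_of_gt hs
      field_simp

theorem pow (j : ℕ) : IsSymbol (Ioi 0) k (fun s => (1 + (j : ℝ)) ^ k * s ^ j)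
    (fun s => (s : ℂ) ^ j) := by
  have h := IsSymbol.rpow (k := k) (j : ℝ)
  simp only [Real.rpow_natCast, Complex.ofReal_pow, Nat.abs_cast] at h
  exact h

/-- The cutoff `1 / (1 + s ^ M)`. -/
theorem inv_one_add_pow (M k : ℕ) : ∃ C : ℝ, 0 ≤ C ∧ IsSymbol (Ioi 0) k
    (fun s => C * (1 + s ^ M)⁻¹) (fun s => (((1 + s ^ M)⁻¹ : ℝ) : ℂ)) := by
  have hpos : ∀ s : ℝ, 0 < s → 0 < 1 + s ^ M := fun s hs => by positivity
  have hd : ∀ s : ℝ, 0 < s → HasDerivAt (fun s : ℝ => (((1 + s ^ M)⁻¹ : ℝ) : ℂ))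
      ((-(M * s ^ (M - 1)) / (1 + s ^ M) ^ 2 : ℝ) : ℂ) s := fun s hs =>
    HasDerivAt.ofReal_comp (((hasDerivAt_pow M s).const_add 1).inv (hpos s hs).ne')
  have hb : ∀ s ∈ Ioi (0 : ℝ), ‖(((1 + s ^ M)⁻¹ : ℝ) : ℂ)‖ ≤ 1 * (1 + s ^ M)⁻¹ := by
    intro s hs
    rw [Complex.norm_real, Real.norm_of_nonneg (inv_pos.2 (hpos s hs)).le, one_mul]
  induction k with
  | zero => exact ⟨1, zero_le_one, hb⟩
  | succ k ih =>
    obtain ⟨C, hC, h⟩ := ih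
    refine ⟨1 + (‖(-M : ℂ)‖ * C + ‖(M : ℂ)‖ * (2 ^ k * C ^ 2)), by positivity, fun s hs => ?_,
      fun s hs => (hd s hs).differentiableAt, ?_⟩
    · refine (hb s hs).trans (mul_le_mul_of_nonneg_right ?_ (inv_pos.2 (hpos s hs)).le)
      have : 0 ≤ ‖(-M : ℂ)‖ * C + ‖(M : ℂ)‖ * (2 ^ k * C ^ 2) := by positivity
      linarith
    -- With φ = 1/(1 + s^M), the Euler derivative is -Mφ + Mφ², and φ² ≤ φ.
    · refine (((h.const_mul isOpen_Ioi (-M : ℂ)).add isOpen_Ioi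
        ((h.mul isOpen_Ioi h).const_mul isOpen_Ioi (M : ℂ))).mono fun s hs => ?_).congr isOpen_Ioi
          fun s hs => ?_
      · have h1 := hpos s hs
        have h2 : (1 + s ^ M)⁻¹ ≤ 1 := inv_le_one_of_one_le₀ (by
          have : 0 ≤ s ^ M := pow_nonneg (le_of_lt hs) _
          linarith)
        have h3 : 0 < (1 + s ^ M)⁻¹ := inv_pos.2 h1
        have h4 : (1 + s ^ M)⁻¹ * (1 + s ^ M)⁻¹ ≤ (1 + s ^ M)⁻¹ := by nlinarith
        have h5 : 0 ≤ ‖(M : ℂ)‖ * (2 ^ k * C ^ 2) := by positivity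
        nlinarith [mul_le_mul_of_nonneg_left h4 h5]
      · simp only [HigherOrderSchrodinger.eul, (hd s hs).deriv]
        have h1 := (hpos s hs).ne'
        norm_cast
        rcases M with _ | M
        · simp; 
        · have : s * s ^ M = s ^ (M + 1) := by ring
          simp only [Nat.add_sub_cancel]
          push_cast
          field_simp
          ring

/-- Decaying or oscillating exponentials. -/
theorem exp_neg {c : ℂ} (K : ℕ) {C : ℝ} {w : ℝ → ℝ} (hcC : ‖c‖ ≤ C) (hC' : (K : ℝ) ≤ C)
    (hw : ∀ j ≤ K, ∀ s : ℝ, 0 < s → s ^ j * Real.exp (-(c.re * s)) ≤ w s) :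
    IsSymbol (Ioi 0) K (fun s => (1 + 2 * C) ^ K * w s) (fun s => Complex.exp (-(c * s))) := by
  have := IsSymbol.of_family (S := Ioi 0) (k := K) (K := K) (j := 0) (M := C) (w := w) isOpen_Ioi
    (X := fun j s => (s : ℂ) ^ j * Complex.exp (-(c * s))) (α := fun j => j) (β := fun _ => -c)
    (fun j hj => ?_) (fun j hj => by simpa using hcC) ?_ ?_ ?_ (by omega)
  · simpa using this
  · have : (j : ℝ) ≤ K := by exact_mod_cast hj
    simpa using this.trans hC'
  · intro j _ s _
    fun_prop
  · intro j _ s hs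
    have h1 : HasDerivAt (fun s : ℝ => (s : ℂ) ^ j * Complex.exp (-(c * s)))
        ((j * (s : ℂ) ^ (j - 1)) * Complex.exp (-(c * s)) +
          (s : ℂ) ^ j * (Complex.exp (-(c * s)) * -(c * 1))) s := by
      have e1 : HasDerivAt (fun s : ℝ => (s : ℂ)) 1 s := Complex.ofRealCLM.hasDerivAt
      have e2 := e1.fun_pow j
      simp only [mul_one] at e2
      exact e2.mul ((e1.const_mul c).neg.cexp)
    simp only [HigherOrderSchrodinger.eul, h1.deriv]
    rcases j with _ | j
    · simp; ring
    · simp only [Nat.add_sub_cancel]; push_cast; ring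
  · intro j hj s hs
    rw [norm_mul, norm_pow, Complex.norm_real, Real.norm_of_nonneg (le_of_lt hs), Complex.norm_exp]
    simpa using hw j hj s hs

end IsSymbol

/-! ### Averages on the half line -/

/-- The weighted average `s^{-(k+1)} ∫₀ˢ t^k f(t) dt`. -/
noncomputable def avg (k : ℕ) (f : ℝ → ℂ) (s : ℝ) : ℂ :=
  ((s : ℂ) ^ (k + 1))⁻¹ * ∫ t in (0 : ℝ)..s, (t : ℂ) ^ k * f t

section avg

variable {k : ℕ} {w : ℝ → ℝ} {f : ℝ → ℂ}

theorem norm_pow_mul_le (hw : MonotoneOn w (Ioi 0)) (hb : ∀ s ∈ Ioi (0 : ℝ), ‖f s‖ ≤ w s) {s t : ℝ}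
    (ht : t ∈ Ioc 0 s) : ‖(t : ℂ) ^ k * f t‖ ≤ s ^ k * w s := by
  have hs : 0 < s := ht.1.trans_le ht.2
  rw [norm_mul, norm_pow, Complex.norm_real, Real.norm_of_nonneg ht.1.le]
  exact mul_le_mul (pow_le_pow_left₀ ht.1.le ht.2 _) ((hb t ht.1).trans (hw (mem_Ioi.2 ht.1) hs ht.2))
    (norm_nonneg _) (by positivity)

theorem intervalIntegrable_pow_mul (hf : ContinuousOn f (Ioi 0)) (hw : MonotoneOn w (Ioi 0))
    (hb : ∀ s ∈ Ioi (0 : ℝ), ‖f s‖ ≤ w s) {s : ℝ} (hs : 0 < s) :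
    IntervalIntegrable (fun t : ℝ => (t : ℂ) ^ k * f t) volume 0 s := by
  rw [intervalIntegrable_iff_integrableOn_Ioc_of_le hs.le]
  have : ContinuousOn (fun t : ℝ => (t : ℂ) ^ k * f t) (Ioc 0 s) :=
    ((Complex.continuous_ofReal.pow k).continuousOn).mul (hf.mono fun t ht => mem_Ioi.2 ht.1)
  refine Integrable.of_bound (this.aestronglyMeasurable measurableSet_Ioc) (s ^ k * w s) ?_
  filter_upwards [ae_restrict_mem measurableSet_Ioc] with t ht using norm_pow_mul_le hw hb ht

theorem norm_avg_le (hw : MonotoneOn w (Ioi 0))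
    (hb : ∀ s ∈ Ioi (0 : ℝ), ‖f s‖ ≤ w s) {s : ℝ} (hs : 0 < s) : ‖avg k f s‖ ≤ w s := by
  have h1 : ‖∫ t in (0 : ℝ)..s, (t : ℂ) ^ k * f t‖ ≤ s ^ k * w s * |s - 0| :=
    intervalIntegral.norm_integral_le_of_norm_le_const fun t ht => by
      rw [uIoc_of_le hs.le] at ht
      exact norm_pow_mul_le hw hb ht
  rw [sub_zero, abs_of_pos hs] at h1
  rw [avg, norm_mul, norm_inv, norm_pow, Complex.norm_real, Real.norm_of_nonneg hs.le,
    inv_mul_le_iff₀ (by positivity)]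
  refine h1.trans (le_of_eq ?_)
  ring

theorem hasDerivAt_avg (hf : ContinuousOn f (Ioi 0)) (hw : MonotoneOn w (Ioi 0))
    (hb : ∀ s ∈ Ioi (0 : ℝ), ‖f s‖ ≤ w s) {s : ℝ} (hs : 0 < s) :
    HasDerivAt (avg k f) ((f s - (k + 1) * avg k f s) / s) s := by
  have h1 : HasDerivAt (fun s : ℝ => ∫ t in (0 : ℝ)..s, (t : ℂ) ^ k * f t) ((s : ℂ) ^ k * f s) s := by
    refine intervalIntegral.integral_hasDerivAt_right (intervalIntegrable_pow_mul hf hw hb hs) ?_ ?_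
    · refine ContinuousOn.stronglyMeasurableAtFilter isOpen_Ioi ?_ s hs
      exact ((Complex.continuous_ofReal.pow k).continuousOn).mul hf
    · exact ((Complex.continuous_ofReal.pow k).continuousAt).mul (hf.continuousAt (Ioi_mem_nhds hs))
  have hs' : (s : ℂ) ≠ 0 := by exact_mod_cast hs.ne'
  have e1 : HasDerivAt (fun s : ℝ => (s : ℂ)) 1 s := Complex.ofRealCLM.hasDerivAt
  have h2 := ((e1.fun_pow (k + 1)).fun_inv (pow_ne_zero _ hs')).mul h1
  refine h2.congr_deriv ?_
  rw [avg]
  simp only [Nat.add_sub_cancel]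
  push_cast
  field_simp
  ring

theorem eul_avg (hf : ContinuousOn f (Ioi 0)) (hw : MonotoneOn w (Ioi 0))
    (hb : ∀ s ∈ Ioi (0 : ℝ), ‖f s‖ ≤ w s) {s : ℝ} (hs : 0 < s) :
    eul (avg k f) s = f s - (k + 1) * avg k f s := by
  have hs' : (s : ℂ) ≠ 0 := by exact_mod_cast hs.ne'
  rw [eul, (hasDerivAt_avg hf hw hb hs).deriv]
  field_simp

/-- The induction closes because the Euler derivative of an average is f - (k + 1) times the same
average. Monotonicity of the weight lets the value at s control the average over (0, s). -/
theorem IsSymbol.avg {N : ℕ} (hf : ContinuousOn f (Ioi 0)) (hw : MonotoneOn w (Ioi 0))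
    (h : IsSymbol (Ioi 0) N w f) :
    IsSymbol (Ioi 0) N (fun s => (k + 3) ^ N * w s) (avg k f) := by
  have h0 : ∀ N : ℕ, ∀ s ∈ Ioi (0 : ℝ), ‖HigherOrderSchrodinger.avg k f s‖ ≤ (k + 3) ^ N * w s := by
    intro N s hs
    have h1 : (1 : ℝ) ≤ (k + 3) ^ N := one_le_pow₀ (by linarith [Nat.cast_nonneg (α := ℝ) k])
    have h2 := norm_avg_le (k := k) hw h.bound hs
    have h3 := h.nonneg s hs
    nlinarith
  induction N with
  | zero => exact h0 0
  | succ N ih =>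
    refine ⟨h0 _, fun s hs => (hasDerivAt_avg hf hw h.bound hs).differentiableAt, ?_⟩
    refine ((h.pred.add isOpen_Ioi ((ih h.pred).const_mul isOpen_Ioi (-(k + 1)))).mono
      fun s hs => ?_).congr isOpen_Ioi fun s hs => ?_
    · have h1 : (1 : ℝ) ≤ (k + 3) ^ N := one_le_pow₀ (by linarith [Nat.cast_nonneg (α := ℝ) k])
      have h3 := h.nonneg s hs
      have h4 : ‖(-((k : ℂ) + 1))‖ = k + 1 := by
        rw [norm_neg]; exact_mod_cast Complex.norm_natCast (k + 1)
      rw [h4, pow_succ]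
      have h5 : w s ≤ (k + 3) ^ N * w s := by nlinarith
      have h6 : 0 ≤ (k + 3) ^ N * w s := h3.trans h5
      nlinarith
    · rw [eul_avg hf hw h.bound hs]
      ring

/-- The average is ∫₀¹ u^k f(su) du, a superposition of dilations, so it commutes with the Euler
derivative. It therefore inherits the vanishing of `eul f` at the origin. The bound near 0 kills the
boundary term of the integration by parts. -/
theorem eul_avg_eq_avg_eul (hw : MonotoneOn w (Ioi 0)) (hw0 : ∃ C, ∀ s ∈ Ioc (0 : ℝ) 1, w s ≤ C)
    (h : IsSymbol (Ioi 0) 2 w f) {s : ℝ} (hs : 0 < s) :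
    eul (avg k f) s = avg k (eul f) s := by
  have hf : ContinuousOn f (Ioi 0) := h.continuousOn
  have hs' : (s : ℂ) ≠ 0 := by exact_mod_cast hs.ne'
  rw [eul_avg hf hw h.bound hs]
  have hF : ∀ t ∈ Ioo 0 s, HasDerivAt (fun t : ℝ => (t : ℂ) ^ (k + 1) * f t)
      ((k + 1) * ((t : ℂ) ^ k * f t) + (t : ℂ) ^ k * eul f t) t := by
    intro t ht
    have e1 : HasDerivAt (fun s : ℝ => (s : ℂ)) 1 t := Complex.ofRealCLM.hasDerivAt
    refine ((e1.fun_pow (k + 1)).mul (h.differentiableAt t ht.1).hasDerivAt).congr_deriv ?_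
    simp only [Nat.add_sub_cancel, eul]
    push_cast
    ring
  have hi1 := intervalIntegrable_pow_mul (k := k) hf hw h.bound hs
  have hi2 := intervalIntegrable_pow_mul (k := k) h.eul.continuousOn hw h.eul.bound hs
  have hint := intervalIntegral.integral_eq_sub_of_hasDerivAt_of_tendsto hs (fa := 0)
    (fb := (s : ℂ) ^ (k + 1) * f s) hF ((hi1.const_mul _).add hi2) ?_ ?_
  · rw [intervalIntegral.integral_add (hi1.const_mul _) hi2, intervalIntegral.integral_const_mul]
      at hint
    rw [sub_zero] at hint
    rw [avg, avg, eq_sub_of_add_eq' hint]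
    field_simp
  · obtain ⟨C, hC⟩ := hw0
    have h1 : Tendsto (fun t : ℝ => t ^ (k + 1) * C) (𝓝[>] 0) (𝓝 0) := by
      have : Tendsto (fun t : ℝ => t ^ (k + 1) * C) (𝓝 0) (𝓝 (0 ^ (k + 1) * C)) :=
        (Continuous.tendsto (by fun_prop) 0)
      simp only [ne_eq, Nat.succ_ne_zero, not_false_eq_true, zero_pow, zero_mul] at this
      exact this.mono_left nhdsWithin_le_nhds
    refine squeeze_zero_norm' ?_ h1
    filter_upwards [Ioc_mem_nhdsGT (zero_lt_one (α := ℝ))] with t ht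
    rw [norm_mul, norm_pow, Complex.norm_real, Real.norm_of_nonneg ht.1.le]
    exact mul_le_mul_of_nonneg_left ((h.bound t ht.1).trans (hC t ht)) (by have := ht.1; positivity)
  · have : ContinuousAt (fun t : ℝ => (t : ℂ) ^ (k + 1) * f t) s :=
      ((Complex.continuous_ofReal.pow (k + 1)).continuousAt).mul (hf.continuousAt (Ioi_mem_nhds hs))
    exact this.tendsto.mono_left nhdsWithin_le_nhds

end avg


/-! ### Poisson integrals -/

/-- `∫₀^∞ e^{-u} u^a (u + 2p)^b du`. -/
noncomputable def poissonInt (a b : ℝ) (p : ℂ) : ℂ :=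
  ∫ u in Ioi (0 : ℝ), ((Real.exp (-u) * u ^ a : ℝ) : ℂ) * ((u : ℂ) + 2 * p) ^ (b : ℂ)

theorem one_add_pow_le_exp (k : ℕ) : ∃ C : ℝ, 0 < C ∧
    ∀ u : ℝ, 0 ≤ u → (1 + u) ^ k ≤ C * Real.exp (u / 2) := by
  refine ⟨2 ^ k * k.factorial * Real.exp (1 / 2), by positivity, fun u hu => ?_⟩
  have h := Real.pow_div_factorial_le_exp ((1 + u) / 2) (by positivity) k
  rw [div_le_iff₀ (by positivity), div_pow, div_le_iff₀ (by positivity)] at h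
  refine h.trans (le_of_eq ?_)
  rw [show (1 + u) / 2 = 1 / 2 + u / 2 by ring, Real.exp_add]
  ring

theorem integrableOn_exp_mul_rpow_mul_rpow {a : ℝ} (ha : -1 < a) (c : ℝ) :
    IntegrableOn (fun u : ℝ => Real.exp (-u) * u ^ a * (1 + u) ^ c) (Ioi 0) := by
  obtain ⟨C, hC, h⟩ := one_add_pow_le_exp ⌈c⌉₊
  have h1 := (integrableOn_rpow_mul_exp_neg_mul_rpow (p := 1) (s := a) (b := 1 / 2) ha (by norm_num)
    (by norm_num)).const_mul C
  refine Integrable.mono' h1 ?_ ?_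
  · refine ContinuousOn.aestronglyMeasurable (fun u hu => ?_) measurableSet_Ioi
    have hu' : (0 : ℝ) < u := hu
    refine ContinuousAt.continuousWithinAt ?_
    have : (1 + u : ℝ) ≠ 0 := by positivity
    exact ((Real.continuous_exp.continuousAt.comp continuousAt_neg).mul
      (Real.continuousAt_rpow_const _ _ (Or.inl hu'.ne'))).mul
      (ContinuousAt.rpow_const (by fun_prop) (Or.inl this))
  · filter_upwards [ae_restrict_mem measurableSet_Ioi] with u hu
    have hu' : (0 : ℝ) < u := hu
    rw [Real.norm_of_nonneg (by positivity), Real.rpow_one]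
    have h2 : (1 + u) ^ c ≤ C * Real.exp (u / 2) := by
      refine le_trans ?_ (h u hu'.le)
      rw [← Real.rpow_natCast]
      exact Real.rpow_le_rpow_of_exponent_le (by linarith) (Nat.le_ceil c)
    have h3 : Real.exp (-u) * Real.exp (u / 2) = Real.exp (-(1 / 2) * u) := by
      rw [← Real.exp_add]; ring_nf
    calc Real.exp (-u) * u ^ a * (1 + u) ^ c
        ≤ Real.exp (-u) * u ^ a * (C * Real.exp (u / 2)) := by gcongr
      _ = C * (u ^ a * (Real.exp (-u) * Real.exp (u / 2))) := by ring
      _ = _ := by rw [h3]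

theorem add_mem_slitPlane {p : ℂ} (hp : p ∈ Complex.slitPlane) {u : ℝ} (hu : 0 ≤ u) :
    (u : ℂ) + 2 * p ∈ Complex.slitPlane := by
  rw [Complex.mem_slitPlane_iff] at hp ⊢
  simp only [Complex.add_re, Complex.ofReal_re, Complex.mul_re, Complex.re_ofNat, Complex.im_ofNat,
    zero_mul, sub_zero, Complex.add_im, Complex.ofReal_im, Complex.mul_im, add_zero, zero_add]
  rcases hp with hp | hp
  · left; linarith
  · right; simpa using hp

/-- Two-sided bounds for `|u + 2p|`, locally uniform in `p` off the negative axis. -/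
theorem exists_bounds_norm_add {p₀ : ℂ} (hp : p₀ ∈ Complex.slitPlane) :
    ∃ ε > 0, ∃ K : ℝ, 1 ≤ K ∧ Metric.ball p₀ ε ⊆ Complex.slitPlane ∧
      ∀ p ∈ Metric.ball p₀ ε, ∀ u : ℝ, 0 ≤ u → K⁻¹ ≤ ‖(u : ℂ) + 2 * p‖ ∧
        ‖(u : ℂ) + 2 * p‖ ≤ K * (1 + u) := by
  obtain ⟨δ, hδ, hball⟩ := Metric.isOpen_iff.1 Complex.isOpen_slitPlane p₀ hp
  have hlow : ∀ p ∈ Metric.ball p₀ (δ / 2), ∀ u : ℝ, 0 ≤ u → δ ≤ ‖(u : ℂ) + 2 * p‖ := by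
    intro p hp u hu
    have h1 : ((-(u / 2) : ℝ) : ℂ) ∉ Metric.ball p₀ δ := fun h => by
      have := hball h
      rw [Complex.ofReal_mem_slitPlane] at this
      linarith
    rw [Metric.mem_ball, not_lt] at h1
    rw [Metric.mem_ball] at hp
    have h2 := dist_triangle ((-(u / 2) : ℝ) : ℂ) p p₀
    have h3 : ‖(u : ℂ) + 2 * p‖ = 2 * dist ((-(u / 2) : ℝ) : ℂ) p := by
      rw [dist_comm, dist_eq_norm]
      calc ‖(u : ℂ) + 2 * p‖ = ‖(2 : ℂ) * (p - ((-(u / 2) : ℝ) : ℂ))‖ := by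
            congr 1; push_cast; ring
        _ = _ := by rw [norm_mul, Complex.norm_two]
    rw [h3]; linarith
  refine ⟨δ / 2, by positivity, max (max δ⁻¹ 1) (2 * (‖p₀‖ + δ)), ?_, ?_, ?_⟩
  · exact (le_max_right _ _).trans (le_max_left _ _)
  · exact (Metric.ball_subset_ball (by linarith)).trans hball
  · intro p hp u hu
    have hK1 : 1 ≤ max (max δ⁻¹ 1) (2 * (‖p₀‖ + δ)) := (le_max_right _ _).trans (le_max_left _ _)
    constructor
    · refine le_trans ?_ (hlow p hp u hu)
      refine inv_le_of_inv_le₀ hδ ((le_max_left _ _).trans (le_max_left _ _))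
    · have h1 : ‖p‖ ≤ ‖p₀‖ + δ := by
        rw [Metric.mem_ball, dist_eq_norm] at hp
        have := norm_sub_norm_le p p₀
        linarith
      have h2 : ‖(u : ℂ) + 2 * p‖ ≤ u + 2 * ‖p‖ := by
        refine (norm_add_le _ _).trans ?_
        rw [norm_mul, Complex.norm_two, Complex.norm_real, Real.norm_of_nonneg hu]
      have h3 : 2 * (‖p₀‖ + δ) ≤ max (max δ⁻¹ 1) (2 * (‖p₀‖ + δ)) := le_max_right _ _
      nlinarith

theorem rpow_le_of_bounds {t K v b : ℝ} (hK : 1 ≤ K) (hv : 1 ≤ v) (h1 : K⁻¹ ≤ t) (h2 : t ≤ K * v) :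
    t ^ b ≤ K ^ |b| * v ^ |b| := by
  have hK0 : 0 < K := by linarith
  have ht : 0 < t := (inv_pos.2 hK0).trans_le h1
  rw [← Real.mul_rpow hK0.le (by linarith)]
  rcases le_total 0 b with hb | hb
  · rw [abs_of_nonneg hb]; exact Real.rpow_le_rpow ht.le h2 hb
  · rw [abs_of_nonpos hb]
    have h3 : t ^ b ≤ K⁻¹ ^ b := Real.rpow_le_rpow_of_nonpos (inv_pos.2 hK0) h1 hb
    rw [Real.inv_rpow hK0.le, ← Real.rpow_neg hK0.le] at h3
    exact h3.trans (Real.rpow_le_rpow hK0.le (by nlinarith) (by linarith))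

theorem continuousOn_poissonIntegrand (a b : ℝ) {p : ℂ} (hp : p ∈ Complex.slitPlane) :
    ContinuousOn (fun u : ℝ => ((Real.exp (-u) * u ^ a : ℝ) : ℂ) * ((u : ℂ) + 2 * p) ^ (b : ℂ))
      (Ioi 0) := by
  intro u hu
  have hu' : (0 : ℝ) < u := hu
  refine ContinuousAt.continuousWithinAt (ContinuousAt.mul ?_ ?_)
  · exact Complex.continuous_ofReal.continuousAt.comp
      ((Real.continuous_exp.continuousAt.comp continuousAt_neg).mul
      (Real.continuousAt_rpow_const _ _ (Or.inl hu'.ne')))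
  · exact ContinuousAt.cpow (by fun_prop) continuousAt_const (add_mem_slitPlane hp hu'.le)

theorem norm_poissonIntegrand (a b : ℝ) (p : ℂ) {u : ℝ} (hu : 0 < u) :
    ‖((Real.exp (-u) * u ^ a : ℝ) : ℂ) * ((u : ℂ) + 2 * p) ^ (b : ℂ)‖ =
      Real.exp (-u) * u ^ a * ‖(u : ℂ) + 2 * p‖ ^ b := by
  rw [norm_mul, Complex.norm_real, Real.norm_of_nonneg (by positivity), Complex.norm_cpow_real]

theorem integrableOn_poissonIntegrand {a : ℝ} (ha : -1 < a) (b : ℝ) {p : ℂ}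
    (hp : p ∈ Complex.slitPlane) :
    IntegrableOn (fun u : ℝ => ((Real.exp (-u) * u ^ a : ℝ) : ℂ) * ((u : ℂ) + 2 * p) ^ (b : ℂ))
      (Ioi 0) := by
  obtain ⟨ε, hε, K, hK, -, hb⟩ := exists_bounds_norm_add hp
  refine Integrable.mono' ((integrableOn_exp_mul_rpow_mul_rpow ha |b|).const_mul (K ^ |b|))
    ((continuousOn_poissonIntegrand a b hp).aestronglyMeasurable measurableSet_Ioi) ?_
  filter_upwards [ae_restrict_mem measurableSet_Ioi] with u hu
  have hu' : (0 : ℝ) < u := hu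
  rw [norm_poissonIntegrand a b p hu']
  obtain ⟨h1, h2⟩ := hb p (Metric.mem_ball_self hε) u hu'.le
  have := rpow_le_of_bounds (b := b) hK (by linarith) h1 h2
  calc _ ≤ Real.exp (-u) * u ^ a * (K ^ |b| * (1 + u) ^ |b|) := by gcongr
    _ = _ := by ring

theorem hasDerivAt_poissonInt {a : ℝ} (ha : -1 < a) (b : ℝ) {p₀ : ℂ} (hp : p₀ ∈ Complex.slitPlane) :
    HasDerivAt (poissonInt a b) (2 * b * poissonInt a (b - 1) p₀) p₀ := by
  obtain ⟨ε, hε, K, hK, hsub, hb⟩ := exists_bounds_norm_add hp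
  have key := hasDerivAt_integral_of_dominated_loc_of_deriv_le (μ := volume.restrict (Ioi (0 : ℝ)))
    (F := fun p u => ((Real.exp (-u) * u ^ a : ℝ) : ℂ) * ((u : ℂ) + 2 * p) ^ (b : ℂ))
    (F' := fun p u => 2 * b * (((Real.exp (-u) * u ^ a : ℝ) : ℂ) *
      ((u : ℂ) + 2 * p) ^ ((b - 1 : ℝ) : ℂ))) (x₀ := p₀)
    (bound := fun u => 2 * |b| * (K ^ |b - 1| * (Real.exp (-u) * u ^ a * (1 + u) ^ |b - 1|)))
    (Metric.ball_mem_nhds p₀ hε) ?_ (integrableOn_poissonIntegrand ha b hp) ?_ ?_ ?_ ?_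
  · have h2 := key.2
    rw [integral_const_mul] at h2
    exact h2
  · filter_upwards [Metric.ball_mem_nhds p₀ hε] with p hp'
    exact (continuousOn_poissonIntegrand a b (hsub hp')).aestronglyMeasurable measurableSet_Ioi
  · exact ((integrableOn_poissonIntegrand ha (b - 1) hp).aestronglyMeasurable).const_mul _
  · filter_upwards [ae_restrict_mem measurableSet_Ioi] with u hu p hp'
    have hu' : (0 : ℝ) < u := hu
    rw [norm_mul, norm_poissonIntegrand a _ p hu', norm_mul, Complex.norm_two, Complex.norm_real,
      Real.norm_eq_abs]
    obtain ⟨h1, h2⟩ := hb p hp' u hu'.le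
    have := rpow_le_of_bounds (b := b - 1) hK (by linarith) h1 h2
    calc _ ≤ 2 * |b| * (Real.exp (-u) * u ^ a * (K ^ |b - 1| * (1 + u) ^ |b - 1|)) := by gcongr
      _ = _ := by ring
  · exact ((integrableOn_exp_mul_rpow_mul_rpow ha _).const_mul _).const_mul _
  · filter_upwards [ae_restrict_mem measurableSet_Ioi] with u hu p hp'
    have hu' : (0 : ℝ) < u := hu
    have h1 : HasDerivAt (fun p : ℂ => (u : ℂ) + 2 * p) 2 p := by
      simpa using ((hasDerivAt_id p).const_mul 2).const_add (u : ℂ)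
    have h2 := (h1.cpow_const (c := (b : ℂ)) (add_mem_slitPlane (hsub hp') hu'.le)).const_mul
      ((Real.exp (-u) * u ^ a : ℝ) : ℂ)
    refine h2.congr_deriv ?_
    push_cast
    ring

/-- The kernel `e^{-p} ∫₀^∞ e^{-u} u^a (u + 2p)^a du`. -/
noncomputable def poissonKer (a : ℝ) (p : ℂ) : ℂ := Complex.exp (-p) * poissonInt a a p

/-- Integrate the u-derivative of e^{-u} u^a (u + 2p)^a over the half line. Since a > 0, both
boundary terms vanish. -/
theorem poissonInt_parts {a : ℝ} (ha : 0 < a) {p : ℂ} (hp : p ∈ Complex.slitPlane) :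
    poissonInt a a p = 2 * a * poissonInt a (a - 1) p + 2 * a * p * poissonInt (a - 1) (a - 1) p := by
  have hp0 : ∀ u : ℝ, 0 ≤ u → (u : ℂ) + 2 * p ≠ 0 := fun u hu =>
    Complex.slitPlane_ne_zero (add_mem_slitPlane hp hu)
  have i1 := integrableOn_poissonIntegrand (by linarith : -1 < a) a hp
  have i2 := integrableOn_poissonIntegrand (by linarith : -1 < a) (a - 1) hp
  have i3 := integrableOn_poissonIntegrand (by linarith : -1 < a - 1) (a - 1) hp
  have hderiv : ∀ u ∈ Ioi (0 : ℝ), HasDerivAt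
      (fun u : ℝ => ((Real.exp (-u) * u ^ a : ℝ) : ℂ) * ((u : ℂ) + 2 * p) ^ (a : ℂ))
      (-(((Real.exp (-u) * u ^ a : ℝ) : ℂ) * ((u : ℂ) + 2 * p) ^ (a : ℂ)) +
        (2 * a * (((Real.exp (-u) * u ^ a : ℝ) : ℂ) * ((u : ℂ) + 2 * p) ^ ((a - 1 : ℝ) : ℂ)) +
        2 * a * p * (((Real.exp (-u) * u ^ (a - 1) : ℝ) : ℂ) *
          ((u : ℂ) + 2 * p) ^ ((a - 1 : ℝ) : ℂ)))) u := by
    intro u hu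
    have hu' : (0 : ℝ) < u := hu
    have e1 : HasDerivAt (fun u : ℂ => u + 2 * p) 1 (u : ℂ) := (hasDerivAt_id _).add_const _
    have e2 : HasDerivAt (fun u : ℝ => ((u : ℂ) + 2 * p) ^ (a : ℂ))
        (a * ((u : ℂ) + 2 * p) ^ ((a : ℂ) - 1) * 1) u :=
      (e1.cpow_const (c := (a : ℂ)) (add_mem_slitPlane hp hu'.le)).comp_ofReal
    have e3 : HasDerivAt (fun u : ℝ => Real.exp (-u) * u ^ a)
        (Real.exp (-u) * (-1) * u ^ a + Real.exp (-u) * (a * u ^ (a - 1))) u :=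
      ((hasDerivAt_neg u).exp).mul (Real.hasDerivAt_rpow_const (Or.inl hu'.ne'))
    refine (e3.ofReal_comp.mul e2).congr_deriv ?_
    have f1 : ((u : ℂ) + 2 * p) ^ (a : ℂ) = ((u : ℂ) + 2 * p) ^ ((a - 1 : ℝ) : ℂ) *
        ((u : ℂ) + 2 * p) := by
      rw [Complex.ofReal_sub, Complex.ofReal_one, Complex.cpow_sub _ _ (hp0 u hu'.le),
        Complex.cpow_one, div_mul_cancel₀ _ (hp0 u hu'.le)]
    have f2 : u ^ a = u ^ (a - 1) * u := by
      rw [← Real.rpow_add_one hu'.ne']; congr 1; ring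
    rw [show ((a : ℂ) - 1) = ((a - 1 : ℝ) : ℂ) by push_cast; rfl, f1, f2]
    push_cast
    ring
  have hint := (i1.neg).add (((i2.const_mul (2 * a : ℂ))).add (i3.const_mul (2 * a * p)))
  have hcont : ContinuousWithinAt
      (fun u : ℝ => ((Real.exp (-u) * u ^ a : ℝ) : ℂ) * ((u : ℂ) + 2 * p) ^ (a : ℂ)) (Ici 0) 0 := by
    refine ContinuousAt.continuousWithinAt (ContinuousAt.mul ?_ ?_)
    · exact Complex.continuous_ofReal.continuousAt.comp
        ((Real.continuous_exp.continuousAt.comp continuousAt_neg).mul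
        (Real.continuousAt_rpow_const _ _ (Or.inr ha.le)))
    · exact ContinuousAt.cpow (by fun_prop) continuousAt_const (add_mem_slitPlane hp le_rfl)
  have hlim : Tendsto (fun u : ℝ => ((Real.exp (-u) * u ^ a : ℝ) : ℂ) * ((u : ℂ) + 2 * p) ^ (a : ℂ))
      atTop (𝓝 0) :=
    tendsto_zero_of_hasDerivAt_of_integrableOn_Ioi hderiv hint i1
  have key := integral_Ioi_of_hasDerivAt_of_tendsto hcont hderiv hint hlim
  rw [Real.zero_rpow ha.ne'] at key
  have k2 := integral_add i1.neg (((i2.const_mul (2 * a : ℂ))).add (i3.const_mul (2 * a * p)))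
  have k3 := integral_add (i2.const_mul (2 * a : ℂ)) (i3.const_mul (2 * a * p))
  simp only [Pi.add_apply, Pi.neg_apply] at k2 k3
  rw [k2, k3, integral_neg, integral_const_mul, integral_const_mul] at key
  simp only [poissonInt]
  linear_combination -key + (by simp : ((Real.exp (-0) * 0 : ℝ) : ℂ) * ((0 : ℝ) + 2 * p) ^ (a : ℂ) = 0)

/-- The Bessel recurrence: differentiation lowers the parameter by one and brings out a factor p.
Integrating it back along a ray yields the expansion at 0. -/
theorem hasDerivAt_poissonKer {a : ℝ} (ha : 0 < a) {p : ℂ} (hp : p ∈ Complex.slitPlane) :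
    HasDerivAt (poissonKer a) (-(2 * a * p * poissonKer (a - 1) p)) p := by
  have h1 := ((hasDerivAt_neg p).cexp).mul (hasDerivAt_poissonInt (by linarith : -1 < a) a hp)
  refine h1.congr_deriv ?_
  simp only [poissonKer]
  rw [poissonInt_parts ha hp]
  ring


/-! ### Poisson kernels along rays -/

section rays

variable {a : ℝ} {θ : ℂ}

theorem mem_slitPlane_of_re_nonneg {p : ℂ} (h : 0 ≤ p.re) (h0 : p ≠ 0) : p ∈ Complex.slitPlane := by
  rw [Complex.mem_slitPlane_iff]
  rcases h.lt_or_eq with h1 | h1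
  · exact Or.inl h1
  · refine Or.inr fun h2 => h0 (Complex.ext h1.symm h2)

theorem le_norm_add {p : ℂ} (h : 0 ≤ p.re) (u : ℝ) : u ≤ ‖(u : ℂ) + 2 * p‖ := by
  refine le_trans ?_ ((le_abs_self _).trans (Complex.abs_re_le_norm _))
  simp; linarith

theorem two_mul_norm_le {p : ℂ} (h : 0 ≤ p.re) {u : ℝ} (hu : 0 ≤ u) :
    2 * ‖p‖ ≤ ‖(u : ℂ) + 2 * p‖ := by
  rw [← Complex.norm_two, ← norm_mul]
  refine le_of_sq_le_sq ?_ (norm_nonneg _)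
  rw [← Complex.normSq_eq_norm_sq, ← Complex.normSq_eq_norm_sq, Complex.normSq_apply,
    Complex.normSq_apply]
  simp
  nlinarith [mul_nonneg hu h]

theorem norm_add_le_mul {p : ℂ} {u : ℝ} (hu : 0 ≤ u) :
    ‖(u : ℂ) + 2 * p‖ ≤ 2 * (1 + u) * (1 + ‖p‖) := by
  refine (norm_add_le _ _).trans ?_
  rw [norm_mul, Complex.norm_two, Complex.norm_real, Real.norm_of_nonneg hu]
  nlinarith [norm_nonneg p, mul_nonneg hu (norm_nonneg p)]

theorem norm_add_rpow_le (ha : 0 ≤ a) {p : ℂ} {u : ℝ} (hu : 0 ≤ u) :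
    ‖(u : ℂ) + 2 * p‖ ^ a ≤ 2 ^ a * (1 + u) ^ a * (1 + ‖p‖) ^ a := by
  have := norm_nonneg p
  rw [← Real.mul_rpow (by norm_num) (by positivity), ← Real.mul_rpow (by positivity) (by positivity)]
  exact Real.rpow_le_rpow (norm_nonneg _) (norm_add_le_mul hu) ha

/-- In the closed right half plane |p| ≤ |u + 2p|, so j factors p pay for lowering the exponent by
j. Hence Euler derivatives of the Poisson integral stay bounded down to p = 0. -/
theorem norm_pow_mul_rpow_le {p : ℂ} (h : 0 ≤ p.re) (hp : p ≠ 0) {u : ℝ} (hu : 0 ≤ u) (b : ℝ) (j : ℕ) :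
    ‖p‖ ^ j * ‖(u : ℂ) + 2 * p‖ ^ (b - j) ≤ ‖(u : ℂ) + 2 * p‖ ^ b := by
  have h1 := two_mul_norm_le h hu
  have hp' : 0 < ‖p‖ := norm_pos_iff.2 hp
  have h2 : 0 < ‖(u : ℂ) + 2 * p‖ := by linarith
  rw [Real.rpow_sub h2, Real.rpow_natCast, mul_div_assoc', div_le_iff₀ (by positivity), mul_comm]
  exact mul_le_mul_of_nonneg_left (pow_le_pow_left₀ hp'.le (by linarith) j)
    (Real.rpow_nonneg h2.le _)

theorem norm_pow_mul_poissonInt_le (ha : 0 ≤ a) : ∃ C : ℝ, 0 ≤ C ∧ ∀ p : ℂ, 0 ≤ p.re → p ≠ 0 → ∀ j : ℕ,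
    ‖p ^ j * poissonInt a (a - j) p‖ ≤ C * (1 + ‖p‖) ^ a := by
  refine ⟨∫ u in Ioi (0 : ℝ), 2 ^ a * (Real.exp (-u) * u ^ a * (1 + u) ^ a), ?_, ?_⟩
  · refine setIntegral_nonneg measurableSet_Ioi fun u hu => ?_
    have hu' : (0 : ℝ) < u := hu
    positivity
  · intro p hp hp0 j
    rw [poissonInt, ← integral_const_mul, ← integral_mul_const]
    refine norm_integral_le_of_norm_le ?_ ?_
    · exact ((integrableOn_exp_mul_rpow_mul_rpow (by linarith : -1 < a) a).const_mul _).mul_const _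
    · filter_upwards [ae_restrict_mem measurableSet_Ioi] with u hu
      have hu' : (0 : ℝ) < u := hu
      rw [norm_mul, norm_pow, norm_poissonIntegrand _ _ _ hu']
      calc ‖p‖ ^ j * (Real.exp (-u) * u ^ a * ‖(u : ℂ) + 2 * p‖ ^ (a - j))
          = Real.exp (-u) * u ^ a * (‖p‖ ^ j * ‖(u : ℂ) + 2 * p‖ ^ (a - j)) := by ring
        _ ≤ Real.exp (-u) * u ^ a * (2 ^ a * (1 + u) ^ a * (1 + ‖p‖) ^ a) := by
            refine mul_le_mul_of_nonneg_left ?_ (by positivity)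
            exact (norm_pow_mul_rpow_le hp hp0 hu'.le a j).trans (norm_add_rpow_le ha hu'.le)
        _ = _ := by ring

/-- One factor p is kept outside and only j of the j + 1 lowered exponents are absorbed. The
remaining exponent a - 1 is harmless: for a ≤ 1 the bound |u + 2p| ≥ u leaves u^{2a-1}, integrable
at 0 as a > 0. -/
theorem norm_pow_succ_mul_poissonInt_le (ha : 0 < a) :
    ∃ C : ℝ, 0 ≤ C ∧ ∀ p : ℂ, 0 ≤ p.re → p ≠ 0 → ∀ j : ℕ,
    ‖p ^ (j + 1) * poissonInt a (a - (j + 1 : ℕ)) p‖ ≤ C * (‖p‖ * (1 + ‖p‖) ^ a) := by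
  refine ⟨∫ u in Ioi (0 : ℝ), (Real.exp (-u) * u ^ (2 * a - 1) * (1 + u) ^ (0 : ℝ) +
    2 ^ a * (Real.exp (-u) * u ^ a * (1 + u) ^ a)), ?_, ?_⟩
  · refine setIntegral_nonneg measurableSet_Ioi fun u hu => ?_
    have hu' : (0 : ℝ) < u := hu
    positivity
  · intro p hp hp0 j
    rw [poissonInt, ← integral_const_mul, ← integral_mul_const]
    refine norm_integral_le_of_norm_le ?_ ?_
    · exact ((integrableOn_exp_mul_rpow_mul_rpow (by linarith : -1 < 2 * a - 1) 0).add
        ((integrableOn_exp_mul_rpow_mul_rpow (by linarith : -1 < a) a).const_mul _)).mul_const _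
    · filter_upwards [ae_restrict_mem measurableSet_Ioi] with u hu
      have hu' : (0 : ℝ) < u := hu
      rw [norm_mul, norm_pow, norm_poissonIntegrand _ _ _ hu']
      have h1 := norm_pow_mul_rpow_le hp hp0 hu'.le (a - 1) j
      have h2 : ‖(u : ℂ) + 2 * p‖ ^ (a - 1) ≤
          u ^ (a - 1) + 2 ^ a * (1 + u) ^ a * (1 + ‖p‖) ^ a := by
        rcases le_total a 1 with h | h
        · have := Real.rpow_le_rpow_of_nonpos hu' (le_norm_add hp u) (by linarith : a - 1 ≤ 0)
          have : 0 ≤ 2 ^ a * (1 + u) ^ a * (1 + ‖p‖) ^ a := by positivity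
          linarith
        · have h3 : ‖(u : ℂ) + 2 * p‖ ^ (a - 1) ≤ (2 * (1 + u) * (1 + ‖p‖)) ^ (a - 1) :=
            Real.rpow_le_rpow (norm_nonneg _) (norm_add_le_mul hu'.le) (by linarith)
          have h4 : (2 * (1 + u) * (1 + ‖p‖)) ^ (a - 1) ≤ (2 * (1 + u) * (1 + ‖p‖)) ^ a :=
            Real.rpow_le_rpow_of_exponent_le (by nlinarith [norm_nonneg p]) (by linarith)
          rw [Real.mul_rpow (by positivity) (by positivity), Real.mul_rpow (by positivity)
            (by positivity)] at h4
          rw [Real.mul_rpow (by positivity) (by positivity)] at h3 h4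
          have : 0 ≤ u ^ (a - 1) := by positivity
          rw [Real.mul_rpow (by positivity) (by positivity)] at h3
          rw [Real.mul_rpow (by positivity) (by positivity)] at h4
          linarith
      have h3 : u ^ (2 * a - 1) = u ^ a * u ^ (a - 1) := by
        rw [← Real.rpow_add hu']; congr 1; ring
      have h4 : (1 : ℝ) ≤ (1 + ‖p‖) ^ a := Real.one_le_rpow (by linarith [norm_nonneg p]) ha.le
      have h5 : (a - (j + 1 : ℕ)) = a - 1 - j := by push_cast; ring
      rw [h3, Real.rpow_zero, h5]
      calc ‖p‖ ^ (j + 1) * (Real.exp (-u) * u ^ a * ‖(u : ℂ) + 2 * p‖ ^ (a - 1 - j))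
          = Real.exp (-u) * u ^ a * ‖p‖ * (‖p‖ ^ j * ‖(u : ℂ) + 2 * p‖ ^ (a - 1 - j)) := by ring
        _ ≤ Real.exp (-u) * u ^ a * ‖p‖ *
            (u ^ (a - 1) * (1 + ‖p‖) ^ a + 2 ^ a * (1 + u) ^ a * (1 + ‖p‖) ^ a) := by
            gcongr
            refine (h1.trans h2).trans ?_
            gcongr
            have : 0 ≤ u ^ (a - 1) := by positivity
            nlinarith
        _ = _ := by ring

/-- The two-term recurrence that `IsSymbol.of_family` asks for, satisfied by the sequence p^j I(a, a
- j) along the ray p = θs, where I is `poissonInt`. -/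
theorem eul_poissonInt_ray (hθ : 0 ≤ θ.re) (hθ0 : θ ≠ 0) (ha : 0 ≤ a) (j : ℕ) {s : ℝ} (hs : 0 < s) :
    HasDerivAt (fun s : ℝ => (θ * s) ^ j * poissonInt a (a - j) (θ * s))
      ((j * ((θ * s) ^ j * poissonInt a (a - j) (θ * s)) +
        2 * (a - j : ℝ) * ((θ * s) ^ (j + 1) * poissonInt a (a - (j + 1 : ℕ)) (θ * s))) / s) s := by
  have hs' : (s : ℂ) ≠ 0 := by exact_mod_cast hs.ne'
  have hmem : θ * s ∈ Complex.slitPlane := by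
    refine mem_slitPlane_of_re_nonneg ?_ (mul_ne_zero hθ0 hs')
    simp only [Complex.mul_re, Complex.ofReal_re, Complex.ofReal_im, mul_zero, sub_zero]
    exact mul_nonneg hθ hs.le
  have e1 : HasDerivAt (fun z : ℂ => θ * z) θ (s : ℂ) := by
    simpa using (hasDerivAt_id (s : ℂ)).const_mul θ
  have e2 := (e1.fun_pow j).mul
    ((hasDerivAt_poissonInt (by linarith : -1 < a) (a - j) hmem).comp (s : ℂ) e1)
  refine (e2.comp_ofReal).congr_deriv ?_
  have h5 : (a - (j + 1 : ℕ)) = a - j - 1 := by push_cast; ring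
  rw [h5]
  rcases j with _ | j
  · simp only [Function.comp]; field_simp; push_cast; ring
  · simp only [Function.comp, Nat.add_sub_cancel]; field_simp; push_cast; ring

theorem ray_re_nonneg (hθ : 0 ≤ θ.re) {s : ℝ} (hs : 0 < s) : 0 ≤ (θ * s).re := by
  simp only [Complex.mul_re, Complex.ofReal_re, Complex.ofReal_im, mul_zero, sub_zero]
  exact mul_nonneg hθ hs.le

theorem ray_ne_zero (hθ0 : θ ≠ 0) {s : ℝ} (hs : 0 < s) : θ * s ≠ 0 :=
  mul_ne_zero hθ0 (by exact_mod_cast hs.ne')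

theorem norm_ray (hθ1 : ‖θ‖ = 1) {s : ℝ} (hs : 0 < s) : ‖θ * s‖ = s := by
  rw [norm_mul, hθ1, one_mul, Complex.norm_real, Real.norm_of_nonneg hs.le]

theorem isSymbol_poissonInt_ray (hθ : 0 ≤ θ.re) (hθ1 : ‖θ‖ = 1) (ha : 0 ≤ a) (N : ℕ) :
    ∃ C : ℝ, 0 ≤ C ∧ IsSymbol (Ioi 0) N (fun s => C * (1 + s) ^ a)
      (fun s => poissonInt a a (θ * s)) := by
  have hθ0 : θ ≠ 0 := norm_pos_iff.1 (by rw [hθ1]; exact one_pos)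
  obtain ⟨C, hC, hb⟩ := norm_pow_mul_poissonInt_le ha
  have := IsSymbol.of_family (S := Ioi 0) (k := N) (K := N) (j := 0) (M := 2 * (a + N) )
    (w := fun s => C * (1 + s) ^ a) isOpen_Ioi
    (X := fun j s => (θ * s) ^ j * poissonInt a (a - j) (θ * s)) (α := fun j => j)
    (β := fun j => 2 * (a - j : ℝ)) (fun j hj => ?_) (fun j hj => ?_)
    (fun j _ s hs => (eul_poissonInt_ray hθ hθ0 ha j hs).differentiableAt) (fun j _ s hs => ?_)
    (fun j _ s hs => ?_) (by omega)
  · refine ⟨(1 + 2 * (2 * (a + N))) ^ N * C, by positivity, ?_⟩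
    simpa [mul_assoc] using this
  · have : (j : ℝ) ≤ N := by exact_mod_cast hj
    rw [Complex.norm_natCast]
    linarith
  · have h1 : (j : ℝ) ≤ N := by exact_mod_cast hj
    have h2 : (0 : ℝ) ≤ j := Nat.cast_nonneg j
    rw [norm_mul, Complex.norm_two, Complex.norm_real, Real.norm_eq_abs]
    have : |a - j| ≤ a + N := abs_le.2 ⟨by linarith, by linarith⟩
    linarith
  · have hs' : (s : ℂ) ≠ 0 := by exact_mod_cast (ne_of_gt hs : s ≠ 0)
    simp only [eul, (eul_poissonInt_ray hθ hθ0 ha j hs).deriv]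
    field_simp
  · have := hb (θ * s) (ray_re_nonneg hθ hs) (ray_ne_zero hθ0 hs) j
    rwa [norm_ray hθ1 hs] at this

theorem isSymbol_eul_poissonInt_ray (hθ : 0 ≤ θ.re) (hθ1 : ‖θ‖ = 1) (ha : 0 ≤ a) (N : ℕ) :
    ∃ C : ℝ, 0 ≤ C ∧ IsSymbol (Ioi 0) N (fun s => C * (s * (1 + s) ^ a))
      (eul fun s => poissonInt a a (θ * s)) := by
  have hθ0 : θ ≠ 0 := norm_pos_iff.1 (by rw [hθ1]; exact one_pos)
  have heul : ∀ s ∈ Ioi (0 : ℝ), eul (fun s => poissonInt a a (θ * s)) s =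
      (2 * a) * ((θ * s) ^ 1 * poissonInt a (a - (1 : ℕ)) (θ * s)) := by
    intro s hs
    have hs' : (s : ℂ) ≠ 0 := by exact_mod_cast (ne_of_gt hs : s ≠ 0)
    have := (eul_poissonInt_ray hθ hθ0 ha 0 hs).deriv
    simp only [pow_zero, one_mul, Nat.cast_zero, sub_zero, zero_mul, zero_add] at this
    rw [eul, this]
    field_simp
  -- At a = 0 the weight u^{2a-1} is not integrable, but the factor 2a makes the Euler derivative
  -- vanish.
  rcases ha.eq_or_lt with ha0 | ha0
  · refine ⟨0, le_rfl, (IsSymbol.zero (w := fun s => 0 * (s * (1 + s) ^ a)) isOpen_Ioi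
      fun s _ => by simp).congr isOpen_Ioi fun s hs => ?_⟩
    rw [heul s hs, ← ha0]; simp
  obtain ⟨C, hC, hb⟩ := norm_pow_succ_mul_poissonInt_le ha0
  have := IsSymbol.of_family (S := Ioi 0) (k := N) (K := N) (j := 0) (M := 2 * (a + N + 1))
    (w := fun s => C * (s * (1 + s) ^ a)) isOpen_Ioi
    (X := fun j s => (θ * s) ^ (j + 1) * poissonInt a (a - (j + 1 : ℕ)) (θ * s))
    (α := fun j => (j + 1 : ℕ)) (β := fun j => 2 * (a - (j + 1 : ℕ) : ℝ)) (fun j hj => ?_)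
    (fun j hj => ?_)
    (fun j _ s hs => (eul_poissonInt_ray hθ hθ0 ha (j + 1) hs).differentiableAt)
    (fun j _ s hs => ?_) (fun j _ s hs => ?_) (by omega)
  · refine ⟨‖(2 * a : ℂ)‖ * ((1 + 2 * (2 * (a + N + 1))) ^ N * C), by positivity, ?_⟩
    refine ((this.const_mul isOpen_Ioi (2 * a : ℂ)).mono fun s hs => le_of_eq ?_).congr isOpen_Ioi
      fun s hs => ?_
    · ring
    · rw [heul s hs]
  · have : (j : ℝ) ≤ N := by exact_mod_cast hj
    rw [Complex.norm_natCast]; push_cast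
    linarith
  · have h1 : (j : ℝ) ≤ N := by exact_mod_cast hj
    have h2 : (0 : ℝ) ≤ j := Nat.cast_nonneg j
    rw [norm_mul, Complex.norm_two, Complex.norm_real, Real.norm_eq_abs]
    have : |a - (j + 1 : ℕ)| ≤ a + N + 1 := abs_le.2 ⟨by push_cast; linarith, by push_cast; linarith⟩
    linarith
  · have hs' : (s : ℂ) ≠ 0 := by exact_mod_cast (ne_of_gt hs : s ≠ 0)
    simp only [eul, (eul_poissonInt_ray hθ hθ0 ha (j + 1) hs).deriv]
    field_simp
  · have := hb (θ * s) (ray_re_nonneg hθ hs) (ray_ne_zero hθ0 hs) j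
    rwa [norm_ray hθ1 hs] at this

/-- Symbols of polynomial growth whose Euler derivative vanishes at the origin to first order. -/
def LipSymbol (f : ℝ → ℂ) : Prop :=
  ∀ N, ∃ C : ℝ, ∃ M : ℕ, 0 ≤ C ∧ IsSymbol (Ioi 0) N (fun s => C * (1 + s) ^ M) f ∧
    IsSymbol (Ioi 0) N (fun s => C * (s * (1 + s) ^ M)) (eul f)

theorem lipSymbol_of {f : ℝ → ℂ} (h : ∀ N, ∃ C : ℝ, ∃ M : ℕ, 0 ≤ C ∧
      IsSymbol (Ioi 0) N (fun s => C * (1 + s) ^ M) f)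
    (h' : ∀ N, ∃ C : ℝ, ∃ M : ℕ, 0 ≤ C ∧ IsSymbol (Ioi 0) N (fun s => C * (s * (1 + s) ^ M)) (eul f)) :
    LipSymbol f := by
  intro N
  obtain ⟨C, M, hC, h1⟩ := h N
  obtain ⟨C', M', hC', h2⟩ := h' N
  refine ⟨C + C', M + M', by positivity, h1.mono fun s hs => ?_, h2.mono fun s hs => ?_⟩
  · have hs' : (0 : ℝ) < s := hs
    have : (1 + s) ^ M ≤ (1 + s) ^ (M + M') := pow_le_pow_right₀ (by linarith) (by omega)
    nlinarith [pow_pos (by linarith : 0 < 1 + s) (M + M')]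
  · have hs' : (0 : ℝ) < s := hs
    have : (1 + s) ^ M' ≤ (1 + s) ^ (M + M') := pow_le_pow_right₀ (by linarith) (by omega)
    have h3 : s * (1 + s) ^ M' ≤ s * (1 + s) ^ (M + M') := by gcongr
    have h4 : 0 ≤ s * (1 + s) ^ (M + M') := by positivity
    nlinarith

theorem isSymbol_exp_ray (hθ : 0 ≤ θ.re) (N : ℕ) :
    ∃ C : ℝ, 0 ≤ C ∧ IsSymbol (Ioi 0) N (fun s => C * (1 + s) ^ N)
      (fun s => Complex.exp (-(θ * s))) := by
  refine ⟨(1 + 2 * (‖θ‖ + N)) ^ N, by positivity, ?_⟩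
  refine IsSymbol.exp_neg N (C := ‖θ‖ + N) (by linarith [Nat.cast_nonneg (α := ℝ) N])
    (by linarith [norm_nonneg θ]) fun j hj s hs => ?_
  have h1 : Real.exp (-(θ.re * s)) ≤ 1 := Real.exp_le_one_iff.2 (by have := mul_nonneg hθ hs.le; linarith)
  have h2 : s ^ j ≤ (1 + s) ^ j := pow_le_pow_left₀ hs.le (by linarith) j
  have h3 : (1 + s) ^ j ≤ (1 + s) ^ N := pow_le_pow_right₀ (by linarith) hj
  have h4 : 0 < s ^ j := by positivity
  nlinarith

theorem one_add_rpow_le_pow {s : ℝ} (hs : 0 < s) (a : ℝ) : (1 + s) ^ a ≤ (1 + s) ^ ⌈a⌉₊ := by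
  rw [← Real.rpow_natCast]
  exact Real.rpow_le_rpow_of_exponent_le (by linarith) (Nat.le_ceil a)

theorem lipSymbol_poissonKer_ray (hθ : 0 ≤ θ.re) (hθ1 : ‖θ‖ = 1) (ha : 0 ≤ a) :
    LipSymbol fun s => poissonKer a (θ * s) := by
  have hθ0 : θ ≠ 0 := norm_pos_iff.1 (by rw [hθ1]; exact one_pos)
  refine lipSymbol_of (fun N => ?_) fun N => ?_
  · obtain ⟨C, hC, h1⟩ := isSymbol_exp_ray hθ N
    obtain ⟨C', hC', h2⟩ := isSymbol_poissonInt_ray hθ hθ1 ha N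
    refine ⟨2 ^ N * (C * C'), N + ⌈a⌉₊, by positivity, (h1.mul isOpen_Ioi h2).mono fun s hs => ?_⟩
    have := one_add_rpow_le_pow hs a
    have hs' : (0 : ℝ) < s := hs
    calc 2 ^ N * (C * (1 + s) ^ N * (C' * (1 + s) ^ a))
        ≤ 2 ^ N * (C * (1 + s) ^ N * (C' * (1 + s) ^ ⌈a⌉₊)) := by gcongr
      _ = _ := by rw [pow_add]; ring
  · obtain ⟨C, hC, h1⟩ := isSymbol_exp_ray hθ N
    obtain ⟨C', hC', h2⟩ := isSymbol_poissonInt_ray hθ hθ1 ha N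
    obtain ⟨C'', hC'', h3⟩ := isSymbol_eul_poissonInt_ray hθ hθ1 ha N
    have h4 := (((IsSymbol.pow (k := N) 1).mul isOpen_Ioi (h1.mul isOpen_Ioi h2)).const_mul isOpen_Ioi
      (-θ)).add isOpen_Ioi (h1.mul isOpen_Ioi h3)
    refine ⟨2 ^ N * ((1 + 1) ^ N * (2 ^ N * (C * C'))) + 2 ^ N * (C * C''), N + ⌈a⌉₊, by positivity,
      (h4.mono fun s hs => ?_).congr isOpen_Ioi fun s hs => ?_⟩
    · have := one_add_rpow_le_pow hs a
      have hs' : (0 : ℝ) < s := hs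
      rw [norm_neg, hθ1]
      calc 1 * (2 ^ N * ((1 + ((1 : ℕ) : ℝ)) ^ N * s ^ 1 * (2 ^ N * (C * (1 + s) ^ N *
            (C' * (1 + s) ^ a))))) + 2 ^ N * (C * (1 + s) ^ N * (C'' * (s * (1 + s) ^ a)))
          ≤ 1 * (2 ^ N * ((1 + ((1 : ℕ) : ℝ)) ^ N * s ^ 1 * (2 ^ N * (C * (1 + s) ^ N *
            (C' * (1 + s) ^ ⌈a⌉₊))))) + 2 ^ N * (C * (1 + s) ^ N * (C'' * (s * (1 + s) ^ ⌈a⌉₊))) := by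
            gcongr
        _ = _ := by rw [pow_add]; push_cast; ring
    · have e1 : HasDerivAt (fun s : ℝ => Complex.exp (-(θ * s)))
          (Complex.exp (-(θ * s)) * -(θ * 1)) s :=
        ((Complex.ofRealCLM.hasDerivAt).const_mul θ).neg.cexp
      have e2 : DifferentiableAt ℝ (fun s : ℝ => poissonInt a a (θ * s)) s := by
        have := (eul_poissonInt_ray hθ hθ0 ha 0 hs).differentiableAt
        simpa using this
      simp only [poissonKer]
      simp only [eul]
      rw [(e1.fun_mul e2.hasDerivAt).deriv]
      ring

theorem LipSymbol.const_mul {f : ℝ → ℂ} (hf : LipSymbol f) (c : ℂ) : LipSymbol fun s => c * f s := by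
  intro N
  -- One order more than needed, so that differentiability is available even for N = 0.
  obtain ⟨C, M, hC, h1, h2⟩ := hf (N + 1)
  refine ⟨‖c‖ * C, M, by positivity, ((h1.pred.const_mul isOpen_Ioi c).mono fun s _ => le_of_eq ?_),
    ((h2.pred.const_mul isOpen_Ioi c).mono fun s _ => le_of_eq ?_).congr isOpen_Ioi fun s hs => ?_⟩
  · ring
  · ring
  · simp only [eul]
    rw [deriv_const_mul c (h1.differentiableAt s hs)]
    ring

theorem LipSymbol.add {f g : ℝ → ℂ} (hf : LipSymbol f) (hg : LipSymbol g) :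
    LipSymbol fun s => f s + g s := by
  refine lipSymbol_of (fun N => ?_) fun N => ?_
  all_goals
    obtain ⟨C, M, hC, h1, h2⟩ := hf (N + 1)
    obtain ⟨C', M', hC', h1', h2'⟩ := hg (N + 1)
    refine ⟨C + C', M + M', by positivity, ?_⟩
  · refine (h1.pred.add isOpen_Ioi h1'.pred).mono fun s hs => ?_
    have hs' : (0 : ℝ) < s := hs
    have e1 : (1 + s) ^ M ≤ (1 + s) ^ (M + M') := pow_le_pow_right₀ (by linarith) (by omega)
    have e2 : (1 + s) ^ M' ≤ (1 + s) ^ (M + M') := pow_le_pow_right₀ (by linarith) (by omega)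
    nlinarith
  · refine ((h2.pred.add isOpen_Ioi h2'.pred).mono fun s hs => ?_).congr isOpen_Ioi fun s hs => ?_
    · have hs' : (0 : ℝ) < s := hs
      have e1 : s * (1 + s) ^ M ≤ s * (1 + s) ^ (M + M') :=
        mul_le_mul_of_nonneg_left (pow_le_pow_right₀ (by linarith) (by omega)) hs'.le
      have e2 : s * (1 + s) ^ M' ≤ s * (1 + s) ^ (M + M') :=
        mul_le_mul_of_nonneg_left (pow_le_pow_right₀ (by linarith) (by omega)) hs'.le
      nlinarith
    · simp only [eul]
      rw [deriv_fun_add (h1.differentiableAt s hs) (h1'.differentiableAt s hs)]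
      ring

theorem LipSymbol.zero : LipSymbol fun _ => 0 := by
  intro N
  refine ⟨0, 0, le_rfl, (IsSymbol.zero isOpen_Ioi fun s _ => by simp), ?_⟩
  refine (IsSymbol.zero (w := fun s => 0 * (s * (1 + s) ^ 0)) isOpen_Ioi fun s _ => by simp).congr
    isOpen_Ioi fun s _ => by simp [eul]

theorem LipSymbol.sum {ι : Type*} (t : Finset ι) {f : ι → ℝ → ℂ} (hf : ∀ i ∈ t, LipSymbol (f i)) :
    LipSymbol fun s => ∑ i ∈ t, f i s := by
  classical
  induction t using Finset.induction_on with
  | empty => simpa using LipSymbol.zero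
  | insert i t hi ih =>
    simp only [Finset.sum_insert hi]
    exact (hf i (Finset.mem_insert_self i t)).add
      (ih fun j hj => hf j (Finset.mem_insert_of_mem hj))

theorem monotoneOn_weight {C : ℝ} (hC : 0 ≤ C) (M : ℕ) :
    MonotoneOn (fun s : ℝ => C * (1 + s) ^ M) (Ioi 0) := by
  intro s hs t ht hst
  have hs' : (0 : ℝ) < s := hs
  have ht' : (0 : ℝ) < t := ht
  show C * (1 + s) ^ M ≤ C * (1 + t) ^ M
  gcongr

theorem monotoneOn_weight' {C : ℝ} (hC : 0 ≤ C) (M : ℕ) :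
    MonotoneOn (fun s : ℝ => C * (s * (1 + s) ^ M)) (Ioi 0) := by
  intro s hs t ht hst
  have hs' : (0 : ℝ) < s := hs
  have ht' : (0 : ℝ) < t := ht
  show C * (s * (1 + s) ^ M) ≤ C * (t * (1 + t) ^ M)
  gcongr

theorem LipSymbol.avg {f : ℝ → ℂ} (hf : LipSymbol f) (k : ℕ) : LipSymbol (avg k f) := by
  intro N
  obtain ⟨C, M, hC, h1, h2⟩ := hf (N + 2)
  have c1 : ContinuousOn f (Ioi 0) := h1.continuousOn
  refine ⟨(k + 3) ^ N * C, M, by positivity,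
    ((h1.pred.pred.avg c1 (monotoneOn_weight hC M)).mono fun s _ => le_of_eq (by ring)),
    ((h2.pred.pred.avg h2.continuousOn (monotoneOn_weight' hC M)).mono
      fun s _ => le_of_eq (by ring)).congr isOpen_Ioi fun s hs => ?_⟩
  refine (eul_avg_eq_avg_eul (monotoneOn_weight hC M) ⟨C * (1 + 1) ^ M, fun s hs => ?_⟩
    (h1.of_le (by omega)) hs).symm
  have := hs.1; have := hs.2
  gcongr

end rays


/-! ### Small-argument expansion of the Poisson kernel -/

/-- The limit is the same along every ray. The expansion at 0 can therefore have coefficients that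
are common to all θ, as the cancellation over the roots of unity requires. -/
theorem tendsto_poissonKer_ray {a : ℝ} {θ : ℂ} (hθ : 0 ≤ θ.re) (hθ1 : ‖θ‖ = 1) (ha : 0 ≤ a) :
    Tendsto (fun s : ℝ => poissonKer a (θ * s)) (𝓝[>] 0)
      (𝓝 (∫ u in Ioi (0 : ℝ), ((Real.exp (-u) * u ^ a : ℝ) : ℂ) * (u : ℂ) ^ (a : ℂ))) := by
  have hθ0 : θ ≠ 0 := norm_pos_iff.1 (by rw [hθ1]; exact one_pos)
  have h1 : Tendsto (fun s : ℝ => poissonInt a a (θ * s)) (𝓝[>] 0)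
      (𝓝 (∫ u in Ioi (0 : ℝ), ((Real.exp (-u) * u ^ a : ℝ) : ℂ) * (u : ℂ) ^ (a : ℂ))) := by
    refine tendsto_integral_filter_of_dominated_convergence
      (fun u => 2 ^ a * 2 ^ a * (Real.exp (-u) * u ^ a * (1 + u) ^ a)) ?_ ?_ ?_ ?_
    · filter_upwards [self_mem_nhdsWithin] with s hs
      exact (continuousOn_poissonIntegrand a a (mem_slitPlane_of_re_nonneg (ray_re_nonneg hθ hs)
        (ray_ne_zero hθ0 hs))).aestronglyMeasurable measurableSet_Ioi
    · filter_upwards [Ioc_mem_nhdsGT (zero_lt_one (α := ℝ))] with s hs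
      filter_upwards [ae_restrict_mem measurableSet_Ioi] with u hu
      have hu' : (0 : ℝ) < u := hu
      rw [norm_poissonIntegrand _ _ _ hu']
      have e1 := norm_add_rpow_le ha (p := θ * s) hu'.le
      rw [norm_ray hθ1 hs.1] at e1
      have e2 : (1 + s) ^ a ≤ 2 ^ a :=
        Real.rpow_le_rpow (by linarith [hs.1]) (by linarith [hs.2]) ha
      calc _ ≤ Real.exp (-u) * u ^ a * (2 ^ a * (1 + u) ^ a * 2 ^ a) := by
            refine mul_le_mul_of_nonneg_left (e1.trans ?_) (by positivity)
            gcongr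
        _ = _ := by ring
    · exact (integrableOn_exp_mul_rpow_mul_rpow (by linarith) a).const_mul _
    · filter_upwards [ae_restrict_mem measurableSet_Ioi] with u hu
      have hu' : (0 : ℝ) < u := hu
      refine Tendsto.const_mul _ ?_
      have : ContinuousAt (fun s : ℝ => ((u : ℂ) + 2 * (θ * s)) ^ (a : ℂ)) 0 := by
        refine ContinuousAt.cpow (by fun_prop) continuousAt_const ?_
        simp [hu']
      have h2 := this.tendsto
      simp only [Complex.ofReal_zero, mul_zero, add_zero] at h2
      exact h2.mono_left nhdsWithin_le_nhds
  have h2 : Tendsto (fun s : ℝ => Complex.exp (-(θ * s))) (𝓝[>] 0) (𝓝 1) := by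
    have : ContinuousAt (fun s : ℝ => Complex.exp (-(θ * s))) 0 := by fun_prop
    have h3 := this.tendsto
    simp only [Complex.ofReal_zero, mul_zero, neg_zero, Complex.exp_zero] at h3
    exact h3.mono_left nhdsWithin_le_nhds
  simpa [poissonKer] using h2.mul h1

/-- Induction on i through P_a' = -2a p P_{a-1}: integrating the expansion of P_{a-1} along the ray
raises every degree by two, and the new remainder is an average of the old one, hence again a
`LipSymbol`. Each step lowers a by one, which is why i ≤ a. The coefficients are chosen before θ. -/
theorem poissonKer_expansion (i : ℕ) {a : ℝ} (ha : (i : ℝ) ≤ a) : ∃ b : ℕ → ℂ, ∀ θ : ℂ, 0 ≤ θ.re →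
    ‖θ‖ = 1 → ∃ R : ℝ → ℂ, LipSymbol R ∧ ∀ s : ℝ, 0 < s →
      poissonKer a (θ * s) = ∑ l ∈ Finset.range i, b l * (θ * s) ^ (2 * l) + (s : ℂ) ^ (2 * i) * R s := by
  induction i generalizing a with
  | zero =>
    exact ⟨fun _ => 0, fun θ hθ hθ1 => ⟨_, lipSymbol_poissonKer_ray hθ hθ1 (by simpa using ha),
      fun s _ => by simp⟩⟩
  | succ i ih =>
    push_cast at ha
    have hi0 : (0 : ℝ) ≤ i := Nat.cast_nonneg i
    have ha0 : 0 < a := by linarith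
    obtain ⟨b, hb⟩ := ih (a := a - 1) (by linarith)
    -- The constant term is the limit at 0. The others come from integrating -2a p times the
    -- previous expansion.
    refine ⟨fun l => if l = 0 then
      ∫ u in Ioi (0 : ℝ), ((Real.exp (-u) * u ^ a : ℝ) : ℂ) * (u : ℂ) ^ (a : ℂ)
      else -(2 * a) * b (l - 1) / (2 * l), fun θ hθ hθ1 => ?_⟩
    have hθ0 : θ ≠ 0 := norm_pos_iff.1 (by rw [hθ1]; exact one_pos)
    obtain ⟨R, hR, hexp⟩ := hb θ hθ hθ1
    refine ⟨fun s => -(2 * a) * θ ^ 2 * avg (2 * i + 1) R s, (hR.avg _).const_mul _, fun s hs => ?_⟩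
    obtain ⟨C, M, hC, hR1, -⟩ := hR 1
    have hd : ∀ t ∈ Ioo 0 s, HasDerivAt (fun t : ℝ => poissonKer a (θ * t))
        (-(2 * a) * θ ^ 2 * (∑ l ∈ Finset.range i, b l * θ ^ (2 * l) * (t : ℂ) ^ (2 * l + 1) +
          (t : ℂ) ^ (2 * i + 1) * R t)) t := by
      intro t ht
      have e1 : HasDerivAt (fun z : ℂ => θ * z) θ (t : ℂ) := by
        simpa using (hasDerivAt_id (t : ℂ)).const_mul θ
      have e2 := (hasDerivAt_poissonKer ha0 (mem_slitPlane_of_re_nonneg (ray_re_nonneg hθ ht.1)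
        (ray_ne_zero hθ0 ht.1))).comp (t : ℂ) e1
      refine e2.comp_ofReal.congr_deriv ?_
      have hsum : (∑ l ∈ Finset.range i, b l * (θ * t) ^ (2 * l)) * t =
          ∑ l ∈ Finset.range i, b l * θ ^ (2 * l) * (t : ℂ) ^ (2 * l + 1) := by
        rw [Finset.sum_mul]
        exact Finset.sum_congr rfl fun l _ => by ring
      rw [hexp t ht.1]
      linear_combination (-(2 * a * θ ^ 2)) * hsum
    have hi1 : IntervalIntegrable (fun t : ℝ => ∑ l ∈ Finset.range i, b l * θ ^ (2 * l) *
        (t : ℂ) ^ (2 * l + 1)) volume 0 s := by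
      refine Continuous.intervalIntegrable ?_ _ _
      fun_prop
    have hi2 := intervalIntegrable_pow_mul (k := 2 * i + 1) hR1.continuousOn (monotoneOn_weight hC M)
      hR1.bound hs
    have hint := intervalIntegral.integral_eq_sub_of_hasDerivAt_of_tendsto hs hd
      ((hi1.add hi2).const_mul _) (tendsto_poissonKer_ray hθ hθ1 ha0.le)
      (fb := poissonKer a (θ * s)) ?_
    · rw [intervalIntegral.integral_const_mul, intervalIntegral.integral_add hi1 hi2,
        intervalIntegral.integral_finsetSum (fun l _ => by
          refine Continuous.intervalIntegrable ?_ _ _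
          fun_prop)] at hint
      have hs' : (s : ℂ) ≠ 0 := by exact_mod_cast hs.ne'
      have hpow : ∀ l : ℕ, ∫ t in (0 : ℝ)..s, b l * θ ^ (2 * l) * (t : ℂ) ^ (2 * l + 1) =
          b l * θ ^ (2 * l) * ((s : ℂ) ^ (2 * l + 2) / (2 * l + 2)) := by
        intro l
        rw [intervalIntegral.integral_const_mul]
        congr 1
        have : ∫ t in (0 : ℝ)..s, (t : ℂ) ^ (2 * l + 1) =
            ((∫ t in (0 : ℝ)..s, t ^ (2 * l + 1) : ℝ) : ℂ) := by
          rw [← intervalIntegral.integral_ofReal]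
          push_cast; rfl
        rw [this, integral_pow]
        push_cast
        rw [zero_pow (by omega)]
        ring
      rw [Finset.sum_range_succ']
      beta_reduce
      rw [if_pos rfl]
      rw [sub_eq_iff_eq_add.1 hint.symm]
      simp only [avg, hpow]
      rw [mul_add, Finset.mul_sum]
      have hsum : ∀ l ∈ Finset.range i, -(2 * (a : ℂ)) * θ ^ 2 *
          (b l * θ ^ (2 * l) * ((s : ℂ) ^ (2 * l + 2) / (2 * l + 2))) =
          (if l + 1 = 0 then ∫ u in Ioi (0 : ℝ), ((Real.exp (-u) * u ^ a : ℝ) : ℂ) * (u : ℂ) ^ (a : ℂ)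
            else -(2 * a) * b (l + 1 - 1) / (2 * ((l + 1 : ℕ) : ℂ))) * (θ * s) ^ (2 * (l + 1)) := by
        intro l _
        rw [if_neg (by omega), Nat.add_sub_cancel]
        have : (l : ℂ) + 1 ≠ 0 := by exact_mod_cast Nat.succ_ne_zero l
        push_cast
        field_simp
        ring
      rw [Finset.sum_congr rfl hsum]
      have e3 : (s : ℂ) ^ (2 * (i + 1)) = (s : ℂ) ^ (2 * i + 1 + 1) := by ring
      rw [e3]
      field_simp
      ring
    · have : DifferentiableAt ℝ (fun t : ℝ => poissonKer a (θ * t)) s := by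
        obtain ⟨C, M, hC, h1, -⟩ := lipSymbol_poissonKer_ray hθ hθ1 ha0.le 1
        exact h1.differentiableAt s hs
      exact this.continuousAt.tendsto.mono_left nhdsWithin_le_nhds

/-! ### The amplitude of the outgoing resolvent -/

/-- The `2m`-th roots of unity. -/
noncomputable def root (m k : ℕ) : ℂ := Complex.exp (Real.pi * k / m * Complex.I)

theorem norm_root (m k : ℕ) : ‖root m k‖ = 1 := by
  have : root m k = Complex.exp ((Real.pi * k / m : ℝ) * Complex.I) := by
    rw [root]; push_cast; rfl
  rw [this, Complex.norm_exp_ofReal_mul_I]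

/-- The squares of these numbers run through the m-th roots of unity, whose j-th power sums vanish
for 0 < j < m. -/
theorem root_pow_sum {m : ℕ} {j : ℕ} (hj : 0 < j) (hjm : j < m) :
    ∑ k ∈ Finset.range m, root m k ^ (2 * j) = 0 := by
  have hm : m ≠ 0 := by omega
  have hprim := Complex.isPrimitiveRoot_exp m hm
  set ζ := Complex.exp (2 * Real.pi * Complex.I / m) with hζ
  have h1 : ∀ k ∈ Finset.range m, root m k ^ (2 * j) = (ζ ^ j) ^ k := by
    intro k _
    rw [root, hζ, ← Complex.exp_nat_mul, ← pow_mul, ← Complex.exp_nat_mul]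
    congr 1; push_cast; ring
  rw [Finset.sum_congr rfl h1]
  have hne : ζ ^ j ≠ 1 := hprim.pow_ne_one_of_pos_of_lt hj.ne' hjm
  have := geom_sum_eq hne m
  rw [this, ← pow_mul, mul_comm, pow_mul, hprim.pow_eq_one, one_pow, sub_self, zero_div]

/-- The amplitude `A` with `𝓡₀⁺(λ^{2m})(x) = c r^{2m-n} A(λ r)`, `r = |x|`, `a = (n - 3) / 2`. -/
noncomputable def outAmp (m : ℕ) (a : ℝ) (s : ℝ) : ℂ :=
  ((s : ℂ) ^ (2 * (m - 1)))⁻¹ * ∑ k ∈ Finset.range m, root m k ^ 2 *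
    poissonKer a (-Complex.I * root m k * s)

theorem re_neg_I_mul_root {m k : ℕ} : (-Complex.I * root m k).re = Real.sin (Real.pi * k / m) := by
  have : root m k = Complex.exp ((Real.pi * k / m : ℝ) * Complex.I) := by
    rw [root]; push_cast; rfl
  rw [this, Complex.mul_re, Complex.exp_ofReal_mul_I_re, Complex.exp_ofReal_mul_I_im]
  simp

theorem re_ray_nonneg {m k : ℕ} (hk : k ≤ m) : 0 ≤ (-Complex.I * root m k).re := by
  rw [re_neg_I_mul_root]
  refine Real.sin_nonneg_of_nonneg_of_le_pi (by positivity) ?_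
  rcases Nat.eq_zero_or_pos m with rfl | hm
  · simpa using Real.pi_pos.le
  · rw [div_le_iff₀ (by positivity)]
    have : (k : ℝ) ≤ m := by exact_mod_cast hk
    nlinarith [Real.pi_pos]

theorem re_ray_pos {m k : ℕ} (hk0 : 0 < k) (hk : k < m) : 0 < (-Complex.I * root m k).re := by
  rw [re_neg_I_mul_root]
  have hm : 0 < m := by omega
  have h1 : (0 : ℝ) < k := by exact_mod_cast hk0
  have h2 : (0 : ℝ) < m := by exact_mod_cast hm
  refine Real.sin_pos_of_pos_of_lt_pi (by positivity) ?_
  rw [div_lt_iff₀ (by positivity)]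
  have : (k : ℝ) < m := by exact_mod_cast hk
  nlinarith [Real.pi_pos]

theorem norm_neg_I_mul_root (m k : ℕ) : ‖-Complex.I * root m k‖ = 1 := by
  rw [norm_mul, norm_neg, Complex.norm_I, norm_root, one_mul]

/-- After multiplication by the squared root, the term of degree 2l carries the power 2(l + 1) of
the root, and the sum over the roots kills it for l + 1 < m. Only the remainder of order s^{2(m-1)}
survives, and it cancels the singular prefactor. For a = (n - 3)/2 the condition m - 1 ≤ a says that
2m < n. -/
theorem outAmp_lipSymbol {m : ℕ} (hm : 1 ≤ m) {a : ℝ} (ha : ((m - 1 : ℕ) : ℝ) ≤ a) :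
    ∃ A : ℝ → ℂ, LipSymbol A ∧ EqOn A (outAmp m a) (Ioi 0) := by
  obtain ⟨b, hb⟩ := poissonKer_expansion (m - 1) ha
  have h1 : ∀ k : ℕ, ∃ R : ℝ → ℂ, k < m → LipSymbol R ∧ ∀ s : ℝ, 0 < s →
      poissonKer a (-Complex.I * root m k * s) = ∑ l ∈ Finset.range (m - 1),
        b l * (-Complex.I * root m k * s) ^ (2 * l) + (s : ℂ) ^ (2 * (m - 1)) * R s := by
    intro k
    by_cases hk : k < m
    · obtain ⟨R, hR⟩ := hb (-Complex.I * root m k) (re_ray_nonneg hk.le) (norm_neg_I_mul_root m k)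
      exact ⟨R, fun _ => hR⟩
    · exact ⟨fun _ => 0, fun h => absurd h hk⟩
  choose R hR using h1
  refine ⟨fun s => ∑ k ∈ Finset.range m, root m k ^ 2 * R k s,
    LipSymbol.sum _ fun k hk => ((hR k (Finset.mem_range.1 hk)).1).const_mul _, fun s hs => ?_⟩
  have hs' : (s : ℂ) ≠ 0 := by exact_mod_cast (ne_of_gt hs : s ≠ 0)
  have h2 : ∑ k ∈ Finset.range m, root m k ^ 2 * poissonKer a (-Complex.I * root m k * s) =
      (s : ℂ) ^ (2 * (m - 1)) * ∑ k ∈ Finset.range m, root m k ^ 2 * R k s := by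
    have h3 : ∀ k ∈ Finset.range m, root m k ^ 2 * poissonKer a (-Complex.I * root m k * s) =
        (∑ l ∈ Finset.range (m - 1), b l * (-1) ^ l * (s : ℂ) ^ (2 * l) * root m k ^ (2 * (l + 1))) +
        (s : ℂ) ^ (2 * (m - 1)) * (root m k ^ 2 * R k s) := by
      intro k hk
      rw [(hR k (Finset.mem_range.1 hk)).2 s hs, mul_add, Finset.mul_sum]
      congr 1
      · refine Finset.sum_congr rfl fun l _ => ?_
        rw [mul_pow, mul_pow, pow_mul (-Complex.I), neg_sq, Complex.I_sq]
        ring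
      · ring
    rw [Finset.sum_congr rfl h3, Finset.sum_add_distrib, Finset.sum_comm, Finset.mul_sum]
    rw [Finset.sum_eq_zero, zero_add]
    intro l hl
    rw [← Finset.mul_sum, root_pow_sum (by omega) (by have := Finset.mem_range.1 hl; omega), mul_zero]
  rw [outAmp, h2, inv_mul_cancel_left₀ (pow_ne_zero _ hs')]

/-! ### Size of the outgoing amplitude at zero and at infinity -/

theorem isSymbol_exp_decay {c : ℂ} (hc : c = 0 ∨ 0 < c.re) (N : ℕ) :
    ∃ C : ℝ, 0 ≤ C ∧ IsSymbol (Ioi 0) N (fun _ => C) (fun s => Complex.exp (-(c * s))) := by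
  rcases hc with rfl | hc
  · refine ⟨‖(1 : ℂ)‖, norm_nonneg _, ?_⟩
    simpa using IsSymbol.const (S := Ioi 0) (k := N) isOpen_Ioi 1
  · refine ⟨(1 + 2 * (‖c‖ + N)) ^ N * ∑ j ∈ Finset.range (N + 1), (j.factorial / c.re ^ j), by positivity,
      IsSymbol.exp_neg N (C := ‖c‖ + N) (w := fun _ => ∑ j ∈ Finset.range (N + 1), (j.factorial / c.re ^ j))
        (by linarith [Nat.cast_nonneg (α := ℝ) N])
        (by linarith [norm_nonneg c]) fun j hj s hs => ?_⟩
    have h1 := Real.pow_div_factorial_le_exp (c.re * s) (by positivity) j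
    have h2 : s ^ j * Real.exp (-(c.re * s)) ≤ j.factorial / c.re ^ j := by
      rw [Real.exp_neg, ← div_eq_mul_inv, div_le_div_iff₀ (Real.exp_pos _) (by positivity)]
      rw [div_le_iff₀ (by positivity), mul_pow] at h1
      linarith
    refine h2.trans (Finset.single_le_sum (f := fun j : ℕ => ((j.factorial : ℝ) / c.re ^ j))
      (fun j _ => by positivity) (Finset.mem_range.2 (by omega)))

/-- Once the phase of the root k = 0 is divided out, that term no longer oscillates and all other
roots carry a decaying exponential. The bound ignores the cancellation at 0 and is only useful for
large s. -/
theorem outAmp_large {m : ℕ} {a : ℝ} (ha : 0 ≤ a) (N : ℕ) :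
    ∃ C : ℝ, 0 ≤ C ∧ IsSymbol (Ioi 0) N (fun s => C * (s ^ (-((2 * (m - 1) : ℕ) : ℝ)) * (1 + s) ^ a))
      (fun s => Complex.exp (-(Complex.I * s)) * outAmp m a s) := by
  have h1 : ∀ k : ℕ, ∃ C : ℝ, 0 ≤ C ∧ (k < m → IsSymbol (Ioi 0) N (fun s => C * (1 + s) ^ a)
      (fun s => Complex.exp (-((Complex.I + -Complex.I * root m k) * s)) *
        poissonInt a a (-Complex.I * root m k * s))) := by
    intro k
    by_cases hk : k < m
    · obtain ⟨C, hC, h1⟩ := isSymbol_exp_decay (c := Complex.I + -Complex.I * root m k) (by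
        rcases Nat.eq_zero_or_pos k with rfl | hk0
        · left; simp [root]
        · right
          have := re_ray_pos hk0 hk
          rw [Complex.add_re]; simpa using this) N
      obtain ⟨C', hC', h2⟩ := isSymbol_poissonInt_ray (re_ray_nonneg hk.le) (norm_neg_I_mul_root m k) ha N
      exact ⟨2 ^ N * (C * C'), by positivity, fun _ =>
        (h1.mul isOpen_Ioi h2).mono fun s _ => le_of_eq (by ring)⟩
    · exact ⟨0, le_rfl, fun h => absurd h hk⟩
  choose C hC h2 using h1
  have h3 := (IsSymbol.rpow (k := N) (-((2 * (m - 1) : ℕ) : ℝ))).mul isOpen_Ioi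
    (IsSymbol.sum isOpen_Ioi (Finset.range m) fun k hk =>
      (h2 k (Finset.mem_range.1 hk)).const_mul isOpen_Ioi (root m k ^ 2))
  refine ⟨2 ^ N * (1 + |(-((2 * (m - 1) : ℕ) : ℝ))|) ^ N * ∑ k ∈ Finset.range m, C k,
    by have := Finset.sum_nonneg (s := Finset.range m) (fun k _ => hC k); positivity,
    (h3.mono fun s hs => le_of_eq ?_).congr isOpen_Ioi fun s hs => ?_⟩
  · simp only [norm_pow, norm_root, one_pow, one_mul, ← Finset.sum_mul]
    ring
  · have hs0 : (0 : ℝ) < s := hs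
    rw [outAmp, Finset.mul_sum, Finset.mul_sum, Finset.mul_sum]
    refine Finset.sum_congr rfl fun k _ => ?_
    rw [Real.rpow_neg hs0.le, Real.rpow_natCast, poissonKer, add_mul, neg_add, Complex.exp_add]
    push_cast
    ring

/-- For s ≥ 1 the first weight is used, where s and 1 + s are comparable. For s ≤ 1 the second is
used, where every power of 1 + s is comparable to 1. -/
theorem min_weight_le {C₁ C₂ : ℝ} (h1 : 0 ≤ C₁) (h2 : 0 ≤ C₂) (k M : ℕ) (a : ℝ) {s : ℝ} (hs : 0 < s) :
    min (C₁ * (s ^ (-(k : ℝ)) * (1 + s) ^ a)) (C₂ * (1 + s) ^ M) ≤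
      (C₁ * 2 ^ k + C₂ * 2 ^ M * 2 ^ |a - k|) * (1 + s) ^ (a - k) := by
  have hp : 0 < (1 + s) ^ (a - k) := by positivity
  rcases le_total 1 s with h | h
  · refine (min_le_left _ _).trans ?_
    have e1 : s ^ (-(k : ℝ)) ≤ 2 ^ k * (1 + s) ^ (-(k : ℝ)) := by
      rw [Real.rpow_neg hs.le, Real.rpow_neg (by linarith), Real.rpow_natCast, Real.rpow_natCast,
        ← div_eq_mul_inv, inv_eq_one_div, div_le_div_iff₀ (by positivity) (by positivity), one_mul,
        ← mul_pow]
      exact pow_le_pow_left₀ (by linarith) (by linarith) k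
    have e2 : (1 + s) ^ (a - k) = (1 + s) ^ (-(k : ℝ)) * (1 + s) ^ a := by
      rw [← Real.rpow_add (by linarith)]; congr 1; ring
    calc C₁ * (s ^ (-(k : ℝ)) * (1 + s) ^ a)
        ≤ C₁ * (2 ^ k * (1 + s) ^ (-(k : ℝ)) * (1 + s) ^ a) := by gcongr
      _ = C₁ * 2 ^ k * (1 + s) ^ (a - k) := by rw [e2]; ring
      _ ≤ _ := by
        have : 0 ≤ C₂ * 2 ^ M * 2 ^ |a - k| := by positivity
        nlinarith
  · refine (min_le_right _ _).trans ?_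
    have e1 : (1 + s) ^ M ≤ 2 ^ M := pow_le_pow_left₀ (by linarith) (by linarith) M
    have e2 : 1 ≤ 2 ^ |a - k| * (1 + s) ^ (a - k) := by
      have f1 : (1 + s) ^ (-|a - k|) ≤ (1 + s) ^ (a - k) :=
        Real.rpow_le_rpow_of_exponent_le (by linarith) (neg_abs_le _)
      have f2 : (2 : ℝ) ^ (-|a - k|) ≤ (1 + s) ^ (-|a - k|) :=
        Real.rpow_le_rpow_of_nonpos (by linarith) (by linarith) (by simp)
      have f3 : (2 : ℝ) ^ |a - k| * 2 ^ (-|a - k|) = 1 := by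
        rw [← Real.rpow_add (by norm_num)]; simp
      calc (1 : ℝ) = 2 ^ |a - k| * 2 ^ (-|a - k|) := f3.symm
        _ ≤ _ := by gcongr; exact f2.trans f1
    calc C₂ * (1 + s) ^ M ≤ C₂ * 2 ^ M * 1 := by rw [mul_one]; gcongr
      _ ≤ C₂ * 2 ^ M * (2 ^ |a - k| * (1 + s) ^ (a - k)) := by gcongr
      _ = C₂ * 2 ^ M * 2 ^ |a - k| * (1 + s) ^ (a - k) := by ring
      _ ≤ _ := by
        have : 0 ≤ C₁ * 2 ^ k := by positivity
        nlinarith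

/-- Near 0 the cancellation among the roots makes the amplitude regular. At infinity the explicit
exponentials give the order. The minimum of the two bounds is the stated weight. -/
theorem isSymbol_outAmp {m : ℕ} (hm : 1 ≤ m) {a : ℝ} (ha : ((m - 1 : ℕ) : ℝ) ≤ a) (N : ℕ) :
    ∃ C : ℝ, 0 ≤ C ∧ IsSymbol (Ioi 0) N (fun s => C * (1 + s) ^ (a - (2 * (m - 1) : ℕ)))
      (fun s => Complex.exp (-(Complex.I * s)) * outAmp m a s) := by
  have ha0 : 0 ≤ a := (Nat.cast_nonneg _).trans ha
  obtain ⟨A, hA, hAeq⟩ := outAmp_lipSymbol hm ha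
  obtain ⟨C₁, hC₁, h1⟩ := outAmp_large (m := m) ha0 N
  obtain ⟨C₂, M, hC₂, h2, -⟩ := hA N
  obtain ⟨C₃, hC₃, h3⟩ := isSymbol_exp_ray (θ := Complex.I) (by simp) N
  have h4 : IsSymbol (Ioi 0) N (fun s => 2 ^ N * C₃ * C₂ * (1 + s) ^ (N + M))
      (fun s => Complex.exp (-(Complex.I * s)) * outAmp m a s) :=
    ((h3.mul isOpen_Ioi h2).mono fun s _ => le_of_eq (by rw [pow_add]; ring)).congr isOpen_Ioi
      fun s hs => by rw [hAeq hs]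
  exact ⟨_, by positivity, (h1.min h4).mono fun s hs =>
    min_weight_le hC₁ (by positivity) (2 * (m - 1)) (N + M) a hs⟩

/-- The same factor s appears at both ends for different reasons. Near 0 the Euler derivative
vanishes to first order (`LipSymbol`). At infinity the derivative falls on the phase e^{is}. -/
theorem isSymbol_eul_outAmp {m : ℕ} (hm : 1 ≤ m) {a : ℝ} (ha : ((m - 1 : ℕ) : ℝ) ≤ a) (N : ℕ) :
    ∃ C : ℝ, 0 ≤ C ∧ IsSymbol (Ioi 0) N (fun s => C * (s * (1 + s) ^ (a - (2 * (m - 1) : ℕ))))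
      (fun s => Complex.exp (-(Complex.I * s)) * eul (outAmp m a) s) := by
  obtain ⟨A, hA, hAeq⟩ := outAmp_lipSymbol hm ha
  obtain ⟨C₁, hC₁, h1⟩ := isSymbol_outAmp hm ha (N + 1)
  obtain ⟨C₂, M, hC₂, hA1, h2⟩ := hA (N + 1)
  obtain ⟨C₃, hC₃, h3⟩ := isSymbol_exp_ray (θ := Complex.I) (by simp) N
  set μ := a - (2 * (m - 1) : ℕ) with hμ
  have hsmall : IsSymbol (Ioi 0) N (fun s => 2 ^ N * C₃ * C₂ * (s * (1 + s) ^ (N + M)))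
      (fun s => Complex.exp (-(Complex.I * s)) * eul (outAmp m a) s) :=
    ((h3.mul isOpen_Ioi h2.pred).mono fun s _ => le_of_eq (by rw [pow_add]; ring)).congr isOpen_Ioi
      fun s hs => by rw [eul_congr isOpen_Ioi hAeq hs]
  have hdiff : ∀ s ∈ Ioi (0 : ℝ), DifferentiableAt ℝ (outAmp m a) s :=
    ((hA1.congr isOpen_Ioi hAeq).differentiableAt)
  have hlarge : IsSymbol (Ioi 0) N
      (fun s => C₁ * (1 + s) ^ μ + 1 * (2 ^ N * ((1 + 1) ^ N * s * (C₁ * (1 + s) ^ μ))))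
      (fun s => Complex.exp (-(Complex.I * s)) * eul (outAmp m a) s) := by
    refine ((h1.eul.add isOpen_Ioi (((IsSymbol.pow (k := N) 1).mul isOpen_Ioi h1.pred).const_mul
      isOpen_Ioi Complex.I)).mono fun s hs => le_of_eq ?_).congr isOpen_Ioi fun s hs => ?_
    · rw [Complex.norm_I]; push_cast; ring
    · have e1 : HasDerivAt (fun s : ℝ => Complex.exp (-(Complex.I * s)))
          (Complex.exp (-(Complex.I * s)) * -(Complex.I * 1)) s :=
        ((Complex.ofRealCLM.hasDerivAt).const_mul Complex.I).neg.cexp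
      simp only [eul]
      rw [(e1.fun_mul (hdiff s hs).hasDerivAt).deriv]
      ring
  set D := 2 ^ N * C₃ * C₂ with hD
  have hD0 : 0 ≤ D := by positivity
  refine ⟨(2 * (C₁ + 2 ^ N * (2 ^ N * C₁))) + D * 2 ^ (N + M) * 2 ^ |μ|, by positivity,
    (hlarge.min hsmall).mono fun s hs => ?_⟩
  have hs0 : (0 : ℝ) < s := hs
  have hp : 0 < (1 + s) ^ μ := by positivity
  rcases le_total 1 s with h | h
  · refine (min_le_left _ _).trans ?_
    have e1 : (1 + s) ^ μ ≤ s * (1 + s) ^ μ := by nlinarith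
    have e2 : 0 ≤ D * 2 ^ (N + M) * 2 ^ |μ| * (s * (1 + s) ^ μ) := by positivity
    have e3 : C₁ * (1 + s) ^ μ ≤ C₁ * (s * (1 + s) ^ μ) := by gcongr
    have e4 : 0 ≤ C₁ * (s * (1 + s) ^ μ) := by positivity
    have e5 : 0 ≤ 2 ^ N * (2 ^ N * (C₁ * (s * (1 + s) ^ μ))) := by positivity
    norm_num
    nlinarith
  · refine (min_le_right _ _).trans ?_
    have e1 : (1 + s) ^ (N + M) ≤ 2 ^ (N + M) := pow_le_pow_left₀ (by linarith) (by linarith) _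
    have e2 : 1 ≤ 2 ^ |μ| * (1 + s) ^ μ := by
      have f1 : (1 + s) ^ (-|μ|) ≤ (1 + s) ^ μ :=
        Real.rpow_le_rpow_of_exponent_le (by linarith) (neg_abs_le _)
      have f2 : (2 : ℝ) ^ (-|μ|) ≤ (1 + s) ^ (-|μ|) :=
        Real.rpow_le_rpow_of_nonpos (by linarith) (by linarith) (by simp)
      have f3 : (2 : ℝ) ^ |μ| * 2 ^ (-|μ|) = 1 := by
        rw [← Real.rpow_add (by norm_num)]; simp
      calc (1 : ℝ) = 2 ^ |μ| * 2 ^ (-|μ|) := f3.symm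
        _ ≤ _ := by gcongr; exact f2.trans f1
    calc D * (s * (1 + s) ^ (N + M)) ≤ D * (s * 2 ^ (N + M)) * 1 := by rw [mul_one]; gcongr
      _ ≤ D * (s * 2 ^ (N + M)) * (2 ^ |μ| * (1 + s) ^ μ) := by gcongr
      _ = D * 2 ^ (N + M) * 2 ^ |μ| * (s * (1 + s) ^ μ) := by ring
      _ ≤ _ := by
        have : 0 ≤ 2 * (C₁ + 2 ^ N * (2 ^ N * C₁)) * (s * (1 + s) ^ μ) := by positivity
        nlinarith


/-! ### Fourier integrals over the sphere -/

/-- `∫_{-1}^1 u^j e^{isu} (1 - u²)^a du`. -/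
noncomputable def sphereMoment (a : ℝ) (j : ℕ) (s : ℝ) : ℂ :=
  ∫ u in (-1 : ℝ)..1, (u : ℂ) ^ j * Complex.exp (Complex.I * s * u) * (((1 - u ^ 2) ^ a : ℝ) : ℂ)

theorem ofReal_mul_cpow {x : ℝ} (hx : 0 < x) {w : ℂ} (hw : w ≠ 0) (c : ℂ) :
    ((x : ℂ) * w) ^ c = (x : ℂ) ^ c * w ^ c := by
  have hx' : (x : ℂ) ≠ 0 := by exact_mod_cast hx.ne'
  rw [Complex.cpow_def_of_ne_zero (mul_ne_zero hx' hw), Complex.cpow_def_of_ne_zero hx',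
    Complex.cpow_def_of_ne_zero hw, Complex.log_ofReal_mul hx hw, ← Complex.exp_add,
    Complex.ofReal_log hx.le]
  congr 1; ring

section sphere

variable {a : ℝ}

theorem continuous_sphereIntegrand (ha : 0 ≤ a) (j : ℕ) (s : ℝ) :
    Continuous fun u : ℝ => (u : ℂ) ^ j * Complex.exp (Complex.I * s * u) *
      (((1 - u ^ 2) ^ a : ℝ) : ℂ) := by
  have : Continuous fun u : ℝ => (1 - u ^ 2) ^ a :=
    Continuous.rpow_const (by fun_prop) fun _ => Or.inr ha
  fun_prop

theorem norm_sphereIntegrand_le (ha : 0 ≤ a) (j : ℕ) (s : ℝ) {u : ℝ} (hu : u ∈ uIoc (-1 : ℝ) 1) :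
    ‖(u : ℂ) ^ j * Complex.exp (Complex.I * s * u) * (((1 - u ^ 2) ^ a : ℝ) : ℂ)‖ ≤ 1 := by
  rw [uIoc_of_le (by norm_num)] at hu
  have h1 : |u| ≤ 1 := abs_le.2 ⟨hu.1.le, hu.2⟩
  have h2 : u ^ 2 ≤ 1 := by nlinarith [sq_abs u, abs_nonneg u]
  rw [norm_mul, norm_mul, norm_pow, Complex.norm_real, Complex.norm_real, Real.norm_eq_abs,
    Real.norm_of_nonneg (Real.rpow_nonneg (by linarith) _),
    show Complex.I * s * u = ((s * u : ℝ) : ℂ) * Complex.I by push_cast; ring,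
    Complex.norm_exp_ofReal_mul_I, mul_one]
  exact mul_le_one₀ (pow_le_one₀ (abs_nonneg _) h1) (Real.rpow_nonneg (by linarith) _)
    (Real.rpow_le_one (by linarith) (by nlinarith) ha)

theorem norm_sphereMoment_le (ha : 0 ≤ a) (j : ℕ) (s : ℝ) : ‖sphereMoment a j s‖ ≤ 2 := by
  refine (intervalIntegral.norm_integral_le_of_norm_le_const
    fun u hu => norm_sphereIntegrand_le ha j s hu).trans ?_
  norm_num

theorem hasDerivAt_sphereMoment (ha : 0 ≤ a) (j : ℕ) (s : ℝ) :
    HasDerivAt (sphereMoment a j) (Complex.I * sphereMoment a (j + 1) s) s := by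
  have key := intervalIntegral.hasDerivAt_integral_of_dominated_loc_of_deriv_le (μ := volume)
    (a := -1) (b := 1) (x₀ := s) (s := univ) (bound := fun _ => 1)
    (F := fun (s : ℝ) (u : ℝ) => (u : ℂ) ^ j * Complex.exp (Complex.I * s * u) *
      (((1 - u ^ 2) ^ a : ℝ) : ℂ))
    (F' := fun (s : ℝ) (u : ℝ) => Complex.I * ((u : ℂ) ^ (j + 1) * Complex.exp (Complex.I * s * u) *
      (((1 - u ^ 2) ^ a : ℝ) : ℂ))) univ_mem ?_ ?_ ?_ ?_ ?_ ?_
  · have h2 := key.2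
    rw [intervalIntegral.integral_const_mul] at h2
    exact h2
  · exact Eventually.of_forall fun t => (continuous_sphereIntegrand ha j t).aestronglyMeasurable
  · exact (continuous_sphereIntegrand ha j s).intervalIntegrable _ _
  · exact ((continuous_sphereIntegrand ha (j + 1) s).const_mul _).aestronglyMeasurable
  · refine Eventually.of_forall fun u hu t _ => ?_
    rw [norm_mul, Complex.norm_I, one_mul]
    exact norm_sphereIntegrand_le ha (j + 1) t hu
  · exact intervalIntegrable_const
  · refine Eventually.of_forall fun u _ t _ => ?_
    have e1 : HasDerivAt (fun t : ℝ => Complex.exp (Complex.I * t * u))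
        (Complex.exp (Complex.I * t * u) * (Complex.I * 1 * u)) t :=
      (((Complex.ofRealCLM.hasDerivAt).const_mul Complex.I).mul_const (u : ℂ)).cexp
    refine ((e1.const_mul ((u : ℂ) ^ j)).mul_const (((1 - u ^ 2) ^ a : ℝ) : ℂ)).congr_deriv ?_
    ring

theorem isSymbol_sphereMoment (ha : 0 ≤ a) (N : ℕ) :
    ∃ C : ℝ, 0 ≤ C ∧ IsSymbol (Ioi 0) N (fun s => C * (1 + s) ^ N) (sphereMoment a 0) := by
  have hd : ∀ j : ℕ, ∀ s : ℝ, HasDerivAt (fun s : ℝ => (s : ℂ) ^ j * sphereMoment a j s)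
      (j * (s : ℂ) ^ (j - 1) * 1 * sphereMoment a j s +
        (s : ℂ) ^ j * (Complex.I * sphereMoment a (j + 1) s)) s := fun j s =>
    (Complex.ofRealCLM.hasDerivAt.fun_pow j).mul (hasDerivAt_sphereMoment ha j s)
  have := IsSymbol.of_family (S := Ioi 0) (k := N) (K := N) (j := 0) (M := N + 1)
    (w := fun s => 2 * (1 + s) ^ N) isOpen_Ioi
    (X := fun j s => (s : ℂ) ^ j * sphereMoment a j s)
    (α := fun j => j) (β := fun j => Complex.I) (fun j hj => ?_)
    (fun j hj => ?_) (fun j _ s hs => (hd j s).differentiableAt)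
    (fun j _ s hs => ?_) (fun j hj s hs => ?_) (by omega)
  · exact ⟨(1 + 2 * (N + 1)) ^ N * 2, by positivity, by simpa [mul_assoc] using this⟩
  · have : (j : ℝ) ≤ N := by exact_mod_cast hj
    rw [Complex.norm_natCast]; linarith
  · rw [Complex.norm_I]; linarith [Nat.cast_nonneg (α := ℝ) N]
  · simp only [eul, (hd j s).deriv]
    rcases j with _ | j
    · simp; ring
    · simp only [Nat.add_sub_cancel]; push_cast; ring
  · have hs' : (0 : ℝ) < s := hs
    rw [norm_mul, norm_pow, Complex.norm_real, Real.norm_of_nonneg hs'.le, mul_comm]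
    have h1 : s ^ j ≤ (1 + s) ^ j := pow_le_pow_left₀ hs'.le (by linarith) j
    have h2 : (1 + s) ^ j ≤ (1 + s) ^ N := pow_le_pow_right₀ (by linarith) hj
    exact mul_le_mul (norm_sphereMoment_le ha j s) (h1.trans h2) (by positivity) (by norm_num)

/-- Integrate the u-derivative of u e^{isu} (1 - u²)^{a+1} over [-1, 1]. Equivalently, s^{2a+2} J_a
is, up to the factor 2(a + 1), the derivative of s^{2a+3} J_{a+1}, and 2a + 3 is the dimension n. -/
theorem eul_sphereMoment_add_one (ha : 0 ≤ a) (s : ℝ) :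
    eul (sphereMoment (a + 1) 0) s =
      -(2 * a + 3) * sphereMoment (a + 1) 0 s + 2 * (a + 1) * sphereMoment a 0 s := by
  have ha1 : 0 ≤ a + 1 := by linarith
  have hd : ∀ u ∈ uIcc (-1 : ℝ) 1, HasDerivAt
      (fun u : ℝ => (u : ℂ) * Complex.exp (Complex.I * s * u) * (((1 - u ^ 2) ^ (a + 1) : ℝ) : ℂ))
      (s * Complex.I * ((u : ℂ) ^ 1 * Complex.exp (Complex.I * s * u) *
          (((1 - u ^ 2) ^ (a + 1) : ℝ) : ℂ)) +
        ((2 * a + 3) * ((u : ℂ) ^ 0 * Complex.exp (Complex.I * s * u) *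
          (((1 - u ^ 2) ^ (a + 1) : ℝ) : ℂ)) -
        2 * (a + 1) * ((u : ℂ) ^ 0 * Complex.exp (Complex.I * s * u) *
          (((1 - u ^ 2) ^ a : ℝ) : ℂ)))) u := by
    intro u hu
    rw [uIcc_of_le (by norm_num)] at hu
    have hu2 : 0 ≤ 1 - u ^ 2 := by nlinarith [hu.1, hu.2]
    have e0 : HasDerivAt (fun u : ℝ => (u : ℂ)) 1 u := Complex.ofRealCLM.hasDerivAt
    have e1 : HasDerivAt (fun u : ℝ => Complex.exp (Complex.I * s * u))
        (Complex.exp (Complex.I * s * u) * (Complex.I * s * 1)) u := (e0.const_mul _).cexp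
    have e2 : HasDerivAt (fun u : ℝ => (1 - u ^ 2) ^ (a + 1))
        (-(2 * u) * (a + 1) * (1 - u ^ 2) ^ (a + 1 - 1)) u := by
      have : HasDerivAt (fun u : ℝ => 1 - u ^ 2) (-(2 * u)) u := by
        simpa using ((hasDerivAt_pow 2 u).const_sub 1)
      exact this.rpow_const (Or.inr (by linarith))
    refine ((e0.fun_mul e1).fun_mul e2.ofReal_comp).congr_deriv ?_
    have e3 : (1 - u ^ 2) ^ (a + 1) = (1 - u ^ 2) ^ a * (1 - u ^ 2) := by
      rcases hu2.eq_or_lt with h | h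
      · rw [← h, Real.zero_rpow (by linarith), mul_zero]
      · rw [Real.rpow_add_one h.ne']
    rw [add_sub_cancel_right, e3]
    push_cast
    ring
  have i1 := (continuous_sphereIntegrand ha1 1 s).intervalIntegrable (μ := volume) (-1) 1
  have i2 := (continuous_sphereIntegrand ha1 0 s).intervalIntegrable (μ := volume) (-1) 1
  have i3 := (continuous_sphereIntegrand ha 0 s).intervalIntegrable (μ := volume) (-1) 1
  have key := intervalIntegral.integral_eq_sub_of_hasDerivAt hd
    ((i1.const_mul _).add ((i2.const_mul _).sub (i3.const_mul _)))
  rw [intervalIntegral.integral_add (i1.const_mul _) ((i2.const_mul _).sub (i3.const_mul _)),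
    intervalIntegral.integral_sub (i2.const_mul _) (i3.const_mul _),
    intervalIntegral.integral_const_mul, intervalIntegral.integral_const_mul,
    intervalIntegral.integral_const_mul] at key
  have hz : (0 : ℝ) ^ (a + 1) = 0 := Real.zero_rpow (by linarith)
  norm_num [hz] at key
  rw [eul, (hasDerivAt_sphereMoment ha1 0 s).deriv]
  simp only [sphereMoment, pow_zero, one_mul, zero_add, pow_one]
  linear_combination key

/-- The jump of the Poisson kernel across the imaginary axis. -/
theorem poissonKer_jump (ha : 0 ≤ a) {s : ℝ} (hs : 0 < s) :
    poissonKer a (-Complex.I * s) - poissonKer a (Complex.I * s) =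
      Complex.I * (s ^ (2 * a + 1) : ℝ) * sphereMoment a 0 s := by
  -- Cauchy's theorem for e^{-q} (q² + s²)^a on the rectangle [0, R] × [-s, s]. On the sides q = x ±
  -- is one has q² + s² = x(x ± 2is), which gives the two Poisson kernels as R → ∞. The side Re q =
  -- R disappears, and the imaginary segment gives the spherical moment. For a > 0 the integrand is
  -- continuous up to the corners ±is although the power is not holomorphic there, and for a = 0 the
  -- power is 1.
  set f : ℂ → ℂ := fun q => Complex.exp (-q) * (q ^ 2 + s ^ 2) ^ (a : ℂ) with hf
  have hre : ∀ q : ℂ, (q ^ 2 + (s : ℂ) ^ 2).re = q.re ^ 2 - q.im ^ 2 + s ^ 2 := by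
    intro q; simp [pow_two]
  have hcont : ∀ R : ℝ, 0 < R → ContinuousOn f (uIcc (0 : ℝ) R ×ℂ uIcc (-s) s) := by
    intro R hR q hq
    refine ContinuousAt.continuousWithinAt (ContinuousAt.mul (by fun_prop) ?_)
    rcases ha.eq_or_lt with h | h
    · simp only [← h, Complex.ofReal_zero, Complex.cpow_zero]; fun_prop
    · refine ContinuousAt.comp (f := fun q : ℂ => q ^ 2 + (s : ℂ) ^ 2) (g := fun z : ℂ => z ^ (a : ℂ))
        (Complex.continuousAt_cpow_const_of_re_pos (Or.inl ?_) (by simpa using h)) (by fun_prop)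
      rw [hre]
      have h2 := hq.2
      rw [mem_preimage, uIcc_of_le (by linarith)] at h2
      nlinarith [h2.1, h2.2, sq_nonneg q.re]
  have hdiff : ∀ R : ℝ, 0 < R → DifferentiableOn ℂ f
      (Ioo (min 0 R) (max 0 R) ×ℂ Ioo (min (-s) s) (max (-s) s)) := by
    intro R hR q hq
    rw [min_eq_left hR.le, max_eq_right hR.le, min_eq_left (by linarith), max_eq_right (by linarith)]
      at hq
    refine DifferentiableAt.differentiableWithinAt (DifferentiableAt.mul (by fun_prop) ?_)
    refine DifferentiableAt.cpow_const (by fun_prop) (Or.inl ?_)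
    rw [hre]
    have h2 := hq.2
    have h1 := hq.1
    simp only [mem_preimage, mem_Ioo] at h1 h2
    nlinarith [sq_pos_of_pos h1.1]
  have hrect : ∀ R : ℝ, 0 < R → (∫ x in (0 : ℝ)..R, f (x + (-s : ℝ) * Complex.I)) -
      (∫ x in (0 : ℝ)..R, f (x + (s : ℝ) * Complex.I)) +
      Complex.I • (∫ y in (-s)..s, f (R + y * Complex.I)) -
      Complex.I • (∫ y in (-s)..s, f ((0 : ℝ) + y * Complex.I)) = 0 := by
    intro R hR
    have := Complex.integral_boundary_rect_eq_zero_of_continuousOn_of_differentiableOn f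
      (⟨0, -s⟩ : ℂ) (⟨R, s⟩ : ℂ) (hcont R hR) (hdiff R hR)
    exact this
  have hside : ∀ σ : ℝ, σ ^ 2 = 1 → Tendsto
      (fun R : ℝ => ∫ x in (0 : ℝ)..R, f (x + (σ * s : ℝ) * Complex.I)) atTop
      (𝓝 (poissonKer a (σ * Complex.I * s))) := by
    intro σ hσ
    have hσ0 : σ ≠ 0 := by rintro rfl; norm_num at hσ
    have hsl : σ * Complex.I * s ∈ Complex.slitPlane := by
      refine mem_slitPlane_of_re_nonneg (by simp) ?_
      simp [hσ0, hs.ne']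
    have hpt : ∀ x ∈ Ioi (0 : ℝ), f (x + (σ * s : ℝ) * Complex.I) =
        Complex.exp (-(σ * Complex.I * s)) * (((Real.exp (-x) * x ^ a : ℝ) : ℂ) *
          ((x : ℂ) + 2 * (σ * Complex.I * s)) ^ (a : ℂ)) := by
      intro x hx
      have hx' : (0 : ℝ) < x := hx
      have hσ' : (σ : ℂ) ^ 2 = 1 := by exact_mod_cast hσ
      have e1 : ((x : ℂ) + (σ * s : ℝ) * Complex.I) ^ 2 + (s : ℂ) ^ 2 =
          x * ((x : ℂ) + 2 * (σ * Complex.I * s)) := by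
        push_cast
        linear_combination ((s : ℂ) ^ 2 * σ ^ 2) * Complex.I_sq - (s : ℂ) ^ 2 * hσ'
      simp only [hf, e1]
      rw [ofReal_mul_cpow hx' (Complex.slitPlane_ne_zero (add_mem_slitPlane hsl hx'.le)),
        neg_add, Complex.exp_add]
      push_cast
      rw [Complex.ofReal_cpow hx'.le]
      rw [show -((σ : ℂ) * s * Complex.I) = -(σ * Complex.I * s) by ring]
      ring
    have hint := (integrableOn_poissonIntegrand (by linarith : -1 < a) a hsl).const_mul
      (Complex.exp (-(σ * Complex.I * s)))
    have hint' : IntegrableOn (fun x : ℝ => f (x + (σ * s : ℝ) * Complex.I)) (Ioi 0) :=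
      IntegrableOn.congr_fun hint (fun x hx => (hpt x hx).symm) measurableSet_Ioi
    have := intervalIntegral_tendsto_integral_Ioi 0 hint' tendsto_id
    rw [setIntegral_congr_fun measurableSet_Ioi hpt, integral_const_mul] at this
    exact this
  have hend : Tendsto (fun R : ℝ => ∫ y in (-s)..s, f (R + y * Complex.I)) atTop (𝓝 0) := by
    have hb : Tendsto (fun R : ℝ => Real.exp (2 * s) *
        ((R + 2 * s) ^ (2 * a) * Real.exp (-1 * (R + 2 * s))) * |s - -s|) atTop (𝓝 0) := by
      have h1 : Tendsto (fun R : ℝ => R + 2 * s) atTop atTop := tendsto_atTop_add_const_right _ _ tendsto_id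
      have h2 := ((tendsto_rpow_mul_exp_neg_mul_atTop_nhds_zero (2 * a) 1 one_pos).comp h1)
      simpa using (h2.const_mul (Real.exp (2 * s))).mul_const |s - -s|
    refine squeeze_zero_norm' ?_ hb
    filter_upwards [eventually_gt_atTop 0] with R hR
    refine intervalIntegral.norm_integral_le_of_norm_le_const fun y hy => ?_
    rw [uIoc_of_le (by linarith)] at hy
    have hy' : |y| ≤ s := abs_le.2 ⟨hy.1.le, hy.2⟩
    rw [hf]
    simp only
    rw [norm_mul, Complex.norm_exp, Complex.norm_cpow_real]
    have e1 : ‖((R : ℂ) + y * Complex.I) ^ 2 + (s : ℂ) ^ 2‖ ≤ (R + 2 * s) ^ 2 := by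
      refine (norm_add_le _ _).trans ?_
      rw [norm_pow, norm_pow, Complex.norm_real, Real.norm_of_nonneg hs.le]
      have : ‖(R : ℂ) + y * Complex.I‖ ≤ R + s := by
        refine (norm_add_le _ _).trans ?_
        rw [norm_mul, Complex.norm_I, mul_one, Complex.norm_real, Complex.norm_real,
          Real.norm_of_nonneg hR.le, Real.norm_eq_abs]
        linarith
      nlinarith [norm_nonneg ((R : ℂ) + y * Complex.I), mul_pos hR hs]
    have e2 : (R + 2 * s) ^ (2 * a) = ((R + 2 * s) ^ 2) ^ a := by
      rw [Real.rpow_mul (by linarith)]; norm_num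
    have e3 : Real.exp (2 * s) * Real.exp (-1 * (R + 2 * s)) = Real.exp (-R) := by
      rw [← Real.exp_add]; congr 1; ring
    have e4 : (-((R : ℂ) + y * Complex.I)).re = -R := by simp
    rw [e4, e2]
    calc Real.exp (-R) * ‖((R : ℂ) + y * Complex.I) ^ 2 + (s : ℂ) ^ 2‖ ^ a
        ≤ Real.exp (-R) * ((R + 2 * s) ^ 2) ^ a := by gcongr
      _ = _ := by rw [← e3]; ring
  have hfar := (((hside (-1) (by norm_num)).sub (hside 1 (by norm_num))).add
    (hend.const_smul Complex.I)).sub_const (Complex.I • (∫ y in (-s)..s, f ((0 : ℝ) + y * Complex.I)))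
  have hzero := hfar.congr' (f₂ := fun _ : ℝ => (0 : ℂ)) (by
    filter_upwards [eventually_gt_atTop 0] with R hR
    rw [← hrect R hR]
    simp)
  have hlim := tendsto_nhds_unique hzero tendsto_const_nhds
  have hmid : ∫ y in (-s)..s, f ((0 : ℝ) + y * Complex.I) =
      (s ^ (2 * a + 1) : ℝ) * sphereMoment a 0 s := by
    have h1 := intervalIntegral.integral_comp_mul_left (a := -1) (b := 1)
      (fun y : ℝ => f ((0 : ℝ) + y * Complex.I)) (c := -s) (by linarith)
    have h2 : ∫ u in (-1 : ℝ)..1, f ((0 : ℝ) + ((-s * u : ℝ) : ℂ) * Complex.I) =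
        (s ^ (2 * a) : ℝ) * sphereMoment a 0 s := by
      rw [sphereMoment, ← intervalIntegral.integral_const_mul]
      refine intervalIntegral.integral_congr fun u hu => ?_
      rw [uIcc_of_le (by norm_num)] at hu
      have hu2 : 0 ≤ 1 - u ^ 2 := by nlinarith [hu.1, hu.2]
      have e1 : ((0 : ℝ) + ((-s * u : ℝ) : ℂ) * Complex.I) ^ 2 + (s : ℂ) ^ 2 =
          ((s ^ 2 * (1 - u ^ 2) : ℝ) : ℂ) := by
        push_cast
        linear_combination ((s : ℂ) ^ 2 * u ^ 2) * Complex.I_sq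
      simp only [hf]
      rw [e1, ← Complex.ofReal_cpow (by positivity), Real.mul_rpow (by positivity) hu2]
      have e2 : s ^ (2 * a) = (s ^ 2) ^ a := by
        rw [Real.rpow_mul hs.le]; norm_num
      rw [e2]
      push_cast
      rw [show -(0 + -(s : ℂ) * u * Complex.I) = Complex.I * s * u by ring]
      ring
    rw [h2] at h1
    have e3 : s ^ (2 * a + 1) = s ^ (2 * a) * s := Real.rpow_add_one hs.ne' _
    rw [e3]
    have e4 : ∫ x in (-s * -1)..(-s * 1), f ((0 : ℝ) + (x : ℂ) * Complex.I) =
        -∫ x in (-s)..s, f ((0 : ℝ) + (x : ℂ) * Complex.I) := by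
      rw [show -s * -1 = s by ring, show -s * 1 = -s by ring, intervalIntegral.integral_symm]
    rw [e4, Complex.real_smul] at h1
    have hs' : (s : ℂ) ≠ 0 := by exact_mod_cast hs.ne'
    push_cast at h1 ⊢
    have aux : ∀ X : ℂ, X = (-(s : ℂ))⁻¹ * -X * s := fun X => by field_simp
    rw [mul_right_comm, h1]
    exact aux _
  rw [hmid] at hlim
  simp only [smul_eq_mul] at hlim
  have e5 : poissonKer a (((-1 : ℝ) : ℂ) * Complex.I * s) = poissonKer a (-Complex.I * s) := by
    congr 1; push_cast; ring
  have e6 : poissonKer a (((1 : ℝ) : ℂ) * Complex.I * s) = poissonKer a (Complex.I * s) := by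
    congr 1; push_cast; ring
  rw [e5, e6] at hlim
  linear_combination hlim

/-! ### Splitting the spherical moment into two waves -/

theorem one_add_pow_le_mul {s : ℝ} (hs : 0 < s) (M : ℕ) : (1 + s) ^ M ≤ 2 ^ M * (1 + s ^ M) := by
  have h0 : 0 < s ^ M := by positivity
  rcases le_total s 1 with h | h
  · have : (1 + s) ^ M ≤ 2 ^ M := pow_le_pow_left₀ (by linarith) (by linarith) M
    nlinarith [pow_pos (two_pos (α := ℝ)) M]
  · have : (1 + s) ^ M ≤ (2 * s) ^ M := pow_le_pow_left₀ (by linarith) (by linarith) M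
    rw [mul_pow] at this
    nlinarith [pow_pos (two_pos (α := ℝ)) M]

theorem inv_one_add_pow_le {s : ℝ} (hs : 0 < s) (M : ℕ) :
    (1 + s ^ M)⁻¹ ≤ 2 ^ M * (1 + s) ^ (-(M : ℝ)) := by
  rw [Real.rpow_neg (by linarith), Real.rpow_natCast, ← div_eq_mul_inv, inv_eq_one_div,
    div_le_div_iff₀ (by positivity) (by positivity), one_mul]
  exact one_add_pow_le_mul hs M

theorem pow_mul_inv_mul_rpow_le {s b : ℝ} (hs : 0 < s) (hb : 0 ≤ b) {M : ℕ} (hM : b ≤ M) :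
    s ^ M * (1 + s ^ M)⁻¹ * s ^ (-b) ≤ 2 ^ b * (1 + s) ^ (-b) := by
  have h0 : 0 < s ^ M := by positivity
  have h1 : (s / (1 + s)) ^ (-b) = s ^ (-b) * ((1 + s) ^ (-b))⁻¹ := by
    rw [Real.div_rpow hs.le (by linarith), div_eq_mul_inv]
  have hp : 0 < (1 + s) ^ (-b) := by positivity
  rw [← div_le_iff₀ hp, div_eq_mul_inv, mul_assoc, ← h1]
  have hq : 0 < s / (1 + s) := by positivity
  rcases le_total s 1 with h | h
  · have e1 : s ^ M * (1 + s ^ M)⁻¹ ≤ (s / (1 + s)) ^ b * 2 ^ b := by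
      rw [← Real.mul_rpow hq.le (by norm_num)]
      have f1 : s ^ M * (1 + s ^ M)⁻¹ ≤ s ^ M := by
        have : (1 + s ^ M)⁻¹ ≤ 1 := inv_le_one_of_one_le₀ (by linarith)
        nlinarith
      have f2 : s ^ M ≤ s ^ b := by
        rw [← Real.rpow_natCast]
        exact Real.rpow_le_rpow_of_exponent_ge hs h hM
      have f3 : s ^ b ≤ (s / (1 + s) * 2) ^ b := by
        refine Real.rpow_le_rpow hs.le ?_ hb
        rw [div_mul_eq_mul_div, le_div_iff₀ (by linarith)]
        nlinarith
      linarith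
    calc s ^ M * (1 + s ^ M)⁻¹ * (s / (1 + s)) ^ (-b)
        ≤ (s / (1 + s)) ^ b * 2 ^ b * (s / (1 + s)) ^ (-b) := by gcongr
      _ = 2 ^ b * ((s / (1 + s)) ^ b * (s / (1 + s)) ^ (-b)) := by ring
      _ = 2 ^ b := by rw [← Real.rpow_add hq]; simp
  · have e1 : s ^ M * (1 + s ^ M)⁻¹ ≤ 1 := by
      rw [← div_eq_mul_inv, div_le_one (by linarith)]; linarith
    have e2 : (s / (1 + s)) ^ (-b) ≤ (1 / 2) ^ (-b) := by
      refine Real.rpow_le_rpow_of_nonpos (by norm_num) ?_ (by linarith)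
      rw [div_le_div_iff₀ (by norm_num) (by linarith)]
      linarith
    have e3 : (1 / 2 : ℝ) ^ (-b) = 2 ^ b := by
      rw [Real.rpow_neg (by norm_num), one_div, Real.inv_rpow (by norm_num), inv_inv]
    rw [e3] at e2
    have e4 : 0 < (s / (1 + s)) ^ (-b) := by positivity
    nlinarith

/-- The sphere integral as a sum of an outgoing and an incoming wave. -/
theorem sphereMoment_decomp (ha : 0 ≤ a) (N : ℕ) : ∃ C : ℝ, ∃ F G : ℝ → ℂ, 0 ≤ C ∧
    IsSymbol (Ioi 0) N (fun s => C * (1 + s) ^ (-(a + 1))) F ∧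
    IsSymbol (Ioi 0) N (fun s => C * (1 + s) ^ (-(a + 1))) G ∧
    ∀ s : ℝ, 0 < s → sphereMoment a 0 s =
      Complex.exp (Complex.I * s) * F s + Complex.exp (-(Complex.I * s)) * G s := by
  set M : ℕ := 2 * N + ⌈2 * a + 1⌉₊ with hM
  have hM1 : 2 * a + 1 ≤ M := by
    rw [hM]; push_cast
    linarith [Nat.le_ceil (2 * a + 1), Nat.cast_nonneg (α := ℝ) N]
  have hM2 : (2 * N : ℕ) + (a + 1) ≤ M := by
    rw [hM]; push_cast
    linarith [Nat.le_ceil (2 * a + 1)]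
  obtain ⟨Cφ, hCφ, hφ⟩ := IsSymbol.inv_one_add_pow M N
  have hout : ∀ θ : ℂ, 0 ≤ θ.re → ‖θ‖ = 1 → ∃ C : ℝ, 0 ≤ C ∧
      IsSymbol (Ioi 0) N (fun s => C * (1 + s) ^ (-(a + 1)))
        (fun s => (s : ℂ) ^ M * (((1 + s ^ M)⁻¹ : ℝ) : ℂ) * ((s ^ (-(2 * a + 1)) : ℝ) : ℂ) *
          poissonInt a a (θ * s)) := by
    intro θ hθ hθ1
    obtain ⟨C, hC, h1⟩ := isSymbol_poissonInt_ray hθ hθ1 ha N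
    have h2 := (((IsSymbol.pow (k := N) M).mul isOpen_Ioi hφ).mul isOpen_Ioi
      (IsSymbol.rpow (-(2 * a + 1)))).mul isOpen_Ioi h1
    refine ⟨2 ^ N * 2 ^ N * 2 ^ N * (1 + (M : ℝ)) ^ N * Cφ * (1 + |(-(2 * a + 1))|) ^ N * C *
      2 ^ (2 * a + 1), by positivity, h2.mono fun s hs => ?_⟩
    have hs0 : (0 : ℝ) < s := hs
    have h3 := pow_mul_inv_mul_rpow_le hs0 (by linarith : 0 ≤ 2 * a + 1) hM1
    have h4 : (1 + s) ^ (-(a + 1)) = (1 + s) ^ (-(2 * a + 1)) * (1 + s) ^ a := by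
      rw [← Real.rpow_add (by linarith)]; congr 1; ring
    rw [h4]
    calc _ = 2 ^ N * 2 ^ N * 2 ^ N * (1 + (M : ℝ)) ^ N * Cφ * (1 + |(-(2 * a + 1))|) ^ N * C *
          (s ^ M * (1 + s ^ M)⁻¹ * s ^ (-(2 * a + 1)) * (1 + s) ^ a) := by ring
      _ ≤ 2 ^ N * 2 ^ N * 2 ^ N * (1 + (M : ℝ)) ^ N * Cφ * (1 + |(-(2 * a + 1))|) ^ N * C *
          (2 ^ (2 * a + 1) * (1 + s) ^ (-(2 * a + 1)) * (1 + s) ^ a) := by gcongr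
      _ = _ := by ring
  obtain ⟨C₁, hC₁, h1⟩ := hout (-Complex.I) (by simp) (by simp)
  obtain ⟨C₂, hC₂, h2⟩ := hout Complex.I (by simp) (by simp)
  obtain ⟨C₃, hC₃, h3⟩ := isSymbol_sphereMoment ha N
  obtain ⟨C₄, hC₄, h4⟩ := isSymbol_exp_ray (θ := Complex.I) (by simp) N
  -- The part near the origin is assigned to the outgoing wave. It is so small at infinity that the
  -- phase e^{is} may be factored out of it at will.
  have hin : IsSymbol (Ioi 0) N (fun s => 2 ^ N * 2 ^ N * Cφ * C₄ * C₃ * 2 ^ M * (1 + s) ^ (-(a + 1)))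
      (fun s => (((1 + s ^ M)⁻¹ : ℝ) : ℂ) * (Complex.exp (-(Complex.I * s)) * sphereMoment a 0 s)) := by
    refine (hφ.mul isOpen_Ioi (h4.mul isOpen_Ioi h3)).mono fun s hs => ?_
    have hs0 : (0 : ℝ) < s := hs
    have e1 := inv_one_add_pow_le hs0 M
    have e2 : (1 + s) ^ (-(M : ℝ)) * ((1 + s) ^ N * (1 + s) ^ N) ≤ (1 + s) ^ (-(a + 1)) := by
      rw [← pow_add, ← Real.rpow_natCast, ← Real.rpow_add (by linarith)]
      refine Real.rpow_le_rpow_of_exponent_le (by linarith) ?_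
      push_cast at hM2 ⊢
      linarith
    calc _ = 2 ^ N * 2 ^ N * Cφ * C₄ * C₃ * ((1 + s ^ M)⁻¹ * ((1 + s) ^ N * (1 + s) ^ N)) := by ring
      _ ≤ 2 ^ N * 2 ^ N * Cφ * C₄ * C₃ *
          (2 ^ M * (1 + s) ^ (-(M : ℝ)) * ((1 + s) ^ N * (1 + s) ^ N)) := by gcongr
      _ = 2 ^ N * 2 ^ N * Cφ * C₄ * C₃ * 2 ^ M *
          ((1 + s) ^ (-(M : ℝ)) * ((1 + s) ^ N * (1 + s) ^ N)) := by ring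
      _ ≤ _ := by gcongr
  set C₅ := 2 ^ N * 2 ^ N * Cφ * C₄ * C₃ * 2 ^ M with hC₅
  have hC₅0 : 0 ≤ C₅ := by positivity
  refine ⟨C₁ + C₂ + C₅, _, _, by positivity,
    ((h1.const_mul isOpen_Ioi (-Complex.I)).add isOpen_Ioi hin).mono fun s hs => ?_,
    (h2.const_mul isOpen_Ioi Complex.I).mono fun s hs => ?_, fun s hs => ?_⟩
  · have hs0 : (0 : ℝ) < s := hs
    have hp : 0 < (1 + s) ^ (-(a + 1)) := by positivity
    rw [norm_neg, Complex.norm_I]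
    nlinarith
  · have hs0 : (0 : ℝ) < s := hs
    have hp : 0 < (1 + s) ^ (-(a + 1)) := by positivity
    rw [Complex.norm_I]
    nlinarith
  · have hj := poissonKer_jump ha hs
    simp only [poissonKer] at hj
    have e1 : ((s ^ (-(2 * a + 1)) : ℝ) : ℂ) * ((s ^ (2 * a + 1) : ℝ) : ℂ) = 1 := by
      rw [← Complex.ofReal_mul, ← Real.rpow_add hs]; simp
    have e2 : (s : ℂ) ^ M * (((1 + s ^ M)⁻¹ : ℝ) : ℂ) + (((1 + s ^ M)⁻¹ : ℝ) : ℂ) = 1 := by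
      have : (1 + s ^ M : ℝ) ≠ 0 := by positivity
      norm_cast
      field_simp
      ring
    have e3 : Complex.exp (Complex.I * s) * Complex.exp (-(Complex.I * s)) = 1 := by
      rw [← Complex.exp_add]; simp
    have e4 : Complex.exp (-(-Complex.I * s)) = Complex.exp (Complex.I * s) := by
      congr 1; ring
    rw [e4] at hj
    set X := poissonInt a a (-Complex.I * s)
    set Y := poissonInt a a (Complex.I * s)
    set J := sphereMoment a 0 s
    set φ := (((1 + s ^ M)⁻¹ : ℝ) : ℂ)
    set P := ((s ^ (-(2 * a + 1)) : ℝ) : ℂ)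
    set Q := ((s ^ (2 * a + 1) : ℝ) : ℂ)
    set E := Complex.exp (Complex.I * s)
    set E' := Complex.exp (-(Complex.I * s))
    linear_combination (-J) * e2 - J * φ * e3 + (Complex.I * (s : ℂ) ^ M * φ * P) * hj
      + ((s : ℂ) ^ M * φ * J) * (Complex.I ^ 2 * e1 + Complex.I_sq)

end sphere


/-! ### Bessel integrals -/

theorem integrableOn_rpow_mul_exp_add_inv (c : ℝ) {A B : ℝ} (hA : 0 < A) (hB : 0 < B) :
    IntegrableOn (fun t : ℝ => t ^ c * Real.exp (-(A * t + B / t))) (Ioi 0) := by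
  set k := ⌈-c⌉₊ with hk
  have hck : 0 ≤ c + k := by linarith [Nat.le_ceil (-c)]
  have h1 := (integrableOn_rpow_mul_exp_neg_mul_rpow (p := 1) (s := c + k) (b := A) (by linarith)
    one_pos hA).const_mul (k.factorial / B ^ k)
  refine Integrable.mono' h1 ?_ ?_
  · refine ContinuousOn.aestronglyMeasurable (fun t ht => ?_) measurableSet_Ioi
    have ht' : t ≠ 0 := ne_of_gt ht
    refine ContinuousAt.continuousWithinAt ?_
    refine (Real.continuousAt_rpow_const _ _ (Or.inl ht')).mul ?_
    exact Real.continuous_exp.continuousAt.comp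
      ((by fun_prop : ContinuousAt (fun t : ℝ => A * t) t).add
        (continuousAt_const.div continuousAt_id ht')).neg
  · filter_upwards [ae_restrict_mem measurableSet_Ioi] with t ht
    have ht' : (0 : ℝ) < t := ht
    rw [Real.norm_of_nonneg (by positivity), Real.rpow_one, neg_add, Real.exp_add,
      Real.rpow_add ht', Real.rpow_natCast]
    have h2 := Real.pow_div_factorial_le_exp (B / t) (by positivity) k
    have h3 : Real.exp (-(B / t)) ≤ k.factorial / B ^ k * t ^ k := by
      rw [Real.exp_neg, inv_eq_one_div, div_le_iff₀ (Real.exp_pos _)]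
      have h4 : k.factorial / B ^ k * t ^ k * ((B / t) ^ k / k.factorial) = 1 := by
        rw [div_pow]; field_simp
      rw [← h4]
      gcongr
    calc t ^ c * (Real.exp (-(A * t)) * Real.exp (-(B / t)))
        ≤ t ^ c * (Real.exp (-(A * t)) * (k.factorial / B ^ k * t ^ k)) := by gcongr
      _ = _ := by rw [neg_mul]; ring

theorem integral_Ioi_inversion (F : ℝ → ℝ) {c : ℝ} (hc : 0 < c) :
    ∫ t in Ioi (0 : ℝ), F t = ∫ t in Ioi (0 : ℝ), c / t ^ 2 * F (c / t) := by
  have himg : (fun t : ℝ => c / t) '' Ioi 0 = Ioi 0 := by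
    ext y
    constructor
    · rintro ⟨x, hx, rfl⟩
      exact div_pos hc hx
    · intro hy
      have hy' : (0 : ℝ) < y := hy
      exact ⟨c / y, div_pos hc hy', by field_simp⟩
  have hd : ∀ t ∈ Ioi (0 : ℝ), HasDerivWithinAt (fun t : ℝ => c / t) (-(c / t ^ 2)) (Ioi 0) t := by
    intro t ht
    have := ((hasDerivAt_inv (ne_of_gt ht : t ≠ 0)).const_mul c).hasDerivWithinAt (s := Ioi 0)
    simp only [← div_eq_mul_inv] at this
    refine this.congr_deriv ?_
    rw [div_eq_mul_inv c]; ring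
  have hinj : InjOn (fun t : ℝ => c / t) (Ioi 0) := by
    intro x hx y hy h
    have hx' : x ≠ 0 := ne_of_gt hx
    have hy' : y ≠ 0 := ne_of_gt hy
    simp only at h
    rw [div_eq_div_iff hx' hy'] at h
    exact (mul_left_cancel₀ hc.ne' h).symm
  have := integral_image_eq_integral_abs_deriv_smul measurableSet_Ioi hd hinj F
  rw [himg] at this
  rw [this]
  refine setIntegral_congr_fun measurableSet_Ioi fun t ht => ?_
  have ht' : (0 : ℝ) < t := ht
  simp only [smul_eq_mul, abs_neg]
  rw [abs_of_pos (by positivity)]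

/-- `∫₀^∞ t^{-b} e^{-t - q²/(4t)} dt`. -/
noncomputable def heatInt (b q : ℝ) : ℝ :=
  ∫ t in Ioi (0 : ℝ), t ^ (-b) * Real.exp (-(1 * t + q ^ 2 / 4 / t))

/-- The substitution t ↦ q²/(4t) exchanges the two terms of the exponent. -/
theorem mul_heatInt {q : ℝ} (hq : 0 < q) : q * heatInt (3 / 2) q = 2 * heatInt (1 / 2) q := by
  rw [heatInt, integral_Ioi_inversion _ (by positivity : 0 < q ^ 2 / 4), heatInt,
    ← integral_const_mul, ← integral_const_mul]
  refine setIntegral_congr_fun measurableSet_Ioi fun t ht => ?_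
  have ht' : (0 : ℝ) < t := ht
  have e1 : q ^ 2 / 4 / (q ^ 2 / 4 / t) = t := by field_simp
  have e2 : (q ^ 2 / 4 / t) ^ (-(3 / 2) : ℝ) = (q ^ 2 / 4 / t)⁻¹ * ((q / 2)⁻¹ * t ^ (1 / 2 : ℝ)) := by
    rw [show (-(3 / 2) : ℝ) = -1 + -(1 / 2) by norm_num, Real.rpow_add (by positivity),
      Real.rpow_neg_one, Real.div_rpow (by positivity) ht'.le, show q ^ 2 / 4 = (q / 2) ^ 2 by ring,
      ← Real.rpow_natCast, ← Real.rpow_mul (by positivity)]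
    norm_num
    rw [Real.rpow_neg_one, Real.rpow_neg ht'.le]
    field_simp
    simp
  have e3 : t ^ (-(1 / 2) : ℝ) = t ^ (1 / 2 : ℝ) * t⁻¹ := by
    rw [← Real.rpow_neg_one, ← Real.rpow_add ht']; norm_num
  rw [e1, e2, e3, add_comm (1 * (q ^ 2 / 4 / t)) t, one_mul, one_mul]
  field_simp

theorem hasDerivAt_heatInt {q : ℝ} (hq : 0 < q) :
    HasDerivAt (heatInt (1 / 2)) (-heatInt (1 / 2) q) q := by
  have hI := fun (b : ℝ) {q : ℝ} (hq : 0 < q) =>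
    integrableOn_rpow_mul_exp_add_inv (-b) one_pos (by positivity : 0 < q ^ 2 / 4)
  have key := hasDerivAt_integral_of_dominated_loc_of_deriv_le (μ := volume.restrict (Ioi (0 : ℝ)))
    (F := fun q t => t ^ (-(1 / 2) : ℝ) * Real.exp (-(1 * t + q ^ 2 / 4 / t)))
    (F' := fun q t => -(q / 2) * (t ^ (-(3 / 2) : ℝ) * Real.exp (-(1 * t + q ^ 2 / 4 / t)))) (x₀ := q)
    (bound := fun t => q * (t ^ (-(3 / 2) : ℝ) * Real.exp (-(1 * t + (q / 2) ^ 2 / 4 / t))))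
    (s := Ioo (q / 2) (2 * q)) (Ioo_mem_nhds (by linarith) (by linarith)) ?_ (hI _ hq) ?_ ?_ ?_ ?_
  · have h2 := key.2
    rw [integral_const_mul] at h2
    refine h2.congr_deriv ?_
    have := mul_heatInt hq
    rw [heatInt] at this
    linarith
  · filter_upwards [Ioi_mem_nhds hq] with q' hq'
    exact (hI _ hq').aestronglyMeasurable
  · exact (hI (3 / 2) hq).aestronglyMeasurable.const_mul _
  · filter_upwards [ae_restrict_mem measurableSet_Ioi] with t ht q' hq'
    have ht' : (0 : ℝ) < t := ht
    have hq0 : 0 < q' := by linarith [hq'.1]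
    rw [norm_mul, norm_neg, Real.norm_of_nonneg (by positivity), Real.norm_of_nonneg (by positivity)]
    have h1 : (q / 2) ^ 2 ≤ q' ^ 2 := pow_le_pow_left₀ (by positivity) hq'.1.le 2
    have h2 : q' / 2 ≤ q := by linarith [hq'.2]
    gcongr
  · exact (hI (3 / 2) (by positivity : 0 < q / 2)).const_mul _
  · filter_upwards [ae_restrict_mem measurableSet_Ioi] with t ht q' hq'
    have ht' : (0 : ℝ) < t := ht
    have h1 : HasDerivAt (fun q : ℝ => -(1 * t + q ^ 2 / 4 / t)) (-(2 * q' / 4 / t)) q' := by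
      refine HasDerivAt.congr_deriv (HasDerivAt.fun_neg
        ((((hasDerivAt_pow 2 q').div_const 4).div_const t).const_add (1 * t))) ?_
      simp
    refine (h1.exp.const_mul (t ^ (-(1 / 2) : ℝ))).congr_deriv ?_
    have e3 : t ^ (-(3 / 2) : ℝ) = t ^ (-(1 / 2) : ℝ) * t⁻¹ := by
      rw [← Real.rpow_neg_one, ← Real.rpow_add ht']; norm_num
    rw [e3]
    field_simp
    ring

/-- The subordination formula: the integral solves f' = -f, so it is a multiple of e^{-q}. Only the
positivity of the constant is used later, so it is left unevaluated. -/
theorem heatInt_eq : ∃ K : ℝ, 0 < K ∧ ∀ q : ℝ, 0 < q → heatInt (1 / 2) q = K * Real.exp (-q) := by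
  have hpos : 0 < heatInt (1 / 2) 1 := by
    refine (integral_pos_iff_support_of_nonneg_ae ?_
      (integrableOn_rpow_mul_exp_add_inv _ one_pos (by positivity))).2 ?_
    · filter_upwards [ae_restrict_mem measurableSet_Ioi] with t ht
      have ht' : (0 : ℝ) < t := ht
      show 0 ≤ t ^ (-(1 / 2) : ℝ) * _
      positivity
    · have : Ioi (0 : ℝ) ⊆ Function.support
          fun t : ℝ => t ^ (-(1 / 2) : ℝ) * Real.exp (-(1 * t + 1 ^ 2 / 4 / t)) := by
        intro t ht
        have ht' : (0 : ℝ) < t := ht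
        exact (by positivity : 0 < t ^ (-(1 / 2) : ℝ) * Real.exp (-(1 * t + 1 ^ 2 / 4 / t))).ne'
      refine lt_of_lt_of_le ?_ (measure_mono this)
      simp
  refine ⟨heatInt (1 / 2) 1 * Real.exp 1, by positivity, fun q hq => ?_⟩
  have hd : ∀ q : ℝ, 0 < q → HasDerivAt (fun q => heatInt (1 / 2) q * Real.exp q) 0 q := by
    intro q hq
    refine ((hasDerivAt_heatInt hq).mul (Real.hasDerivAt_exp q)).congr_deriv ?_
    ring
  have hconst := isOpen_Ioi.is_const_of_deriv_eq_zero isPreconnected_Ioi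
    (fun q hq => (hd q hq).differentiableAt.differentiableWithinAt) (fun q hq => (hd q hq).deriv)
    (mem_Ioi.2 hq) (mem_Ioi.2 one_pos)
  rw [← hconst, mul_assoc, ← Real.exp_add]
  simp

/-- With y = u² + 2pu = (u + p)² - p² it becomes a Gamma integral. -/
theorem integral_sq_add (a : ℝ) (ha : 0 ≤ a) {p c : ℝ} (hp : 0 < p) (hc : 0 < c) :
    IntegrableOn (fun u : ℝ => (u + p) * (u ^ 2 + 2 * p * u) ^ a * Real.exp (-(c * (u + p) ^ 2)))
      (Ioi 0) ∧
    ∫ u in Ioi (0 : ℝ), (u + p) * (u ^ 2 + 2 * p * u) ^ a * Real.exp (-(c * (u + p) ^ 2)) =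
      1 / 2 * Real.Gamma (a + 1) * (1 / c) ^ (a + 1) * Real.exp (-(c * p ^ 2)) := by
  have himg : (fun u : ℝ => u ^ 2 + 2 * p * u) '' Ioi 0 = Ioi 0 := by
    ext y
    constructor
    · rintro ⟨x, hx, rfl⟩
      have hx' : (0 : ℝ) < x := hx
      show 0 < x ^ 2 + 2 * p * x
      positivity
    · intro hy
      have hy' : (0 : ℝ) < y := hy
      have h1 : Real.sqrt (y + p ^ 2) ^ 2 = y + p ^ 2 := Real.sq_sqrt (by positivity)
      have h2 : p < Real.sqrt (y + p ^ 2) := by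
        rw [Real.lt_sqrt hp.le]; linarith
      refine ⟨Real.sqrt (y + p ^ 2) - p, by simpa using h2, ?_⟩
      simp only
      nlinarith
  have hd : ∀ u ∈ Ioi (0 : ℝ), HasDerivWithinAt (fun u : ℝ => u ^ 2 + 2 * p * u) (2 * u + 2 * p)
      (Ioi 0) u := by
    intro u _
    refine (HasDerivAt.congr_deriv (HasDerivAt.fun_add (hasDerivAt_pow 2 u)
      ((hasDerivAt_id u).const_mul (2 * p))) ?_).hasDerivWithinAt
    simp
  have hinj : InjOn (fun u : ℝ => u ^ 2 + 2 * p * u) (Ioi 0) := by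
    intro x hx y hy h
    have hx' : (0 : ℝ) < x := hx
    have hy' : (0 : ℝ) < y := hy
    simp only at h
    have : (x - y) * (x + y + 2 * p) = 0 := by linear_combination h
    rcases mul_eq_zero.1 this with h1 | h1
    · linarith
    · linarith
  have hpt : ∀ u ∈ Ioi (0 : ℝ), |2 * u + 2 * p| • ((u ^ 2 + 2 * p * u) ^ (a + 1 - 1) *
      Real.exp (-(c * (u ^ 2 + 2 * p * u)))) = (2 * Real.exp (c * p ^ 2)) *
      ((u + p) * (u ^ 2 + 2 * p * u) ^ a * Real.exp (-(c * (u + p) ^ 2))) := by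
    intro u hu
    have hu' : (0 : ℝ) < u := hu
    have e1 : Real.exp (-(c * (u ^ 2 + 2 * p * u))) =
        Real.exp (c * p ^ 2) * Real.exp (-(c * (u + p) ^ 2)) := by
      rw [← Real.exp_add]; congr 1; ring
    rw [abs_of_pos (by positivity), e1, add_sub_cancel_right, smul_eq_mul]
    ring
  have hE : 2 * Real.exp (c * p ^ 2) ≠ 0 := by positivity
  constructor
  · have h1 : IntegrableOn (fun y : ℝ => y ^ (a + 1 - 1) * Real.exp (-(c * y))) (Ioi 0) := by
      have := integrableOn_rpow_mul_exp_neg_mul_rpow (p := 1) (s := a + 1 - 1) (b := c) (by linarith)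
        one_pos hc
      simpa only [Real.rpow_one, neg_mul] using this
    rw [← himg, integrableOn_image_iff_integrableOn_abs_deriv_smul measurableSet_Ioi hd hinj] at h1
    have h2 := (IntegrableOn.congr_fun h1 hpt measurableSet_Ioi).const_mul (2 * Real.exp (c * p ^ 2))⁻¹
    simp only [inv_mul_cancel_left₀ hE] at h2
    exact h2
  · have h1 := integral_image_eq_integral_abs_deriv_smul measurableSet_Ioi hd hinj
      (fun y : ℝ => y ^ (a + 1 - 1) * Real.exp (-(c * y)))
    rw [himg, setIntegral_congr_fun measurableSet_Ioi hpt, integral_const_mul,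
      Real.integral_rpow_mul_exp_neg_mul_Ioi (by linarith) hc] at h1
    have e2 : Real.exp (c * p ^ 2) * Real.exp (-(c * p ^ 2)) = 1 := by
      rw [← Real.exp_add]; simp
    have h3 : Real.Gamma (a + 1) * (1 / c) ^ (a + 1) * Real.exp (-(c * p ^ 2)) =
      2 * (Real.exp (c * p ^ 2) * Real.exp (-(c * p ^ 2))) * ∫ u in Ioi (0 : ℝ),
        (u + p) * (u ^ 2 + 2 * p * u) ^ a * Real.exp (-(c * (u + p) ^ 2)) := by
      rw [mul_comm (Real.Gamma _), h1]; ring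
    rw [e2] at h3
    linarith

/-- `∫₀^∞ t^{-b} e^{-p (t + 1/(4t))} dt`. -/
noncomputable def besselInt (b : ℝ) (p : ℂ) : ℂ :=
  ∫ t in Ioi (0 : ℝ), ((t ^ (-b) : ℝ) : ℂ) * Complex.exp (-(p * (t + 1 / (4 * t) : ℝ)))

theorem poissonKer_ofReal {a p : ℝ} (hp : 0 < p) : poissonKer a p =
    ((∫ u in Ioi (0 : ℝ), (u ^ 2 + 2 * p * u) ^ a * Real.exp (-(u + p)) : ℝ) : ℂ) := by
  rw [poissonKer, poissonInt, ← integral_const_mul, ← integral_complex_ofReal]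
  refine setIntegral_congr_fun measurableSet_Ioi fun u hu => ?_
  have hu' : (0 : ℝ) < u := hu
  have e1 : (u : ℂ) + 2 * p = ((u + 2 * p : ℝ) : ℂ) := by push_cast; ring
  rw [e1, ← Complex.ofReal_cpow (by positivity), ← Complex.ofReal_neg, ← Complex.ofReal_exp,
    ← Complex.ofReal_mul, ← Complex.ofReal_mul]
  congr 1
  rw [show u ^ 2 + 2 * p * u = u * (u + 2 * p) by ring, Real.mul_rpow hu'.le (by positivity), neg_add,
    Real.exp_add]
  ring

theorem besselInt_ofReal {b p : ℝ} : besselInt b p =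
    ((∫ t in Ioi (0 : ℝ), t ^ (-b) * Real.exp (-(p * (t + 1 / (4 * t)))) : ℝ) : ℂ) := by
  rw [besselInt, ← integral_complex_ofReal]
  refine setIntegral_congr_fun measurableSet_Ioi fun u _ => ?_
  push_cast
  rfl

/-- Two classical integrals for the Macdonald function of order a + 1/2. Subordination writes
e^{-(u+p)} as a superposition of the Gaussians e^{-(u+p)²/(4t)}. The resulting double integral is
computed in both orders, the u-integral by `integral_sq_add`, and t ↦ p/(4t) brings the remaining
t-integral to the stated form. -/
theorem rpow_mul_bessel_real {a : ℝ} (ha : 0 ≤ a) : ∃ C : ℝ, ∀ p : ℝ, 0 < p →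
    p ^ (a + 1 / 2) * ∫ t in Ioi (0 : ℝ), t ^ (-(a + 3 / 2)) * Real.exp (-(p * (t + 1 / (4 * t)))) =
      C * ∫ u in Ioi (0 : ℝ), (u ^ 2 + 2 * p * u) ^ a * Real.exp (-(u + p)) := by
  obtain ⟨K, hK, hKeq⟩ := heatInt_eq
  have hΓ : 0 < Real.Gamma (a + 1) := Real.Gamma_pos_of_pos (by linarith)
  refine ⟨K * (1 / 4 * Real.Gamma (a + 1) * 4 ^ (a + 1) * (1 / 4) ^ (a + 1 / 2))⁻¹, fun p hp => ?_⟩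
  set D := 1 / 4 * Real.Gamma (a + 1) * 4 ^ (a + 1) * (1 / 4) ^ (a + 1 / 2) with hD
  have hD0 : 0 < D := by positivity
  set f : ℝ → ℝ → ℝ := fun u t => (u ^ 2 + 2 * p * u) ^ a * ((u + p) / 2 *
    (t ^ (-(3 / 2) : ℝ) * Real.exp (-(1 * t + (u + p) ^ 2 / 4 / t)))) with hf
  have hfeq : ∀ u t : ℝ, 0 < t → f u t = 1 / 2 * (t ^ (-(3 / 2) : ℝ) * Real.exp (-t)) *
      ((u + p) * (u ^ 2 + 2 * p * u) ^ a * Real.exp (-(1 / (4 * t) * (u + p) ^ 2))) := by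
    intro u t ht
    have : Real.exp (-(1 * t + (u + p) ^ 2 / 4 / t)) =
        Real.exp (-t) * Real.exp (-(1 / (4 * t) * (u + p) ^ 2)) := by
      rw [← Real.exp_add]; congr 1; field_simp; ring
    simp only [hf]
    rw [this]; ring
  have hinner : ∀ t : ℝ, 0 < t → ∫ u in Ioi (0 : ℝ), f u t = 1 / 4 * Real.Gamma (a + 1) * 4 ^ (a + 1) *
      (t ^ (a - 1 / 2) * Real.exp (-(1 * t + p ^ 2 / 4 / t))) := by
    intro t ht
    simp only [hfeq _ t ht]
    rw [integral_const_mul, (integral_sq_add a ha hp (by positivity : 0 < 1 / (4 * t))).2]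
    have e1 : Real.exp (-(1 * t + p ^ 2 / 4 / t)) =
        Real.exp (-t) * Real.exp (-(1 / (4 * t) * p ^ 2)) := by
      rw [← Real.exp_add]; congr 1; field_simp; ring
    have e2 : (1 / (1 / (4 * t))) ^ (a + 1) = 4 ^ (a + 1) * t ^ (a + 1) := by
      rw [one_div_one_div, Real.mul_rpow (by norm_num) ht.le]
    have e3 : t ^ (a - 1 / 2) = t ^ (-(3 / 2) : ℝ) * t ^ (a + 1) := by
      rw [← Real.rpow_add ht]; congr 1; ring
    rw [e1, e2, e3]
    ring
  have hmeas : AEStronglyMeasurable (Function.uncurry f)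
      ((volume.restrict (Ioi (0 : ℝ))).prod (volume.restrict (Ioi (0 : ℝ)))) := by
    refine Measurable.aestronglyMeasurable ?_
    simp only [hf, Function.uncurry_def]
    fun_prop
  have hint : Integrable (Function.uncurry f)
      ((volume.restrict (Ioi (0 : ℝ))).prod (volume.restrict (Ioi (0 : ℝ)))) := by
    rw [integrable_prod_iff' hmeas]
    constructor
    · filter_upwards [ae_restrict_mem measurableSet_Ioi] with t ht
      have ht' : (0 : ℝ) < t := ht
      simp only [Function.uncurry_apply_pair, hfeq _ t ht']
      exact (integral_sq_add a ha hp (by positivity : 0 < 1 / (4 * t))).1.const_mul _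
    · have h1 := (integrableOn_rpow_mul_exp_add_inv (a - 1 / 2) one_pos
        (by positivity : 0 < p ^ 2 / 4)).const_mul (1 / 4 * Real.Gamma (a + 1) * 4 ^ (a + 1))
      refine IntegrableOn.congr_fun h1 (fun t ht => ?_) measurableSet_Ioi
      rw [← hinner t ht]
      refine setIntegral_congr_fun measurableSet_Ioi fun u hu => ?_
      have hu' : (0 : ℝ) < u := hu
      have ht' : (0 : ℝ) < t := ht
      simp only [Function.uncurry_apply_pair]
      rw [Real.norm_of_nonneg]
      simp only [hf]
      positivity
  have hswap := integral_integral_swap hint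
  have hL : ∫ u in Ioi (0 : ℝ), ∫ t in Ioi (0 : ℝ), f u t =
      K * ∫ u in Ioi (0 : ℝ), (u ^ 2 + 2 * p * u) ^ a * Real.exp (-(u + p)) := by
    rw [← integral_const_mul]
    refine setIntegral_congr_fun measurableSet_Ioi fun u hu => ?_
    have hu' : (0 : ℝ) < u := hu
    simp only [hf]
    rw [integral_const_mul, integral_const_mul]
    have h1 := mul_heatInt (by positivity : 0 < u + p)
    rw [hKeq _ (by positivity : 0 < u + p), heatInt] at h1
    linear_combination ((u ^ 2 + 2 * p * u) ^ a / 2) * h1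
  have hR : ∫ t in Ioi (0 : ℝ), ∫ u in Ioi (0 : ℝ), f u t = D * (p ^ (a + 1 / 2) *
      ∫ t in Ioi (0 : ℝ), t ^ (-(a + 3 / 2)) * Real.exp (-(p * (t + 1 / (4 * t))))) := by
    rw [setIntegral_congr_fun measurableSet_Ioi fun t ht => hinner t ht, integral_const_mul,
      integral_Ioi_inversion _ (by positivity : 0 < p / 4), hD, mul_assoc _ ((1 / 4 : ℝ) ^ _),
      ← mul_assoc ((1 / 4 : ℝ) ^ _), ← Real.mul_rpow (by norm_num) hp.le]
    refine congrArg _ ?_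
    rw [← integral_const_mul]
    refine setIntegral_congr_fun measurableSet_Ioi fun t ht => ?_
    have ht' : (0 : ℝ) < t := ht
    have e1 : (p / 4 / t) ^ (a - 1 / 2) = (p / 4) ^ (a - 1 / 2) * t ^ (-(a - 1 / 2)) := by
      rw [Real.div_rpow (by positivity) ht'.le, Real.rpow_neg ht'.le, div_eq_mul_inv]
    have e2 : (1 / 4 * p) ^ (a + 1 / 2) = p / 4 * (p / 4) ^ (a - 1 / 2) := by
      rw [← Real.rpow_one_add' (by positivity) (by linarith)]
      congr 1 <;> ring
    have e3 : t ^ (-(a + 3 / 2)) = t ^ (-(a - 1 / 2)) / t ^ 2 := by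
      rw [← Real.rpow_natCast, ← Real.rpow_sub ht']; congr 1; push_cast; ring
    rw [e1, e2, e3]
    have e4 : -(1 * (p / 4 / t) + p ^ 2 / 4 / (p / 4 / t)) = -(p * (t + 1 / (4 * t))) := by
      field_simp
      ring
    rw [e4]
    ring
  rw [hL, hR] at hswap
  rw [mul_assoc, mul_left_comm, hswap, inv_mul_cancel_left₀ hD0.ne']

theorem hasDerivAt_besselInt (b : ℝ) {p : ℂ} (hp : 0 < p.re) :
    DifferentiableAt ℂ (besselInt b) p := by
  have hcont : ∀ (b : ℝ) (p : ℂ), ContinuousOn (fun t : ℝ => ((t ^ (-b) : ℝ) : ℂ) *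
      Complex.exp (-(p * (t + 1 / (4 * t) : ℝ)))) (Ioi 0) := by
    intro b p t ht
    have ht' : (0 : ℝ) < t := ht
    refine ContinuousAt.continuousWithinAt (ContinuousAt.mul ?_ ?_)
    · exact Complex.continuous_ofReal.continuousAt.comp (Real.continuousAt_rpow_const _ _ (Or.inl ht'.ne'))
    · have : ContinuousAt (fun t : ℝ => t + 1 / (4 * t)) t :=
        continuousAt_id.add (continuousAt_const.div (by fun_prop) (mul_ne_zero four_ne_zero ht'.ne'))
      exact Complex.continuous_exp.continuousAt.comp
        ((continuousAt_const.mul (Complex.continuous_ofReal.continuousAt.comp this)).neg)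
  have hnorm : ∀ (b : ℝ) (p : ℂ) (t : ℝ), 0 < t → ‖((t ^ (-b) : ℝ) : ℂ) *
      Complex.exp (-(p * (t + 1 / (4 * t) : ℝ)))‖ =
      t ^ (-b) * Real.exp (-(p.re * t + p.re / 4 / t)) := by
    intro b p t ht
    rw [norm_mul, Complex.norm_real, Real.norm_of_nonneg (by positivity), Complex.norm_exp]
    congr 2
    simp only [Complex.neg_re, Complex.mul_re, Complex.ofReal_re, Complex.ofReal_im, mul_zero, sub_zero]
    field_simp
  have hint : ∀ (b : ℝ) (p : ℂ), 0 < p.re → IntegrableOn (fun t : ℝ => ((t ^ (-b) : ℝ) : ℂ) *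
      Complex.exp (-(p * (t + 1 / (4 * t) : ℝ)))) (Ioi 0) := by
    intro b p hp
    refine Integrable.mono' (integrableOn_rpow_mul_exp_add_inv (-b) hp (by linarith : (0 : ℝ) < p.re / 4))
      ((hcont b p).aestronglyMeasurable measurableSet_Ioi) ?_
    filter_upwards [ae_restrict_mem measurableSet_Ioi] with t ht
    exact (hnorm b p t ht).le
  have key := hasDerivAt_integral_of_dominated_loc_of_deriv_le (μ := volume.restrict (Ioi (0 : ℝ)))
    (F := fun (p : ℂ) (t : ℝ) => ((t ^ (-b) : ℝ) : ℂ) * Complex.exp (-(p * (t + 1 / (4 * t) : ℝ))))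
    (F' := fun (p : ℂ) (t : ℝ) => -(((t ^ (-(b - 1)) : ℝ) : ℂ) *
        Complex.exp (-(p * (t + 1 / (4 * t) : ℝ))) + 1 / 4 * (((t ^ (-(b + 1)) : ℝ) : ℂ) *
        Complex.exp (-(p * (t + 1 / (4 * t) : ℝ))))))
    (bound := fun t => t ^ (-(b - 1)) * Real.exp (-(p.re / 2 * t + p.re / 2 / 4 / t)) +
      1 / 4 * (t ^ (-(b + 1)) * Real.exp (-(p.re / 2 * t + p.re / 2 / 4 / t)))) (x₀ := p)
    (s := {z : ℂ | p.re / 2 < z.re})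
    ((isOpen_lt continuous_const Complex.continuous_re).mem_nhds (show p.re / 2 < p.re by linarith))
    ?_ (hint b p hp) ?_ ?_ ?_ ?_
  · exact key.2.differentiableAt
  · exact Eventually.of_forall fun p => (hcont b p).aestronglyMeasurable measurableSet_Ioi
  · exact (((hint _ p hp).add ((hint _ p hp).const_mul _)).neg).aestronglyMeasurable
  · filter_upwards [ae_restrict_mem measurableSet_Ioi] with t ht z hz
    have ht' : (0 : ℝ) < t := ht
    have hz' : p.re / 2 < z.re := hz
    rw [norm_neg]
    refine (norm_add_le _ _).trans ?_
    rw [norm_mul (1 / 4 : ℂ), hnorm _ _ _ ht', hnorm _ _ _ ht']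
    norm_num
    gcongr
  · have h1 := fun c : ℝ => integrableOn_rpow_mul_exp_add_inv c (by linarith : (0 : ℝ) < p.re / 2)
      (by linarith : (0 : ℝ) < p.re / 2 / 4)
    exact (h1 _).add ((h1 _).const_mul _)
  · filter_upwards [ae_restrict_mem measurableSet_Ioi] with t ht z _
    have ht' : (0 : ℝ) < t := ht
    have h1 : HasDerivAt (fun z : ℂ => -(z * (t + 1 / (4 * t) : ℝ))) (-(1 * (t + 1 / (4 * t) : ℝ))) z :=
      ((hasDerivAt_id z).mul_const _).neg
    refine (h1.cexp.const_mul ((t ^ (-b) : ℝ) : ℂ)).congr_deriv ?_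
    have e1 : t ^ (-(b - 1)) = t ^ (-b) * t := by
      rw [← Real.rpow_add_one ht'.ne']; congr 1; ring
    have e2 : t ^ (-(b + 1)) = t ^ (-b) / t := by
      rw [← Real.rpow_sub_one ht'.ne']; congr 1; ring
    have ht0 : (t : ℂ) ≠ 0 := by exact_mod_cast ht'.ne'
    rw [e1, e2]
    push_cast
    field_simp

/-- Bessel integrals in terms of Poisson kernels, in the right half plane. -/
theorem cpow_mul_besselInt {a : ℝ} (ha : 0 ≤ a) : ∃ C : ℂ, ∀ p : ℂ, 0 < p.re →
    p ^ ((a + 1 / 2 : ℝ) : ℂ) * besselInt (a + 3 / 2) p = C * poissonKer a p := by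
  obtain ⟨C, hC⟩ := rpow_mul_bessel_real ha
  refine ⟨C, fun p hp => ?_⟩
  have hopen : IsOpen {z : ℂ | 0 < z.re} := isOpen_lt continuous_const Complex.continuous_re
  have hconn : IsPreconnected {z : ℂ | 0 < z.re} := (convex_halfSpace_re_gt 0).isPreconnected
  have hL : AnalyticOnNhd ℂ (fun p : ℂ => p ^ ((a + 1 / 2 : ℝ) : ℂ) * besselInt (a + 3 / 2) p)
      {z : ℂ | 0 < z.re} := by
    refine DifferentiableOn.analyticOnNhd (fun z hz => ?_) hopen
    refine DifferentiableAt.differentiableWithinAt (DifferentiableAt.mul ?_ (hasDerivAt_besselInt _ hz))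
    exact DifferentiableAt.cpow_const (by fun_prop) (Or.inl hz)
  have hR : AnalyticOnNhd ℂ (fun p : ℂ => (C : ℂ) * poissonKer a p) {z : ℂ | 0 < z.re} := by
    refine DifferentiableOn.analyticOnNhd (fun z hz => ?_) hopen
    refine DifferentiableAt.differentiableWithinAt (DifferentiableAt.const_mul ?_ _)
    have : DifferentiableAt ℂ (poissonInt a a) z :=
      (hasDerivAt_poissonInt (by linarith) a (Or.inl hz)).differentiableAt
    exact (by fun_prop : DifferentiableAt ℂ (fun z : ℂ => Complex.exp (-z)) z).mul this
  -- Identity theorem: both sides are analytic in the right half plane and agree at the real points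
  -- 1 + 1/(k + 1), which accumulate at 1.
  refine hL.eqOn_of_preconnected_of_frequently_eq hR hconn (z₀ := 1) (by simp) ?_ hp
  have hseq : Tendsto (fun k : ℕ => ((1 + 1 / ((k : ℝ) + 1) : ℝ) : ℂ)) atTop (𝓝[≠] 1) := by
    refine tendsto_nhdsWithin_iff.2 ⟨?_, Eventually.of_forall fun k => ?_⟩
    · have h1 : Tendsto (fun k : ℕ => (1 + 1 / ((k : ℝ) + 1) : ℝ)) atTop (𝓝 (1 + 0)) :=
        tendsto_const_nhds.add tendsto_one_div_add_atTop_nhds_zero_nat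
      rw [add_zero] at h1
      exact_mod_cast (Complex.continuous_ofReal.tendsto 1).comp h1
    · have : (0 : ℝ) < 1 / ((k : ℝ) + 1) := by positivity
      rw [mem_compl_iff, mem_singleton_iff]
      intro h
      have h2 : (1 + 1 / ((k : ℝ) + 1) : ℝ) = 1 := by exact_mod_cast h
      linarith
  refine hseq.frequently (Eventually.of_forall fun k => ?_).frequently
  have hk : (0 : ℝ) < 1 + 1 / ((k : ℝ) + 1) := by positivity
  rw [besselInt_ofReal, poissonKer_ofReal hk, ← Complex.ofReal_cpow hk.le, ← Complex.ofReal_mul,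
    ← Complex.ofReal_mul, hC _ hk]


/-! ### The resolvent kernel -/

theorem rpow_mul_exp_neg_le {d A : ℝ} (hd : 0 ≤ d) (hA : 0 < A) :
    ∃ C, 0 ≤ C ∧ ∀ y : ℝ, 0 ≤ y → y ^ d * Real.exp (-(A * y)) ≤ C := by
  set k := ⌈d⌉₊ with hk
  have hdk : d ≤ k := Nat.le_ceil d
  refine ⟨1 + k.factorial / A ^ k, by positivity, fun y hy => ?_⟩
  rcases le_total y 1 with h1 | h1
  · have h2 : y ^ d ≤ 1 := Real.rpow_le_one hy h1 hd
    have h3 : Real.exp (-(A * y)) ≤ 1 := Real.exp_le_one_iff.2 (by nlinarith)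
    have h4 : (0 : ℝ) ≤ k.factorial / A ^ k := by positivity
    nlinarith [Real.exp_pos (-(A * y)), Real.rpow_nonneg hy d]
  · have h2 : y ^ d ≤ y ^ k := by
      rw [← Real.rpow_natCast]; exact Real.rpow_le_rpow_of_exponent_le h1 hdk
    have h3 := Real.pow_div_factorial_le_exp (A * y) (by positivity) k
    have h4 : y ^ k * Real.exp (-(A * y)) ≤ k.factorial / A ^ k := by
      rw [Real.exp_neg, ← div_eq_mul_inv, div_le_div_iff₀ (Real.exp_pos _) (by positivity)]
      rw [div_le_iff₀ (by positivity)] at h3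
      rw [← mul_pow, mul_comm y A]
      linarith
    have := mul_le_mul_of_nonneg_right h2 (Real.exp_pos (-(A * y))).le
    linarith

section

variable {n : ℕ} {κ : ℂ}

/-- Exponentiating T + κ² directly would require Re κ² > 0. Writing it as κ(κ + Tκ⁻¹) instead only
requires Re κ > 0, which covers all roots needed for the resolvent. -/
theorem inv_add_sq_eq_integral (hκ : 0 < κ.re) {T : ℝ} (hT : 0 ≤ T) :
    1 / ((T : ℂ) + κ ^ 2) =
      κ⁻¹ * ∫ ρ in Ioi (0 : ℝ), Complex.exp (-(κ + T * κ⁻¹) * ρ) := by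
  have hκ0 : κ ≠ 0 := by rintro rfl; simp at hκ
  have hre : 0 < (κ + T * κ⁻¹).re := by
    have h1 : 0 < (κ⁻¹).re := by
      rw [Complex.inv_re]; exact div_pos hκ (Complex.normSq_pos.2 hκ0)
    rw [Complex.add_re, Complex.re_ofReal_mul]
    positivity
  have h0 : κ + T * κ⁻¹ ≠ 0 := by intro h; rw [h] at hre; simp at hre
  rw [integral_exp_mul_complex_Ioi (by rw [Complex.neg_re]; linarith)]
  have h1 : (T : ℂ) + κ ^ 2 ≠ 0 := by
    have : (T : ℂ) + κ ^ 2 = κ * (κ + T * κ⁻¹) := by field_simp; ring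
    rw [this]; exact mul_ne_zero hκ0 h0
  simp only [Complex.ofReal_zero, mul_zero, Complex.exp_zero]
  rw [neg_div_neg_eq, eq_comm]
  have : κ * (κ + T * κ⁻¹) = (T : ℂ) + κ ^ 2 := by field_simp; ring
  rw [← this, one_div, one_div, mul_inv]

/-- The Gaussian-regularized symbol of `(-Δ + κ²)⁻¹`, written as an integral over `ρ`. -/
theorem integrable_regularized (hκ : 0 < κ.re) {δ : ℝ} (hδ : 0 < δ) (x : EuclideanSpace ℝ (Fin n)) :
    Integrable (Function.uncurry fun (ξ : EuclideanSpace ℝ (Fin n)) (ρ : ℝ) =>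
      Complex.exp ((↑(2 * Real.pi * inner ℝ ξ x) * Complex.I)) * ((Real.exp (-δ * ‖ξ‖ ^ 2) : ℂ) *
        (κ⁻¹ * Complex.exp (-(κ + ((2 * Real.pi * ‖ξ‖) ^ 2 : ℝ) * κ⁻¹) * ρ))))
      (volume.prod (volume.restrict (Ioi 0))) := by
  have hκ0 : κ ≠ 0 := by rintro rfl; simp at hκ
  have h1 : 0 < (κ⁻¹).re := by
    rw [Complex.inv_re]; exact div_pos hκ (Complex.normSq_pos.2 hκ0)
  have hg : Integrable (fun ξ : EuclideanSpace ℝ (Fin n) => Real.exp (-δ * ‖ξ‖ ^ 2)) := by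
    have := (GaussianFourier.integrable_cexp_neg_mul_sq_norm_add (V := EuclideanSpace ℝ (Fin n))
      (b := (δ : ℂ)) (by simpa using hδ) 0 0).norm
    refine this.congr (Eventually.of_forall fun ξ => ?_)
    simp only [Complex.norm_exp]
    congr 1
    simp [← Complex.ofReal_pow]
  have he : Integrable (fun ρ : ℝ => ‖κ⁻¹‖ * Real.exp (-κ.re * ρ)) (volume.restrict (Ioi 0)) :=
    (exp_neg_integrableOn_Ioi 0 hκ).const_mul _
  refine Integrable.mono' (hg.mul_prod he) ?_ ?_
  · refine Continuous.aestronglyMeasurable ?_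
    simp only [Function.uncurry_def]
    fun_prop
  · have : ∀ᵐ z : EuclideanSpace ℝ (Fin n) × ℝ ∂(volume.prod (volume.restrict (Ioi 0))), 0 < z.2 :=
      Measure.quasiMeasurePreserving_snd.ae (ae_restrict_mem measurableSet_Ioi)
    filter_upwards [this] with z hz
    simp only [Function.uncurry_def, norm_mul, Complex.norm_exp_ofReal_mul_I, one_mul]
    rw [Complex.norm_real, Real.norm_of_nonneg (Real.exp_pos _).le, Complex.norm_exp]
    gcongr
    rw [Complex.re_mul_ofReal, Complex.neg_re, Complex.add_re, Complex.re_ofReal_mul]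
    have : 0 ≤ (2 * Real.pi * ‖z.1‖) ^ 2 * (κ⁻¹).re := by positivity
    nlinarith

theorem integrable_regularized_symbol (hκ : 0 < κ.re) {δ : ℝ} (hδ : 0 < δ)
    (x : EuclideanSpace ℝ (Fin n)) :
    Integrable (fun ξ : EuclideanSpace ℝ (Fin n) =>
      Complex.exp ((↑(2 * Real.pi * inner ℝ ξ x) * Complex.I)) * ((Real.exp (-δ * ‖ξ‖ ^ 2) : ℂ) /
        (((2 * Real.pi * ‖ξ‖) ^ 2 : ℝ) + κ ^ 2))) := by
  refine (integrable_regularized hκ hδ x).integral_prod_left.congr (Eventually.of_forall fun ξ => ?_)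
  simp only [Function.uncurry_apply_pair]
  rw [integral_const_mul, integral_const_mul, integral_const_mul,
    ← inv_add_sq_eq_integral hκ (by positivity), mul_one_div]

/-- The Gaussian cutoff makes the integral in (ξ, ρ) absolutely convergent, so Fubini applies, and
the ξ-integral becomes the transform of a complex Gaussian. -/
theorem fourierInv_regularized (hκ : 0 < κ.re) {δ : ℝ} (hδ : 0 < δ) (x : EuclideanSpace ℝ (Fin n)) :
    𝓕⁻ (fun ξ : EuclideanSpace ℝ (Fin n) => (Real.exp (-δ * ‖ξ‖ ^ 2) : ℂ) /
        (((2 * Real.pi * ‖ξ‖) ^ 2 : ℝ) + κ ^ 2)) x =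
      ∫ ρ in Ioi (0 : ℝ), κ⁻¹ * Complex.exp (-κ * ρ) *
        ((Real.pi / (δ + 4 * Real.pi ^ 2 * κ⁻¹ * ρ)) ^ ((n : ℂ) / 2) *
          Complex.exp (-Real.pi ^ 2 * ‖x‖ ^ 2 / (δ + 4 * Real.pi ^ 2 * κ⁻¹ * ρ))) := by
  have hκ0 : κ ≠ 0 := by rintro rfl; simp at hκ
  have h1 : 0 < (κ⁻¹).re := by
    rw [Complex.inv_re]; exact div_pos hκ (Complex.normSq_pos.2 hκ0)
  rw [Real.fourierInv_eq']
  have e1 : ∀ ξ : EuclideanSpace ℝ (Fin n), Complex.exp ((↑(2 * Real.pi * inner ℝ ξ x) * Complex.I)) •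
      ((Real.exp (-δ * ‖ξ‖ ^ 2) : ℂ) / (((2 * Real.pi * ‖ξ‖) ^ 2 : ℝ) + κ ^ 2)) =
      ∫ ρ in Ioi (0 : ℝ), Complex.exp ((↑(2 * Real.pi * inner ℝ ξ x) * Complex.I)) *
      ((Real.exp (-δ * ‖ξ‖ ^ 2) : ℂ) *
        (κ⁻¹ * Complex.exp (-(κ + ((2 * Real.pi * ‖ξ‖) ^ 2 : ℝ) * κ⁻¹) * ρ))) := by
    intro ξ
    rw [integral_const_mul, integral_const_mul, integral_const_mul,
      ← inv_add_sq_eq_integral hκ (by positivity), mul_one_div, smul_eq_mul]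
  simp only [e1]
  rw [integral_integral_swap (integrable_regularized hκ hδ x)]
  refine setIntegral_congr_fun measurableSet_Ioi fun ρ hρ => ?_
  have hρ' : (0 : ℝ) < ρ := hρ
  have hb : 0 < ((δ : ℂ) + 4 * Real.pi ^ 2 * κ⁻¹ * ρ).re := by
    have : ((δ : ℂ) + 4 * Real.pi ^ 2 * κ⁻¹ * ρ) = ((δ : ℝ) : ℂ) + ((4 * Real.pi ^ 2 * ρ : ℝ) : ℂ) * κ⁻¹ := by
      push_cast; ring
    rw [this, Complex.add_re, Complex.ofReal_re, Complex.re_ofReal_mul]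
    positivity
  have h2 := fourier_gaussian_innerProductSpace hb (-x)
  rw [← Real.fourierInv_eq_fourier_neg, Real.fourierInv_eq', finrank_euclideanSpace_fin, norm_neg] at h2
  rw [← h2, ← integral_const_mul]
  refine integral_congr_ae (Eventually.of_forall fun ξ => ?_)
  simp only [smul_eq_mul]
  have e2 : Complex.exp (-(κ + ((2 * Real.pi * ‖ξ‖) ^ 2 : ℝ) * κ⁻¹) * ρ) * Complex.exp (-δ * ‖ξ‖ ^ 2) =
      Complex.exp (-κ * ρ) * Complex.exp (-(δ + 4 * Real.pi ^ 2 * κ⁻¹ * ρ) * ‖ξ‖ ^ 2) := by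
    rw [← Complex.exp_add, ← Complex.exp_add]
    congr 1
    push_cast
    ring
  push_cast at e2 ⊢
  linear_combination Complex.exp (2 * Real.pi * (inner ℝ ξ x : ℝ) * Complex.I) * κ⁻¹ * e2

theorem tendsto_fourierInv_regularized (hκ : 0 < κ.re) {x : EuclideanSpace ℝ (Fin n)} (hx : x ≠ 0) :
    Tendsto (fun δ : ℝ => 𝓕⁻ (fun ξ : EuclideanSpace ℝ (Fin n) => (Real.exp (-δ * ‖ξ‖ ^ 2) : ℂ) /
        (((2 * Real.pi * ‖ξ‖) ^ 2 : ℝ) + κ ^ 2)) x) (𝓝[>] 0)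
      (𝓝 (∫ ρ in Ioi (0 : ℝ), κ⁻¹ * Complex.exp (-κ * ρ) *
        ((Real.pi / (4 * Real.pi ^ 2 * κ⁻¹ * ρ)) ^ ((n : ℂ) / 2) *
          Complex.exp (-Real.pi ^ 2 * ‖x‖ ^ 2 / (4 * Real.pi ^ 2 * κ⁻¹ * ρ))))) := by
  have hκ0 : κ ≠ 0 := by rintro rfl; simp at hκ
  have h1 : 0 < (κ⁻¹).re := by
    rw [Complex.inv_re]; exact div_pos hκ (Complex.normSq_pos.2 hκ0)
  set q : ℂ := 4 * Real.pi ^ 2 * κ⁻¹ with hq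
  have hqre : 0 < q.re := by
    have : q = ((4 * Real.pi ^ 2 : ℝ) : ℂ) * κ⁻¹ := by rw [hq]; push_cast; ring
    rw [this, Complex.re_ofReal_mul]; positivity
  have hq0 : 0 < ‖q‖ := norm_pos_iff.2 (by rintro h; rw [h] at hqre; simp at hqre)
  have hr : 0 < ‖x‖ := norm_pos_iff.2 hx
  have hre : ∀ δ ρ : ℝ, ((δ : ℂ) + q * ρ).re = δ + q.re * ρ := by
    intro δ ρ; rw [Complex.add_re, Complex.re_mul_ofReal, Complex.ofReal_re]
  -- Domination uniform in δ. For z = δ + qρ one has Re z ≥ (Re q/|q|)|z|, hence Re(1/z) ≥ (Re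
  -- q/|q|)/|z|. As x ≠ 0, the exponential factor then beats |z|^{-n/2}. This is the elementary
  -- inequality with y = π/|z|.
  obtain ⟨C, hC0, hC⟩ := rpow_mul_exp_neg_le (d := (n : ℝ) / 2) (by positivity)
    (by positivity : 0 < Real.pi * ‖x‖ ^ 2 * (q.re / ‖q‖))
  have key : Tendsto (fun δ : ℝ => ∫ ρ in Ioi (0 : ℝ), κ⁻¹ * Complex.exp (-κ * ρ) *
        ((Real.pi / (δ + q * ρ)) ^ ((n : ℂ) / 2) *
          Complex.exp (-Real.pi ^ 2 * ‖x‖ ^ 2 / (δ + q * ρ)))) (𝓝[>] 0)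
      (𝓝 (∫ ρ in Ioi (0 : ℝ), κ⁻¹ * Complex.exp (-κ * ρ) *
        ((Real.pi / (q * ρ)) ^ ((n : ℂ) / 2) *
          Complex.exp (-Real.pi ^ 2 * ‖x‖ ^ 2 / (q * ρ))))) := by
    have hcont : ∀ δ ρ : ℝ, 0 < δ + q.re * ρ → ContinuousAt (fun z : ℂ => (Real.pi / z) ^ ((n : ℂ) / 2) *
          Complex.exp (-Real.pi ^ 2 * ‖x‖ ^ 2 / z)) (δ + q * ρ) := by
      intro δ ρ h
      have h3 : ((δ : ℂ) + q * ρ) ≠ 0 := by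
        intro h4; have := hre δ ρ; rw [h4] at this; simp at this; linarith
      have hsl : (Real.pi : ℂ) / (δ + q * ρ) ∈ Complex.slitPlane := by
        refine Or.inl ?_
        rw [div_eq_mul_inv, Complex.re_ofReal_mul, Complex.inv_re, hre]
        exact mul_pos Real.pi_pos (div_pos h (Complex.normSq_pos.2 h3))
      refine ContinuousAt.mul ?_ ?_
      · exact (continuousAt_const.div continuousAt_id h3).cpow continuousAt_const hsl
      · exact (continuousAt_const.div continuousAt_id h3).cexp
    refine tendsto_integral_filter_of_dominated_convergence
      (fun ρ => ‖κ⁻¹‖ * C * Real.exp (-κ.re * ρ)) ?_ ?_ ?_ ?_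
    · filter_upwards [self_mem_nhdsWithin] with δ hδ
      have hδ' : (0 : ℝ) < δ := hδ
      refine ContinuousOn.aestronglyMeasurable (fun ρ hρ => ?_) measurableSet_Ioi
      have hρ' : (0 : ℝ) < ρ := hρ
      refine ContinuousAt.continuousWithinAt (ContinuousAt.mul (by fun_prop) ?_)
      exact ContinuousAt.comp (f := fun ρ : ℝ => (δ : ℂ) + q * ρ) (hcont δ ρ (by positivity)) (by fun_prop)
    · filter_upwards [self_mem_nhdsWithin] with δ hδ
      have hδ' : (0 : ℝ) < δ := hδ
      filter_upwards [ae_restrict_mem measurableSet_Ioi] with ρ hρ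
      have hρ' : (0 : ℝ) < ρ := hρ
      have hb : 0 < δ + q.re * ρ := by positivity
      have h3 : ((δ : ℂ) + q * ρ) ≠ 0 := by
        intro h4; have := hre δ ρ; rw [h4] at this; simp at this; linarith
      have h4 : 0 < ‖(δ : ℂ) + q * ρ‖ := norm_pos_iff.2 h3
      have h5 : ‖(δ : ℂ) + q * ρ‖ ≤ ‖q‖ / q.re * (δ + q.re * ρ) := by
        refine (norm_add_le _ _).trans ?_
        rw [norm_mul, Complex.norm_real, Complex.norm_real, Real.norm_of_nonneg hδ'.le,
          Real.norm_of_nonneg hρ'.le]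
        have : 1 ≤ ‖q‖ / q.re := by rw [one_le_div hqre]; exact Complex.re_le_norm q
        have e : ‖q‖ / q.re * (δ + q.re * ρ) = ‖q‖ / q.re * δ + ‖q‖ * ρ := by field_simp
        rw [e]; nlinarith
      rw [norm_mul, norm_mul, norm_mul, mul_assoc ‖κ⁻¹‖, mul_assoc ‖κ⁻¹‖]
      have e1 : ‖Complex.exp (-κ * ρ)‖ = Real.exp (-κ.re * ρ) := by
        rw [Complex.norm_exp, Complex.re_mul_ofReal, Complex.neg_re]
      rw [e1, mul_comm C]
      refine mul_le_mul_of_nonneg_left (mul_le_mul_of_nonneg_left ?_ (Real.exp_pos _).le) (norm_nonneg _)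
      have e2 : ((n : ℂ) / 2) = (((n : ℝ) / 2 : ℝ) : ℂ) := by push_cast; rfl
      rw [e2, Complex.norm_cpow_real, Complex.norm_exp, norm_div, Complex.norm_real,
        Real.norm_of_nonneg Real.pi_pos.le]
      refine le_trans ?_ (hC (Real.pi / ‖(δ : ℂ) + q * ρ‖) (by positivity))
      gcongr
      have e3 : (-Real.pi ^ 2 * ‖x‖ ^ 2 / ((δ : ℂ) + q * ρ)) =
          ((-(Real.pi ^ 2 * ‖x‖ ^ 2) : ℝ) : ℂ) * ((δ : ℂ) + q * ρ)⁻¹ := by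
        push_cast; rw [div_eq_mul_inv]; ring
      rw [e3, Complex.re_ofReal_mul, neg_mul, neg_le_neg_iff, Complex.inv_re, hre,
        Complex.normSq_eq_norm_sq]
      have e4 : Real.pi * ‖x‖ ^ 2 * (q.re / ‖q‖) * (Real.pi / ‖(δ : ℂ) + q * ρ‖) =
          Real.pi ^ 2 * ‖x‖ ^ 2 * ((q.re / ‖q‖) * ‖(δ : ℂ) + q * ρ‖ / ‖(δ : ℂ) + q * ρ‖ ^ 2) := by
        field_simp
      rw [e4]
      gcongr
      rw [div_mul_eq_mul_div, div_le_iff₀ hq0]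
      rw [div_mul_eq_mul_div, le_div_iff₀ hqre] at h5
      linarith
    · exact (exp_neg_integrableOn_Ioi 0 hκ).const_mul _
    · filter_upwards [ae_restrict_mem measurableSet_Ioi] with ρ hρ
      have hρ' : (0 : ℝ) < ρ := hρ
      have h6 := hcont 0 ρ (by positivity)
      have h7 : Tendsto (fun δ : ℝ => (δ : ℂ) + q * ρ) (𝓝[>] 0) (𝓝 (((0 : ℝ) : ℂ) + q * ρ)) := by
        refine Tendsto.mono_left (Continuous.tendsto ?_ 0) nhdsWithin_le_nhds
        fun_prop
      have h8 := h6.tendsto.comp h7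
      rw [Complex.ofReal_zero, zero_add] at h8
      exact h8.const_mul _
  refine key.congr' ?_
  filter_upwards [self_mem_nhdsWithin] with δ hδ
  exact (fourierInv_regularized hκ hδ x).symm

/-- The substitution ρ = rt turns the exponent into -κr(t + 1/(4t)). -/
theorem heat_integral_eq (hκ : 0 < κ.re) {r : ℝ} (hr : 0 < r) :
    ∫ ρ in Ioi (0 : ℝ), κ⁻¹ * Complex.exp (-κ * ρ) *
        ((Real.pi / (4 * Real.pi ^ 2 * κ⁻¹ * ρ)) ^ ((n : ℂ) / 2) *
          Complex.exp (-Real.pi ^ 2 * r ^ 2 / (4 * Real.pi ^ 2 * κ⁻¹ * ρ))) =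
      ((4 * Real.pi) ^ (-(n : ℝ) / 2) : ℝ) * (r ^ (2 - n : ℝ) : ℝ) *
        ((κ * r) ^ (((n : ℝ) / 2 - 1 : ℝ) : ℂ) * besselInt ((n : ℝ) / 2) (κ * r)) := by
  have hκ0 : κ ≠ 0 := by rintro rfl; simp at hκ
  have hp0 : κ * r ≠ 0 := mul_ne_zero hκ0 (by exact_mod_cast hr.ne')
  have hpi : (Real.pi : ℂ) ≠ 0 := by exact_mod_cast Real.pi_ne_zero
  have hr0 : (r : ℂ) ≠ 0 := by exact_mod_cast hr.ne'
  have hsub := integral_comp_mul_left_Ioi (fun ρ : ℝ => κ⁻¹ * Complex.exp (-κ * ρ) *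
        ((Real.pi / (4 * Real.pi ^ 2 * κ⁻¹ * ρ)) ^ ((n : ℂ) / 2) *
          Complex.exp (-Real.pi ^ 2 * r ^ 2 / (4 * Real.pi ^ 2 * κ⁻¹ * ρ)))) 0 hr
  rw [mul_zero] at hsub
  have h1 : ∫ ρ in Ioi (0 : ℝ), κ⁻¹ * Complex.exp (-κ * ρ) *
        ((Real.pi / (4 * Real.pi ^ 2 * κ⁻¹ * ρ)) ^ ((n : ℂ) / 2) *
          Complex.exp (-Real.pi ^ 2 * r ^ 2 / (4 * Real.pi ^ 2 * κ⁻¹ * ρ))) = r • (r⁻¹ •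
      ∫ ρ in Ioi (0 : ℝ), κ⁻¹ * Complex.exp (-κ * ρ) *
        ((Real.pi / (4 * Real.pi ^ 2 * κ⁻¹ * ρ)) ^ ((n : ℂ) / 2) *
          Complex.exp (-Real.pi ^ 2 * r ^ 2 / (4 * Real.pi ^ 2 * κ⁻¹ * ρ)))) := by
    rw [smul_smul, mul_inv_cancel₀ hr.ne', one_smul]
  rw [h1, ← hsub, besselInt, Complex.real_smul, ← integral_const_mul, ← integral_const_mul,
    ← integral_const_mul]
  refine setIntegral_congr_fun measurableSet_Ioi fun t ht => ?_
  have ht' : (0 : ℝ) < t := ht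
  have ht0 : (t : ℂ) ≠ 0 := by exact_mod_cast ht'.ne'
  have e1 : (Real.pi : ℂ) / (4 * Real.pi ^ 2 * κ⁻¹ * (r * t : ℝ)) =
      (((4 * Real.pi * r ^ 2 * t)⁻¹ : ℝ) : ℂ) * (κ * r) := by
    push_cast
    field_simp
  have e2 : ((4 * Real.pi * r ^ 2 * t)⁻¹ : ℝ) ^ ((n : ℝ) / 2) =
      (4 * Real.pi) ^ (-(n : ℝ) / 2) * (r ^ (2 - n : ℝ) / r ^ 2) * t ^ (-((n : ℝ) / 2)) := by
    rw [Real.inv_rpow (by positivity), Real.mul_rpow (by positivity) ht'.le,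
      Real.mul_rpow (by positivity) (by positivity), ← Real.rpow_natCast r 2, ← Real.rpow_mul hr.le,
      ← Real.rpow_sub hr, neg_div, Real.rpow_neg (by positivity), Real.rpow_neg ht'.le,
      show ((2 : ℝ) - n - (2 : ℕ)) = -((2 : ℕ) * ((n : ℝ) / 2)) by push_cast; ring,
      Real.rpow_neg hr.le]
    field_simp
  have e3 : (κ * r) ^ (((n : ℝ) / 2 : ℝ) : ℂ) = (κ * r) ^ (((n : ℝ) / 2 - 1 : ℝ) : ℂ) * (κ * r) := by
    have := Complex.cpow_add (((n : ℝ) / 2 - 1 : ℝ) : ℂ) 1 hp0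
    rw [Complex.cpow_one] at this
    rw [← this]
    push_cast; ring_nf
  have e4 : Complex.exp (-κ * (r * t : ℝ)) *
      Complex.exp (-Real.pi ^ 2 * r ^ 2 / (4 * Real.pi ^ 2 * κ⁻¹ * (r * t : ℝ))) =
      Complex.exp (-(κ * r * (t + 1 / (4 * t) : ℝ))) := by
    rw [← Complex.exp_add]
    congr 1
    push_cast
    field_simp
    ring
  have e5 : ((n : ℂ) / 2) = (((n : ℝ) / 2 : ℝ) : ℂ) := by push_cast; rfl
  rw [e1, e5, ofReal_mul_cpow (by positivity) hp0, ← Complex.ofReal_cpow (by positivity), e2, e3]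
  rw [← e4]
  push_cast
  field_simp

end

/-- The constant depends on n alone and not on κ. This is what allows the kernels for different
roots to be added and to telescope. -/
theorem exists_tendsto_fourierInv {n : ℕ} (hn : 3 ≤ n) : ∃ C : ℂ, ∀ (κ : ℂ), 0 < κ.re →
    ∀ x : EuclideanSpace ℝ (Fin n), x ≠ 0 →
    Tendsto (fun δ : ℝ => 𝓕⁻ (fun ξ : EuclideanSpace ℝ (Fin n) => (Real.exp (-δ * ‖ξ‖ ^ 2) : ℂ) /
        (((2 * Real.pi * ‖ξ‖) ^ 2 : ℝ) + κ ^ 2)) x) (𝓝[>] 0)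
      (𝓝 (C * (‖x‖ ^ (2 - n : ℝ) : ℝ) * poissonKer (((n : ℝ) - 3) / 2) (κ * ‖x‖))) := by
  have hn' : (3 : ℝ) ≤ n := by exact_mod_cast hn
  obtain ⟨C, hC⟩ := cpow_mul_besselInt (a := ((n : ℝ) - 3) / 2) (by linarith)
  refine ⟨((4 * Real.pi) ^ (-(n : ℝ) / 2) : ℝ) * C, fun κ hκ x hx => ?_⟩
  have hr : 0 < ‖x‖ := norm_pos_iff.2 hx
  have h := tendsto_fourierInv_regularized hκ hx
  rw [heat_integral_eq hκ hr] at h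
  have h2 := hC (κ * ‖x‖) (by rw [Complex.re_mul_ofReal]; positivity)
  rw [show ((n : ℝ) - 3) / 2 + 1 / 2 = (n : ℝ) / 2 - 1 by ring,
    show ((n : ℝ) - 3) / 2 + 3 / 2 = (n : ℝ) / 2 by ring] at h2
  rw [h2] at h
  convert h using 2
  ring


/-! ### Partial fractions and boundary values -/

theorem root_pow_two_mul {m : ℕ} (hm : 1 ≤ m) (k : ℕ) : root m k ^ (2 * m) = 1 := by
  have hm0 : (m : ℂ) ≠ 0 := by exact_mod_cast (by omega : m ≠ 0)
  rw [root, ← Complex.exp_nat_mul, ← Complex.exp_nat_mul_two_pi_mul_I k]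
  congr 1
  push_cast
  field_simp

theorem root_zero (m : ℕ) : root m 0 = 1 := by simp [root]

theorem root_self {m : ℕ} (hm : 1 ≤ m) : root m m = -1 := by
  have hm0 : (m : ℂ) ≠ 0 := by exact_mod_cast (by omega : m ≠ 0)
  rw [root, mul_div_cancel_right₀ _ hm0, Complex.exp_pi_mul_I]

theorem root_mul_root (m j k : ℕ) : root m j * root m k = root m (j + k) := by
  rw [root, root, root, ← Complex.exp_add]
  congr 1
  push_cast
  ring

/-- Each numerator is expanded as a geometric sum in s and root²w². Summing over the roots
annihilates all powers of s except s⁰. -/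
theorem one_div_pow_sub_pow {m : ℕ} (hm : 1 ≤ m) {s w : ℂ} (hw : w ≠ 0)
    (h : ∀ k ∈ Finset.range m, s - root m k ^ 2 * w ^ 2 ≠ 0) :
    1 / (s ^ m - w ^ (2 * m)) = ∑ k ∈ Finset.range m, root m k ^ 2 * w ^ 2 / (m * w ^ (2 * m)) *
      (1 / (s - root m k ^ 2 * w ^ 2)) := by
  have hm0 : (m : ℂ) ≠ 0 := by exact_mod_cast (by omega : m ≠ 0)
  have hz : ∀ k, (root m k ^ 2 * w ^ 2) ^ m = w ^ (2 * m) := by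
    intro k
    rw [mul_pow, ← pow_mul, ← pow_mul, root_pow_two_mul hm, one_mul]
  have h1 : ∀ k ∈ Finset.range m, root m k ^ 2 * w ^ 2 * (1 / (s - root m k ^ 2 * w ^ 2)) *
      (s ^ m - w ^ (2 * m)) = ∑ j ∈ Finset.range m, s ^ j * w ^ (2 * (m - j)) *
        root m k ^ (2 * (m - j)) := by
    intro k hk
    have h2 := (Commute.all s (root m k ^ 2 * w ^ 2)).mul_geom_sum₂ m
    rw [hz] at h2
    rw [← h2, mul_assoc, ← mul_assoc (1 / _), one_div_mul_cancel (h k hk), one_mul, Finset.mul_sum]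
    refine Finset.sum_congr rfl fun j hj => ?_
    have hj' : j < m := Finset.mem_range.1 hj
    have e : m - j = (m - 1 - j) + 1 := by omega
    rw [e, pow_mul, pow_mul, pow_succ (w ^ 2), pow_succ (root m k ^ 2), mul_pow]
    ring
  have h2 : (∑ k ∈ Finset.range m, root m k ^ 2 * w ^ 2 * (1 / (s - root m k ^ 2 * w ^ 2))) *
      (s ^ m - w ^ (2 * m)) = m * w ^ (2 * m) := by
    rw [Finset.sum_mul, Finset.sum_congr rfl h1, Finset.sum_comm]
    simp only [← Finset.mul_sum]
    rw [Finset.sum_eq_single_of_mem 0 (Finset.mem_range.2 (by omega))]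
    · rw [pow_zero, one_mul, Nat.sub_zero]
      simp only [root_pow_two_mul hm]
      simp [mul_comm]
    · intro j hj hj0
      have hj' : j < m := Finset.mem_range.1 hj
      rw [root_pow_sum (by omega) (by omega), mul_zero]
  have hz0 : (m : ℂ) * w ^ (2 * m) ≠ 0 := mul_ne_zero hm0 (pow_ne_zero _ hw)
  have h3 : s ^ m - w ^ (2 * m) ≠ 0 := by
    intro h4; rw [h4, mul_zero] at h2; exact hz0 h2.symm
  rw [div_eq_iff h3]
  have h4 : ∑ k ∈ Finset.range m, root m k ^ 2 * w ^ 2 / (m * w ^ (2 * m)) *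
      (1 / (s - root m k ^ 2 * w ^ 2)) = (m * w ^ (2 * m))⁻¹ *
      ∑ k ∈ Finset.range m, root m k ^ 2 * w ^ 2 * (1 / (s - root m k ^ 2 * w ^ 2)) := by
    rw [Finset.mul_sum]
    refine Finset.sum_congr rfl fun k _ => ?_
    ring
  rw [h4, mul_assoc, h2, inv_mul_cancel₀ hz0]

theorem continuousAt_poissonKer {a : ℝ} (ha : -1 < a) {p : ℂ} (hp : p ∈ Complex.slitPlane) :
    ContinuousAt (poissonKer a) p := by
  have : ContinuousAt (poissonInt a a) p := (hasDerivAt_poissonInt ha a hp).continuousAt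
  exact (by fun_prop : ContinuousAt (fun z : ℂ => Complex.exp (-z)) p).mul this

/-- The free resolvent kernel at the energy `w^{2m}`, as a combination of Poisson kernels. -/
noncomputable def resolventSum (n m : ℕ) (C w : ℂ) (r : ℝ) : ℂ :=
  ∑ k ∈ Finset.range m, root m k ^ 2 * w ^ 2 / (m * w ^ (2 * m)) *
    (C * (r ^ (2 - n : ℝ) : ℝ) * poissonKer (((n : ℝ) - 3) / 2) (-Complex.I * root m k * w * r))

/-- With κ = -i·root·w one has κ² = -root²w², and Re κ > 0 is exactly the assumption on the
imaginary parts. Partial fractions then reduce the operator of order 2m to operators of order 2. -/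
theorem exists_freeResolvent_eq {n : ℕ} (hn : 3 ≤ n) : ∃ C : ℂ, ∀ m : ℕ, 1 ≤ m → ∀ w : ℂ,
    (∀ k < m, 0 < (root m k * w).im) → ∀ x : EuclideanSpace ℝ (Fin n), x ≠ 0 →
    freeResolvent n m (w ^ (2 * m)) x = resolventSum n m C w ‖x‖ := by
  obtain ⟨C, hC⟩ := exists_tendsto_fourierInv hn
  refine ⟨C, fun m hm w hw x hx => ?_⟩
  have hw0 : w ≠ 0 := by
    rintro rfl
    have := hw 0 (by omega)
    simp at this
  have hre : ∀ k ∈ Finset.range m, 0 < (-Complex.I * root m k * w).re := by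
    intro k hk
    rw [mul_assoc, neg_mul, Complex.neg_re, Complex.I_mul_re, neg_neg]
    exact hw k (Finset.mem_range.1 hk)
  have hsq : ∀ k, (-Complex.I * root m k * w) ^ 2 = -(root m k ^ 2 * w ^ 2) := by
    intro k
    rw [mul_pow, mul_pow, neg_sq, Complex.I_sq]; ring
  refine Tendsto.limUnder_eq ?_
  have hlim : Tendsto (fun δ : ℝ => ∑ k ∈ Finset.range m, root m k ^ 2 * w ^ 2 / (m * w ^ (2 * m)) *
      𝓕⁻ (fun ξ : EuclideanSpace ℝ (Fin n) => (Real.exp (-δ * ‖ξ‖ ^ 2) : ℂ) /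
        (((2 * Real.pi * ‖ξ‖) ^ 2 : ℝ) + (-Complex.I * root m k * w) ^ 2)) x) (𝓝[>] 0)
      (𝓝 (resolventSum n m C w ‖x‖)) :=
    tendsto_finsetSum _ fun k hk => (hC _ (hre k hk) x hx).const_mul _
  refine hlim.congr' ?_
  filter_upwards [self_mem_nhdsWithin] with δ hδ
  have hδ' : (0 : ℝ) < δ := hδ
  -- For δ > 0 every regularized term is absolutely integrable, so the finite sum may be moved
  -- inside the Fourier integral before the limit.
  simp only [Real.fourierInv_eq', smul_eq_mul, ← integral_const_mul]
  rw [← integral_finsetSum _ fun k hk =>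
    (integrable_regularized_symbol (hre k hk) hδ' x).const_mul _]
  refine integral_congr_ae (Eventually.of_forall fun ξ => ?_)
  simp only
  have hT : ∀ k ∈ Finset.range m, (((2 * Real.pi * ‖ξ‖) ^ 2 : ℝ) : ℂ) - root m k ^ 2 * w ^ 2 ≠ 0 := by
    intro k hk
    rw [sub_eq_add_neg, ← hsq]
    intro h
    have h1 : (-Complex.I * root m k * w) ^ 2 = ((-(2 * Real.pi * ‖ξ‖) ^ 2 : ℝ) : ℂ) := by
      rw [Complex.ofReal_neg]; exact eq_neg_of_add_eq_zero_right h
    have h2 := hre k hk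
    set q := -Complex.I * root m k * w
    have h3 : q.re * q.im + q.im * q.re = 0 := by
      have := congrArg Complex.im h1
      rwa [sq, Complex.mul_im, Complex.ofReal_im] at this
    have h4 : q.re * q.re - q.im * q.im = -(2 * Real.pi * ‖ξ‖) ^ 2 := by
      have := congrArg Complex.re h1
      rwa [sq, Complex.mul_re, Complex.ofReal_re] at this
    have h5 : q.im = 0 := by
      have : q.re * q.im = 0 := by linarith
      exact (mul_eq_zero.1 this).resolve_left h2.ne'
    rw [h5] at h4
    nlinarith [sq_nonneg (2 * Real.pi * ‖ξ‖)]
  have hpf := one_div_pow_sub_pow hm hw0 hT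
  have e1 : (((2 * Real.pi * ‖ξ‖) ^ (2 * m) : ℝ) : ℂ) = (((2 * Real.pi * ‖ξ‖) ^ 2 : ℝ) : ℂ) ^ m := by
    push_cast; rw [pow_mul]
  rw [e1, div_eq_mul_one_div _ ((((2 * Real.pi * ‖ξ‖) ^ 2 : ℝ) : ℂ) ^ m - _), hpf, Finset.mul_sum,
    Finset.mul_sum]
  refine Finset.sum_congr rfl fun k _ => ?_
  rw [hsq, ← sub_eq_add_neg]
  ring

/-! ### Boundary values from the two half planes -/

theorem im_root_mul_exp_pos {m : ℕ} (hm : 1 ≤ m) {j : ℕ} {z : ℂ}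
    (h1 : 0 < 2 * Real.pi * j + z.arg) (h2 : 2 * Real.pi * j + z.arg < 2 * Real.pi * m) :
    0 < (root m j * Complex.exp (Complex.log z / (2 * m))).im := by
  have hm0 : (0 : ℝ) < m := by exact_mod_cast hm
  have e : root m j * Complex.exp (Complex.log z / (2 * m)) =
      Complex.exp (((Real.log ‖z‖ / (2 * m) : ℝ) : ℂ) + ((2 * Real.pi * j + z.arg) / (2 * m) : ℝ) * Complex.I) := by
    have hm0' : (m : ℂ) ≠ 0 := by exact_mod_cast hm0.ne'
    rw [root, ← Complex.exp_add, Complex.log]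
    congr 1
    push_cast
    field_simp
    ring
  rw [e, Complex.exp_im]
  refine mul_pos (Real.exp_pos _) ?_
  have e2 : (((Real.log ‖z‖ / (2 * m) : ℝ) : ℂ) +
      ((2 * Real.pi * j + z.arg) / (2 * m) : ℝ) * Complex.I).im = (2 * Real.pi * j + z.arg) / (2 * m) := by
    rw [Complex.add_im, Complex.ofReal_im, Complex.im_ofReal_mul, Complex.I_im, mul_one, zero_add]
  rw [e2]
  refine Real.sin_pos_of_pos_of_lt_pi (by positivity) ?_
  rw [div_lt_iff₀ (by positivity)]
  linarith

theorem exp_log_div_pow {m : ℕ} (hm : 1 ≤ m) {z : ℂ} (hz : z ≠ 0) :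
    Complex.exp (Complex.log z / (2 * m)) ^ (2 * m) = z := by
  have hm0' : (m : ℂ) ≠ 0 := by exact_mod_cast (by omega : m ≠ 0)
  rw [← Complex.exp_nat_mul]
  push_cast
  rw [mul_div_cancel₀ _ (mul_ne_zero two_ne_zero hm0'), Complex.exp_log hz]

theorem tendsto_exp_log_div {m : ℕ} (hm : 1 ≤ m) {lam : ℝ} (hlam : 0 < lam) (c : ℂ) :
    Tendsto (fun ε : ℝ => Complex.exp (Complex.log (((lam ^ (2 * m) : ℝ) : ℂ) + ε * c) / (2 * m)))
      (𝓝[>] 0) (𝓝 lam) := by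
  have hm0' : (m : ℂ) ≠ 0 := by exact_mod_cast (by omega : m ≠ 0)
  have h1 : Tendsto (fun ε : ℝ => ((lam ^ (2 * m) : ℝ) : ℂ) + ε * c) (𝓝[>] 0)
      (𝓝 ((lam ^ (2 * m) : ℝ) : ℂ)) := by
    have : Continuous fun ε : ℝ => ((lam ^ (2 * m) : ℝ) : ℂ) + ε * c := by fun_prop
    have h := (this.tendsto 0).mono_left (nhdsWithin_le_nhds (s := Ioi 0))
    rwa [Complex.ofReal_zero, zero_mul, add_zero] at h
  have h2 := ((h1.clog (Or.inl (by rw [Complex.ofReal_re]; positivity))).div_const (2 * (m : ℂ))).cexp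
  convert h2 using 2
  rw [← Complex.ofReal_log (by positivity), Real.log_pow]
  push_cast
  rw [mul_div_cancel_left₀ _ (mul_ne_zero two_ne_zero hm0'), ← Complex.ofReal_exp, Real.exp_log hlam]

/-- The index j = 0 serves the limit from above and j = 1 the limit from below. As k + j ≤ m, the
limit points lie in the closed right half plane away from 0, where the Poisson kernel is still
continuous. -/
theorem tendsto_resolventSum {n m : ℕ} (hn : 3 ≤ n) (hm : 1 ≤ m) (C : ℂ) {r : ℝ} (hr : 0 < r) {j : ℕ}
    (hj : j ≤ 1) {lam : ℝ} (hlam : 0 < lam) {w : ℝ → ℂ} (hw : Tendsto w (𝓝[>] 0) (𝓝 lam)) :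
    Tendsto (fun ε => resolventSum n m C (root m j * w ε) r) (𝓝[>] 0)
      (𝓝 (resolventSum n m C (root m j * lam) r)) := by
  have hn' : (3 : ℝ) ≤ n := by exact_mod_cast hn
  have hm0' : (m : ℂ) ≠ 0 := by exact_mod_cast (by omega : m ≠ 0)
  have hl0 : (lam : ℂ) ≠ 0 := by exact_mod_cast hlam.ne'
  have hroot0 : root m j ≠ 0 := norm_ne_zero_iff.1 (by rw [norm_root]; exact one_ne_zero)
  refine tendsto_finsetSum _ fun k hk => ?_
  have hk' : k + j ≤ m := by have := Finset.mem_range.1 hk; omega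
  have h1 : Tendsto (fun ε => root m j * w ε) (𝓝[>] 0) (𝓝 (root m j * lam)) := hw.const_mul _
  refine Tendsto.mul (Tendsto.div ((h1.pow 2).const_mul _) ((h1.pow _).const_mul _) ?_)
    (Tendsto.const_mul _ ?_)
  · exact mul_ne_zero hm0' (pow_ne_zero _ (mul_ne_zero hroot0 hl0))
  · have hpt : -Complex.I * root m k * (root m j * lam) * r =
        ((lam * r : ℝ) : ℂ) * (-Complex.I * root m (k + j)) := by
      rw [← root_mul_root]; push_cast; ring
    have hsl : -Complex.I * root m k * (root m j * lam) * r ∈ Complex.slitPlane := by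
      refine mem_slitPlane_of_re_nonneg ?_ ?_
      · rw [hpt, Complex.re_ofReal_mul]
        exact mul_nonneg (by positivity) (re_ray_nonneg hk')
      · rw [hpt]
        refine mul_ne_zero (by exact_mod_cast (mul_pos hlam hr).ne') ?_
        exact norm_ne_zero_iff.1 (by rw [norm_neg_I_mul_root]; exact one_ne_zero)
    exact (continuousAt_poissonKer (by linarith) hsl).tendsto.comp ((h1.const_mul _).mul_const _)

/-- From above, the principal 2m-th root w of the energy has small positive argument and all m
multiples lie in the upper half plane. From below, the argument is slightly negative and k = 0 would
fail. Multiplying w by the first root of unity moves the indices to 1, ..., m and restores the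
condition. -/
theorem exists_freeResolvent_boundary_eq {n m : ℕ} (hm : 1 ≤ m) (hmn : 2 * m < n) : ∃ C : ℂ,
    ∀ lam : ℝ, 0 < lam → ∀ x : EuclideanSpace ℝ (Fin n), x ≠ 0 →
    freeResolventPlus n m (lam ^ (2 * m)) x = resolventSum n m C lam ‖x‖ ∧
    freeResolventMinus n m (lam ^ (2 * m)) x = resolventSum n m C (root m 1 * lam) ‖x‖ := by
  have hn : 3 ≤ n := by omega
  obtain ⟨C, hC⟩ := exists_freeResolvent_eq hn
  have hm0 : (1 : ℝ) ≤ m := by exact_mod_cast hm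
  have hpi := Real.pi_pos
  refine ⟨C, fun lam hlam x hx => ⟨?_, ?_⟩⟩
  · refine Tendsto.limUnder_eq ?_
    have h := tendsto_resolventSum hn hm C (norm_pos_iff.2 hx) (zero_le_one : 0 ≤ 1) hlam
      (tendsto_exp_log_div hm hlam Complex.I)
    rw [root_zero] at h
    simp only [one_mul] at h
    refine h.congr' ?_
    filter_upwards [self_mem_nhdsWithin] with ε hε
    have hε' : (0 : ℝ) < ε := hε
    set z : ℂ := ((lam ^ (2 * m) : ℝ) : ℂ) + ε * Complex.I with hz
    have hzre : 0 < z.re := by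
      rw [hz, Complex.add_re, Complex.ofReal_re, Complex.re_ofReal_mul, Complex.I_re]
      simp only [mul_zero, add_zero]
      positivity
    have hzim : 0 < z.im := by
      rw [hz, Complex.add_im, Complex.ofReal_im, Complex.im_ofReal_mul, Complex.I_im]; simpa using hε'
    have hz0 : z ≠ 0 := by rintro h; rw [h] at hzre; simp at hzre
    have harg0 : 0 < z.arg := by
      refine lt_of_le_of_ne (Complex.arg_nonneg_iff.2 hzim.le) fun h => ?_
      exact hzim.ne' (Complex.arg_eq_zero_iff.1 h.symm).2
    have harg1 : z.arg < Real.pi := by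
      have := Complex.abs_arg_lt_pi_div_two_iff.2 (Or.inl hzre)
      linarith [abs_lt.1 this]
    rw [← hC m hm _ (fun k hk => ?_) x hx, exp_log_div_pow hm hz0]
    have hk' : (k : ℝ) + 1 ≤ m := by exact_mod_cast hk
    refine im_root_mul_exp_pos hm (by positivity) ?_
    nlinarith
  · refine Tendsto.limUnder_eq ?_
    have h := tendsto_resolventSum hn hm C (norm_pos_iff.2 hx) (le_refl 1) hlam
      (tendsto_exp_log_div hm hlam (-Complex.I))
    refine h.congr' ?_
    filter_upwards [self_mem_nhdsWithin] with ε hε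
    have hε' : (0 : ℝ) < ε := hε
    have hzeq : ((lam ^ (2 * m) : ℝ) : ℂ) - ε * Complex.I = ((lam ^ (2 * m) : ℝ) : ℂ) + ε * -Complex.I := by
      ring
    rw [hzeq]
    set z : ℂ := ((lam ^ (2 * m) : ℝ) : ℂ) + ε * -Complex.I with hz
    have hzre : 0 < z.re := by
      rw [hz, Complex.add_re, Complex.ofReal_re, Complex.re_ofReal_mul, Complex.neg_re, Complex.I_re]
      simp only [neg_zero, mul_zero, add_zero]
      positivity
    have hzim : z.im < 0 := by
      rw [hz, Complex.add_im, Complex.ofReal_im, Complex.im_ofReal_mul, Complex.neg_im, Complex.I_im]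
      linarith
    have hz0 : z ≠ 0 := by rintro h; rw [h] at hzre; simp at hzre
    have harg0 : z.arg < 0 := Complex.arg_neg_iff.2 hzim
    have harg1 : -Real.pi < z.arg := Complex.neg_pi_lt_arg z
    have hpow : (root m 1 * Complex.exp (Complex.log z / (2 * m))) ^ (2 * m) = z := by
      rw [mul_pow, root_pow_two_mul hm, one_mul, exp_log_div_pow hm hz0]
    rw [← hC m hm _ (fun k hk => ?_) x hx, hpow]
    rw [← mul_assoc, root_mul_root]
    have hk' : (k : ℝ) + 1 ≤ m := by exact_mod_cast hk
    have hk0 : (0 : ℝ) ≤ k := k.cast_nonneg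
    refine im_root_mul_exp_pos hm ?_ ?_
    · push_cast; nlinarith
    · push_cast; nlinarith

/-- Both boundary values sum the same terms, over k = 0, ..., m - 1 and over k = 1, ..., m. The
difference telescopes to the terms k = 0 and k = m, which is the jump of the Poisson kernel across
the imaginary axis, hence the spherical moment. -/
theorem exists_freeResolvent_amplitude {n m : ℕ} (hm : 1 ≤ m) (hmn : 2 * m < n) : ∃ C : ℂ,
    ∀ lam : ℝ, 0 < lam → ∀ x : EuclideanSpace ℝ (Fin n), x ≠ 0 →
    freeResolventPlus n m (lam ^ (2 * m)) x =
      C * ((‖x‖ ^ (2 * m - n : ℝ) : ℝ) * outAmp m (((n : ℝ) - 3) / 2) (lam * ‖x‖)) ∧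
    freeResolventPlus n m (lam ^ (2 * m)) x - freeResolventMinus n m (lam ^ (2 * m)) x =
      C * (Complex.I * (lam : ℂ) ^ (n - 2 * m) * sphereMoment (((n : ℝ) - 3) / 2) 0 (lam * ‖x‖)) := by
  obtain ⟨C, hC⟩ := exists_freeResolvent_boundary_eq hm hmn
  have hm0' : (m : ℂ) ≠ 0 := by exact_mod_cast (by omega : m ≠ 0)
  have hn : (3 : ℝ) ≤ n := by exact_mod_cast (by omega : 3 ≤ n)
  refine ⟨C / m, fun lam hlam x hx => ?_⟩
  have hl0 : (lam : ℂ) ≠ 0 := by exact_mod_cast hlam.ne'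
  have hr : 0 < ‖x‖ := norm_pos_iff.2 hx
  have hr0 : (‖x‖ : ℂ) ≠ 0 := by exact_mod_cast hr.ne'
  obtain ⟨h1, h2⟩ := hC lam hlam x hx
  set a := ((n : ℝ) - 3) / 2 with ha
  set f : ℕ → ℂ := fun k => root m k ^ 2 * poissonKer a (-Complex.I * root m k * (lam * ‖x‖ : ℝ)) with hf
  set D : ℂ := C / m * ((lam ^ 2 : ℂ) / (lam : ℂ) ^ (2 * m)) * (‖x‖ ^ (2 - n : ℝ) : ℝ) with hD
  have h1' : freeResolventPlus n m (lam ^ (2 * m)) x = D * ∑ k ∈ Finset.range m, f k := by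
    rw [h1, resolventSum, Finset.mul_sum]
    refine Finset.sum_congr rfl fun k _ => ?_
    simp only [hf, hD]
    rw [Complex.ofReal_mul, ← mul_assoc (-Complex.I * root m k)]
    generalize poissonKer _ _ = P
    field_simp
  have h2' : freeResolventMinus n m (lam ^ (2 * m)) x = D * ∑ k ∈ Finset.range m, f (k + 1) := by
    rw [h2, resolventSum, Finset.mul_sum]
    refine Finset.sum_congr rfl fun k _ => ?_
    simp only [hf, hD]
    rw [Complex.ofReal_mul, mul_pow (root m 1) _ (2 * m), root_pow_two_mul hm, one_mul,
      ← root_mul_root,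
      show -Complex.I * root m k * (root m 1 * lam) * ‖x‖ =
        -Complex.I * (root m k * root m 1) * (lam * ‖x‖) by ring]
    generalize poissonKer _ _ = P
    field_simp
  have hpow : (lam : ℂ) ^ (2 * m) = lam ^ (2 * (m - 1)) * lam ^ 2 := by
    rw [← pow_add]; congr 1; omega
  constructor
  · rw [h1', outAmp, show ∑ k ∈ Finset.range m, root m k ^ 2 *
      poissonKer a (-Complex.I * root m k * ((lam * ‖x‖ : ℝ) : ℂ)) = ∑ k ∈ Finset.range m, f k from rfl]
    generalize ∑ k ∈ Finset.range m, f k = S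
    have e1 : (‖x‖ ^ (2 - n : ℝ) : ℝ) = ‖x‖ ^ (2 * m - n : ℝ) / ‖x‖ ^ (2 * (m - 1)) := by
      rw [← Real.rpow_natCast, ← Real.rpow_sub hr]
      congr 1
      push_cast [Nat.cast_sub hm]
      ring
    rw [hD, e1, hpow]
    push_cast
    rw [mul_pow]
    field_simp
  · rw [h1', h2', ← mul_sub, ← Finset.sum_sub_distrib, Finset.sum_range_sub']
    have hj := poissonKer_jump (a := a) (by rw [ha]; linarith) (mul_pos hlam hr)
    simp only [hf, root_zero, root_self hm, one_pow, one_mul, mul_one, neg_sq, mul_neg, neg_neg]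
    rw [hj]
    have e2 : (‖x‖ ^ (2 - n : ℝ) : ℝ) * (lam * ‖x‖) ^ (2 * a + 1) = lam ^ (n - 2) := by
      rw [Real.mul_rpow hlam.le hr.le, mul_left_comm, ← Real.rpow_add hr, ← Real.rpow_natCast]
      rw [show (2 - n : ℝ) + (2 * a + 1) = 0 by rw [ha]; ring, Real.rpow_zero, mul_one]
      congr 1
      push_cast [Nat.cast_sub (by omega : 2 ≤ n)]
      rw [ha]; ring
    have e3 : ((lam ^ (n - 2) : ℝ) : ℂ) * (lam ^ 2 / lam ^ (2 * m)) = (lam : ℂ) ^ (n - 2 * m) := by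
      push_cast
      rw [mul_div_assoc', ← pow_add, div_eq_iff (pow_ne_zero _ hl0), ← pow_add]
      congr 1; omega
    rw [← e3, ← e2, hD]
    push_cast
    ring


/-! ### Oscillatory integrals with symbol amplitudes -/

theorem IsSymbol.eul_eq_zero {f : ℝ → ℂ} {c : ℝ} (h : ∀ t, c < t → f t = 0) {t : ℝ} (ht : c < t) :
    HigherOrderSchrodinger.eul f t = 0 := by
  have : f =ᶠ[𝓝 t] fun _ => 0 := by
    filter_upwards [Ioi_mem_nhds ht] with u hu using h u hu
  rw [HigherOrderSchrodinger.eul, this.deriv_eq]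
  simp

theorem norm_exp_I_mul_mul (R t : ℝ) : ‖Complex.exp (Complex.I * R * t)‖ = 1 := by
  have : Complex.I * R * t = ((R * t : ℝ) : ℂ) * Complex.I := by push_cast; ring
  rw [this, Complex.norm_exp_ofReal_mul_I]

theorem integrableOn_exp_mul {L : ℝ} {w : ℝ → ℝ} {a : ℝ → ℂ} (R : ℝ)
    (hw : IntegrableOn w (Ioo 0 L)) (ha : AEStronglyMeasurable a (volume.restrict (Ioo 0 L)))
    (hb : ∀ t ∈ Ioo 0 L, ‖a t‖ ≤ w t) :
    IntegrableOn (fun t : ℝ => Complex.exp (Complex.I * R * t) * a t) (Ioo 0 L) := by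
  refine Integrable.mono' hw ?_ ?_
  · exact (Continuous.aestronglyMeasurable (by fun_prop)).mul ha
  · filter_upwards [ae_restrict_mem measurableSet_Ioo] with t ht
    rw [norm_mul, norm_exp_I_mul_mul, one_mul]
    exact hb t ht

theorem norm_integral_exp_mul_le_weight {L : ℝ} {w : ℝ → ℝ} {a : ℝ → ℂ} (R : ℝ)
    (hw : IntegrableOn w (Ioo 0 L)) (hb : ∀ t ∈ Ioo 0 L, ‖a t‖ ≤ w t) :
    ‖∫ t in Ioo 0 L, Complex.exp (Complex.I * R * t) * a t‖ ≤ ∫ t in Ioo 0 L, w t := by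
  refine norm_integral_le_of_norm_le hw ?_
  filter_upwards [ae_restrict_mem measurableSet_Ioo] with t ht
  rw [norm_mul, norm_exp_I_mul_mul, one_mul]
  exact hb t ht

theorem integrableOn_inv_mul {L : ℝ} {w : ℝ → ℝ} (hw : IntegrableOn w (Ioo 0 L)) (R : ℝ) (k : ℕ) :
    IntegrableOn (fun t => ((1 + t * |R|) ^ k)⁻¹ * w t) (Ioo 0 L) := by
  refine Integrable.bdd_mul (c := 1) hw ?_ ?_
  · exact Measurable.aestronglyMeasurable (by fun_prop)
  · filter_upwards [ae_restrict_mem measurableSet_Ioo] with t ht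
    have h0 : 0 ≤ t * |R| := mul_nonneg ht.1.le (abs_nonneg R)
    rw [Real.norm_of_nonneg (by positivity)]
    exact inv_le_one_of_one_le₀ (one_le_pow₀ (by linarith))

/-- Integration by parts in an oscillatory integral. -/
theorem exists_norm_integral_exp_mul_le (N : ℕ) : ∃ C : ℝ, 0 ≤ C ∧ ∀ (L R : ℝ) (w : ℝ → ℝ) (a : ℝ → ℂ),
    0 < L → IsSymbol (Ioo 0 L) N w a → IntegrableOn w (Ioo 0 L) →
    Tendsto (fun t => t * w t) (𝓝[>] 0) (𝓝 0) → (∃ c < L, ∀ t, c < t → a t = 0) →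
    ‖∫ t in Ioo 0 L, Complex.exp (Complex.I * R * t) * a t‖ ≤
      C * ∫ t in Ioo 0 L, ((1 + t * |R|) ^ N)⁻¹ * w t := by
  induction N with
  | zero =>
    refine ⟨1, zero_le_one, fun L R w a _ hs hw _ _ => ?_⟩
    simp only [pow_zero, inv_one, one_mul]
    exact norm_integral_exp_mul_le_weight R hw hs.bound
  | succ N ih =>
    obtain ⟨C, hC, ih⟩ := ih
    obtain ⟨C₁, hC₁, h1⟩ := IsSymbol.inv_one_add_pow 1 (N + 1)
    set D := 3 * 2 ^ (N + 1) * C₁ with hD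
    have hD0 : 0 ≤ D := by positivity
    refine ⟨max 1 (C * D), by positivity, fun L R w a hL hs hw hlim hvan => ?_⟩
    have hInn : 0 ≤ ∫ t in Ioo 0 L, ((1 + t * |R|) ^ (N + 1))⁻¹ * w t := by
      refine setIntegral_nonneg measurableSet_Ioo fun t ht => ?_
      have h0 : 0 ≤ t * |R| := mul_nonneg ht.1.le (abs_nonneg R)
      have := hs.nonneg t ht
      positivity
    rcases eq_or_ne R 0 with rfl | hR
    · refine (norm_integral_exp_mul_le_weight 0 hw hs.bound).trans ?_
      refine le_trans (le_of_eq ?_) (le_mul_of_one_le_left hInn (le_max_left _ _))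
      simp
    have hRp : 0 < |R| := abs_pos.2 hR
    obtain ⟨σ, hσ, hRσ⟩ : ∃ σ : ℝ, σ ^ 2 = 1 ∧ R = σ * |R| := by
      rcases lt_or_gt_of_ne hR with h | h
      · exact ⟨-1, by norm_num, by rw [abs_of_neg h]; ring⟩
      · exact ⟨1, by norm_num, by rw [abs_of_pos h]; ring⟩
    have hσn : ‖(σ : ℂ)‖ = 1 := by
      rw [Complex.norm_real, Real.norm_eq_abs]
      nlinarith [sq_abs σ, abs_nonneg σ]
    set c : ℂ := -Complex.I * σ with hc
    have hcn : ‖c‖ = 1 := by rw [hc, norm_mul, norm_neg, Complex.norm_I, hσn, one_mul]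
    set q : ℝ → ℂ := fun t => (((1 + (t * |R|) ^ 1)⁻¹ : ℝ) : ℂ) with hq
    set b : ℝ → ℂ := fun t => a t * q t with hb
    set w₁ : ℝ → ℝ := fun t => 2 ^ (N + 1) * (w t * (C₁ * (1 + (t * |R|) ^ 1)⁻¹)) with hw₁
    have hbs : IsSymbol (Ioo 0 L) (N + 1) w₁ b :=
      hs.mul isOpen_Ioo ((h1.comp_mul hRp).mono_set fun t ht => ht.1)
    -- Here σ is the sign of R and b = a/(1 + t|R|). The derivative of t e^{iRt} b is iσ e^{iRt} (a
    -- - a'), and the boundary terms vanish, so a may be replaced by a'. The latter has one factor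
    -- 1/(1 + t|R|) more and one derivative less. No splitting at t|R| = 1 is needed.
    set a' : ℝ → ℂ := fun t => (1 - c) * b t + -c * eul b t with ha'
    set w' : ℝ → ℝ := fun t => D * (((1 + t * |R|) ^ 1)⁻¹ * w t) with hw'
    have has : IsSymbol (Ioo 0 L) N w' a' := by
      refine ((hbs.pred.const_mul isOpen_Ioo (1 - c)).add isOpen_Ioo
        (hbs.eul.const_mul isOpen_Ioo (-c))).mono fun t ht => ?_
      have hn1 : ‖1 - c‖ ≤ 2 := by
        refine (norm_sub_le _ _).trans ?_
        rw [norm_one, hcn]; norm_num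
      have h2 := hbs.nonneg t ht
      have h3 : w' t = 3 * w₁ t := by simp only [hw', hw₁, hD, pow_one]; ring
      rw [norm_neg, hcn, h3]
      nlinarith
    have hw'i : IntegrableOn w' (Ioo 0 L) := (integrableOn_inv_mul hw R 1).const_mul D
    obtain ⟨c₀, hc₀, hvan⟩ := hvan
    have hbv : ∀ t, c₀ < t → b t = 0 := fun t ht => by simp only [hb, hvan t ht, zero_mul]
    have hw'lim : Tendsto (fun t => t * w' t) (𝓝[>] 0) (𝓝 0) := by
      have h2 := hlim.const_mul D
      rw [mul_zero] at h2
      refine squeeze_zero' ?_ ?_ h2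
      · filter_upwards [Ioo_mem_nhdsGT hL] with t ht
        exact mul_nonneg ht.1.le (has.nonneg t ht)
      · filter_upwards [Ioo_mem_nhdsGT hL] with t ht
        have h0 : 0 ≤ t * |R| := mul_nonneg ht.1.le (abs_nonneg R)
        have h3 : ((1 + t * |R|) ^ 1)⁻¹ ≤ 1 := inv_le_one_of_one_le₀ (one_le_pow₀ (by linarith))
        have h4 := hs.nonneg t ht
        have h5 : t * w' t = D * (t * w t) * ((1 + t * |R|) ^ 1)⁻¹ := by simp only [hw']; ring
        have h6 := ht.1.le
        rw [h5]
        exact mul_le_of_le_one_right (by positivity) h3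
    have hIH := ih L R w' a' hL has hw'i hw'lim ⟨c₀, hc₀, fun t ht => by
      simp only [ha', hbv t ht, IsSymbol.eul_eq_zero hbv ht, mul_zero, add_zero]⟩
    have hi1 := integrableOn_exp_mul R hw
      (hs.continuousOn.aestronglyMeasurable measurableSet_Ioo) hs.bound
    have hi2 := integrableOn_exp_mul R hw'i (a := a') (by
      refine AEStronglyMeasurable.add ?_ ?_
      · exact (hbs.continuousOn.aestronglyMeasurable measurableSet_Ioo).const_mul _
      · refine AEStronglyMeasurable.const_mul ?_ _
        exact ((Complex.measurable_ofReal).mul (measurable_deriv b)).aestronglyMeasurable) has.bound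
    have hder : ∀ t ∈ Ioo 0 L, HasDerivAt (fun t : ℝ => (t : ℂ) * Complex.exp (Complex.I * R * t) * b t)
        (Complex.I * σ * (Complex.exp (Complex.I * R * t) * a t -
          Complex.exp (Complex.I * R * t) * a' t)) t := by
      intro t ht
      have h2 : HasDerivAt (fun t : ℝ => Complex.exp (Complex.I * R * t))
          (Complex.exp (Complex.I * R * t) * (Complex.I * R * 1)) t :=
        ((Complex.ofRealCLM.hasDerivAt (x := t)).const_mul (Complex.I * R)).cexp
      have h3 : HasDerivAt (fun t : ℝ => (t : ℂ)) 1 t := Complex.ofRealCLM.hasDerivAt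
      refine ((h3.mul h2).mul (hbs.differentiableAt t ht).hasDerivAt).congr_deriv ?_
      have h0 : 0 < 1 + t * |R| := by
        have : 0 ≤ t * |R| := mul_nonneg ht.1.le (abs_nonneg R)
        linarith
      have h4 : a t = (1 + t * |R|) * b t := by
        simp only [hb, hq, pow_one]
        have h0' : ((1 + t * |R| : ℝ) : ℂ) ≠ 0 := by exact_mod_cast h0.ne'
        push_cast at h0' ⊢
        field_simp
      have h5 : (R : ℂ) = σ * |R| := by exact_mod_cast hRσ
      have h6 : (σ : ℂ) ^ 2 = 1 := by exact_mod_cast hσ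
      simp only [ha', h4, eul, hc, Pi.mul_apply]
      generalize Complex.exp (Complex.I * R * t) = E
      rw [h5]
      linear_combination (-E * b t - E * t * deriv b t) * h6 +
        (E * b t * σ ^ 2 + E * t * deriv b t * σ ^ 2) * Complex.I_sq
    have hlim0 : Tendsto (fun t : ℝ => (t : ℂ) * Complex.exp (Complex.I * R * t) * b t) (𝓝[>] 0) (𝓝 0) := by
      rw [tendsto_zero_iff_norm_tendsto_zero]
      refine squeeze_zero' (Eventually.of_forall fun _ => norm_nonneg _) ?_ hw'lim
      filter_upwards [Ioo_mem_nhdsGT hL] with t ht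
      rw [norm_mul, norm_mul, norm_exp_I_mul_mul, mul_one, Complex.norm_real, Real.norm_of_nonneg ht.1.le]
      refine mul_le_mul_of_nonneg_left ((hbs.bound t ht).trans ?_) ht.1.le
      have h2 := hbs.nonneg t ht
      have h3 : w' t = 3 * w₁ t := by simp only [hw', hw₁, hD, pow_one]; ring
      linarith
    have hlimL : Tendsto (fun t : ℝ => (t : ℂ) * Complex.exp (Complex.I * R * t) * b t) (𝓝[<] L) (𝓝 0) := by
      refine tendsto_const_nhds.congr' ?_
      filter_upwards [Ioo_mem_nhdsLT hc₀] with t ht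
      rw [hbv t ht.1, mul_zero]
    have hftc := intervalIntegral.integral_eq_sub_of_hasDerivAt_of_tendsto hL hder
      ((intervalIntegrable_iff_integrableOn_Ioo_of_le hL.le).2 ((hi1.sub hi2).const_mul _)) hlim0 hlimL
    rw [intervalIntegral.integral_of_le hL.le, integral_Ioc_eq_integral_Ioo, integral_const_mul,
      sub_zero, integral_sub hi1 hi2] at hftc
    have hne : Complex.I * (σ : ℂ) ≠ 0 :=
      mul_ne_zero Complex.I_ne_zero (norm_ne_zero_iff.1 (by rw [hσn]; exact one_ne_zero))
    rw [sub_eq_zero.1 ((mul_eq_zero.1 hftc).resolve_left hne)]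
    refine hIH.trans ?_
    have h7 : ∫ t in Ioo 0 L, ((1 + t * |R|) ^ N)⁻¹ * w' t =
        D * ∫ t in Ioo 0 L, ((1 + t * |R|) ^ (N + 1))⁻¹ * w t := by
      rw [← integral_const_mul]
      refine integral_congr_ae (Eventually.of_forall fun t => ?_)
      simp only [hw', pow_succ, pow_zero, one_mul, mul_inv]
      ring
    rw [h7, ← mul_assoc]
    exact mul_le_mul_of_nonneg_right (le_max_right _ _) hInn


/-! ### Amplitudes built from the resolvent -/

theorem eul_mul {f g : ℝ → ℂ} {s : ℝ} (hf : DifferentiableAt ℝ f s) (hg : DifferentiableAt ℝ g s) :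
    eul (fun t => f t * g t) s = eul f s * g s + f s * eul g s := by
  simp only [eul]
  rw [deriv_fun_mul hf hg]
  ring

theorem eul_comp_mul (f : ℝ → ℂ) (r s : ℝ) : eul (fun t => f (t * r)) s = eul f (s * r) := by
  simp only [eul, mul_comm _ r]
  rw [deriv_comp_mul_left r f s, Complex.real_smul]
  push_cast
  ring

/-- Bounds on `f` and on `t^{k-1} f^{(k)}` make `f` and `eul f` symbols. -/
theorem isSymbol_of_iteratedDeriv {L G : ℝ} {N : ℕ} {f : ℝ → ℂ}
    (hd : ∀ k < N + 1, DifferentiableOn ℝ (iteratedDeriv k f) (Ioo 0 L))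
    (h0 : ∀ t ∈ Ioo 0 L, ‖f t‖ ≤ G)
    (hk : ∀ k ∈ Finset.Icc 1 (N + 1), ∀ t ∈ Ioo 0 L, ‖(t : ℂ) ^ (k - 1) * iteratedDeriv k f t‖ ≤ G) :
    IsSymbol (Ioo 0 L) (N + 1) (fun _ => (2 * N + 5) ^ (N + 1) * ((1 + L) * G)) f ∧
    IsSymbol (Ioo 0 L) N (fun t => (2 * N + 5) ^ (N + 1) * (t * G)) (eul f) := by
  -- The functions t^j f^{(j)} satisfy eul X_j = j X_j + X_{j+1}. The hypothesis has t^{k-1} rather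
  -- than t^k, so from j = 1 on they carry an extra factor t. This is the gain for `eul f = X 1`.
  set X : ℕ → ℝ → ℂ := fun j t => (t : ℂ) ^ j * iteratedDeriv j f t with hX
  have hdX : ∀ j < N + 1, ∀ s ∈ Ioo 0 L, HasDerivAt (X j)
      (j * (s : ℂ) ^ (j - 1) * iteratedDeriv j f s + (s : ℂ) ^ j * iteratedDeriv (j + 1) f s) s := by
    intro j hj s hs
    have h1 : DifferentiableAt ℝ (iteratedDeriv j f) s :=
      (hd j hj s hs).differentiableAt (isOpen_Ioo.mem_nhds hs)
    have h2 : HasDerivAt (fun t : ℝ => (t : ℂ) ^ j) (j * (s : ℂ) ^ (j - 1)) s := by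
      simpa using (Complex.ofRealCLM.hasDerivAt (x := s)).fun_pow j
    refine (h2.mul h1.hasDerivAt).congr_deriv ?_
    rw [iteratedDeriv_succ]
  have heul : ∀ j < N + 1, ∀ s ∈ Ioo 0 L, eul (X j) s = (j : ℂ) * X j s + 1 * X (j + 1) s := by
    intro j hj s hs
    rw [eul, (hdX j hj s hs).deriv]
    simp only [hX]
    rcases j with _ | j
    · simp
    · rw [Nat.add_sub_cancel]
      push_cast
      ring
  have hbk : ∀ k ∈ Finset.Icc 1 (N + 1), ∀ t ∈ Ioo 0 L, ‖X k t‖ ≤ t * G := by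
    intro k hk' t ht
    have h1 := hk k hk' t ht
    have h2 : X k t = t * ((t : ℂ) ^ (k - 1) * iteratedDeriv k f t) := by
      simp only [hX]
      rw [← mul_assoc, ← pow_succ', Nat.sub_add_cancel (Finset.mem_Icc.1 hk').1]
    rw [h2, norm_mul, Complex.norm_real, Real.norm_of_nonneg ht.1.le]
    exact mul_le_mul_of_nonneg_left h1 ht.1.le
  have hG : ∀ t ∈ Ioo 0 L, 0 ≤ G := fun t ht => (norm_nonneg _).trans (h0 t ht)
  have hjn : ∀ j ≤ N + 1, ‖(j : ℂ)‖ ≤ N + 2 := by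
    intro j hj
    rw [Complex.norm_natCast]
    have : (j : ℝ) ≤ ((N + 1 : ℕ) : ℝ) := by exact_mod_cast hj
    push_cast at this; linarith
  have hM : (1 + 2 * ((N : ℝ) + 2)) = 2 * N + 5 := by ring
  have hone : (1 : ℝ) ≤ 2 * N + 5 := by linarith [Nat.cast_nonneg (α := ℝ) N]
  constructor
  · have h1 := IsSymbol.of_family (S := Ioo 0 L) (k := N + 1) (K := N + 1) (j := 0) (M := N + 2)
      (w := fun _ => (1 + L) * G) isOpen_Ioo (X := X) (α := fun j => j) (β := fun _ => 1)
      hjn (fun j _ => by simp; linarith [Nat.cast_nonneg (α := ℝ) N])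
      (fun j hj s hs => (hdX j hj s hs).differentiableAt) heul (fun j hj t ht => ?_) (by omega)
    · rw [hM] at h1
      exact h1.congr isOpen_Ioo fun t _ => by simp [hX]
    · have hL : 0 < L := ht.1.trans ht.2
      have hG' := hG t ht
      rcases Nat.eq_zero_or_pos j with rfl | hj0
      · simp only [hX, pow_zero, one_mul, iteratedDeriv_zero]
        nlinarith [h0 t ht]
      · refine (hbk j (Finset.mem_Icc.2 ⟨hj0, hj⟩) t ht).trans ?_
        nlinarith [ht.2]
  · have h1 := IsSymbol.of_family (S := Ioo 0 L) (k := N) (K := N) (j := 0) (M := N + 2)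
      (w := fun t => t * G) isOpen_Ioo (X := fun j => X (j + 1)) (α := fun j => ((j + 1 : ℕ) : ℂ)) (β := fun _ => 1)
      (fun j hj => hjn _ (by omega)) (fun j _ => by simp; linarith [Nat.cast_nonneg (α := ℝ) N])
      (fun j hj s hs => (hdX _ (by omega) s hs).differentiableAt) (fun j hj => heul _ (by omega))
      (fun j hj t ht => hbk _ (Finset.mem_Icc.2 ⟨by omega, by omega⟩) t ht) (by omega)
    rw [hM] at h1
    refine (h1.congr isOpen_Ioo fun t _ => ?_).mono fun t ht => ?_
    · simp [hX, eul]
    · have h2 : (2 * N + 5 : ℝ) ^ N ≤ (2 * N + 5) ^ (N + 1) := pow_le_pow_right₀ hone (by omega)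
      exact mul_le_mul_of_nonneg_right h2 (mul_nonneg ht.1.le (hG t ht))

/-- The constant depends only on the cutoff, L and N, and the bound is linear in G. It can thus be
applied pointwise in the kernel variables with G the majorant there. -/
theorem exists_isSymbol_cutoff_mul {L : ℝ} (hL : 0 < L) (N : ℕ) {χ : ℝ → ℝ} (hχ : ContDiff ℝ ∞ χ) :
    ∃ C : ℝ, 0 ≤ C ∧ ∀ (f : ℝ → ℂ) (G : ℝ),
      (∀ k < N + 1, DifferentiableOn ℝ (iteratedDeriv k f) (Ioo 0 L)) →
      (∀ t ∈ Ioo 0 L, ‖f t‖ ≤ G) →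
      (∀ k ∈ Finset.Icc 1 (N + 1), ∀ t ∈ Ioo 0 L, ‖(t : ℂ) ^ (k - 1) * iteratedDeriv k f t‖ ≤ G) →
      IsSymbol (Ioo 0 L) (N + 1) (fun _ => C * G) (fun t => (χ t : ℂ) * f t) ∧
      IsSymbol (Ioo 0 L) N (fun t => C * G * t) (eul fun t => (χ t : ℂ) * f t) := by
  have hχ' : ContDiff ℝ ∞ fun t => (χ t : ℂ) := Complex.ofRealCLM.contDiff.comp hχ
  have hcont : ∀ k, Continuous (iteratedDeriv k fun t => (χ t : ℂ)) := fun k =>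
    hχ'.continuous_iteratedDeriv k (by exact_mod_cast le_top)
  have hbd : ∀ k : ℕ, ∃ B : ℝ, 0 ≤ B ∧ ∀ t ∈ Ioo 0 L,
      ‖(t : ℂ) ^ (k - 1) * iteratedDeriv k (fun t => (χ t : ℂ)) t‖ ≤ B := by
    intro k
    have h1 : Continuous fun t : ℝ => (t : ℂ) ^ (k - 1) * iteratedDeriv k (fun t => (χ t : ℂ)) t :=
      (Complex.continuous_ofReal.pow _).mul (hcont k)
    obtain ⟨B, hB⟩ := (isCompact_Icc (a := (0 : ℝ)) (b := L)).exists_bound_of_continuousOn h1.continuousOn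
    exact ⟨|B|, abs_nonneg B, fun t ht => (hB t (Ioo_subset_Icc_self ht)).trans (le_abs_self B)⟩
  choose B hB0 hB using hbd
  set G₀ := ∑ k ∈ Finset.range (N + 2), B k with hG₀
  have hBG : ∀ k < N + 2, B k ≤ G₀ := fun k hk =>
    Finset.single_le_sum (fun i _ => hB0 i) (Finset.mem_range.2 hk)
  have hG₀0 : 0 ≤ G₀ := Finset.sum_nonneg fun i _ => hB0 i
  obtain ⟨h1, h2⟩ := isSymbol_of_iteratedDeriv (L := L) (G := G₀) (N := N) (f := fun t => (χ t : ℂ))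
    (fun k _ => (hχ'.differentiable_iteratedDeriv k (by exact_mod_cast WithTop.coe_lt_top _)).differentiableOn)
    (fun t ht => by
      have := hB 0 t ht
      simp only [Nat.zero_sub, pow_zero, one_mul, iteratedDeriv_zero] at this
      exact this.trans (hBG 0 (by omega)))
    (fun k hk t ht => (hB k t ht).trans (hBG k (by have := Finset.mem_Icc.1 hk; omega)))
  set D : ℝ := (2 * N + 5) ^ (N + 1) with hD
  have hD0 : 0 ≤ D := by positivity
  refine ⟨2 ^ (N + 1) * (2 * (D * (1 + L) * G₀ * D * (1 + L))), by positivity, fun f G hd h0 hk => ?_⟩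
  have hG : ∀ t ∈ Ioo 0 L, 0 ≤ G := fun t ht => (norm_nonneg _).trans (h0 t ht)
  obtain ⟨h3, h4⟩ := isSymbol_of_iteratedDeriv hd h0 hk
  constructor
  · refine (h1.mul isOpen_Ioo h3).mono fun t ht => ?_
    have hG' := hG t ht
    have : 0 ≤ 2 ^ (N + 1) * (D * (1 + L) * G₀ * D * (1 + L)) * G := by positivity
    nlinarith
  · have h5 := ((h2.mul isOpen_Ioo h3.pred).add isOpen_Ioo (h1.pred.mul isOpen_Ioo h4)).congr isOpen_Ioo
      (g := eul fun t => (χ t : ℂ) * f t)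
      (fun t ht => (eul_mul (h1.differentiableAt t ht) (h3.differentiableAt t ht)).symm)
    refine h5.mono fun t ht => ?_
    have hG' := hG t ht
    have ht0 := ht.1.le
    have e : (2 : ℝ) ^ N * (D * (t * G₀) * (D * ((1 + L) * G))) +
        2 ^ N * (D * ((1 + L) * G₀) * (D * (t * G))) = 2 ^ N * 2 * (D * D * (1 + L) * G₀ * G * t) := by ring
    have e2 : 2 ^ (N + 1) * (2 * (D * (1 + L) * G₀ * D * (1 + L))) * G * t =
      2 ^ N * 2 * (D * D * (1 + L) * G₀ * G * t) * (2 * (1 + L)) := by ring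
    rw [e, e2]
    refine le_mul_of_one_le_right (by positivity) (by linarith)

/-- Oscillatory integrals against a spherical Fourier moment. -/
theorem exists_norm_integral_mul_sphereMoment_le {b : ℝ} (hb : 0 ≤ b) (N : ℕ) :
    ∃ C : ℝ, 0 ≤ C ∧ ∀ (L r₁ r₂ : ℝ) (w : ℝ → ℝ) (p : ℝ → ℂ), 0 < L → 0 < r₁ → 0 < r₂ →
    IsSymbol (Ioo 0 L) (N + 1) w p → IntegrableOn w (Ioo 0 L) →
    Tendsto (fun t => t * w t) (𝓝[>] 0) (𝓝 0) → (∃ c < L, ∀ t, c < t → p t = 0) →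
    ‖∫ t in Ioo 0 L, Complex.exp (Complex.I * r₁ * t) * p t * sphereMoment b 0 (t * r₂)‖ ≤
      C * ∫ t in Ioo 0 L, ((1 + t * |r₁ - r₂|) ^ (N + 1))⁻¹ * (w t * (1 + t * r₂) ^ (-(b + 1))) := by
  obtain ⟨C₁, F, G, hC₁, hF, hG, hFG⟩ := sphereMoment_decomp hb (N + 1)
  obtain ⟨C₂, hC₂, hosc⟩ := exists_norm_integral_exp_mul_le (N + 1)
  set D := C₂ * (2 ^ (N + 1) * C₁) with hD
  have hD0 : 0 ≤ D := by positivity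
  refine ⟨2 * D, by positivity, fun L r₁ r₂ w p hL hr₁ hr₂ hp hw hlim hvan => ?_⟩
  obtain ⟨c, hc, hvan⟩ := hvan
  set u : ℝ → ℝ := fun t => w t * (1 + t * r₂) ^ (-(b + 1)) with hu
  have hfac : ∀ t ∈ Ioo 0 L, 0 ≤ (1 + t * r₂) ^ (-(b + 1)) ∧ (1 + t * r₂) ^ (-(b + 1)) ≤ 1 := by
    intro t ht
    have h0 : 0 < t * r₂ := mul_pos ht.1 hr₂
    exact ⟨by positivity, Real.rpow_le_one_of_one_le_of_nonpos (by linarith) (by linarith)⟩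
  have hui : IntegrableOn u (Ioo 0 L) := by
    refine Integrable.mul_bdd (c := 1) hw ?_ ?_
    · exact Measurable.aestronglyMeasurable (by fun_prop)
    · filter_upwards [ae_restrict_mem measurableSet_Ioo] with t ht
      rw [Real.norm_of_nonneg (hfac t ht).1]
      exact (hfac t ht).2
  have hulim : Tendsto (fun t => t * u t) (𝓝[>] 0) (𝓝 0) := by
    refine squeeze_zero' ?_ ?_ hlim
    · filter_upwards [Ioo_mem_nhdsGT hL] with t ht
      exact mul_nonneg ht.1.le (mul_nonneg (hp.nonneg t ht) (hfac t ht).1)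
    · filter_upwards [Ioo_mem_nhdsGT hL] with t ht
      exact mul_le_mul_of_nonneg_left (mul_le_of_le_one_right (hp.nonneg t ht) (hfac t ht).2) ht.1.le
  -- The two waves of the moment combine with e^{ir₁t} to the frequencies r₁ + r₂ and r₁ - r₂. Both
  -- are at least |r₁ - r₂| in modulus, so one bound covers both.
  have hamp : ∀ F : ℝ → ℂ, IsSymbol (Ioi 0) (N + 1) (fun s => C₁ * (1 + s) ^ (-(b + 1))) F → ∀ R : ℝ,
      |r₁ - r₂| ≤ |R| →
      IntegrableOn (fun t : ℝ => Complex.exp (Complex.I * R * t) * (p t * F (t * r₂))) (Ioo 0 L) ∧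
      ‖∫ t in Ioo 0 L, Complex.exp (Complex.I * R * t) * (p t * F (t * r₂))‖ ≤
        D * ∫ t in Ioo 0 L, ((1 + t * |r₁ - r₂|) ^ (N + 1))⁻¹ * u t := by
    intro F hF R hR
    have hs := hp.mul isOpen_Ioo ((hF.comp_mul hr₂).mono_set fun t ht => ht.1 : IsSymbol (Ioo 0 L) _ _ _)
    have hs' : IsSymbol (Ioo 0 L) (N + 1) (fun t => 2 ^ (N + 1) * C₁ * u t) (fun t => p t * F (t * r₂)) :=
      hs.mono fun t _ => le_of_eq (by simp only [hu]; ring)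
    have hi : IntegrableOn (fun t => 2 ^ (N + 1) * C₁ * u t) (Ioo 0 L) := hui.const_mul _
    refine ⟨integrableOn_exp_mul R hi (hs'.continuousOn.aestronglyMeasurable measurableSet_Ioo) hs'.bound,
      ?_⟩
    have hl : Tendsto (fun t => t * (2 ^ (N + 1) * C₁ * u t)) (𝓝[>] 0) (𝓝 0) := by
      have := hulim.const_mul (2 ^ (N + 1) * C₁)
      rw [mul_zero] at this
      refine this.congr fun t => ?_
      ring
    refine (hosc L R _ _ hL hs' hi hl ⟨c, hc, fun t ht => by simp only [hvan t ht, zero_mul]⟩).trans ?_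
    rw [hD, mul_assoc C₂, ← integral_const_mul (2 ^ (N + 1) * C₁)]
    refine mul_le_mul_of_nonneg_left ?_ hC₂
    refine setIntegral_mono_on (integrableOn_inv_mul hi R _)
      ((integrableOn_inv_mul hui (r₁ - r₂) _).const_mul _) measurableSet_Ioo fun t ht => ?_
    have h0 : 0 ≤ u t := mul_nonneg (hp.nonneg t ht) (hfac t ht).1
    have ht0 := ht.1.le
    have h1 : ((1 + t * |R|) ^ (N + 1))⁻¹ ≤ ((1 + t * |r₁ - r₂|) ^ (N + 1))⁻¹ := by gcongr
    calc ((1 + t * |R|) ^ (N + 1))⁻¹ * (2 ^ (N + 1) * C₁ * u t)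
        ≤ ((1 + t * |r₁ - r₂|) ^ (N + 1))⁻¹ * (2 ^ (N + 1) * C₁ * u t) := by gcongr
      _ = _ := by ring
  have h3 : |r₁ - r₂| ≤ |r₁ + r₂| := by
    rw [abs_of_nonneg (add_nonneg hr₁.le hr₂.le), abs_le]; constructor <;> linarith
  obtain ⟨hi1, hb1⟩ := hamp F hF (r₁ + r₂) h3
  obtain ⟨hi2, hb2⟩ := hamp G hG (r₁ - r₂) le_rfl
  have heq : ∫ t in Ioo 0 L, Complex.exp (Complex.I * r₁ * t) * p t * sphereMoment b 0 (t * r₂) =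
      (∫ t in Ioo 0 L, Complex.exp (Complex.I * (r₁ + r₂ : ℝ) * t) * (p t * F (t * r₂))) +
      ∫ t in Ioo 0 L, Complex.exp (Complex.I * (r₁ - r₂ : ℝ) * t) * (p t * G (t * r₂)) := by
    rw [← integral_add hi1 hi2]
    refine setIntegral_congr_fun measurableSet_Ioo fun t ht => ?_
    rw [hFG _ (mul_pos ht.1 hr₂)]
    have e1 : Complex.exp (Complex.I * (r₁ + r₂ : ℝ) * t) =
        Complex.exp (Complex.I * r₁ * t) * Complex.exp (Complex.I * (t * r₂ : ℝ)) := by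
      rw [← Complex.exp_add]; congr 1; push_cast; ring
    have e2 : Complex.exp (Complex.I * (r₁ - r₂ : ℝ) * t) =
        Complex.exp (Complex.I * r₁ * t) * Complex.exp (-(Complex.I * (t * r₂ : ℝ))) := by
      rw [← Complex.exp_add]; congr 1; push_cast; ring
    rw [e1, e2]
    ring
  rw [heq, two_mul, add_mul]
  exact (norm_add_le _ _).trans (add_le_add hb1 hb2)


/-! ### Pointwise bounds for the `λ`-integral -/

/-- The growth exponent of the amplitude of the outgoing resolvent. -/
noncomputable def outExp (m : ℕ) (a : ℝ) : ℝ := a - (2 * (m - 1) : ℕ)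

/-- Majorant of the `λ`-integrand after integrating by parts `N` times. -/
noncomputable def oscWeight (m j N : ℕ) (a b r₁ r₂ t : ℝ) : ℝ :=
  t ^ j * (1 + t * r₁) ^ outExp m a * (1 + t * r₂) ^ (-(b + 1)) * ((1 + t * |r₁ - r₂|) ^ N)⁻¹

theorem continuousOn_pow_mul_rpow {r : ℝ} (hr : 0 ≤ r) (j : ℕ) (μ : ℝ) :
    ContinuousOn (fun t : ℝ => t ^ j * (1 + t * r) ^ μ) (Ici 0) := by
  refine ContinuousOn.mul (by fun_prop) (ContinuousOn.rpow_const (by fun_prop) fun t ht => Or.inl ?_)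
  have : 0 ≤ t * r := mul_nonneg ht hr
  linarith

theorem integrableOn_pow_mul_rpow {r : ℝ} (hr : 0 ≤ r) (j : ℕ) (μ L : ℝ) :
    IntegrableOn (fun t : ℝ => t ^ j * (1 + t * r) ^ μ) (Ioo 0 L) :=
  (((continuousOn_pow_mul_rpow hr j μ).mono Icc_subset_Ici_self).integrableOn_compact isCompact_Icc).mono_set
    Ioo_subset_Icc_self

theorem tendsto_mul_pow_mul_rpow {r : ℝ} (hr : 0 ≤ r) (j : ℕ) (μ c : ℝ) :
    Tendsto (fun t : ℝ => t * (c * (t ^ j * (1 + t * r) ^ μ))) (𝓝[>] 0) (𝓝 0) := by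
  have h1 := ((continuousOn_pow_mul_rpow hr j μ) 0 self_mem_Ici).tendsto.mono_left
    (nhdsWithin_mono 0 Ioi_subset_Ici_self)
  have h2 : Tendsto (fun t : ℝ => t) (𝓝[>] 0) (𝓝 0) := tendsto_id.mono_left nhdsWithin_le_nhds
  have h3 := h2.mul (h1.const_mul c)
  rwa [zero_mul] at h3

section

variable {m : ℕ} {a : ℝ}

theorem outAmp_eq (s : ℝ) : outAmp m a s =
    Complex.exp (Complex.I * s) * (Complex.exp (-(Complex.I * s)) * outAmp m a s) := by
  rw [← mul_assoc, ← Complex.exp_add]; simp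

theorem exp_mul_exp_neg_mul (r t : ℝ) (z : ℂ) :
    Complex.exp (Complex.I * r * t) * (Complex.exp (-(Complex.I * (t * r : ℝ))) * z) = z := by
  rw [← mul_assoc, ← Complex.exp_add]
  have : Complex.I * r * t + -(Complex.I * (t * r : ℝ)) = 0 := by push_cast; ring
  rw [this, Complex.exp_zero, one_mul]

/-- Repeated integration by parts with the total phase. -/
theorem exists_norm_oscillatory_le (hm : 1 ≤ m) (ha : ((m - 1 : ℕ) : ℝ) ≤ a) (j N : ℕ) :
    ∃ C : ℝ, 0 ≤ C ∧ ∀ (L r₁ r₂ G : ℝ) (g : ℝ → ℂ), 0 < L → 0 < r₁ → 0 < r₂ → 0 ≤ G →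
    IsSymbol (Ioo 0 L) (N + 1) (fun _ => G) g → (∃ c < L, ∀ t, c < t → g t = 0) →
    ‖∫ t in Ioo 0 L, g t * (t : ℂ) ^ j * outAmp m a (t * r₁) * sphereMoment a 0 (t * r₂)‖ ≤
      C * G * ∫ t in Ioo 0 L, oscWeight m j (N + 1) a a r₁ r₂ t := by
  have ha0 : 0 ≤ a := (Nat.cast_nonneg _).trans ha
  obtain ⟨C₁, hC₁, hA⟩ := isSymbol_outAmp hm ha (N + 1)
  obtain ⟨C₂, hC₂, hJ⟩ := exists_norm_integral_mul_sphereMoment_le ha0 N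
  set B : ℝ → ℂ := fun s => Complex.exp (-(Complex.I * s)) * outAmp m a s with hB
  set D : ℝ := 2 ^ (N + 1) * (1 + j) ^ (N + 1) * 2 ^ (N + 1) * C₁ with hD
  refine ⟨C₂ * D, by positivity, fun L r₁ r₂ G g hL hr₁ hr₂ hG hg hvan => ?_⟩
  set p : ℝ → ℂ := fun t => g t * (t : ℂ) ^ j * B (t * r₁) with hp
  have hps : IsSymbol (Ioo 0 L) (N + 1) (fun t => D * G * (t ^ j * (1 + t * r₁) ^ outExp m a)) p := by
    refine ((hg.mul isOpen_Ioo ((IsSymbol.pow j).mono_set fun t ht => ht.1)).mul isOpen_Ioo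
      ((hA.comp_mul hr₁).mono_set fun t ht => ht.1)).mono fun t ht => le_of_eq ?_
    simp only [hD, outExp]; ring
  obtain ⟨c, hc, hvan⟩ := hvan
  have h := hJ L r₁ r₂ _ p hL hr₁ hr₂ hps ((integrableOn_pow_mul_rpow hr₁.le j _ L).const_mul _)
    (tendsto_mul_pow_mul_rpow hr₁.le j _ _) ⟨c, hc, fun t ht => by simp only [hp, hvan t ht, zero_mul]⟩
  have e1 : ∫ t in Ioo 0 L, g t * (t : ℂ) ^ j * outAmp m a (t * r₁) * sphereMoment a 0 (t * r₂) =
      ∫ t in Ioo 0 L, Complex.exp (Complex.I * r₁ * t) * p t * sphereMoment a 0 (t * r₂) := by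
    refine integral_congr_ae (Eventually.of_forall fun t => ?_)
    simp only [hp, hB]
    linear_combination -(g t * (t : ℂ) ^ j * sphereMoment a 0 (t * r₂)) *
      exp_mul_exp_neg_mul r₁ t (outAmp m a (t * r₁))
  rw [e1]
  refine h.trans (le_of_eq ?_)
  rw [mul_assoc C₂, mul_assoc C₂, ← integral_const_mul (D * G)]
  congr 1
  refine integral_congr_ae (Eventually.of_forall fun t => ?_)
  simp only [oscWeight]
  ring

/-- With the phase left in, a derivative costs a power of s. Order one is enough where no
oscillation is exploited: differentiability, measurability and absolute bounds. -/
theorem isSymbol_outAmp_one (hm : 1 ≤ m) (ha : ((m - 1 : ℕ) : ℝ) ≤ a) : ∃ C : ℝ, 0 ≤ C ∧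
    IsSymbol (Ioi 0) 1 (fun s => C * (1 + s) ^ (outExp m a + 1)) (outAmp m a) := by
  obtain ⟨C₁, hC₁, h1⟩ := isSymbol_outAmp hm ha 1
  obtain ⟨C₂, hC₂, h2⟩ := isSymbol_eul_outAmp hm ha 0
  have hn : ∀ (s : ℝ) (z : ℂ), ‖Complex.exp (-(Complex.I * s)) * z‖ = ‖z‖ := by
    intro s z
    have : -(Complex.I * s) = ((-s : ℝ) : ℂ) * Complex.I := by push_cast; ring
    rw [norm_mul, this, Complex.norm_exp_ofReal_mul_I, one_mul]
  have hb : ∀ s : ℝ, 0 < s → 0 ≤ (1 + s) ^ outExp m a ∧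
      (1 + s) ^ (outExp m a + 1) = (1 + s) ^ outExp m a * (1 + s) := fun s hs =>
    ⟨by positivity, Real.rpow_add_one (by positivity) _⟩
  refine ⟨C₁ + C₂, by positivity, fun s hs => ?_, fun s hs => ?_, fun s hs => ?_⟩
  · have hs' : (0 : ℝ) < s := hs
    have h3 := h1.bound s hs
    rw [hn] at h3
    obtain ⟨h4, h5⟩ := hb s hs'
    beta_reduce
    rw [h5]
    refine h3.trans ?_
    change C₁ * (1 + s) ^ outExp m a ≤ _
    have : 0 ≤ C₂ * ((1 + s) ^ outExp m a * (1 + s)) := by positivity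
    have : 0 ≤ C₁ * (1 + s) ^ outExp m a * s := by positivity
    nlinarith
  · have h3 : DifferentiableAt ℝ (fun s : ℝ => Complex.exp (Complex.I * s)) s :=
      ((Complex.ofRealCLM.hasDerivAt (x := s)).const_mul Complex.I).cexp.differentiableAt
    have h4 := h3.mul (h1.differentiableAt s hs)
    refine h4.congr_of_eventuallyEq (Eventually.of_forall fun t => ?_)
    exact outAmp_eq t
  · have hs' : (0 : ℝ) < s := hs
    have h3 := h2.bound s hs
    rw [hn] at h3
    obtain ⟨h4, h5⟩ := hb s hs'
    beta_reduce
    rw [h5]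
    refine h3.trans ?_
    change C₂ * (s * (1 + s) ^ outExp m a) ≤ _
    have : 0 ≤ C₁ * ((1 + s) ^ outExp m a * (1 + s)) := by positivity
    have : 0 ≤ C₂ * (1 + s) ^ outExp m a := by positivity
    nlinarith

/-- When j + 1 = 2a + 3, the function t^j J_a(tr) is the derivative of t^{j+1} J_{a+1}(tr)/(2(a +
1)). After integrating by parts, one factor t joins the derivative of h to form `eul h`. -/
theorem integral_pow_mul_sphereMoment_mul (ha : 0 ≤ a) {j : ℕ} (hj : (j : ℝ) + 1 = 2 * a + 3) {L r M : ℝ}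
    (hL : 0 < L) {h : ℝ → ℂ} (hs : IsSymbol (Ioo 0 L) 1 (fun _ => M) h)
    (hvan : ∃ c < L, ∀ t, c < t → h t = 0) :
    ∫ t in Ioo 0 L, h t * (t : ℂ) ^ j * sphereMoment a 0 (t * r) =
      -(2 * (a + 1) : ℂ)⁻¹ * ∫ t in Ioo 0 L, eul h t * (t : ℂ) ^ j * sphereMoment (a + 1) 0 (t * r) := by
  have ha1 : 0 ≤ a + 1 := by linarith
  have hb0 : (2 * (a + 1) : ℂ) ≠ 0 := by
    have : (2 * (a + 1) : ℝ) ≠ 0 := by positivity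
    exact_mod_cast this
  have hcont : ∀ {b : ℝ}, 0 ≤ b → Continuous fun t : ℝ => sphereMoment b 0 (t * r) := fun hb =>
    (continuous_iff_continuousAt.2 fun t => (hasDerivAt_sphereMoment hb 0 t).continuousAt).comp
      (by fun_prop)
  have hint : ∀ {f : ℝ → ℂ} {b : ℝ}, 0 ≤ b → AEStronglyMeasurable f (volume.restrict (Ioo 0 L)) →
      (∀ t ∈ Ioo 0 L, ‖f t‖ ≤ M) →
      IntegrableOn (fun t : ℝ => f t * (t : ℂ) ^ j * sphereMoment b 0 (t * r)) (Ioo 0 L) := by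
    intro f b hb hf hfb
    have hM : IntegrableOn (fun _ : ℝ => M * L ^ j * 2) (Ioo 0 L) := integrableOn_const (by simp)
    refine Integrable.mono' hM ?_ ?_
    · exact (hf.mul (Continuous.aestronglyMeasurable (by fun_prop))).mul (hcont hb).aestronglyMeasurable
    · filter_upwards [ae_restrict_mem measurableSet_Ioo] with t ht
      rw [norm_mul, norm_mul, norm_pow, Complex.norm_real, Real.norm_of_nonneg ht.1.le]
      have h1 := hfb t ht
      have h2 := norm_sphereMoment_le hb 0 (t * r)
      have h3 := pow_le_pow_left₀ ht.1.le ht.2.le j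
      have h4 := ht.1.le
      have h5 : 0 ≤ M := (norm_nonneg _).trans h1
      gcongr
  have hi1 := hint ha (hs.continuousOn.aestronglyMeasurable measurableSet_Ioo) hs.bound
  have hi2 := hint ha1 (f := eul h)
    ((Complex.measurable_ofReal.mul (measurable_deriv h)).aestronglyMeasurable) hs.eul.bound
  set f : ℝ → ℂ := fun t => h t * (t : ℂ) ^ (j + 1) * sphereMoment (a + 1) 0 (t * r) with hf
  have hder : ∀ t ∈ Ioo 0 L, HasDerivAt f (2 * (a + 1) * (h t * (t : ℂ) ^ j * sphereMoment a 0 (t * r)) +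
      eul h t * (t : ℂ) ^ j * sphereMoment (a + 1) 0 (t * r)) t := by
    intro t ht
    have h1 : HasDerivAt (fun t : ℝ => (t : ℂ) ^ (j + 1)) ((j + 1 : ℕ) * (t : ℂ) ^ j) t := by
      simpa using (Complex.ofRealCLM.hasDerivAt (x := t)).fun_pow (j + 1)
    have h2 : DifferentiableAt ℝ (fun t : ℝ => sphereMoment (a + 1) 0 (t * r)) t :=
      (HasDerivAt.scomp (h := fun t : ℝ => t * r) t (hasDerivAt_sphereMoment ha1 0 (t * r))
        ((hasDerivAt_id t).mul_const r)).differentiableAt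
    refine (((hs.differentiableAt t ht).hasDerivAt.mul h1).mul h2.hasDerivAt).congr_deriv ?_
    have h3 := eul_comp_mul (sphereMoment (a + 1) 0) r t
    rw [eul_sphereMoment_add_one ha] at h3
    have h4 : ((j + 1 : ℕ) : ℂ) = 2 * a + 3 := by exact_mod_cast hj
    simp only [Pi.mul_apply, h4]
    have h5 : (t : ℂ) * deriv (fun t : ℝ => sphereMoment (a + 1) 0 (t * r)) t =
      -(2 * a + 3) * sphereMoment (a + 1) 0 (t * r) + 2 * (a + 1) * sphereMoment a 0 (t * r) := h3
    rw [eul]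
    linear_combination (h t * t ^ j) * h5
  have hbf : ∀ t ∈ Ioo 0 L, ‖f t‖ ≤ M * t ^ (j + 1) * 2 := by
    intro t ht
    simp only [hf]
    rw [norm_mul, norm_mul, norm_pow, Complex.norm_real, Real.norm_of_nonneg ht.1.le]
    have h1 := hs.bound t ht
    have h2 := norm_sphereMoment_le ha1 0 (t * r)
    have h4 := ht.1.le
    have h5 : 0 ≤ M := (norm_nonneg _).trans h1
    gcongr
  have hlim0 : Tendsto f (𝓝[>] 0) (𝓝 0) := by
    rw [tendsto_zero_iff_norm_tendsto_zero]
    have h1 : Tendsto (fun t : ℝ => M * t ^ (j + 1) * 2) (𝓝[>] 0) (𝓝 (M * 0 ^ (j + 1) * 2)) :=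
      ((by fun_prop : Continuous fun t : ℝ => M * t ^ (j + 1) * 2).tendsto 0).mono_left nhdsWithin_le_nhds
    rw [zero_pow (by omega), mul_zero, zero_mul] at h1
    refine squeeze_zero' (Eventually.of_forall fun _ => norm_nonneg _) ?_ h1
    filter_upwards [Ioo_mem_nhdsGT hL] with t ht using hbf t ht
  have hlimL : Tendsto f (𝓝[<] L) (𝓝 0) := by
    obtain ⟨c, hc, hvan⟩ := hvan
    refine tendsto_const_nhds.congr' ?_
    filter_upwards [Ioo_mem_nhdsLT hc] with t ht
    simp only [hf, hvan t ht.1, zero_mul]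
  have hftc := intervalIntegral.integral_eq_sub_of_hasDerivAt_of_tendsto hL hder
    ((intervalIntegrable_iff_integrableOn_Ioo_of_le hL.le).2 ((hi1.const_mul _).add hi2)) hlim0 hlimL
  rw [intervalIntegral.integral_of_le hL.le, integral_Ioc_eq_integral_Ioo,
    integral_add (hi1.const_mul _) hi2, integral_const_mul, sub_zero] at hftc
  rw [neg_mul, eq_neg_iff_add_eq_zero]
  have := congrArg (fun z => (2 * (a + 1) : ℂ)⁻¹ * z) hftc
  beta_reduce at this
  rwa [mul_add, inv_mul_cancel_left₀ hb0, mul_zero] at this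

/-- One integration by parts in the spherical moment gains decay in `r₂`. -/
theorem exists_norm_oscillatory_le' (hm : 1 ≤ m) (ha : ((m - 1 : ℕ) : ℝ) ≤ a) {j : ℕ}
    (hj : (j : ℝ) + 1 = 2 * a + 3) (N : ℕ) :
    ∃ C : ℝ, 0 ≤ C ∧ ∀ (L r₁ r₂ G : ℝ) (g : ℝ → ℂ), 0 < L → 0 < r₁ → 0 < r₂ → 0 ≤ G →
    IsSymbol (Ioo 0 L) (N + 2) (fun _ => G) g → IsSymbol (Ioo 0 L) (N + 1) (fun t => G * t) (eul g) →
    (∃ c < L, ∀ t, c < t → g t = 0) →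
    ‖∫ t in Ioo 0 L, g t * (t : ℂ) ^ j * outAmp m a (t * r₁) * sphereMoment a 0 (t * r₂)‖ ≤
      C * G * ((1 + r₁) * ∫ t in Ioo 0 L, oscWeight m (j + 1) (N + 1) a (a + 1) r₁ r₂ t) := by
  have ha0 : 0 ≤ a := (Nat.cast_nonneg _).trans ha
  obtain ⟨C₀, hC₀, hA0⟩ := isSymbol_outAmp_one hm ha
  obtain ⟨C₁, hC₁, hA⟩ := isSymbol_outAmp hm ha (N + 1)
  obtain ⟨C₃, hC₃, hA'⟩ := isSymbol_eul_outAmp hm ha (N + 1)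
  obtain ⟨C₂, hC₂, hJ⟩ := exists_norm_integral_mul_sphereMoment_le (by linarith : 0 ≤ a + 1) N
  set B : ℝ → ℂ := fun s => Complex.exp (-(Complex.I * s)) * outAmp m a s with hB
  set B' : ℝ → ℂ := fun s => Complex.exp (-(Complex.I * s)) * eul (outAmp m a) s with hB'
  set D : ℝ := 2 ^ (N + 1) * (1 + j) ^ (N + 1) * 2 ^ (N + 1) * (C₁ + C₃) with hD
  refine ⟨‖-(2 * (a + 1) : ℂ)⁻¹‖ * (C₂ * D), by positivity, fun L r₁ r₂ G g hL hr₁ hr₂ hG hg hg' hvan => ?_⟩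
  obtain ⟨c, hc, hvan⟩ := hvan
  have hsub : Ioo 0 L ⊆ Ioi 0 := fun t ht => ht.1
  set h : ℝ → ℂ := fun t => g t * outAmp m a (t * r₁) with hh
  have hAr := ((hA0.comp_mul hr₁).mono_set hsub : IsSymbol (Ioo 0 L) 1 _ _)
  have hhs : IsSymbol (Ioo 0 L) 1 (fun _ => 2 ^ 1 * (G * (C₀ * (1 + L * r₁) ^ |outExp m a + 1|))) h := by
    refine ((hg.of_le (by omega) : IsSymbol (Ioo 0 L) 1 _ _).mul isOpen_Ioo hAr).mono fun t ht => ?_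
    have h0 : 0 < t * r₁ := mul_pos ht.1 hr₁
    have h1 : (1 + t * r₁) ^ (outExp m a + 1) ≤ (1 + L * r₁) ^ |outExp m a + 1| := by
      refine (Real.rpow_le_rpow_of_exponent_le (by linarith) (le_abs_self _)).trans ?_
      have := mul_le_mul_of_nonneg_right ht.2.le hr₁.le
      exact Real.rpow_le_rpow (by linarith) (by linarith) (abs_nonneg _)
    gcongr
  have hhv : ∀ t, c < t → h t = 0 := fun t ht => by simp only [hh, hvan t ht, zero_mul]
  have hibp := integral_pow_mul_sphereMoment_mul ha0 hj (r := r₂) hL hhs ⟨c, hc, hhv⟩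
  -- Leibniz rule for the Euler derivative of g(t) A(tr₁), with the phase removed. The first term
  -- gains a factor t from `eul g`, the second a factor tr₁ from `eul` of the amplitude. Together
  -- this is t(1 + r₁), which raises the power of t to j + 1.
  set p : ℝ → ℂ := fun t => (eul g t * (t : ℂ) ^ j) * B (t * r₁) + (g t * (t : ℂ) ^ j) * B' (t * r₁) with hp
  have hps : IsSymbol (Ioo 0 L) (N + 1)
      (fun t => D * G * (1 + r₁) * (t ^ (j + 1) * (1 + t * r₁) ^ outExp m a)) p := by
    have hpow : IsSymbol (Ioo 0 L) (N + 1) _ _ := (IsSymbol.pow j).mono_set hsub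
    have s1 := (hg'.mul isOpen_Ioo hpow).mul isOpen_Ioo
      ((hA.comp_mul hr₁).mono_set hsub : IsSymbol (Ioo 0 L) (N + 1) _ _)
    have s2 := (hg.pred.mul isOpen_Ioo hpow).mul isOpen_Ioo
      ((hA'.comp_mul hr₁).mono_set hsub : IsSymbol (Ioo 0 L) (N + 1) _ _)
    refine (s1.add isOpen_Ioo s2).mono fun t ht => ?_
    have h0 : 0 < t * r₁ := mul_pos ht.1 hr₁
    have ht0 := ht.1
    have e : D * G * (1 + r₁) * (t ^ (j + 1) * (1 + t * r₁) ^ outExp m a) =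
      2 ^ (N + 1) * (1 + j) ^ (N + 1) * 2 ^ (N + 1) * G * (t ^ (j + 1) * (1 + t * r₁) ^ outExp m a) *
        ((C₁ + C₃) * (1 + r₁)) := by simp only [hD]; ring
    have e2 : 2 ^ (N + 1) * (2 ^ (N + 1) * (G * t * ((1 + (j : ℝ)) ^ (N + 1) * t ^ j)) *
        (C₁ * (1 + t * r₁) ^ (a - (2 * (m - 1) : ℕ)))) +
        2 ^ (N + 1) * (2 ^ (N + 1) * (G * ((1 + (j : ℝ)) ^ (N + 1) * t ^ j)) *
        (C₃ * (t * r₁ * (1 + t * r₁) ^ (a - (2 * (m - 1) : ℕ))))) =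
      2 ^ (N + 1) * (1 + j) ^ (N + 1) * 2 ^ (N + 1) * G * (t ^ (j + 1) * (1 + t * r₁) ^ outExp m a) *
        (C₁ + C₃ * r₁) := by simp only [outExp]; ring
    rw [e]
    refine (le_of_eq e2).trans (mul_le_mul_of_nonneg_left ?_ (by positivity))
    nlinarith
  have hpv : ∀ t, c < t → p t = 0 := fun t ht => by
    simp only [hp, hvan t ht, IsSymbol.eul_eq_zero hvan ht, zero_mul, add_zero]
  have hJ' := hJ L r₁ r₂ _ p hL hr₁ hr₂ hps ((integrableOn_pow_mul_rpow hr₁.le (j + 1) _ L).const_mul _)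
    (tendsto_mul_pow_mul_rpow hr₁.le (j + 1) _ _) ⟨c, hc, hpv⟩
  have e1 : ∫ t in Ioo 0 L, g t * (t : ℂ) ^ j * outAmp m a (t * r₁) * sphereMoment a 0 (t * r₂) =
      ∫ t in Ioo 0 L, h t * (t : ℂ) ^ j * sphereMoment a 0 (t * r₂) := by
    refine integral_congr_ae (Eventually.of_forall fun t => ?_)
    simp only [hh]; ring
  have e2 : ∫ t in Ioo 0 L, eul h t * (t : ℂ) ^ j * sphereMoment (a + 1) 0 (t * r₂) =
      ∫ t in Ioo 0 L, Complex.exp (Complex.I * r₁ * t) * p t * sphereMoment (a + 1) 0 (t * r₂) := by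
    refine setIntegral_congr_fun measurableSet_Ioo fun t ht => ?_
    have h1 : eul h t = eul g t * outAmp m a (t * r₁) + g t * eul (outAmp m a) (t * r₁) := by
      rw [hh, eul_mul (hg.differentiableAt t ht) (hAr.differentiableAt t ht), eul_comp_mul]
    have h2 : Complex.exp (Complex.I * r₁ * t) * p t = (t : ℂ) ^ j * eul h t := by
      rw [h1]
      simp only [hp, hB, hB']
      linear_combination (eul g t * (t : ℂ) ^ j) * exp_mul_exp_neg_mul r₁ t (outAmp m a (t * r₁)) +
        (g t * (t : ℂ) ^ j) *
          exp_mul_exp_neg_mul r₁ t (eul (outAmp m a) (t * r₁))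
    rw [h2]; ring
  rw [e1, hibp, e2, norm_mul, mul_assoc (‖-(2 * (a + 1) : ℂ)⁻¹‖), mul_assoc (‖-(2 * (a + 1) : ℂ)⁻¹‖)]
  refine mul_le_mul_of_nonneg_left (hJ'.trans (le_of_eq ?_)) (norm_nonneg _)
  rw [mul_assoc C₂, mul_assoc C₂, ← mul_assoc (D * G), ← integral_const_mul (D * G * (1 + r₁))]
  congr 1
  refine integral_congr_ae (Eventually.of_forall fun t => ?_)
  simp only [oscWeight]
  ring

end


/-! ### Radial integrals -/

theorem lintegral_fun_norm {E : Type*} [NormedAddCommGroup E] [NormedSpace ℝ E] [FiniteDimensional ℝ E]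
    [Nontrivial E] [MeasurableSpace E] [BorelSpace E] (μ : Measure E) [μ.IsAddHaarMeasure]
    {f : ℝ → ℝ≥0∞} (hf : Measurable f) :
    ∫⁻ x, f ‖x‖ ∂μ = μ.toSphere univ *
      ∫⁻ r in Ioi (0 : ℝ), ENNReal.ofReal (r ^ (Module.finrank ℝ E - 1)) * f r := by
  have h1 : ∫⁻ x, f ‖x‖ ∂μ = ∫⁻ x : ({0}ᶜ : Set E), f ‖(x : E)‖ ∂(μ.comap (↑)) := by
    rw [lintegral_subtype_comap (measurableSet_singleton _).compl fun x => f ‖x‖,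
      restrict_compl_singleton]
  have h2 := μ.measurePreserving_homeomorphUnitSphereProd.lintegral_comp_emb
    (Homeomorph.measurableEmbedding _) (fun z => f (z.2 : ℝ))
  simp only [homeomorphUnitSphereProd_apply_snd_coe] at h2
  have hf' : Measurable fun z : Metric.sphere (0 : E) 1 × Ioi (0 : ℝ) => f (z.2 : ℝ) := by fun_prop
  rw [h1, h2, lintegral_prod _ hf'.aemeasurable]
  simp only [lintegral_const]
  rw [mul_comm, Measure.volumeIoiPow, lintegral_withDensity_eq_lintegral_mul _ (by fun_prop) (by fun_prop)]
  congr 1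
  exact lintegral_subtype_comap measurableSet_Ioi
    fun r : ℝ => ENNReal.ofReal (r ^ (Module.finrank ℝ E - 1)) * f r

/-- Peetre's inequality 1 + tr ≤ (1 + tr₀)(1 + t|r - r₀|) moves the weight to r₀. The rest is
integrable since N - q > 1, and scaling gives t⁻¹. -/
theorem exists_lintegral_peetre_le {q : ℝ} (hq : 0 ≤ q) {N : ℕ} (hN : q + 1 < N) :
    ∃ C : ℝ, 0 ≤ C ∧ ∀ t r₀ : ℝ, 0 < t → 0 ≤ r₀ →
      ∫⁻ r in Ioi (0 : ℝ), ENNReal.ofReal ((1 + t * r) ^ q * ((1 + t * |r - r₀|) ^ N)⁻¹) ≤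
        ENNReal.ofReal (C * t⁻¹ * (1 + t * r₀) ^ q) := by
  have hint : Integrable (fun s : ℝ => (1 + ‖s‖) ^ (-((N : ℝ) - q))) :=
    integrable_one_add_norm (by simp; linarith)
  set C := ∫ s : ℝ, (1 + ‖s‖) ^ (-((N : ℝ) - q)) with hC
  have hC0 : 0 ≤ C := integral_nonneg fun s => by positivity
  refine ⟨C, hC0, fun t r₀ ht hr₀ => ?_⟩
  have hpt : ∀ r ∈ Ioi (0 : ℝ), (1 + t * r) ^ q * ((1 + t * |r - r₀|) ^ N)⁻¹ ≤
      (1 + t * r₀) ^ q * (1 + ‖t * (r - r₀)‖) ^ (-((N : ℝ) - q)) := by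
    intro r hr
    have hr' : (0 : ℝ) < r := hr
    have h0 : 0 ≤ t * |r - r₀| := by positivity
    have h1 : 1 + t * r ≤ (1 + t * r₀) * (1 + t * |r - r₀|) := by
      have := le_abs_self (r - r₀)
      have h2 : 0 ≤ t * r₀ * (t * |r - r₀|) := by positivity
      nlinarith
    have h2 : (1 + t * r) ^ q ≤ (1 + t * r₀) ^ q * (1 + t * |r - r₀|) ^ q := by
      rw [← Real.mul_rpow (by positivity) (by positivity)]
      exact Real.rpow_le_rpow (by positivity) h1 hq
    have h3 : ‖t * (r - r₀)‖ = t * |r - r₀| := by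
      rw [Real.norm_eq_abs, abs_mul, abs_of_pos ht]
    have h4 : (1 + t * |r - r₀|) ^ (-((N : ℝ) - q)) =
        (1 + t * |r - r₀|) ^ q * ((1 + t * |r - r₀|) ^ N)⁻¹ := by
      rw [neg_sub, Real.rpow_sub (by positivity), Real.rpow_natCast, div_eq_mul_inv]
    rw [h3, h4, ← mul_assoc]
    gcongr
  have hint2 : Integrable fun r : ℝ => (1 + ‖t * (r - r₀)‖) ^ (-((N : ℝ) - q)) :=
    (hint.comp_mul_left' ht.ne').comp_sub_right r₀
  calc ∫⁻ r in Ioi (0 : ℝ), ENNReal.ofReal ((1 + t * r) ^ q * ((1 + t * |r - r₀|) ^ N)⁻¹)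
      ≤ ∫⁻ r in Ioi (0 : ℝ), ENNReal.ofReal
          ((1 + t * r₀) ^ q * (1 + ‖t * (r - r₀)‖) ^ (-((N : ℝ) - q))) :=
        setLIntegral_mono' measurableSet_Ioi fun r hr => ENNReal.ofReal_le_ofReal (hpt r hr)
    _ ≤ ∫⁻ r : ℝ, ENNReal.ofReal ((1 + t * r₀) ^ q * (1 + ‖t * (r - r₀)‖) ^ (-((N : ℝ) - q))) :=
        setLIntegral_le_lintegral _ _
    _ = ENNReal.ofReal (∫ r : ℝ, (1 + t * r₀) ^ q * (1 + ‖t * (r - r₀)‖) ^ (-((N : ℝ) - q))) :=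
        (ofReal_integral_eq_lintegral_ofReal (hint2.const_mul _)
          (Eventually.of_forall fun r => by positivity)).symm
    _ = ENNReal.ofReal (C * t⁻¹ * (1 + t * r₀) ^ q) := by
        congr 1
        rw [integral_const_mul, integral_sub_right_eq_self
          (fun r : ℝ => (1 + ‖t * r‖) ^ (-((N : ℝ) - q))) r₀,
          Measure.integral_comp_mul_left (fun s : ℝ => (1 + ‖s‖) ^ (-((N : ℝ) - q))) t, smul_eq_mul, ← hC,
          abs_of_pos (by positivity)]
        ring

/-- The size of the resolvent kernel `𝓡₀⁺` at distance `r`. -/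
noncomputable def resWeight (n m : ℕ) (r : ℝ) : ℝ := 1 + r ^ (2 * m - n : ℝ)

theorem resWeight_nonneg {n m : ℕ} {r : ℝ} (hr : 0 ≤ r) : 0 ≤ resWeight n m r := by
  unfold resWeight; positivity

theorem rpow_mul_one_add_pow_le {n m : ℕ} (hmn : 2 * m ≤ n) {t r L : ℝ} (ht : 0 ≤ t) (htL : t ≤ L)
    (hr : 0 < r) :
    r ^ (2 * m - n : ℝ) * (1 + t * r) ^ (n - 2 * m) ≤ (1 + L) ^ (n - 2 * m) * resWeight n m r := by
  have hp : 0 < r ^ (2 * m - n : ℝ) := by positivity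
  have hL : 0 ≤ L := ht.trans htL
  have h0 : 0 ≤ t * r := by positivity
  rw [resWeight]
  rcases le_total r 1 with h1 | h1
  · have h2 : (1 + t * r) ^ (n - 2 * m) ≤ (1 + L) ^ (n - 2 * m) :=
      pow_le_pow_left₀ (by positivity) (by nlinarith) _
    have h3 : 0 ≤ (1 + L) ^ (n - 2 * m) := by positivity
    nlinarith
  · have h2 : (1 + t * r) ^ (n - 2 * m) ≤ (1 + L) ^ (n - 2 * m) * r ^ (n - 2 * m) := by
      rw [← mul_pow]
      exact pow_le_pow_left₀ (by positivity) (by nlinarith) _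
    have h3 : r ^ (2 * m - n : ℝ) * r ^ (n - 2 * m) = 1 := by
      rw [← Real.rpow_natCast, ← Real.rpow_add hr]
      push_cast [Nat.cast_sub hmn]
      simp
    have h4 : 0 ≤ (1 + L) ^ (n - 2 * m) := by positivity
    calc r ^ (2 * m - n : ℝ) * (1 + t * r) ^ (n - 2 * m)
        ≤ r ^ (2 * m - n : ℝ) * ((1 + L) ^ (n - 2 * m) * r ^ (n - 2 * m)) := by gcongr
      _ = (1 + L) ^ (n - 2 * m) * (r ^ (2 * m - n : ℝ) * r ^ (n - 2 * m)) := by ring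
      _ ≤ _ := by rw [h3]; nlinarith

theorem rpow_mul_one_add_mul_pow_le {n m : ℕ} (hmn : 2 * m < n) {t r₁ L : ℝ} (ht : 0 ≤ t) (htL : t ≤ L)
    (hr₁ : 0 < r₁) :
    r₁ ^ (2 * m - n : ℝ) * ((1 + r₁) * (1 + t * r₁) ^ (n - 1 - 2 * m)) ≤
      2 * (1 + L) ^ (n - 2 * m) * resWeight n m r₁ := by
  have hL0 : 0 ≤ L := ht.trans htL
  have hsucc : n - 2 * m = (n - 1 - 2 * m) + 1 := by omega
  have hL1 : (1 + L) ^ (n - 1 - 2 * m) ≤ (1 + L) ^ (n - 2 * m) :=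
    pow_le_pow_right₀ (by linarith) (by omega)
  have h0 : 0 ≤ t * r₁ := by positivity
  have hp : 0 < r₁ ^ (2 * m - n : ℝ) := by positivity
  rw [resWeight]
  rcases le_total r₁ 1 with h1 | h1
  · have h2 : (1 + t * r₁) ^ (n - 1 - 2 * m) ≤ (1 + L) ^ (n - 2 * m) :=
      (pow_le_pow_left₀ (by positivity) (by nlinarith) _).trans hL1
    have h3 : (1 + r₁) * (1 + t * r₁) ^ (n - 1 - 2 * m) ≤ 2 * (1 + L) ^ (n - 2 * m) := by
      have : 0 ≤ (1 + t * r₁) ^ (n - 1 - 2 * m) := by positivity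
      nlinarith
    have h4 : 0 ≤ (1 + L) ^ (n - 2 * m) := by positivity
    nlinarith
  · have h2 : (1 + t * r₁) ^ (n - 1 - 2 * m) ≤ (1 + L) ^ (n - 2 * m) * r₁ ^ (n - 1 - 2 * m) := by
      refine (pow_le_pow_left₀ (by positivity) (by nlinarith : 1 + t * r₁ ≤ (1 + L) * r₁) _).trans ?_
      rw [mul_pow]
      gcongr
    have h3 : r₁ ^ (2 * m - n : ℝ) * (r₁ * r₁ ^ (n - 1 - 2 * m)) = 1 := by
      rw [← pow_succ', ← hsucc, ← Real.rpow_natCast, ← Real.rpow_add hr₁]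
      push_cast [Nat.cast_sub hmn.le]
      simp
    have h4 : 0 ≤ (1 + L) ^ (n - 2 * m) := by positivity
    calc r₁ ^ (2 * m - n : ℝ) * ((1 + r₁) * (1 + t * r₁) ^ (n - 1 - 2 * m))
        ≤ r₁ ^ (2 * m - n : ℝ) * ((2 * r₁) * ((1 + L) ^ (n - 2 * m) * r₁ ^ (n - 1 - 2 * m))) := by
          gcongr; linarith
      _ = 2 * (1 + L) ^ (n - 2 * m) * (r₁ ^ (2 * m - n : ℝ) * (r₁ * r₁ ^ (n - 1 - 2 * m))) := by ring
      _ ≤ _ := by rw [h3]; nlinarith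

theorem pow_le_inv_mul_one_add_pow {t r : ℝ} (ht : 0 < t) (hr : 0 ≤ r) (k : ℕ) :
    r ^ k ≤ (t ^ k)⁻¹ * (1 + t * r) ^ k := by
  have h1 : r ^ k = (t ^ k)⁻¹ * (t * r) ^ k := by rw [mul_pow]; field_simp
  rw [h1]
  have h2 : 0 ≤ t * r := by positivity
  gcongr
  linarith

section

variable {n m : ℕ} {L : ℝ}

theorem oscWeight_nonneg {j N : ℕ} {a b r₁ r₂ t : ℝ} (hr₁ : 0 ≤ r₁) (hr₂ : 0 ≤ r₂) (ht : 0 ≤ t) :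
    0 ≤ oscWeight m j N a b r₁ r₂ t := by
  unfold oscWeight; positivity

theorem measurable_oscWeight (j N : ℕ) (a b : ℝ) :
    Measurable fun z : ℝ × ℝ × ℝ => oscWeight m j N a b z.1 z.2.1 z.2.2 := by
  unfold oscWeight
  have : Measurable fun z : ℝ × ℝ × ℝ => |z.1 - z.2.1| := by
    simp only [← Real.norm_eq_abs]; fun_prop
  fun_prop

/-- Power counting: r^{n-1} r^{2m-n} = r^{2m-1} ≤ t^{-(2m-1)} (1 + tr)^{2m-1}, which raises the
amplitude's exponent to a + 1. Peetre's inequality turns this into t⁻¹(1 + tr₂)^{a+1}, which cancels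
the decay in r₂. What remains is t^{n-1-2m}, bounded on (0, L) since n > 2m. -/
theorem exists_lintegral_oscWeight_fst_le (hm : 1 ≤ m) (hmn : 2 * m < n) (L : ℝ) {N : ℕ}
    (hN : ((n : ℝ) - 3) / 2 + 2 < N) :
    ∃ C : ℝ≥0, ∀ r₂ : ℝ, 0 ≤ r₂ → ∫⁻ x : EuclideanSpace ℝ (Fin n), ∫⁻ t in Ioo 0 L,
      ENNReal.ofReal (‖x‖ ^ (2 * m - n : ℝ) *
        oscWeight m (n - 1) N (((n : ℝ) - 3) / 2) (((n : ℝ) - 3) / 2) ‖x‖ r₂ t) ≤ C := by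
  have hn3 : 3 ≤ n := by omega
  have : Nontrivial (EuclideanSpace ℝ (Fin n)) :=
    Module.nontrivial_of_finrank_pos (R := ℝ) (by rw [finrank_euclideanSpace_fin]; omega)
  have hn3' : (3 : ℝ) ≤ n := by exact_mod_cast hn3
  set a := ((n : ℝ) - 3) / 2 with ha
  have ha0 : 0 ≤ a := by rw [ha]; linarith
  obtain ⟨C, hC, hpe⟩ := exists_lintegral_peetre_le (q := a + 1) (by linarith) (N := N) (by linarith)
  set S := (volume : Measure (EuclideanSpace ℝ (Fin n))).toSphere univ with hS
  have hSt : S ≠ ⊤ := measure_ne_top _ _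
  refine ⟨(∫⁻ t in Ioo 0 L, S * ENNReal.ofReal (C * L ^ (n - 1 - 2 * m))).toNNReal, fun r₂ hr₂ => ?_⟩
  have hfin : ∫⁻ t in Ioo 0 L, S * ENNReal.ofReal (C * L ^ (n - 1 - 2 * m)) ≠ ⊤ := by
    rw [lintegral_const]
    exact ENNReal.mul_ne_top (ENNReal.mul_ne_top hSt ENNReal.ofReal_ne_top) (by simp)
  rw [ENNReal.coe_toNNReal hfin]
  have hmeas : Measurable fun z : ℝ × ℝ => ENNReal.ofReal (z.1 ^ (2 * m - n : ℝ) *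
      oscWeight m (n - 1) N a a z.1 r₂ z.2) := by
    have h1 := (measurable_oscWeight (m := m) (n - 1) N a a).comp
      (by fun_prop : Measurable fun z : ℝ × ℝ => (z.1, r₂, z.2))
    exact ENNReal.measurable_ofReal.comp ((by fun_prop : Measurable fun z : ℝ × ℝ => z.1 ^ (2 * m - n : ℝ)).mul h1)
  have hcomp := hmeas.comp (by fun_prop : Measurable fun z : EuclideanSpace ℝ (Fin n) × ℝ => (‖z.1‖, z.2))
  refine (lintegral_lintegral_swap (by exact hcomp.aemeasurable)).trans_le ?_
  refine setLIntegral_mono' measurableSet_Ioo fun t ht => ?_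
  have ht0 := ht.1
  rw [lintegral_fun_norm volume (f := fun r => ENNReal.ofReal (r ^ (2 * m - n : ℝ) *
      oscWeight m (n - 1) N a a r r₂ t)) (hmeas.comp (by fun_prop : Measurable fun r : ℝ => (r, t))),
      finrank_euclideanSpace_fin]
  refine mul_le_mul_right ?_ S
  have hpt : ∀ r ∈ Ioi (0 : ℝ), ENNReal.ofReal (r ^ (n - 1)) * ENNReal.ofReal (r ^ (2 * m - n : ℝ) *
      oscWeight m (n - 1) N a a r r₂ t) ≤
      ENNReal.ofReal (t ^ (n - 1) * (t ^ (2 * m - 1))⁻¹ * (1 + t * r₂) ^ (-(a + 1))) *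
      ENNReal.ofReal ((1 + t * r) ^ (a + 1) * ((1 + t * |r - r₂|) ^ N)⁻¹) := by
    intro r hr
    have hr' : (0 : ℝ) < r := hr
    rw [← ENNReal.ofReal_mul (by positivity), ← ENNReal.ofReal_mul (by positivity)]
    refine ENNReal.ofReal_le_ofReal ?_
    have e1 : r ^ (n - 1) * r ^ (2 * m - n : ℝ) = r ^ (2 * m - 1) := by
      rw [← Real.rpow_natCast, ← Real.rpow_natCast, ← Real.rpow_add hr']
      congr 1
      push_cast [Nat.cast_sub (by omega : 1 ≤ n), Nat.cast_sub (by omega : 1 ≤ 2 * m)]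
      ring
    have e2 : (1 + t * r) ^ (a + 1) = (1 + t * r) ^ (2 * m - 1) * (1 + t * r) ^ outExp m a := by
      rw [← Real.rpow_natCast, ← Real.rpow_add (by positivity)]
      congr 1
      rw [outExp]
      push_cast [Nat.cast_sub hm, Nat.cast_sub (by omega : 1 ≤ 2 * m)]
      ring
    have h1 := pow_le_inv_mul_one_add_pow ht0 hr'.le (2 * m - 1)
    rw [oscWeight, e2, ← mul_assoc, e1]
    calc r ^ (2 * m - 1) * (t ^ (n - 1) * (1 + t * r) ^ outExp m a * (1 + t * r₂) ^ (-(a + 1)) *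
          ((1 + t * |r - r₂|) ^ N)⁻¹)
        ≤ ((t ^ (2 * m - 1))⁻¹ * (1 + t * r) ^ (2 * m - 1)) * (t ^ (n - 1) * (1 + t * r) ^ outExp m a *
          (1 + t * r₂) ^ (-(a + 1)) * ((1 + t * |r - r₂|) ^ N)⁻¹) := by gcongr
      _ = _ := by ring
  refine (setLIntegral_mono' measurableSet_Ioi hpt).trans ?_
  rw [lintegral_const_mul' _ _ ENNReal.ofReal_ne_top]
  refine (mul_le_mul_right (hpe t r₂ ht0 hr₂) _).trans ?_
  rw [← ENNReal.ofReal_mul (by positivity)]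
  refine ENNReal.ofReal_le_ofReal ?_
  have e3 : (1 + t * r₂) ^ (-(a + 1)) * (1 + t * r₂) ^ (a + 1) = 1 := by
    rw [← Real.rpow_add (by positivity)]; simp
  have e4 : t ^ (n - 1) * (t ^ (2 * m - 1))⁻¹ * t⁻¹ = t ^ (n - 1 - 2 * m) := by
    rw [mul_assoc, ← mul_inv, ← pow_succ, ← div_eq_mul_inv, div_eq_iff (by positivity), ← pow_add]
    congr 1; omega
  calc t ^ (n - 1) * (t ^ (2 * m - 1))⁻¹ * (1 + t * r₂) ^ (-(a + 1)) * (C * t⁻¹ * (1 + t * r₂) ^ (a + 1))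
      = C * (t ^ (n - 1) * (t ^ (2 * m - 1))⁻¹ * t⁻¹) *
          ((1 + t * r₂) ^ (-(a + 1)) * (1 + t * r₂) ^ (a + 1)) := by ring
    _ = C * t ^ (n - 1 - 2 * m) := by rw [e3, e4, mul_one]
    _ ≤ _ := by
      gcongr
      exact ht.2.le

/-- The volume factor costs t^{-(n-1)} and scaling costs t⁻¹, so the weight t^n just suffices; with
t^{n-1} the t-integral would diverge logarithmically. The improved decay of order a + 2 leaves the
exponent a in r, hence growth (1 + tr₁)^{n-1-2m} after Peetre's inequality. -/
theorem exists_lintegral_oscWeight_snd_le (hm : 1 ≤ m) (hmn : 2 * m < n) (L : ℝ) {N : ℕ}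
    (hN : ((n : ℝ) - 3) / 2 + 1 < N) :
    ∃ C : ℝ≥0, ∀ r₁ : ℝ, 0 < r₁ → ∫⁻ y : EuclideanSpace ℝ (Fin n), ∫⁻ t in Ioo 0 L,
      ENNReal.ofReal (r₁ ^ (2 * m - n : ℝ) * ((1 + r₁) *
        oscWeight m n N (((n : ℝ) - 3) / 2) (((n : ℝ) - 3) / 2 + 1) r₁ ‖y‖ t)) ≤
      C * ENNReal.ofReal (resWeight n m r₁) := by
  have hn3 : 3 ≤ n := by omega
  have : Nontrivial (EuclideanSpace ℝ (Fin n)) :=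
    Module.nontrivial_of_finrank_pos (R := ℝ) (by rw [finrank_euclideanSpace_fin]; omega)
  have hn3' : (3 : ℝ) ≤ n := by exact_mod_cast hn3
  set a := ((n : ℝ) - 3) / 2 with ha
  have ha0 : 0 ≤ a := by rw [ha]; linarith
  obtain ⟨C, hC, hpe⟩ := exists_lintegral_peetre_le (q := a) ha0 (N := N) (by linarith)
  set S := (volume : Measure (EuclideanSpace ℝ (Fin n))).toSphere univ with hS
  have hSt : S ≠ ⊤ := measure_ne_top _ _
  set K := S * ENNReal.ofReal (2 * C * (1 + L) ^ (n - 2 * m)) * volume (Ioo 0 L) with hK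
  have hfin : K ≠ ⊤ :=
    ENNReal.mul_ne_top (ENNReal.mul_ne_top hSt ENNReal.ofReal_ne_top) (by simp)
  refine ⟨K.toNNReal, fun r₁ hr₁ => ?_⟩
  rw [ENNReal.coe_toNNReal hfin]
  have hmeas : Measurable fun z : ℝ × ℝ => ENNReal.ofReal (r₁ ^ (2 * m - n : ℝ) * ((1 + r₁) *
      oscWeight m n N a (a + 1) r₁ z.1 z.2)) := by
    have h1 := (measurable_oscWeight (m := m) n N a (a + 1)).comp
      (by fun_prop : Measurable fun z : ℝ × ℝ => (r₁, z.1, z.2))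
    exact ENNReal.measurable_ofReal.comp ((h1.const_mul _).const_mul _)
  have hcomp := hmeas.comp (by fun_prop : Measurable fun z : EuclideanSpace ℝ (Fin n) × ℝ => (‖z.1‖, z.2))
  refine (lintegral_lintegral_swap (by exact hcomp.aemeasurable)).trans_le ?_
  have hKeq : K * ENNReal.ofReal (resWeight n m r₁) = ∫⁻ t in Ioo 0 L,
      S * ENNReal.ofReal (2 * C * (1 + L) ^ (n - 2 * m) * resWeight n m r₁) := by
    have hL2 : 0 ≤ L ∨ L < 0 := le_or_gt 0 L
    rcases hL2 with hL | hL
    · rw [lintegral_const, ENNReal.ofReal_mul (by positivity), Measure.restrict_apply_univ, hK]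
      ring
    · rw [lintegral_const, Measure.restrict_apply_univ, hK, Ioo_eq_empty (by linarith)]; simp
  rw [hKeq]
  refine setLIntegral_mono' measurableSet_Ioo fun t ht => ?_
  have ht0 := ht.1
  rw [lintegral_fun_norm volume (f := fun r => ENNReal.ofReal (r₁ ^ (2 * m - n : ℝ) * ((1 + r₁) *
      oscWeight m n N a (a + 1) r₁ r t))) (hmeas.comp (by fun_prop : Measurable fun r : ℝ => (r, t))),
      finrank_euclideanSpace_fin]
  refine mul_le_mul_right ?_ S
  have hpt : ∀ r ∈ Ioi (0 : ℝ), ENNReal.ofReal (r ^ (n - 1)) * ENNReal.ofReal (r₁ ^ (2 * m - n : ℝ) *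
      ((1 + r₁) * oscWeight m n N a (a + 1) r₁ r t)) ≤
      ENNReal.ofReal (t * (r₁ ^ (2 * m - n : ℝ) * ((1 + r₁) * (1 + t * r₁) ^ outExp m a))) *
      ENNReal.ofReal ((1 + t * r) ^ a * ((1 + t * |r - r₁|) ^ N)⁻¹) := by
    intro r hr
    have hr' : (0 : ℝ) < r := hr
    rw [← ENNReal.ofReal_mul (by positivity), ← ENNReal.ofReal_mul (by positivity)]
    refine ENNReal.ofReal_le_ofReal ?_
    have e2 : (1 + t * r) ^ a = (1 + t * r) ^ (n - 1) * (1 + t * r) ^ (-(a + 1 + 1)) := by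
      rw [← Real.rpow_natCast, ← Real.rpow_add (by positivity)]
      congr 1
      push_cast [Nat.cast_sub (by omega : 1 ≤ n)]
      rw [ha]; ring
    have e3 : t ^ n = t * t ^ (n - 1) := by rw [← pow_succ']; congr 1; omega
    have h1 := pow_le_inv_mul_one_add_pow ht0 hr'.le (n - 1)
    rw [oscWeight, e2, abs_sub_comm r₁ r]
    calc r ^ (n - 1) * (r₁ ^ (2 * m - n : ℝ) * ((1 + r₁) * (t ^ n * (1 + t * r₁) ^ outExp m a *
          (1 + t * r) ^ (-(a + 1 + 1)) * ((1 + t * |r - r₁|) ^ N)⁻¹)))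
        ≤ ((t ^ (n - 1))⁻¹ * (1 + t * r) ^ (n - 1)) * (r₁ ^ (2 * m - n : ℝ) * ((1 + r₁) *
          (t ^ n * (1 + t * r₁) ^ outExp m a *
          (1 + t * r) ^ (-(a + 1 + 1)) * ((1 + t * |r - r₁|) ^ N)⁻¹))) := by gcongr
      _ = _ := by rw [e3]; field_simp
  refine (setLIntegral_mono' measurableSet_Ioi hpt).trans ?_
  rw [lintegral_const_mul' _ _ ENNReal.ofReal_ne_top]
  refine (mul_le_mul_right (hpe t r₁ ht0 hr₁.le) _).trans ?_
  rw [← ENNReal.ofReal_mul (by positivity)]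
  refine ENNReal.ofReal_le_ofReal ?_
  have e4 : (1 + t * r₁) ^ outExp m a * (1 + t * r₁) ^ a = (1 + t * r₁) ^ (n - 1 - 2 * m) := by
    rw [← Real.rpow_natCast, ← Real.rpow_add (by positivity)]
    congr 1
    rw [outExp]
    push_cast [Nat.cast_sub hm, Nat.cast_sub (by omega : 1 ≤ n), Nat.cast_sub (by omega : 2 * m ≤ n - 1)]
    rw [ha]; ring
  have hkey : r₁ ^ (2 * m - n : ℝ) * ((1 + r₁) * (1 + t * r₁) ^ (n - 1 - 2 * m)) ≤
      2 * (1 + L) ^ (n - 2 * m) * resWeight n m r₁ :=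
    rpow_mul_one_add_mul_pow_le hmn ht0.le ht.2.le hr₁
  calc t * (r₁ ^ (2 * m - n : ℝ) * ((1 + r₁) * (1 + t * r₁) ^ outExp m a)) * (C * t⁻¹ * (1 + t * r₁) ^ a)
      = C * (r₁ ^ (2 * m - n : ℝ) * ((1 + r₁) * ((1 + t * r₁) ^ outExp m a * (1 + t * r₁) ^ a))) := by
        field_simp
    _ ≤ C * (2 * (1 + L) ^ (n - 2 * m) * resWeight n m r₁) := by rw [e4]; gcongr
    _ = _ := by ring

end


/-! ### The Schur test -/

/-- Comparison of the L¹ and L^q norms for the measure k dμ, whose mass is at most A. -/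
theorem rpow_lintegral_mul_le {α : Type*} [MeasurableSpace α] {μ : Measure α} {k : α → ℝ≥0∞}
    (hk : AEMeasurable k μ) {A : ℝ≥0∞} (hA : ∫⁻ y, k y ∂μ ≤ A) {f : α → ℂ}
    (hf : AEStronglyMeasurable f μ) {q : ℝ} (hq : 1 ≤ q) :
    (∫⁻ y, k y * ‖f y‖ₑ ∂μ) ^ q ≤ A ^ (q - 1) * ∫⁻ y, k y * ‖f y‖ₑ ^ q ∂μ := by
  have hq0 : 0 < q := by linarith
  have hac : μ.withDensity k ≪ μ := withDensity_absolutelyContinuous _ _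
  have hfν : AEStronglyMeasurable f (μ.withDensity k) := hf.mono_ac hac
  have h1 := eLpNorm_le_eLpNorm_mul_rpow_measure_univ (p := 1) (q := ENNReal.ofReal q)
    (by rw [← ENNReal.ofReal_one]; exact ENNReal.ofReal_le_ofReal hq) hfν
  rw [eLpNorm_one_eq_lintegral_enorm, eLpNorm_eq_lintegral_rpow_enorm_toReal (by simpa using hq0)
    ENNReal.ofReal_ne_top, ENNReal.toReal_ofReal hq0.le, withDensity_apply _ MeasurableSet.univ,
    Measure.restrict_univ, lintegral_withDensity_eq_lintegral_mul₀ hk hf.enorm,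
    lintegral_withDensity_eq_lintegral_mul₀ hk (hf.enorm.pow_const q)] at h1
  simp only [Pi.mul_apply] at h1
  have h2 := ENNReal.rpow_le_rpow h1 hq0.le
  rw [ENNReal.mul_rpow_of_nonneg _ _ hq0.le, ← ENNReal.rpow_mul, ← ENNReal.rpow_mul,
    one_div_mul_cancel hq0.ne', ENNReal.rpow_one] at h2
  have e : (1 / ENNReal.toReal 1 - 1 / q) * q = q - 1 := by
    rw [ENNReal.toReal_one]; field_simp
  rw [e, mul_comm] at h2
  refine h2.trans ?_
  gcongr

variable {n : ℕ}

theorem Admissible.kernelBoundedLp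
    {K : EuclideanSpace ℝ (Fin n) → EuclideanSpace ℝ (Fin n) → ℂ} (hK : Admissible K) {p : ℝ≥0∞}
    (hp : 1 ≤ p) : KernelBoundedLp K p := by
  obtain ⟨hKm, hKA⟩ := hK
  set A := (⨆ x, ∫⁻ y, ‖K x y‖ₑ) + (⨆ y, ∫⁻ x, ‖K x y‖ₑ) with hA
  have hrow : ∀ x, ∫⁻ y, ‖K x y‖ₑ ≤ A := fun x =>
    (le_iSup (fun x => ∫⁻ y, ‖K x y‖ₑ) x).trans le_self_add
  have hcol : ∀ y, ∫⁻ x, ‖K x y‖ₑ ≤ A := fun y =>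
    (le_iSup (fun y => ∫⁻ x, ‖K x y‖ₑ) y).trans le_add_self
  refine ⟨A.toNNReal, fun f hf => ?_⟩
  rw [ENNReal.coe_toNNReal hKA.ne]
  have hfm := hf.1
  have hprod : AEStronglyMeasurable (fun z : EuclideanSpace ℝ (Fin n) × EuclideanSpace ℝ (Fin n) =>
      K z.1 z.2 * f z.2) (volume.prod volume) := hKm.mul hfm.comp_snd
  have hmeas : AEStronglyMeasurable (fun x => ∫ y, K x y * f y) volume := hprod.integral_prod_right'
  have hle : ∀ x, ‖∫ y, K x y * f y‖ₑ ≤ ∫⁻ y, ‖K x y‖ₑ * ‖f y‖ₑ := by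
    intro x
    refine (enorm_integral_le_lintegral_enorm _).trans (le_of_eq ?_)
    simp only [enorm_mul]
  have hsec : ∀ᵐ x, AEStronglyMeasurable (fun y => K x y) volume := hKm.prodMk_left
  have hkey : (∀ᵐ x, ∫⁻ y, ‖K x y‖ₑ * ‖f y‖ₑ < ⊤) ∧
      eLpNorm (fun x => ∫ y, K x y * f y) p volume ≤ A * eLpNorm f p volume := by
    -- At p = ∞ the row bound alone suffices. For finite p the previous lemma uses the rows, and
    -- Tonelli's theorem then uses the columns.
    rcases eq_or_ne p ⊤ with rfl | hpt
    · have hb : ∀ x, ∫⁻ y, ‖K x y‖ₑ * ‖f y‖ₑ ≤ A * eLpNorm f ⊤ volume := by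
        intro x
        calc ∫⁻ y, ‖K x y‖ₑ * ‖f y‖ₑ ≤ ∫⁻ y, ‖K x y‖ₑ * eLpNorm f ⊤ volume := by
              refine lintegral_mono_ae ?_
              rw [eLpNorm_exponent_top]
              filter_upwards [enorm_ae_le_eLpNormEssSup f volume] with y hy
              gcongr
          _ = (∫⁻ y, ‖K x y‖ₑ) * eLpNorm f ⊤ volume := lintegral_mul_const' _ _ hf.2.ne
          _ ≤ _ := by gcongr; exact hrow x
      refine ⟨Eventually.of_forall fun x => (hb x).trans_lt (ENNReal.mul_lt_top hKA hf.2), ?_⟩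
      rw [eLpNorm_exponent_top, eLpNormEssSup]
      exact essSup_le_of_ae_le _ (Eventually.of_forall fun x => (hle x).trans (hb x))
    · have hp0 : p ≠ 0 := (zero_lt_one.trans_le hp).ne'
      set q := p.toReal with hq
      have hq1 : 1 ≤ q := by
        rw [hq, ← ENNReal.toReal_one]; exact ENNReal.toReal_mono hpt hp
      have hq0 : 0 < q := by linarith
      have hFm : AEMeasurable (fun x => ∫⁻ y, ‖K x y‖ₑ * ‖f y‖ₑ) volume := by
        have := hprod.enorm.lintegral_prod_right'
        simpa only [enorm_mul] using this
      have hFq : ∫⁻ x, (∫⁻ y, ‖K x y‖ₑ * ‖f y‖ₑ) ^ q ≤ A ^ q * ∫⁻ y, ‖f y‖ₑ ^ q := by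
        have hAt : A ^ (q - 1) ≠ ⊤ := ENNReal.rpow_ne_top_of_nonneg (by linarith) hKA.ne
        calc ∫⁻ x, (∫⁻ y, ‖K x y‖ₑ * ‖f y‖ₑ) ^ q
            ≤ ∫⁻ x, A ^ (q - 1) * ∫⁻ y, ‖K x y‖ₑ * ‖f y‖ₑ ^ q := by
              refine lintegral_mono_ae ?_
              filter_upwards [hsec] with x hx
              exact rpow_lintegral_mul_le hx.enorm (hrow x) hfm hq1
          _ = A ^ (q - 1) * ∫⁻ x, ∫⁻ y, ‖K x y‖ₑ * ‖f y‖ₑ ^ q := lintegral_const_mul' _ _ hAt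
          _ = A ^ (q - 1) * ∫⁻ y, ∫⁻ x, ‖K x y‖ₑ * ‖f y‖ₑ ^ q := by
              rw [lintegral_lintegral_swap]
              exact hKm.enorm.mul ((hfm.enorm.pow_const q).comp_snd)
          _ ≤ A ^ (q - 1) * ∫⁻ y, A * ‖f y‖ₑ ^ q := by
              gcongr with y
              rw [lintegral_mul_const' _ _ (ENNReal.rpow_ne_top_of_nonneg hq0.le enorm_ne_top)]
              gcongr
              exact hcol y
          _ = A ^ q * ∫⁻ y, ‖f y‖ₑ ^ q := by
              rw [lintegral_const_mul' _ _ hKA.ne, ← mul_assoc]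
              congr 1
              rcases eq_or_ne A 0 with h0 | h0
              · rw [h0, mul_zero, ENNReal.zero_rpow_of_pos hq0]
              · conv_lhs => rw [← ENNReal.rpow_one A, ← ENNReal.rpow_mul, ← ENNReal.rpow_add _ _ h0 hKA.ne]
                congr 1; ring
      have hfin : ∫⁻ y, ‖f y‖ₑ ^ q < ⊤ :=
        lintegral_rpow_enorm_lt_top_of_eLpNorm_lt_top hp0 hpt hf.2
      constructor
      · have h1 : ∫⁻ x, (∫⁻ y, ‖K x y‖ₑ * ‖f y‖ₑ) ^ q ≠ ⊤ :=
          (hFq.trans_lt (ENNReal.mul_lt_top (ENNReal.rpow_lt_top_of_nonneg hq0.le hKA.ne) hfin)).ne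
        filter_upwards [ae_lt_top' (hFm.pow_const q) h1] with x hx
        exact (ENNReal.rpow_lt_top_iff_of_pos hq0).1 hx
      · rw [eLpNorm_eq_lintegral_rpow_enorm_toReal hp0 hpt, eLpNorm_eq_lintegral_rpow_enorm_toReal hp0 hpt,
          ← hq]
        have h1 : ∫⁻ x, ‖∫ y, K x y * f y‖ₑ ^ q ≤ A ^ q * ∫⁻ y, ‖f y‖ₑ ^ q :=
          (lintegral_mono fun x => ENNReal.rpow_le_rpow (hle x) hq0.le).trans hFq
        refine (ENNReal.rpow_le_rpow h1 (by positivity)).trans (le_of_eq ?_)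
        rw [ENNReal.mul_rpow_of_nonneg _ _ (by positivity), ← ENNReal.rpow_mul,
          mul_one_div_cancel hq0.ne', ENNReal.rpow_one]
  refine ⟨?_, ⟨hmeas, hkey.2.trans_lt (ENNReal.mul_lt_top hKA hf.2)⟩, hkey.2⟩
  filter_upwards [hkey.1, hsec] with x hx hxm
  refine ⟨hxm.mul hfm, ?_⟩
  rw [hasFiniteIntegral_iff_enorm]
  simpa only [enorm_mul] using hx


/-! ### The potential and the majorant of `Γ` -/

section

variable {n : ℕ}

theorem one_le_bracket (x : EuclideanSpace ℝ (Fin n)) : 1 ≤ bracket x := by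
  rw [bracket, Real.one_le_sqrt]
  nlinarith [sq_nonneg ‖x‖]

theorem bracket_pos (x : EuclideanSpace ℝ (Fin n)) : 0 < bracket x :=
  zero_lt_one.trans_le (one_le_bracket x)

theorem measurable_bracket : Measurable (bracket (n := n)) := by
  unfold bracket
  fun_prop

theorem bracket_rpow (x : EuclideanSpace ℝ (Fin n)) (b : ℝ) :
    bracket x ^ b = (1 + ‖x‖ ^ 2) ^ (b / 2) := by
  rw [bracket, Real.sqrt_eq_rpow, ← Real.rpow_mul (by positivity)]
  congr 1; ring

theorem integrable_bracket_rpow {b : ℝ} (hb : (n : ℝ) < b) :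
    Integrable (fun x : EuclideanSpace ℝ (Fin n) => bracket x ^ (-b)) := by
  simp only [bracket_rpow]
  exact integrable_rpow_neg_one_add_norm_sq (by simpa using hb)

theorem lintegral_bracket_rpow_lt_top {b : ℝ} (hb : (n : ℝ) < b) :
    ∫⁻ x : EuclideanSpace ℝ (Fin n), ENNReal.ofReal (bracket x ^ (-b)) < ⊤ := by
  rw [← ofReal_integral_eq_lintegral_ofReal (integrable_bracket_rpow hb)
    (Eventually.of_forall fun x => Real.rpow_nonneg (bracket_pos x).le _)]
  exact ENNReal.ofReal_lt_top

/-- Split at |x - z| = 1. Inside, the bracket is at most 1 and the singularity is integrable because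
s < n. Outside, the singular factor is at most 1 and the bracket is integrable because b > n. Both
bounds are translation invariant or free of x. -/
theorem exists_lintegral_bracket_mul_rpow_le (hn : 0 < n) {b s : ℝ} (hb : (n : ℝ) < b) (hs0 : 0 ≤ s)
    (hs : s < n) :
    ∃ C : ℝ≥0, ∀ x : EuclideanSpace ℝ (Fin n), ∫⁻ z : EuclideanSpace ℝ (Fin n),
      ENNReal.ofReal (bracket z ^ (-b) * ‖x - z‖ ^ (-s)) ≤ C := by
  have : Nontrivial (EuclideanSpace ℝ (Fin n)) :=
    Module.nontrivial_of_finrank_pos (R := ℝ) (by rw [finrank_euclideanSpace_fin]; exact hn)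
  set f : ℝ → ℝ := (Iio (1 : ℝ)).indicator fun r => r ^ (-s) with hf
  have hint : Integrable (fun z : EuclideanSpace ℝ (Fin n) => f ‖z‖) := by
    have h1 : IntegrableOn (fun z : EuclideanSpace ℝ (Fin n) => ‖z‖ ^ (-s)) (Metric.ball 0 1) := by
      rw [integrableOn_fun_norm_addHaar volume (f := fun r => r ^ (-s)), finrank_euclideanSpace_fin]
      have h2 := (intervalIntegral.integrableOn_Ioo_rpow_iff (s := (n : ℝ) - 1 - s) one_pos).2 (by linarith)
      refine IntegrableOn.congr_fun h2 (fun r hr => ?_) measurableSet_Ioo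
      have hr0 : 0 < r := hr.1
      simp only [smul_eq_mul]
      rw [← Real.rpow_natCast, ← Real.rpow_add hr0]
      congr 1
      push_cast [Nat.cast_sub (by omega : 1 ≤ n)]
      ring
    rw [← integrable_indicator_iff measurableSet_ball] at h1
    refine h1.congr (Eventually.of_forall fun z => ?_)
    simp [hf, indicator]
  have hf0 : ∀ r, 0 ≤ r → 0 ≤ f r := fun r hr =>
    indicator_apply_nonneg fun _ => Real.rpow_nonneg hr _
  have hF : ∫⁻ z : EuclideanSpace ℝ (Fin n), ENNReal.ofReal (f ‖z‖) < ⊤ := by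
    rw [← ofReal_integral_eq_lintegral_ofReal hint (Eventually.of_forall fun z => hf0 _ (norm_nonneg _))]
    exact ENNReal.ofReal_lt_top
  have hB := lintegral_bracket_rpow_lt_top (n := n) hb
  refine ⟨((∫⁻ z : EuclideanSpace ℝ (Fin n), ENNReal.ofReal (f ‖z‖)) +
    ∫⁻ z : EuclideanSpace ℝ (Fin n), ENNReal.ofReal (bracket z ^ (-b))).toNNReal, fun x => ?_⟩
  rw [ENNReal.coe_toNNReal (ENNReal.add_lt_top.2 ⟨hF, hB⟩).ne]
  have hfm : Measurable f := (by fun_prop : Measurable fun r : ℝ => r ^ (-s)).indicator measurableSet_Iio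
  calc ∫⁻ z : EuclideanSpace ℝ (Fin n), ENNReal.ofReal (bracket z ^ (-b) * ‖x - z‖ ^ (-s))
      ≤ ∫⁻ z : EuclideanSpace ℝ (Fin n), (ENNReal.ofReal (f ‖x - z‖) + ENNReal.ofReal (bracket z ^ (-b))) := by
        refine lintegral_mono fun z => ?_
        have h0 : 0 ≤ bracket z ^ (-b) := Real.rpow_nonneg (bracket_pos z).le _
        have h1 : bracket z ^ (-b) ≤ 1 :=
          Real.rpow_le_one_of_one_le_of_nonpos (one_le_bracket z) (by linarith [Nat.cast_nonneg (α := ℝ) n])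
        have h2 : 0 ≤ ‖x - z‖ ^ (-s) := by positivity
        rw [← ENNReal.ofReal_add (hf0 _ (norm_nonneg _)) h0]
        refine ENNReal.ofReal_le_ofReal ?_
        rcases lt_or_ge ‖x - z‖ 1 with h | h
        · rw [hf, indicator_of_mem (mem_Iio.2 h)]
          nlinarith
        · have h3 : ‖x - z‖ ^ (-s) ≤ 1 := Real.rpow_le_one_of_one_le_of_nonpos h (by linarith)
          have h4 := hf0 ‖x - z‖ (norm_nonneg _)
          nlinarith
    _ = _ := by
        rw [lintegral_add_left (by fun_prop)]
        congr 1
        exact lintegral_sub_left_eq_self (fun z : EuclideanSpace ℝ (Fin n) => ENNReal.ofReal (f ‖z‖)) x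

theorem sqrt_abs_le_bracket {V : EuclideanSpace ℝ (Fin n) → ℝ} {β C : ℝ} {x : EuclideanSpace ℝ (Fin n)}
    (h : |V x| ≤ C * bracket x ^ (-β)) :
    Real.sqrt |V x| ≤ Real.sqrt |C| * bracket x ^ (-(β / 2)) := by
  have hb := bracket_pos x
  have h1 : Real.sqrt (bracket x ^ (-β)) = bracket x ^ (-(β / 2)) := by
    rw [Real.sqrt_eq_rpow, ← Real.rpow_mul hb.le]
    congr 1; ring
  rw [← h1, ← Real.sqrt_mul (abs_nonneg C)]
  refine Real.sqrt_le_sqrt (h.trans ?_)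
  exact mul_le_mul_of_nonneg_right (le_abs_self C) (Real.rpow_nonneg hb.le _)

/-- Each factor v contributes decay of order β/2, so v Γ̃ v decays in each variable like the bracket
to the power -b with b = n/2 + ε + β/2 > n. The singularity of order n - 2m is locally integrable.
-/
theorem exists_majorant_of_pointwise {m : ℕ} (hm : 1 ≤ m) (hmn : 2 * m < n)
    {V : EuclideanSpace ℝ (Fin n) → ℝ} {β : ℝ} (hβ : (n : ℝ) < β)
    (hV : ∃ C : ℝ, ∀ᵐ x, |V x| ≤ C * bracket x ^ (-β))
    {k : EuclideanSpace ℝ (Fin n) → EuclideanSpace ℝ (Fin n) → ℝ≥0∞} {C ε : ℝ} (hε : 0 < ε)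
    (hk : ∀ᵐ z : EuclideanSpace ℝ (Fin n) × EuclideanSpace ℝ (Fin n) ∂(volume.prod volume),
      k z.1 z.2 ≤ ENNReal.ofReal
        (C * bracket z.1 ^ (-(n : ℝ) / 2 - ε) * bracket z.2 ^ (-(n : ℝ) / 2 - ε))) :
    ∃ H : EuclideanSpace ℝ (Fin n) × EuclideanSpace ℝ (Fin n) → ℝ≥0∞, Measurable H ∧
      (∀ᵐ z ∂(volume.prod volume), ENNReal.ofReal (Real.sqrt |V z.1|) * k z.1 z.2 *
        ENNReal.ofReal (Real.sqrt |V z.2|) ≤ H z) ∧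
      ∃ B : ℝ≥0, ∀ x, ∫⁻ z, H z * ENNReal.ofReal (resWeight n m ‖x - z.1‖) ∂(volume.prod volume) ≤ B := by
  obtain ⟨D, hD⟩ := hV
  have hmn' : (2 * m : ℝ) < n := by exact_mod_cast hmn
  set b := (n : ℝ) / 2 + ε + β / 2 with hb
  have hbn : (n : ℝ) < b := by rw [hb]; linarith
  obtain ⟨C₁, hC₁⟩ := exists_lintegral_bracket_mul_rpow_le (n := n) (by omega) hbn
    (by linarith : (0 : ℝ) ≤ n - 2 * m) (by have : (1 : ℝ) ≤ m := by exact_mod_cast hm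
                                            linarith)
  have hB := lintegral_bracket_rpow_lt_top (n := n) hbn
  set B₀ := ∫⁻ x : EuclideanSpace ℝ (Fin n), ENNReal.ofReal (bracket x ^ (-b)) with hB₀
  set M := |D| * |C| with hM
  have hmb : Measurable fun z : EuclideanSpace ℝ (Fin n) => ENNReal.ofReal (bracket z ^ (-b)) :=
    ENNReal.measurable_ofReal.comp (measurable_bracket.pow_const _)
  refine ⟨fun z => ENNReal.ofReal M * (ENNReal.ofReal (bracket z.1 ^ (-b)) *
    ENNReal.ofReal (bracket z.2 ^ (-b))), ?_, ?_,
    (ENNReal.ofReal M * ((B₀ + C₁) * B₀)).toNNReal, fun x => ?_⟩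
  · exact Measurable.const_mul ((hmb.comp measurable_fst).mul (hmb.comp measurable_snd)) _
  · filter_upwards [hk, Measure.quasiMeasurePreserving_fst.ae hD, Measure.quasiMeasurePreserving_snd.ae hD]
      with z h1 h2 h3
    refine (mul_le_mul' (mul_le_mul' (ENNReal.ofReal_le_ofReal (sqrt_abs_le_bracket h2)) h1)
      (ENNReal.ofReal_le_ofReal (sqrt_abs_le_bracket h3))).trans ?_
    have p1 := bracket_pos z.1
    have p2 := bracket_pos z.2
    rw [← ENNReal.ofReal_mul (by positivity), ← ENNReal.ofReal_mul' (by positivity),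
      ← ENNReal.ofReal_mul (by positivity), ← ENNReal.ofReal_mul (by positivity)]
    refine ENNReal.ofReal_le_ofReal ?_
    have e : ∀ {t : ℝ}, 0 < t → t ^ (-b) = t ^ (-(n : ℝ) / 2 - ε) * t ^ (-(β / 2)) := by
      intro t ht
      rw [← Real.rpow_add ht]; congr 1; rw [hb]; ring
    rw [e p1, e p2, hM]
    have hs : Real.sqrt |D| * Real.sqrt |D| = |D| := Real.mul_self_sqrt (abs_nonneg D)
    have hpos : 0 ≤ |D| * ((bracket z.1 ^ (-(n : ℝ) / 2 - ε) * bracket z.1 ^ (-(β / 2))) *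
      (bracket z.2 ^ (-(n : ℝ) / 2 - ε) * bracket z.2 ^ (-(β / 2)))) := by positivity
    calc Real.sqrt |D| * bracket z.1 ^ (-(β / 2)) *
          (C * bracket z.1 ^ (-(n : ℝ) / 2 - ε) * bracket z.2 ^ (-(n : ℝ) / 2 - ε)) *
          (Real.sqrt |D| * bracket z.2 ^ (-(β / 2)))
        = C * ((Real.sqrt |D| * Real.sqrt |D|) *
          ((bracket z.1 ^ (-(n : ℝ) / 2 - ε) * bracket z.1 ^ (-(β / 2))) *
          (bracket z.2 ^ (-(n : ℝ) / 2 - ε) * bracket z.2 ^ (-(β / 2))))) := by ring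
      _ ≤ |C| * ((Real.sqrt |D| * Real.sqrt |D|) *
          ((bracket z.1 ^ (-(n : ℝ) / 2 - ε) * bracket z.1 ^ (-(β / 2))) *
          (bracket z.2 ^ (-(n : ℝ) / 2 - ε) * bracket z.2 ^ (-(β / 2))))) := by
          rw [hs]; exact mul_le_mul_of_nonneg_right (le_abs_self C) hpos
      _ = _ := by rw [hs]; ring
  · have hfin : ENNReal.ofReal M * ((B₀ + C₁) * B₀) ≠ ⊤ :=
      ENNReal.mul_ne_top ENNReal.ofReal_ne_top
        (ENNReal.mul_ne_top (ENNReal.add_ne_top.2 ⟨hB.ne, ENNReal.coe_ne_top⟩) hB.ne)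
    rw [ENNReal.coe_toNNReal hfin]
    have e : ∀ z : EuclideanSpace ℝ (Fin n) × EuclideanSpace ℝ (Fin n),
        ENNReal.ofReal M * (ENNReal.ofReal (bracket z.1 ^ (-b)) * ENNReal.ofReal (bracket z.2 ^ (-b))) *
          ENNReal.ofReal (resWeight n m ‖x - z.1‖) =
        ENNReal.ofReal M * ((ENNReal.ofReal (bracket z.1 ^ (-b)) + ENNReal.ofReal (bracket z.1 ^ (-b) *
          ‖x - z.1‖ ^ (-((n : ℝ) - 2 * m)))) * ENNReal.ofReal (bracket z.2 ^ (-b))) := by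
      intro z
      have p1 := bracket_pos z.1
      have h0 : 0 ≤ bracket z.1 ^ (-b) := by positivity
      rw [← ENNReal.ofReal_add h0 (by positivity), neg_sub, ← mul_one_add,
        ENNReal.ofReal_mul h0, resWeight]
      generalize ENNReal.ofReal M = M'
      ring
    have hm1 : Measurable fun z : EuclideanSpace ℝ (Fin n) =>
        ENNReal.ofReal (bracket z ^ (-b) * ‖x - z‖ ^ (-((n : ℝ) - 2 * m))) :=
      ENNReal.measurable_ofReal.comp ((measurable_bracket.pow_const _).mul (by fun_prop))
    simp only [e]
    rw [lintegral_const_mul' _ _ ENNReal.ofReal_ne_top,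
      lintegral_prod_mul (f := fun z => ENNReal.ofReal (bracket z ^ (-b)) + ENNReal.ofReal (bracket z ^ (-b) *
          ‖x - z‖ ^ (-((n : ℝ) - 2 * m)))) (hmb.add hm1).aemeasurable hmb.aemeasurable,
      lintegral_add_left hmb]
    gcongr
    exact hC₁ x

/-- Cauchy–Schwarz in z₁. The function Γ̃v is in L² because v is. The function v(z₁)(1 + |x -
z₁|^{2m-n}) is in L² uniformly in x because 2(n - 2m) < n, which is where n < 4m enters. -/
theorem exists_majorant_of_boundedL2 {m : ℕ} (hmn : 2 * m < n) (hn4 : n < 4 * m)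
    {V : EuclideanSpace ℝ (Fin n) → ℝ} (hVm : AEMeasurable V volume) {β : ℝ} (hβ : (n : ℝ) < β)
    (hV : ∃ C : ℝ, ∀ᵐ x, |V x| ≤ C * bracket x ^ (-β))
    {k : EuclideanSpace ℝ (Fin n) → EuclideanSpace ℝ (Fin n) → ℝ≥0∞} (hk : KernelBoundedL2 k) :
    ∃ H : EuclideanSpace ℝ (Fin n) × EuclideanSpace ℝ (Fin n) → ℝ≥0∞, Measurable H ∧
      (∀ᵐ z ∂(volume.prod volume), ENNReal.ofReal (Real.sqrt |V z.1|) * k z.1 z.2 *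
        ENNReal.ofReal (Real.sqrt |V z.2|) ≤ H z) ∧
      ∃ B : ℝ≥0, ∀ x, ∫⁻ z, H z * ENNReal.ofReal (resWeight n m ‖x - z.1‖) ∂(volume.prod volume) ≤ B := by
  obtain ⟨D, hD⟩ := hV
  obtain ⟨hkm, A, hA⟩ := hk
  have hmn' : (2 * m : ℝ) < n := by exact_mod_cast hmn
  have hn4' : (n : ℝ) < 4 * m := by exact_mod_cast hn4
  set v : EuclideanSpace ℝ (Fin n) → ℝ := fun z => Real.sqrt |V z| with hv
  have hvm : AEMeasurable v volume :=
    Real.continuous_sqrt.measurable.comp_aemeasurable (continuous_abs.measurable.comp_aemeasurable hVm)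
  have hv0 : ∀ z, 0 ≤ v z := fun z => Real.sqrt_nonneg _
  have hv2 : ∀ z, v z ^ 2 = |V z| := fun z => Real.sq_sqrt (abs_nonneg _)
  obtain ⟨C₁, hC₁⟩ := exists_lintegral_bracket_mul_rpow_le (n := n) (by omega) hβ
    (by linarith : (0 : ℝ) ≤ 2 * (n - 2 * m)) (by linarith)
  have hB := lintegral_bracket_rpow_lt_top (n := n) hβ
  set B₀ := ∫⁻ x : EuclideanSpace ℝ (Fin n), ENNReal.ofReal (bracket x ^ (-β)) with hB₀
  have hsq : ∀ {t : ℝ}, 0 ≤ t → ENNReal.ofReal t ^ (2 : ℝ) = ENNReal.ofReal (t ^ 2) := by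
    intro t ht
    rw [ENNReal.ofReal_rpow_of_nonneg ht (by norm_num), Real.rpow_two]
  have hvL2 : ∫⁻ z, ENNReal.ofReal (v z) ^ (2 : ℝ) ≤ ENNReal.ofReal |D| * B₀ := by
    rw [hB₀, ← lintegral_const_mul' _ _ ENNReal.ofReal_ne_top]
    refine lintegral_mono_ae ?_
    filter_upwards [hD] with z hz
    rw [hsq (hv0 z), hv2, ← ENNReal.ofReal_mul (abs_nonneg D)]
    exact ENNReal.ofReal_le_ofReal (hz.trans (mul_le_mul_of_nonneg_right (le_abs_self D)
      (Real.rpow_nonneg (bracket_pos z).le _)))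
  have hvmem : MemLp (fun z => (v z : ℂ)) 2 (volume : Measure (EuclideanSpace ℝ (Fin n))) := by
    refine ⟨(Complex.measurable_ofReal.comp_aemeasurable hvm).aestronglyMeasurable, ?_⟩
    rw [eLpNorm_lt_top_iff_lintegral_rpow_enorm_lt_top (by norm_num) (by norm_num)]
    have e : ∀ z, ‖(v z : ℂ)‖ₑ ^ (2 : ℝ≥0∞).toReal = ENNReal.ofReal (v z) ^ (2 : ℝ) := by
      intro z
      rw [← ofReal_norm, Complex.norm_real, Real.norm_of_nonneg (hv0 z)]; rfl
    simp only [e]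
    exact hvL2.trans_lt (ENNReal.mul_lt_top ENNReal.ofReal_lt_top hB)
  have hT := hA _ hvmem
  set T : EuclideanSpace ℝ (Fin n) → ℝ≥0∞ := fun x => ∫⁻ y, k x y * ‖(v y : ℂ)‖ₑ with hTdef
  have hTL2 : (∫⁻ z, T z ^ (2 : ℝ)) ^ (1 / 2 : ℝ) < ⊤ := by
    have h1 := hT.trans_lt (ENNReal.mul_lt_top ENNReal.coe_lt_top hvmem.2)
    rw [eLpNorm_eq_lintegral_rpow_enorm_toReal (by norm_num) (by norm_num)] at h1
    simpa using h1
  have hen : ∀ y, ‖(v y : ℂ)‖ₑ = ENNReal.ofReal (v y) := fun y => by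
    rw [← ofReal_norm, Complex.norm_real, Real.norm_of_nonneg (hv0 y)]
  have hvE : AEMeasurable (fun z => ENNReal.ofReal (v z)) (volume : Measure (EuclideanSpace ℝ (Fin n))) :=
    hvm.ennreal_ofReal
  have hTm : AEMeasurable T volume := by
    refine AEMeasurable.lintegral_prod_right' (f := fun z : EuclideanSpace ℝ (Fin n) × _ => k z.1 z.2 * ‖(v z.2 : ℂ)‖ₑ) ?_
    simp only [hen]
    exact hkm.mul (hvE.comp_quasiMeasurePreserving Measure.quasiMeasurePreserving_snd)
  have hHm : AEMeasurable (fun z : EuclideanSpace ℝ (Fin n) × EuclideanSpace ℝ (Fin n) =>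
      ENNReal.ofReal (v z.1) * k z.1 z.2 * ENNReal.ofReal (v z.2)) (volume.prod volume) :=
    ((hvE.comp_quasiMeasurePreserving Measure.quasiMeasurePreserving_fst).mul hkm).mul
      (hvE.comp_quasiMeasurePreserving Measure.quasiMeasurePreserving_snd)
  set P : ℝ≥0∞ := ENNReal.ofReal (2 * |D|) * (B₀ + C₁) with hP
  have hPt : P ≠ ⊤ :=
    ENNReal.mul_ne_top ENNReal.ofReal_ne_top (ENNReal.add_ne_top.2 ⟨hB.ne, ENNReal.coe_ne_top⟩)
  have hfin : P ^ (1 / 2 : ℝ) * (∫⁻ z, T z ^ (2 : ℝ)) ^ (1 / 2 : ℝ) ≠ ⊤ :=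
    ENNReal.mul_ne_top (ENNReal.rpow_ne_top_of_nonneg (by norm_num) hPt) hTL2.ne
  -- The product is only almost everywhere measurable, so H is a measurable representative of it.
  refine ⟨hHm.mk _, hHm.measurable_mk, hHm.ae_eq_mk.mono fun z hz => hz.le,
    (P ^ (1 / 2 : ℝ) * (∫⁻ z, T z ^ (2 : ℝ)) ^ (1 / 2 : ℝ)).toNNReal, fun x => ?_⟩
  rw [ENNReal.coe_toNNReal hfin]
  set W : EuclideanSpace ℝ (Fin n) → ℝ≥0∞ := fun z =>
    ENNReal.ofReal (v z) * ENNReal.ofReal (resWeight n m ‖x - z‖) with hW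
  have hrm : Measurable fun z : EuclideanSpace ℝ (Fin n) => ENNReal.ofReal (resWeight n m ‖x - z‖) := by
    unfold resWeight; fun_prop
  have hWm : AEMeasurable W volume := hvE.mul hrm.aemeasurable
  have hW2 : ∫⁻ z, W z ^ (2 : ℝ) ≤ P := by
    have hmb : Measurable fun z : EuclideanSpace ℝ (Fin n) => ENNReal.ofReal (bracket z ^ (-β)) :=
      ENNReal.measurable_ofReal.comp (measurable_bracket.pow_const _)
    calc ∫⁻ z, W z ^ (2 : ℝ) ≤ ∫⁻ z, ENNReal.ofReal (2 * |D|) * (ENNReal.ofReal (bracket z ^ (-β)) +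
          ENNReal.ofReal (bracket z ^ (-β) * ‖x - z‖ ^ (-(2 * ((n : ℝ) - 2 * m))))) := by
          refine lintegral_mono_ae ?_
          filter_upwards [hD] with z hz
          have p1 := bracket_pos z
          have hr0 := resWeight_nonneg (n := n) (m := m) (norm_nonneg (x - z))
          change (ENNReal.ofReal (v z) * ENNReal.ofReal (resWeight n m ‖x - z‖)) ^ (2 : ℝ) ≤ _
          rw [← ENNReal.ofReal_mul (hv0 z), hsq (mul_nonneg (hv0 z) hr0),
            ← ENNReal.ofReal_add (by positivity) (by positivity), ← ENNReal.ofReal_mul (by positivity)]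
          refine ENNReal.ofReal_le_ofReal ?_
          rw [mul_pow, hv2]
          have h1 : ‖x - z‖ ^ (-(2 * ((n : ℝ) - 2 * m))) = (‖x - z‖ ^ (2 * m - n : ℝ)) ^ 2 := by
            rw [← Real.rpow_natCast, ← Real.rpow_mul (norm_nonneg _)]
            congr 1; push_cast; ring
          have h2 : resWeight n m ‖x - z‖ ^ 2 ≤ 2 * (1 + (‖x - z‖ ^ (2 * m - n : ℝ)) ^ 2) := by
            rw [resWeight]; nlinarith [sq_nonneg (‖x - z‖ ^ (2 * m - n : ℝ) - 1)]
          have h3 : |V z| ≤ |D| * bracket z ^ (-β) :=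
            hz.trans (mul_le_mul_of_nonneg_right (le_abs_self D) (Real.rpow_nonneg p1.le _))
          rw [h1]
          calc |V z| * resWeight n m ‖x - z‖ ^ 2
              ≤ (|D| * bracket z ^ (-β)) * (2 * (1 + (‖x - z‖ ^ (2 * m - n : ℝ)) ^ 2)) :=
                mul_le_mul h3 h2 (sq_nonneg _) (by positivity)
            _ = _ := by ring
      _ ≤ P := by
          rw [lintegral_const_mul' _ _ ENNReal.ofReal_ne_top, lintegral_add_left hmb, hP]
          gcongr
          exact hC₁ x
  calc ∫⁻ z, hHm.mk _ z * ENNReal.ofReal (resWeight n m ‖x - z.1‖) ∂(volume.prod volume)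
      = ∫⁻ z, ENNReal.ofReal (v z.1) * k z.1 z.2 * ENNReal.ofReal (v z.2) *
          ENNReal.ofReal (resWeight n m ‖x - z.1‖) ∂(volume.prod volume) := by
        refine lintegral_congr_ae ?_
        filter_upwards [hHm.ae_eq_mk] with z hz
        rw [← hz]
    _ = ∫⁻ z₁, ∫⁻ z₂, ENNReal.ofReal (v z₁) * k z₁ z₂ * ENNReal.ofReal (v z₂) *
          ENNReal.ofReal (resWeight n m ‖x - z₁‖) := by
        rw [lintegral_prod]
        exact hHm.mul (hrm.comp measurable_fst).aemeasurable
    _ = ∫⁻ z₁, (W * T) z₁ := by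
        refine lintegral_congr fun z₁ => ?_
        simp only [Pi.mul_apply, hW, hTdef, hen]
        rw [← lintegral_const_mul' _ _ (ENNReal.mul_ne_top ENNReal.ofReal_ne_top ENNReal.ofReal_ne_top)]
        refine lintegral_congr fun z₂ => ?_
        ring
    _ ≤ (∫⁻ z, W z ^ (2 : ℝ)) ^ (1 / 2 : ℝ) * (∫⁻ z, T z ^ (2 : ℝ)) ^ (1 / 2 : ℝ) :=
        ENNReal.lintegral_mul_le_Lp_mul_Lq _ Real.HolderConjugate.two_two hWm hTm
    _ ≤ _ := by gcongr

end


/-! ### Families of kernels depending on the spectral parameter -/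

/-- For each t the function f t is measurable off a null set that may depend on t. Continuity in t
makes a countable dense set of parameters decisive, so one null set serves for all t and joint
measurability follows. -/
theorem exists_stronglyMeasurable_of_continuousOn {Z : Type*} [MeasurableSpace Z] {μ : Measure Z} {L : ℝ}
    (hL : 0 < L) {f : ℝ → Z → ℂ} (hf : ∀ t ∈ Ioo 0 L, AEStronglyMeasurable (f t) μ)
    (hc : ∀ᵐ z ∂μ, ContinuousOn (fun t => f t z) (Ioo 0 L)) :
    ∃ u : ℝ × Z → ℂ, StronglyMeasurable u ∧ ∀ᵐ z ∂μ, ∀ t ∈ Ioo 0 L, u (t, z) = f t z := by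
  have : Nonempty (Ioo 0 L) := ⟨⟨L / 2, by constructor <;> linarith⟩⟩
  set d : ℕ → Ioo 0 L := TopologicalSpace.denseSeq (Ioo 0 L) with hd
  have hq : ∀ᵐ z ∂μ, ContinuousOn (fun t => f t z) (Ioo 0 L) ∧
      ∀ i, f (d i) z = (hf _ (d i).2).mk _ z :=
    hc.and (ae_all_iff.2 fun i => (hf _ (d i).2).ae_eq_mk)
  -- A measurable null set off which f is continuous in t and agrees with its representatives at all
  -- points of the dense sequence.
  set S := toMeasurable μ {z | ¬ (ContinuousOn (fun t => f t z) (Ioo 0 L) ∧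
      ∀ i, f (d i) z = (hf _ (d i).2).mk _ z)} with hS
  have hS0 : μ S = 0 := by rw [hS, measure_toMeasurable]; exact hq
  have hSm : MeasurableSet S := measurableSet_toMeasurable _ _
  have hSn : ∀ z ∉ S, ContinuousOn (fun t => f t z) (Ioo 0 L) ∧
      ∀ i, f (d i) z = (hf _ (d i).2).mk _ z := fun z hz => by
    by_contra h
    exact hz (subset_toMeasurable μ _ h)
  set u : Ioo 0 L → Z → ℂ := fun t => Sᶜ.indicator (f t) with hu
  have hcont : ∀ z, Continuous fun t => u t z := by
    intro z
    by_cases hz : z ∈ S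
    · have : (fun t => u t z) = fun _ => 0 := by
        funext t; rw [hu]; exact indicator_of_notMem (not_not.2 hz) _
      rw [this]; exact continuous_const
    · have : (fun t => u t z) = (Ioo 0 L).domRestrict fun t => f t z := by
        funext t; rw [hu]; exact indicator_of_mem hz _
      rw [this]; exact continuousOn_iff_continuous_domRestrict.1 (hSn z hz).1
  have hdm : ∀ i, StronglyMeasurable (u (d i)) := by
    intro i
    have : u (d i) = Sᶜ.indicator ((hf _ (d i).2).mk _) := by
      funext z
      by_cases hz : z ∈ S
      · simp [hu, hz]
      · simp only [hu]
        rw [indicator_of_mem hz, indicator_of_mem hz, (hSn z hz).2 i]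
    rw [this]
    exact (hf _ (d i).2).stronglyMeasurable_mk.indicator hSm.compl
  have hum : ∀ t, StronglyMeasurable (u t) := by
    intro t
    obtain ⟨s, hs, hst⟩ := mem_closure_iff_seq_limit.1
      ((TopologicalSpace.denseRange_denseSeq (Ioo 0 L)) t)
    refine stronglyMeasurable_of_tendsto atTop (f := fun i => u (s i)) (fun i => ?_)
      (tendsto_pi_nhds.2 fun z => ((hcont z).tendsto t).comp hst)
    obtain ⟨j, hj⟩ := hs i
    rw [← hj]; exact hdm j
  have hj := stronglyMeasurable_uncurry_of_continuous_of_stronglyMeasurable hcont hum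
  have hemb : MeasurableEmbedding (Prod.map (Subtype.val : Ioo (0 : ℝ) L → ℝ) (id : Z → Z)) :=
    (MeasurableEmbedding.subtype_coe measurableSet_Ioo).prodMap MeasurableEmbedding.id
  obtain ⟨w, hw, hwu⟩ := hemb.exists_stronglyMeasurable_extend hj fun _ => ⟨0⟩
  refine ⟨w, hw, ?_⟩
  have hSae : ∀ᵐ z ∂μ, z ∉ S := measure_eq_zero_iff_ae_notMem.1 hS0
  filter_upwards [hSae] with z hz t ht
  have := congrFun hwu (⟨t, ht⟩, z)
  change w (t, z) = Sᶜ.indicator (f t) z at this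
  rw [this, indicator_of_mem hz]

/-- `G` bounds `f` and the weighted derivatives `t^{k-1} f^{(k)}`, `1 ≤ k ≤ N`, on `(0, L)`. -/
def Majorized (L : ℝ) (N : ℕ) (f : ℝ → ℂ) (G : ℝ≥0∞) : Prop :=
  (∀ k < N, DifferentiableOn ℝ (iteratedDeriv k f) (Ioo 0 L)) ∧ (∀ t ∈ Ioo 0 L, ‖f t‖ₑ ≤ G) ∧
    ∀ k ∈ Finset.Icc 1 N, ∀ t ∈ Ioo 0 L, ‖(t : ℂ) ^ (k - 1) * iteratedDeriv k f t‖ₑ ≤ G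

theorem Majorized.continuousOn {L : ℝ} {N : ℕ} {f : ℝ → ℂ} {G : ℝ≥0∞} (h : Majorized L N f G) (hN : 0 < N) :
    ContinuousOn f (Ioo 0 L) := by
  have := (h.1 0 hN).continuousOn
  rwa [iteratedDeriv_zero] at this

theorem Majorized.mul_const {L : ℝ} {N : ℕ} {f : ℝ → ℂ} {G G' : ℝ≥0∞} (h : Majorized L N f G) (a b : ℂ)
    (hG : ‖a‖ₑ * G * ‖b‖ₑ ≤ G') : Majorized L N (fun t => a * f t * b) G' := by
  have e : ∀ k t, iteratedDeriv k (fun t => a * f t * b) t = a * iteratedDeriv k f t * b := fun k t => by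
    rw [iteratedDeriv_mul_const_field, iteratedDeriv_const_mul_field]
  refine ⟨fun k hk => ?_, fun t ht => ?_, fun k hk t ht => ?_⟩
  · have : iteratedDeriv k (fun t => a * f t * b) = fun t => a * iteratedDeriv k f t * b := funext (e k)
    rw [this]
    exact ((h.1 k hk).const_mul a).mul_const b
  · refine le_trans ?_ hG
    rw [enorm_mul, enorm_mul]
    gcongr
    exact h.2.1 t ht
  · refine le_trans ?_ hG
    have e' : (t : ℂ) ^ (k - 1) * (a * iteratedDeriv k f t * b) =
        a * ((t : ℂ) ^ (k - 1) * iteratedDeriv k f t) * b := by ring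
    rw [e, e', enorm_mul, enorm_mul]
    gcongr
    exact h.2.2 k hk t ht

theorem majorized_gammaTilde {n : ℕ} {L : ℝ}
    {Γ : ℝ → EuclideanSpace ℝ (Fin n) → EuclideanSpace ℝ (Fin n) → ℂ} {x y : EuclideanSpace ℝ (Fin n)}
    (h : ∀ k < numDeriv n, DifferentiableOn ℝ (iteratedDeriv k fun t => Γ t x y) (Ioo 0 L)) :
    Majorized L (numDeriv n) (fun t => Γ t x y) (gammaTilde L Γ x y) := by
  have hsup : ∀ t ∈ Ioo 0 L, (‖Γ t x y‖ₑ + ⨆ k ∈ Finset.Icc 1 (numDeriv n),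
      ‖(t : ℂ) ^ (k - 1) * iteratedDeriv k (fun μ => Γ μ x y) t‖ₑ) ≤ gammaTilde L Γ x y := fun t ht =>
    le_iSup₂ (f := fun (t : ℝ) (_ : t ∈ Ioo 0 L) => ‖Γ t x y‖ₑ + ⨆ k ∈ Finset.Icc 1 (numDeriv n),
      ‖(t : ℂ) ^ (k - 1) * iteratedDeriv k (fun μ => Γ μ x y) t‖ₑ) t ht
  refine ⟨h, fun t ht => le_self_add.trans (hsup t ht), fun k hk t ht => ?_⟩
  refine le_trans ?_ ((le_add_self).trans (hsup t ht))
  exact le_iSup₂ (f := fun (k : ℕ) (_ : k ∈ Finset.Icc 1 (numDeriv n)) =>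
    ‖(t : ℂ) ^ (k - 1) * iteratedDeriv k (fun μ => Γ μ x y) t‖ₑ) k hk

theorem enorm_le_mul_lintegral {z : ℂ} {A L : ℝ} {W : ℝ → ℝ} (hA : 0 ≤ A) (hW : ∀ t ∈ Ioo 0 L, 0 ≤ W t)
    (hWm : Measurable W) (h : ‖z‖ ≤ A * ∫ t in Ioo 0 L, W t) :
    ‖z‖ₑ ≤ ENNReal.ofReal A * ∫⁻ t in Ioo 0 L, ENNReal.ofReal (W t) := by
  rw [← ofReal_norm]
  refine (ENNReal.ofReal_le_ofReal h).trans ?_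
  rw [ENNReal.ofReal_mul hA, integral_eq_lintegral_of_nonneg_ae
    ((ae_restrict_iff' measurableSet_Ioo).2 (Eventually.of_forall hW)) hWm.aestronglyMeasurable]
  gcongr
  exact ENNReal.ofReal_toReal_le

/-- Both estimates use all ⌈n/2⌉ + 1 derivatives. The first spends them on the phase. The second
spends one on the spherical moment and ⌈n/2⌉ on the phase. Neither replaces the other: the first is
integrable in x, the second in y. -/
theorem exists_enorm_oscillatory_le {n m : ℕ} (hm : 1 ≤ m) (hmn : 2 * m < n) {L : ℝ} (hL : 0 < L)
    {χ : ℝ → ℝ} (hχ : ContDiff ℝ ∞ χ) (hχ0 : ∃ c < L, ∀ t, c < t → χ t = 0) :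
    ∃ C : ℝ≥0, ∀ (f : ℝ → ℂ) (G : ℝ≥0∞), G ≠ ⊤ → Majorized L (numDeriv n) f G →
      ∀ r₁ r₂ : ℝ, 0 < r₁ → 0 < r₂ →
      ‖∫ t in Ioo 0 L, (χ t : ℂ) * (t : ℂ) ^ (n - 1) * (f t * (((r₁ ^ (2 * m - n : ℝ) : ℝ) : ℂ) *
        outAmp m (((n : ℝ) - 3) / 2) (t * r₁) * sphereMoment (((n : ℝ) - 3) / 2) 0 (t * r₂)))‖ₑ ≤
        C * G * ∫⁻ t in Ioo 0 L, ENNReal.ofReal (r₁ ^ (2 * m - n : ℝ) *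
          oscWeight m (n - 1) (⌈(n : ℝ) / 2⌉₊ + 1) (((n : ℝ) - 3) / 2) (((n : ℝ) - 3) / 2) r₁ r₂ t) ∧
      ‖∫ t in Ioo 0 L, (χ t : ℂ) * (t : ℂ) ^ (n - 1) * (f t * (((r₁ ^ (2 * m - n : ℝ) : ℝ) : ℂ) *
        outAmp m (((n : ℝ) - 3) / 2) (t * r₁) * sphereMoment (((n : ℝ) - 3) / 2) 0 (t * r₂)))‖ₑ ≤
        C * G * ∫⁻ t in Ioo 0 L, ENNReal.ofReal (r₁ ^ (2 * m - n : ℝ) * ((1 + r₁) *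
          oscWeight m n ⌈(n : ℝ) / 2⌉₊ (((n : ℝ) - 3) / 2) (((n : ℝ) - 3) / 2 + 1) r₁ r₂ t)) := by
  set a := ((n : ℝ) - 3) / 2 with ha
  have hmn' : (2 * m : ℝ) + 1 ≤ n := by exact_mod_cast hmn
  have ham : ((m - 1 : ℕ) : ℝ) ≤ a := by
    rw [Nat.cast_sub hm, ha]; push_cast; linarith
  set q := ⌈(n : ℝ) / 2⌉₊ with hq
  have hq1 : 1 ≤ q := Nat.one_le_iff_ne_zero.2 (Nat.ceil_pos.2 (by
    have : 0 < n := by omega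
    positivity)).ne'
  obtain ⟨C₀, hC₀, h0⟩ := exists_isSymbol_cutoff_mul hL q hχ
  obtain ⟨C₁, hC₁, h1⟩ := exists_norm_oscillatory_le hm ham (n - 1) q
  obtain ⟨C₂, hC₂, h2⟩ := exists_norm_oscillatory_le' hm ham (j := n - 1) (by
    rw [Nat.cast_sub (by omega), ha]; push_cast; ring) (q - 1)
  rw [show q - 1 + 1 = q by omega, show q - 1 + 2 = q + 1 by omega, show n - 1 + 1 = n by omega] at h2
  refine ⟨Real.toNNReal (C₁ * C₀ + C₂ * C₀), fun f G hG hf r₁ r₂ hr₁ hr₂ => ?_⟩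
  obtain ⟨G, rfl⟩ : ∃ g : ℝ≥0, G = g := ⟨G.toNNReal, (ENNReal.coe_toNNReal hG).symm⟩
  have hcv : ∀ z : ℂ, ‖z‖ₑ ≤ (G : ℝ≥0∞) → ‖z‖ ≤ (G : ℝ) := fun z hz => by
    have : ‖z‖₊ ≤ G := by exact_mod_cast hz
    exact_mod_cast this
  obtain ⟨hg, hg'⟩ := h0 f G hf.1 (fun t ht => hcv _ (hf.2.1 t ht))
    (fun k hk t ht => hcv _ (hf.2.2 k hk t ht))
  obtain ⟨c, hc, hχ0⟩ := hχ0
  have hvan : ∃ c < L, ∀ t, c < t → (χ t : ℂ) * f t = 0 := ⟨c, hc, fun t ht => by rw [hχ0 t ht]; simp⟩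
  have hr : 0 ≤ r₁ ^ (2 * m - n : ℝ) := by positivity
  have hrew : ∫ t in Ioo 0 L, (χ t : ℂ) * (t : ℂ) ^ (n - 1) * (f t * (((r₁ ^ (2 * m - n : ℝ) : ℝ) : ℂ) *
        outAmp m a (t * r₁) * sphereMoment a 0 (t * r₂))) = ((r₁ ^ (2 * m - n : ℝ) : ℝ) : ℂ) *
      ∫ t in Ioo 0 L, (χ t : ℂ) * f t * (t : ℂ) ^ (n - 1) * outAmp m a (t * r₁) * sphereMoment a 0 (t * r₂) := by
    rw [← integral_const_mul]
    refine integral_congr_ae (Eventually.of_forall fun t => ?_)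
    beta_reduce
    ring
  have hm1 : Measurable fun t => oscWeight m (n - 1) (q + 1) a a r₁ r₂ t :=
    (measurable_oscWeight (n - 1) (q + 1) a a).comp
      (g := fun z : ℝ × ℝ × ℝ => oscWeight m (n - 1) (q + 1) a a z.1 z.2.1 z.2.2)
      (f := fun t : ℝ => (r₁, r₂, t)) (by fun_prop)
  have hm2 : Measurable fun t => oscWeight m n q a (a + 1) r₁ r₂ t :=
    (measurable_oscWeight n q a (a + 1)).comp
      (g := fun z : ℝ × ℝ × ℝ => oscWeight m n q a (a + 1) z.1 z.2.1 z.2.2)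
      (f := fun t : ℝ => (r₁, r₂, t)) (by fun_prop)
  have hG0 : (0 : ℝ) ≤ G := G.2
  have hGr : ENNReal.ofReal (G : ℝ) = (G : ℝ≥0∞) := ENNReal.ofReal_coe_nnreal
  rw [hrew]
  constructor
  · have b1 := h1 L r₁ r₂ (C₀ * G) _ hL hr₁ hr₂ (by positivity) hg hvan
    have b2 : ‖((r₁ ^ (2 * m - n : ℝ) : ℝ) : ℂ) * ∫ t in Ioo 0 L, (χ t : ℂ) * f t * (t : ℂ) ^ (n - 1) *
        outAmp m a (t * r₁) * sphereMoment a 0 (t * r₂)‖ ≤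
        (C₁ * (C₀ * G)) * ∫ t in Ioo 0 L, r₁ ^ (2 * m - n : ℝ) * oscWeight m (n - 1) (q + 1) a a r₁ r₂ t := by
      rw [norm_mul, Complex.norm_real, Real.norm_of_nonneg hr, integral_const_mul]
      calc _ ≤ r₁ ^ (2 * m - n : ℝ) * _ := mul_le_mul_of_nonneg_left b1 hr
        _ = _ := by ring
    refine (enorm_le_mul_lintegral (by positivity) (fun t ht => mul_nonneg hr
      (oscWeight_nonneg hr₁.le hr₂.le ht.1.le)) (hm1.const_mul _) b2).trans ?_
    gcongr
    rw [← mul_assoc, ENNReal.ofReal_mul (by positivity), hGr]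
    gcongr
    exact ENNReal.ofReal_le_ofReal (by nlinarith [mul_nonneg hC₂ hC₀])
  · have b1 := h2 L r₁ r₂ (C₀ * G) _ hL hr₁ hr₂ (by positivity) hg hg' hvan
    have b2 : ‖((r₁ ^ (2 * m - n : ℝ) : ℝ) : ℂ) * ∫ t in Ioo 0 L, (χ t : ℂ) * f t * (t : ℂ) ^ (n - 1) *
        outAmp m a (t * r₁) * sphereMoment a 0 (t * r₂)‖ ≤
        (C₂ * (C₀ * G)) * ∫ t in Ioo 0 L, r₁ ^ (2 * m - n : ℝ) * ((1 + r₁) * oscWeight m n q a (a + 1) r₁ r₂ t) := by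
      rw [norm_mul, Complex.norm_real, Real.norm_of_nonneg hr, integral_const_mul, integral_const_mul]
      calc _ ≤ r₁ ^ (2 * m - n : ℝ) * _ := mul_le_mul_of_nonneg_left b1 hr
        _ = _ := by ring
    refine (enorm_le_mul_lintegral (by positivity) (fun t ht => mul_nonneg hr (mul_nonneg (by positivity)
      (oscWeight_nonneg hr₁.le hr₂.le ht.1.le))) ((hm2.const_mul _).const_mul _) b2).trans ?_
    gcongr
    rw [← mul_assoc, ENNReal.ofReal_mul (by positivity), hGr]
    gcongr
    exact ENNReal.ofReal_le_ofReal (by nlinarith [mul_nonneg hC₁ hC₀])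

theorem exists_measurable_eqOn_outAmp {m : ℕ} {a : ℝ} (hm : 1 ≤ m) (ha : ((m - 1 : ℕ) : ℝ) ≤ a) :
    ∃ p : ℝ → ℂ, Measurable p ∧ EqOn p (outAmp m a) (Ioi 0) := by
  obtain ⟨C, -, h⟩ := isSymbol_outAmp_one hm ha
  classical
  exact ⟨(Ioi 0).piecewise (outAmp m a) 0,
    h.continuousOn.measurable_piecewise continuousOn_const measurableSet_Ioi,
    fun s hs => piecewise_eq_of_mem _ _ _ hs⟩

/-- A bound without any use of oscillation. It gives the absolute convergence of all integrals for
every x and y, and justifies Fubini. -/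
theorem exists_enorm_amplitude_le {n m : ℕ} (hm : 1 ≤ m) (hmn : 2 * m < n) (L : ℝ) :
    ∃ C : ℝ≥0, ∀ t ∈ Ioo 0 L, ∀ r₁ r₂ : ℝ, 0 < r₁ →
      ‖((r₁ ^ (2 * m - n : ℝ) : ℝ) : ℂ) * outAmp m (((n : ℝ) - 3) / 2) (t * r₁) *
        sphereMoment (((n : ℝ) - 3) / 2) 0 (t * r₂)‖ₑ ≤ C * ENNReal.ofReal (resWeight n m r₁) := by
  set a := ((n : ℝ) - 3) / 2 with ha
  have hmn' : (2 * m : ℝ) + 1 ≤ n := by exact_mod_cast hmn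
  have hn3 : (3 : ℝ) ≤ n := by exact_mod_cast (by omega : 3 ≤ n)
  have ham : ((m - 1 : ℕ) : ℝ) ≤ a := by
    rw [Nat.cast_sub hm, ha]; push_cast; linarith
  have ha0 : 0 ≤ a := by rw [ha]; linarith
  obtain ⟨C, hC, h⟩ := isSymbol_outAmp_one hm ham
  have hexp : outExp m a + 1 ≤ ((n - 2 * m : ℕ) : ℝ) := by
    rw [outExp, ha, Nat.cast_sub hmn.le]; push_cast [Nat.cast_sub hm]; linarith
  refine ⟨Real.toNNReal (2 * C * (1 + L) ^ (n - 2 * m)), fun t ht r₁ r₂ hr₁ => ?_⟩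
  have ht0 : 0 < t := ht.1
  have hL : 0 < L := ht0.trans ht.2
  have hr : 0 ≤ r₁ ^ (2 * m - n : ℝ) := by positivity
  rw [← ofReal_norm]
  change _ ≤ ENNReal.ofReal _ * _
  rw [← ENNReal.ofReal_mul (by positivity)]
  refine ENNReal.ofReal_le_ofReal ?_
  rw [norm_mul, norm_mul, Complex.norm_real, Real.norm_of_nonneg hr]
  have b1 : ‖outAmp m a (t * r₁)‖ ≤ C * (1 + t * r₁) ^ (n - 2 * m) := by
    refine (h.bound _ (mul_pos ht0 hr₁)).trans ?_
    gcongr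
    rw [← Real.rpow_natCast]
    exact Real.rpow_le_rpow_of_exponent_le (by nlinarith [mul_pos ht0 hr₁]) hexp
  have b2 := rpow_mul_one_add_pow_le hmn.le ht0.le ht.2.le hr₁
  calc r₁ ^ (2 * m - n : ℝ) * ‖outAmp m a (t * r₁)‖ * ‖sphereMoment a 0 (t * r₂)‖
      ≤ r₁ ^ (2 * m - n : ℝ) * (C * (1 + t * r₁) ^ (n - 2 * m)) * 2 := by
        gcongr
        exact norm_sphereMoment_le ha0 0 _
    _ = 2 * C * (r₁ ^ (2 * m - n : ℝ) * (1 + t * r₁) ^ (n - 2 * m)) := by ring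
    _ ≤ 2 * C * ((1 + L) ^ (n - 2 * m) * resWeight n m r₁) := by gcongr
    _ = _ := by ring


/-! ### The composed kernel -/

section

variable {n : ℕ}

theorem lintegral_mul_norm_sub_fst {H : EuclideanSpace ℝ (Fin n) × EuclideanSpace ℝ (Fin n) → ℝ≥0∞}
    (hH : Measurable H) {Q : ℝ × ℝ → ℝ≥0∞} (hQ : Measurable Q) (y : EuclideanSpace ℝ (Fin n)) :
    ∫⁻ x : EuclideanSpace ℝ (Fin n), ∫⁻ z, H z * Q (‖x - z.1‖, ‖z.2 - y‖) ∂(volume.prod volume) =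
      ∫⁻ z, H z * (∫⁻ x : EuclideanSpace ℝ (Fin n), Q (‖x‖, ‖z.2 - y‖)) ∂(volume.prod volume) := by
  rw [lintegral_lintegral_swap (Measurable.aemeasurable (by fun_prop))]
  refine lintegral_congr fun z => ?_
  rw [lintegral_const_mul _ (by fun_prop)]
  congr 1
  exact lintegral_sub_right_eq_self (fun x : EuclideanSpace ℝ (Fin n) => Q (‖x‖, ‖z.2 - y‖)) z.1

theorem lintegral_mul_norm_sub_snd {H : EuclideanSpace ℝ (Fin n) × EuclideanSpace ℝ (Fin n) → ℝ≥0∞}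
    (hH : Measurable H) {Q : ℝ × ℝ → ℝ≥0∞} (hQ : Measurable Q) (x : EuclideanSpace ℝ (Fin n)) :
    ∫⁻ y : EuclideanSpace ℝ (Fin n), ∫⁻ z, H z * Q (‖x - z.1‖, ‖z.2 - y‖) ∂(volume.prod volume) =
      ∫⁻ z, H z * (∫⁻ y : EuclideanSpace ℝ (Fin n), Q (‖x - z.1‖, ‖y‖)) ∂(volume.prod volume) := by
  rw [lintegral_lintegral_swap (Measurable.aemeasurable (by fun_prop))]
  refine lintegral_congr fun z => ?_
  rw [lintegral_const_mul _ (by fun_prop)]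
  congr 1
  exact lintegral_sub_left_eq_self (fun y : EuclideanSpace ℝ (Fin n) => Q (‖x - z.1‖, ‖y‖)) z.2

/-- The kernel `|x - z₁|^{2m-n} A(t|x - z₁|) J(t|z₂ - y|)` of the outgoing amplitude at `x` and the
spherical average at `y`. -/
noncomputable def amplitudeKernel (m : ℕ) (x y : EuclideanSpace ℝ (Fin n)) (t : ℝ)
    (z : EuclideanSpace ℝ (Fin n) × EuclideanSpace ℝ (Fin n)) : ℂ :=
  ((‖x - z.1‖ ^ (2 * m - n : ℝ) : ℝ) : ℂ) * outAmp m (((n : ℝ) - 3) / 2) (t * ‖x - z.1‖) *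
    sphereMoment (((n : ℝ) - 3) / 2) 0 (t * ‖z.2 - y‖)

theorem ae_norm_sub_pos (hn : 0 < n) (x y : EuclideanSpace ℝ (Fin n)) :
    ∀ᵐ z : EuclideanSpace ℝ (Fin n) × EuclideanSpace ℝ (Fin n) ∂(volume.prod volume),
      0 < ‖x - z.1‖ ∧ 0 < ‖z.2 - y‖ := by
  have : Nontrivial (EuclideanSpace ℝ (Fin n)) :=
    Module.nontrivial_of_finrank_pos (R := ℝ) (by rw [finrank_euclideanSpace_fin]; exact hn)
  have h : ∀ w : EuclideanSpace ℝ (Fin n), ∀ᵐ z : EuclideanSpace ℝ (Fin n), z ≠ w := fun w =>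
    Measure.ae_ne volume w
  filter_upwards [Measure.quasiMeasurePreserving_fst.ae (h x), Measure.quasiMeasurePreserving_snd.ae (h y)]
    with z h1 h2
  exact ⟨norm_pos_iff.2 (sub_ne_zero.2 h1.symm), norm_pos_iff.2 (sub_ne_zero.2 h2)⟩

theorem exists_measurable_amplitudeKernel {m : ℕ} (hm : 1 ≤ m) (hmn : 2 * m < n) :
    ∃ P : EuclideanSpace ℝ (Fin n) × EuclideanSpace ℝ (Fin n) → ℝ → EuclideanSpace ℝ (Fin n) ×
      EuclideanSpace ℝ (Fin n) → ℂ, Measurable (fun q : (EuclideanSpace ℝ (Fin n) × EuclideanSpace ℝ (Fin n)) ×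
        ℝ × EuclideanSpace ℝ (Fin n) × EuclideanSpace ℝ (Fin n) => P q.1 q.2.1 q.2.2) ∧
      ∀ x y t z, 0 < t → 0 < ‖x - z.1‖ → P (x, y) t z = amplitudeKernel m x y t z := by
  have hmn' : (2 * m : ℝ) + 1 ≤ n := by exact_mod_cast hmn
  have hm' : (1 : ℝ) ≤ m := by exact_mod_cast hm
  obtain ⟨p, hp, hpe⟩ := exists_measurable_eqOn_outAmp (m := m) (a := ((n : ℝ) - 3) / 2) hm (by
    rw [Nat.cast_sub hm]; push_cast; linarith)
  have hs : Measurable (sphereMoment (((n : ℝ) - 3) / 2) 0) :=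
    (continuous_iff_continuousAt.2 fun s =>
      (hasDerivAt_sphereMoment (by linarith) 0 s).continuousAt).measurable
  refine ⟨fun q t z => ((‖q.1 - z.1‖ ^ (2 * m - n : ℝ) : ℝ) : ℂ) * p (t * ‖q.1 - z.1‖) *
    sphereMoment (((n : ℝ) - 3) / 2) 0 (t * ‖z.2 - q.2‖), by fun_prop, fun x y t z ht hr => ?_⟩
  beta_reduce
  rw [hpe (mul_pos ht hr), amplitudeKernel]

/-- The absolute bound allows the λ-integral to be carried out first, at fixed (z₁, z₂). There the
oscillatory estimates apply with the majorant H(z). Integration in y or in x is then a radial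
integral, by translation invariance, and the bound on H finishes each side of the Schur condition.
-/
theorem exists_admissible_of_majorized {m : ℕ} (hm : 1 ≤ m) (hmn : 2 * m < n) {L : ℝ} (hL : 0 < L)
    {χ : ℝ → ℝ} (hχ : ContDiff ℝ ∞ χ) (hχ0 : ∃ c < L, ∀ t, c < t → χ t = 0)
    {w : ℝ → EuclideanSpace ℝ (Fin n) × EuclideanSpace ℝ (Fin n) → ℂ}
    (hw : ∀ t ∈ Ioo 0 L, AEStronglyMeasurable (w t) (volume.prod volume))
    {H : EuclideanSpace ℝ (Fin n) × EuclideanSpace ℝ (Fin n) → ℝ≥0∞} (hH : Measurable H)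
    (hmaj : ∀ᵐ z ∂(volume.prod volume), Majorized L (numDeriv n) (fun t => w t z) (H z))
    (hB : ∃ B : ℝ≥0, ∀ x, ∫⁻ z, H z * ENNReal.ofReal (resWeight n m ‖x - z.1‖) ∂(volume.prod volume) ≤ B) :
    (∀ x y, (∀ t ∈ Ioo 0 L, Integrable (fun z => w t z * amplitudeKernel m x y t z) (volume.prod volume)) ∧
      IntegrableOn (fun t => (χ t : ℂ) * (t : ℂ) ^ (n - 1) *
        ∫ z, w t z * amplitudeKernel m x y t z ∂(volume.prod volume)) (Ioo 0 L)) ∧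
    Admissible fun x y : EuclideanSpace ℝ (Fin n) => ∫ t in Ioo 0 L, (χ t : ℂ) * (t : ℂ) ^ (n - 1) *
      ∫ z, w t z * amplitudeKernel m x y t z ∂(volume.prod volume) := by
  obtain ⟨B, hB⟩ := hB
  have hn : 0 < n := by omega
  -- As `resWeight` is at least 1, the weighted bound also controls the integral of H. Hence H is
  -- finite almost everywhere, as the pointwise estimates require.
  have hwt : ∀ x : EuclideanSpace ℝ (Fin n), ∀ z : EuclideanSpace ℝ (Fin n) × EuclideanSpace ℝ (Fin n),
      H z ≤ H z * ENNReal.ofReal (resWeight n m ‖x - z.1‖) := fun x z => by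
    refine le_mul_of_one_le_right zero_le ?_
    rw [← ENNReal.ofReal_one]
    refine ENNReal.ofReal_le_ofReal ?_
    rw [resWeight]
    have : 0 ≤ ‖x - z.1‖ ^ (2 * m - n : ℝ) := by positivity
    linarith
  have hHB : ∫⁻ z, H z ∂(volume.prod volume) ≤ B := (lintegral_mono (hwt 0)).trans (hB 0)
  have hHfin : ∀ᵐ z ∂(volume.prod volume), H z ≠ ⊤ :=
    (ae_lt_top hH (hHB.trans_lt ENNReal.coe_lt_top).ne).mono fun z hz => hz.ne
  obtain ⟨u, hu, huw⟩ := exists_stronglyMeasurable_of_continuousOn hL hw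
    (hmaj.mono fun z hz => hz.continuousOn (by rw [numDeriv]; omega))
  obtain ⟨P, hP, hPe⟩ := exists_measurable_amplitudeKernel (n := n) hm hmn
  obtain ⟨C₀, hC₀⟩ := exists_enorm_amplitude_le hm hmn L
  obtain ⟨C₁, hC₁⟩ := exists_enorm_oscillatory_le hm hmn hL hχ hχ0
  have hgood : ∀ x y : EuclideanSpace ℝ (Fin n), ∀ᵐ z ∂(volume.prod volume), 0 < ‖x - z.1‖ ∧ 0 < ‖z.2 - y‖ ∧
      H z ≠ ⊤ ∧ Majorized L (numDeriv n) (fun t => w t z) (H z) ∧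
      ∀ t ∈ Ioo 0 L, u (t, z) * P (x, y) t z = w t z * amplitudeKernel m x y t z := by
    intro x y
    filter_upwards [ae_norm_sub_pos hn x y, hHfin, hmaj, huw] with z h1 h2 h3 h4
    exact ⟨h1.1, h1.2, h2, h3, fun t ht => by rw [h4 t ht, hPe x y t z ht.1 h1.1]⟩
  have hbd : ∀ x y : EuclideanSpace ℝ (Fin n), ∀ᵐ z ∂(volume.prod volume), ∀ t ∈ Ioo 0 L,
      ‖u (t, z) * P (x, y) t z‖ₑ ≤ C₀ * (H z * ENNReal.ofReal (resWeight n m ‖x - z.1‖)) := by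
    intro x y
    filter_upwards [hgood x y] with z ⟨h1, h2, h3, h4, h5⟩ t ht
    rw [h5 t ht, enorm_mul]
    calc ‖w t z‖ₑ * ‖amplitudeKernel m x y t z‖ₑ
        ≤ H z * (C₀ * ENNReal.ofReal (resWeight n m ‖x - z.1‖)) :=
          mul_le_mul' (h4.2.1 t ht) (hC₀ t ht _ _ h1)
      _ = _ := by ring
  have hfin : ∀ x : EuclideanSpace ℝ (Fin n), ∫⁻ z, C₀ * (H z * ENNReal.ofReal (resWeight n m ‖x - z.1‖))
      ∂(volume.prod volume) < ⊤ := fun x => by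
    rw [lintegral_const_mul' _ _ ENNReal.coe_ne_top]
    exact ENNReal.mul_lt_top ENNReal.coe_lt_top ((hB x).trans_lt ENNReal.coe_lt_top)
  have hint : ∀ x y : EuclideanSpace ℝ (Fin n), ∀ t ∈ Ioo 0 L,
      Integrable (fun z => w t z * amplitudeKernel m x y t z) (volume.prod volume) := by
    intro x y t ht
    have h1 : Integrable (fun z => u (t, z) * P (x, y) t z) (volume.prod volume) := by
      refine ⟨(Measurable.mul (hu.measurable.comp measurable_prodMk_left) (hP.comp
        (g := fun q : (EuclideanSpace ℝ (Fin n) × EuclideanSpace ℝ (Fin n)) × ℝ ×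
          EuclideanSpace ℝ (Fin n) × EuclideanSpace ℝ (Fin n) => P q.1 q.2.1 q.2.2)
        (f := fun z => ((x, y), t, z)) (by fun_prop))).aestronglyMeasurable, ?_⟩
      exact (lintegral_mono_ae ((hbd x y).mono fun z hz => hz t ht)).trans_lt (hfin x)
    exact h1.congr ((hgood x y).mono fun z hz => hz.2.2.2.2 t ht)
  set ν : Measure ℝ := volume.restrict (Ioo 0 L) with hν
  have hνae : ∀ᵐ t ∂ν, t ∈ Ioo 0 L := ae_restrict_mem measurableSet_Ioo
  -- The integrand built from the jointly measurable substitutes `u` and `P`. It agrees with the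
  -- true one for t in (0, L) and almost every z.
  set Φ : (EuclideanSpace ℝ (Fin n) × EuclideanSpace ℝ (Fin n)) × ℝ × EuclideanSpace ℝ (Fin n) ×
    EuclideanSpace ℝ (Fin n) → ℂ := fun q => (χ q.2.1 : ℂ) * (q.2.1 : ℂ) ^ (n - 1) *
      (u q.2 * P q.1 q.2.1 q.2.2) with hΦ
  have hχm : Measurable χ := hχ.continuous.measurable
  have hΦm : Measurable Φ := by
    have := hu.measurable
    fun_prop
  obtain ⟨M, hM⟩ := (isCompact_Icc (a := 0) (b := L)).exists_bound_of_continuousOn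
    (f := fun t : ℝ => (χ t : ℂ) * (t : ℂ) ^ (n - 1)) (by
      have := hχ.continuous
      fun_prop)
  have hΦint : ∀ x y : EuclideanSpace ℝ (Fin n), Integrable (fun q => Φ ((x, y), q)) (ν.prod (volume.prod volume)) := by
    intro x y
    refine ⟨(hΦm.comp measurable_prodMk_left).aestronglyMeasurable, ?_⟩
    have h1 : ∀ᵐ q ∂(ν.prod (volume.prod volume)), ‖Φ ((x, y), q)‖ₑ ≤ ENNReal.ofReal M *
        (C₀ * (H q.2 * ENNReal.ofReal (resWeight n m ‖x - q.2.1‖))) := by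
      filter_upwards [Measure.quasiMeasurePreserving_fst.ae hνae,
        Measure.quasiMeasurePreserving_snd.ae (hbd x y)] with q hq1 hq2
      rw [hΦ, enorm_mul]
      refine mul_le_mul' ?_ (hq2 _ hq1)
      rw [← ofReal_norm]
      exact ENNReal.ofReal_le_ofReal (hM _ (Ioo_subset_Icc_self hq1))
    refine (lintegral_mono_ae h1).trans_lt ?_
    have hrm : Measurable fun z : EuclideanSpace ℝ (Fin n) × EuclideanSpace ℝ (Fin n) =>
        ENNReal.ofReal (resWeight n m ‖x - z.1‖) := by
      unfold resWeight; fun_prop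
    rw [lintegral_prod_mul (f := fun _ : ℝ => ENNReal.ofReal M)
      (g := fun z => C₀ * (H z * ENNReal.ofReal (resWeight n m ‖x - z.1‖))) aemeasurable_const
      ((hH.mul hrm).const_mul _).aemeasurable, lintegral_const]
    refine ENNReal.mul_lt_top (ENNReal.mul_lt_top ENNReal.ofReal_lt_top ?_) (hfin x)
    rw [hν, Measure.restrict_apply_univ, Real.volume_Ioo]
    exact ENNReal.ofReal_lt_top
  have hinner : ∀ x y : EuclideanSpace ℝ (Fin n), ∀ t ∈ Ioo 0 L, (χ t : ℂ) * (t : ℂ) ^ (n - 1) *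
      ∫ z, w t z * amplitudeKernel m x y t z ∂(volume.prod volume) =
      ∫ z, Φ ((x, y), t, z) ∂(volume.prod volume) := by
    intro x y t ht
    rw [← integral_const_mul]
    refine integral_congr_ae ((hgood x y).mono fun z hz => ?_)
    beta_reduce
    rw [hΦ, ← hz.2.2.2.2 t ht]
  have hK : ∀ x y : EuclideanSpace ℝ (Fin n), ∫ t in Ioo 0 L, (χ t : ℂ) * (t : ℂ) ^ (n - 1) *
      ∫ z, w t z * amplitudeKernel m x y t z ∂(volume.prod volume) =
      ∫ q, Φ ((x, y), q) ∂(ν.prod (volume.prod volume)) := by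
    intro x y
    rw [integral_prod _ (hΦint x y)]
    exact setIntegral_congr_fun measurableSet_Ioo fun t ht => hinner x y t ht
  refine ⟨fun x y => ⟨hint x y, ?_⟩, ?_⟩
  · exact (IntegrableOn.congr_fun (hΦint x y).integral_prod_left
      (fun t ht => (hinner x y t ht).symm) measurableSet_Ioo)
  set a := ((n : ℝ) - 3) / 2 with ha
  have hQ1 : Measurable fun r : ℝ × ℝ => ∫⁻ t in Ioo 0 L, ENNReal.ofReal (r.1 ^ (2 * m - n : ℝ) *
      oscWeight m (n - 1) (⌈(n : ℝ) / 2⌉₊ + 1) a a r.1 r.2 t) := by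
    have h1 := (measurable_oscWeight (m := m) (n - 1) (⌈(n : ℝ) / 2⌉₊ + 1) a a).comp
      (f := fun q : (ℝ × ℝ) × ℝ => (q.1.1, q.1.2, q.2)) (by fun_prop)
    exact Measurable.lintegral_prod_right' (f := fun q : (ℝ × ℝ) × ℝ => ENNReal.ofReal
      (q.1.1 ^ (2 * m - n : ℝ) * oscWeight m (n - 1) (⌈(n : ℝ) / 2⌉₊ + 1) a a q.1.1 q.1.2 q.2))
      (ENNReal.measurable_ofReal.comp (Measurable.mul (by fun_prop) h1))
  have hQ2 : Measurable fun r : ℝ × ℝ => ∫⁻ t in Ioo 0 L, ENNReal.ofReal (r.1 ^ (2 * m - n : ℝ) *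
      ((1 + r.1) * oscWeight m n ⌈(n : ℝ) / 2⌉₊ a (a + 1) r.1 r.2 t)) := by
    have h1 := (measurable_oscWeight (m := m) n ⌈(n : ℝ) / 2⌉₊ a (a + 1)).comp
      (f := fun q : (ℝ × ℝ) × ℝ => (q.1.1, q.1.2, q.2)) (by fun_prop)
    exact Measurable.lintegral_prod_right' (f := fun q : (ℝ × ℝ) × ℝ => ENNReal.ofReal
      (q.1.1 ^ (2 * m - n : ℝ) * ((1 + q.1.1) * oscWeight m n ⌈(n : ℝ) / 2⌉₊ a (a + 1) q.1.1 q.1.2 q.2)))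
      (ENNReal.measurable_ofReal.comp (Measurable.mul (by fun_prop) (Measurable.mul (by fun_prop) h1)))
  set Q₁ : ℝ × ℝ → ℝ≥0∞ := fun r => ∫⁻ t in Ioo 0 L, ENNReal.ofReal (r.1 ^ (2 * m - n : ℝ) *
      oscWeight m (n - 1) (⌈(n : ℝ) / 2⌉₊ + 1) a a r.1 r.2 t) with hQ₁
  set Q₂ : ℝ × ℝ → ℝ≥0∞ := fun r => ∫⁻ t in Ioo 0 L, ENNReal.ofReal (r.1 ^ (2 * m - n : ℝ) *
      ((1 + r.1) * oscWeight m n ⌈(n : ℝ) / 2⌉₊ a (a + 1) r.1 r.2 t)) with hQ₂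
  have hceil : (n : ℝ) / 2 ≤ ⌈(n : ℝ) / 2⌉₊ := Nat.le_ceil _
  obtain ⟨D₁, hD₁⟩ := exists_lintegral_oscWeight_fst_le hm hmn L (N := ⌈(n : ℝ) / 2⌉₊ + 1)
    (by push_cast; linarith)
  obtain ⟨D₂, hD₂⟩ := exists_lintegral_oscWeight_snd_le hm hmn L (N := ⌈(n : ℝ) / 2⌉₊) (by linarith)
  have hKz : ∀ x y : EuclideanSpace ℝ (Fin n), ‖∫ t in Ioo 0 L, (χ t : ℂ) * (t : ℂ) ^ (n - 1) *
      ∫ z, w t z * amplitudeKernel m x y t z ∂(volume.prod volume)‖ₑ ≤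
      ∫⁻ z, ‖∫ t in Ioo 0 L, Φ ((x, y), t, z)‖ₑ ∂(volume.prod volume) := by
    intro x y
    rw [hK, integral_prod_symm _ (hΦint x y)]
    exact enorm_integral_le_lintegral_enorm _
  have hΦz : ∀ x y : EuclideanSpace ℝ (Fin n), ∀ᵐ z ∂(volume.prod volume),
      ‖∫ t in Ioo 0 L, Φ ((x, y), t, z)‖ₑ ≤ C₁ * (H z * Q₁ (‖x - z.1‖, ‖z.2 - y‖)) ∧
      ‖∫ t in Ioo 0 L, Φ ((x, y), t, z)‖ₑ ≤ C₁ * (H z * Q₂ (‖x - z.1‖, ‖z.2 - y‖)) := by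
    intro x y
    filter_upwards [hgood x y] with z ⟨h1, h2, h3, h4, h5⟩
    have e : ∫ t in Ioo 0 L, Φ ((x, y), t, z) = ∫ t in Ioo 0 L, (χ t : ℂ) * (t : ℂ) ^ (n - 1) *
        (w t z * amplitudeKernel m x y t z) :=
      setIntegral_congr_fun measurableSet_Ioo fun t ht => by
        rw [← h5 t ht]
    rw [e, ← mul_assoc, ← mul_assoc]
    exact hC₁ _ _ h3 h4 _ _ h1 h2
  refine ⟨?_, ENNReal.add_lt_top.2 ⟨?_, ?_⟩⟩
  · have h1 : StronglyMeasurable fun q : EuclideanSpace ℝ (Fin n) × EuclideanSpace ℝ (Fin n) =>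
        ∫ s, Φ (q, s) ∂(ν.prod (volume.prod volume)) := hΦm.stronglyMeasurable.integral_prod_right'
    refine h1.aestronglyMeasurable.congr (Eventually.of_forall fun q => ?_)
    exact (hK q.1 q.2).symm
  -- Rows: the y-integral of the second estimate leaves `resWeight` at |x - z₁|, which is the weight
  -- in the hypothesis on H.
  · refine lt_of_le_of_lt (b := (C₁ * (D₂ * B) : ℝ≥0∞)) (iSup_le fun x => ?_)
      (ENNReal.mul_lt_top ENNReal.coe_lt_top (ENNReal.mul_lt_top ENNReal.coe_lt_top ENNReal.coe_lt_top))
    calc _ ≤ ∫⁻ y : EuclideanSpace ℝ (Fin n), ∫⁻ z, C₁ * (H z * Q₂ (‖x - z.1‖, ‖z.2 - y‖)) ∂(volume.prod volume) :=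
          lintegral_mono fun y => (hKz x y).trans (lintegral_mono_ae ((hΦz x y).mono fun z hz => hz.2))
      _ = C₁ * ∫⁻ z, H z * (∫⁻ y : EuclideanSpace ℝ (Fin n), Q₂ (‖x - z.1‖, ‖y‖)) ∂(volume.prod volume) := by
          simp only [lintegral_const_mul' _ _ (ENNReal.coe_ne_top (r := C₁))]
          rw [lintegral_mul_norm_sub_snd hH hQ2]
      _ ≤ C₁ * ∫⁻ z, D₂ * (H z * ENNReal.ofReal (resWeight n m ‖x - z.1‖)) ∂(volume.prod volume) := by
          gcongr C₁ * ?_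
          refine lintegral_mono_ae ((hgood x 0).mono fun z hz => ?_)
          calc H z * ∫⁻ y : EuclideanSpace ℝ (Fin n), Q₂ (‖x - z.1‖, ‖y‖)
              ≤ H z * (D₂ * ENNReal.ofReal (resWeight n m ‖x - z.1‖)) := by
                gcongr
                exact hD₂ _ hz.1
            _ = _ := by ring
      _ ≤ _ := by
          rw [lintegral_const_mul' _ _ ENNReal.coe_ne_top]
          gcongr
          exact hB x
  -- Columns: the x-integral of the first estimate is bounded uniformly in |z₂ - y|, so the plain
  -- integral of H suffices.
  · refine lt_of_le_of_lt (b := (C₁ * (D₁ * B) : ℝ≥0∞)) (iSup_le fun y => ?_)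
      (ENNReal.mul_lt_top ENNReal.coe_lt_top (ENNReal.mul_lt_top ENNReal.coe_lt_top ENNReal.coe_lt_top))
    calc _ ≤ ∫⁻ x : EuclideanSpace ℝ (Fin n), ∫⁻ z, C₁ * (H z * Q₁ (‖x - z.1‖, ‖z.2 - y‖)) ∂(volume.prod volume) :=
          lintegral_mono fun x => (hKz x y).trans (lintegral_mono_ae ((hΦz x y).mono fun z hz => hz.1))
      _ = C₁ * ∫⁻ z, H z * (∫⁻ x : EuclideanSpace ℝ (Fin n), Q₁ (‖x‖, ‖z.2 - y‖)) ∂(volume.prod volume) := by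
          simp only [lintegral_const_mul' _ _ (ENNReal.coe_ne_top (r := C₁))]
          rw [lintegral_mul_norm_sub_fst hH hQ1]
      _ ≤ C₁ * ∫⁻ z, D₁ * H z ∂(volume.prod volume) := by
          gcongr C₁ * ?_
          refine lintegral_mono fun z => ?_
          rw [mul_comm]
          gcongr
          exact hD₁ ‖z.2 - y‖ (norm_nonneg _)
      _ ≤ _ := by
          rw [lintegral_const_mul' _ _ ENNReal.coe_ne_top]
          gcongr

end

theorem Admissible.const_mul {n : ℕ}
    {K : EuclideanSpace ℝ (Fin n) → EuclideanSpace ℝ (Fin n) → ℂ} (h : Admissible K) (c : ℂ) :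
    Admissible fun x y => c * K x y := by
  refine ⟨h.1.const_mul c, ?_⟩
  have h2 := ENNReal.add_lt_top.1 h.2
  simp only [enorm_mul, lintegral_const_mul' _ _ (enorm_ne_top (x := c)), ← ENNReal.mul_iSup]
  exact ENNReal.add_lt_top.2 ⟨ENNReal.mul_lt_top enorm_lt_top h2.1, ENNReal.mul_lt_top enorm_lt_top h2.2⟩

end HigherOrderSchrodinger

/-! ### The theorem: assembling the kernel from its amplitudes -/

open HigherOrderSchrodinger in
theorem proposition2p1 (n m : ℕ) (hm : 1 ≤ m) (hmn : 2 * m < n)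
    -- the potential, and `β > n`
    (V : EuclideanSpace ℝ (Fin n) → ℝ) (hVmeas : AEMeasurable V volume)
    (β : ℝ) (hβ : (n : ℝ) < β)
    (hV : ∃ C : ℝ, ∀ᵐ x, |V x| ≤ C * bracket x ^ (-β))
    -- the cut-off to a neighbourhood of zero
    (lam₀ : ℝ) (hlam₀ : 0 < lam₀)
    (χ : ℝ → ℝ) (hχ : ContDiff ℝ ∞ χ) (hχc : HasCompactSupport χ)
    (hχsupp : tsupport χ ⊆ Ioo (-lam₀) lam₀) (hχone : ∀ᶠ lam in 𝓝 (0 : ℝ), χ lam = 1)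
    -- the family of operators
    (Γ : ℝ → EuclideanSpace ℝ (Fin n) → EuclideanSpace ℝ (Fin n) → ℂ)
    (hΓ : ∀ lam ∈ Ioo 0 lam₀, AbsolutelyBounded (Γ lam))
    (hΓdiff : HasLamDerivatives lam₀ Γ)
    (hlow : n < 4 * m → KernelBoundedL2 (gammaTilde lam₀ Γ))
    (hhigh : 4 * m ≤ n → ∃ C : ℝ, ∃ ε : ℝ, 0 < ε ∧
      ∀ᵐ z : EuclideanSpace ℝ (Fin n) × EuclideanSpace ℝ (Fin n) ∂(volume.prod volume),
        gammaTilde lam₀ Γ z.1 z.2 ≤ ENNReal.ofReal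
          (C * bracket z.1 ^ (-(n : ℝ) / 2 - ε) * bracket z.2 ^ (-(n : ℝ) / 2 - ε))) :
    -- the integrals that define the kernel converge absolutely,
    (∀ x y : EuclideanSpace ℝ (Fin n),
      (∀ lam ∈ Ioo 0 lam₀, Integrable (compIntegrand m V Γ lam x y) (volume.prod volume)) ∧
      IntegrableOn (lowEnergyIntegrand m χ V Γ x y) (Ioi 0) volume) ∧
    -- the kernel is admissible, and the operator is bounded on every `L^p`
    Admissible (lowEnergyKernel m χ V Γ) ∧
    ∀ p : ℝ≥0∞, 1 ≤ p → KernelBoundedLp (lowEnergyKernel m χ V Γ) p := by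
  -- The compact support is not empty because χ(0) = 1, and its greatest point is below λ₀. The
  -- vanishing before λ₀ removes the upper boundary terms.
  have hχ0 : ∃ c < lam₀, ∀ t, c < t → χ t = 0 := by
    have hne : (tsupport χ).Nonempty :=
      ⟨0, subset_tsupport χ (by rw [Function.mem_support, hχone.self_of_nhds]; exact one_ne_zero)⟩
    obtain ⟨c, hc, hcm⟩ := hχc.isCompact.exists_isGreatest hne
    exact ⟨c, (hχsupp hc).2, fun t ht => image_eq_zero_of_notMem_tsupport fun h => ht.not_ge (hcm h)⟩
  obtain ⟨H, hHm, hHmaj, hHB⟩ : ∃ H : EuclideanSpace ℝ (Fin n) × EuclideanSpace ℝ (Fin n) → ℝ≥0∞,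
      Measurable H ∧ (∀ᵐ z ∂(volume.prod volume), ENNReal.ofReal (Real.sqrt |V z.1|) *
        gammaTilde lam₀ Γ z.1 z.2 * ENNReal.ofReal (Real.sqrt |V z.2|) ≤ H z) ∧
      ∃ B : ℝ≥0, ∀ x, ∫⁻ z, H z * ENNReal.ofReal (resWeight n m ‖x - z.1‖) ∂(volume.prod volume) ≤ B := by
    rcases lt_or_ge n (4 * m) with h | h
    · exact exists_majorant_of_boundedL2 hmn h hVmeas hβ hV (hlow h)
    · obtain ⟨C, ε, hε, hk⟩ := hhigh h
      exact exists_majorant_of_pointwise hm hmn hβ hV hε hk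
  set w : ℝ → EuclideanSpace ℝ (Fin n) × EuclideanSpace ℝ (Fin n) → ℂ := fun t z =>
    (Real.sqrt |V z.1| : ℂ) * Γ t z.1 z.2 * (Real.sqrt |V z.2| : ℂ) with hw
  have hv : AEStronglyMeasurable (fun z => (Real.sqrt |V z| : ℂ)) (volume : Measure (EuclideanSpace ℝ (Fin n))) :=
    (Complex.measurable_ofReal.comp_aemeasurable (Real.continuous_sqrt.measurable.comp_aemeasurable
      (continuous_abs.measurable.comp_aemeasurable hVmeas))).aestronglyMeasurable
  have hwm : ∀ t ∈ Ioo 0 lam₀, AEStronglyMeasurable (w t) (volume.prod volume) := fun t ht =>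
    (hv.comp_fst.mul (hΓ t ht).1).mul hv.comp_snd
  have hmaj : ∀ᵐ z ∂(volume.prod volume), Majorized lam₀ (numDeriv n) (fun t => w t z) (H z) := by
    filter_upwards [hHmaj, hΓdiff] with z h1 h2
    refine (majorized_gammaTilde h2).mul_const _ _ (le_trans (le_of_eq ?_) h1)
    rw [← ofReal_norm, ← ofReal_norm, Complex.norm_real, Complex.norm_real,
      Real.norm_of_nonneg (Real.sqrt_nonneg _), Real.norm_of_nonneg (Real.sqrt_nonneg _)]
  obtain ⟨hint, hadm⟩ := exists_admissible_of_majorized hm hmn hlam₀ hχ hχ0 hwm hHm hmaj hHB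
  obtain ⟨c, hc⟩ := exists_freeResolvent_amplitude hm hmn
  -- The formulas for the resolvent hold off the diagonal, so the two integrands agree for almost
  -- every z, which is enough for each fixed x and y.
  have hcomp : ∀ x y : EuclideanSpace ℝ (Fin n), ∀ t ∈ Ioo 0 lam₀, ∀ᵐ z ∂(volume.prod volume),
      (c * (c * Complex.I)) * (t : ℂ) ^ (n - 2 * m) * (w t z * amplitudeKernel m x y t z) =
        compIntegrand m V Γ t x y z := by
    intro x y t ht
    filter_upwards [ae_norm_sub_pos (by omega) x y] with z hz
    rw [compIntegrand, (hc t ht.1 _ (norm_pos_iff.1 hz.1)).1, (hc t ht.1 _ (norm_pos_iff.1 hz.2)).2,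
      amplitudeKernel, hw]
    ring
  -- The factor λ^{2m-1} of the kernel and λ^{n-2m} from the jump of the resolvent combine to
  -- λ^{n-1}.
  have hlowE : ∀ x y : EuclideanSpace ℝ (Fin n), ∀ t ∈ Ioo 0 lam₀, lowEnergyIntegrand m χ V Γ x y t =
      (c * (c * Complex.I)) * ((χ t : ℂ) * (t : ℂ) ^ (n - 1) *
        ∫ z, w t z * amplitudeKernel m x y t z ∂(volume.prod volume)) := by
    intro x y t ht
    rw [lowEnergyIntegrand, compKernel, ← integral_congr_ae (hcomp x y t ht), integral_const_mul,
      show n - 1 = 2 * m - 1 + (n - 2 * m) by omega, pow_add]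
    ring
  have hvan : ∀ x y : EuclideanSpace ℝ (Fin n), ∀ t ∈ Ioi 0 \ Ioo 0 lam₀,
      lowEnergyIntegrand m χ V Γ x y t = 0 := by
    intro x y t ht
    obtain ⟨b, hb, hb0⟩ := hχ0
    have : lam₀ ≤ t := not_lt.1 fun h => ht.2 ⟨ht.1, h⟩
    rw [lowEnergyIntegrand, hb0 t (hb.trans_le this)]
    simp
  have hK : lowEnergyKernel m χ V Γ = fun x y => (c * (c * Complex.I)) * ∫ t in Ioo 0 lam₀, (χ t : ℂ) *
      (t : ℂ) ^ (n - 1) * ∫ z, w t z * amplitudeKernel m x y t z ∂(volume.prod volume) := by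
    funext x y
    rw [lowEnergyKernel, setIntegral_eq_of_subset_of_forall_sdiff_eq_zero measurableSet_Ioi
      Ioo_subset_Ioi_self (hvan x y), ← integral_const_mul]
    exact setIntegral_congr_fun measurableSet_Ioo fun t ht => hlowE x y t ht
  have hA : Admissible (lowEnergyKernel m χ V Γ) := hK ▸ hadm.const_mul _
  refine ⟨fun x y => ⟨fun t ht => ?_, ?_⟩, hA, fun p hp => hA.kernelBoundedLp hp⟩
  · exact (((hint x y).1 t ht).const_mul _).congr (hcomp x y t ht)
  · refine IntegrableOn.of_forall_sdiff_eq_zero ?_ measurableSet_Ioi (hvan x y)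
    exact IntegrableOn.congr_fun ((hint x y).2.const_mul (c * (c * Complex.I)))
      (fun t ht => (hlowE x y t ht).symm) measurableSet_Ioo
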